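/- **Setting.** Let $v_1,\dots,v_5\in\mathbb R^4$ be the vertices of a regular 4-simplex with barycentre the origin, scaled so that the midpoints of its edges lie on the unit sphere, i.e. $\langle v_i,v_i\rangle=\tfrac83$ and $\langle v_i,v_j\rangle=-\tfrac23$ for $i\ne j$. For $\tau\in\mathbb R$ put $$Q_\tau=\{x\in\mathbb R^4:\ -\tfrac23\le\langle x,v_i\rangle\le\tau\ \text{ for all } i\},\qquad F_i=Q_\tau\cap\{\langle x,v_i\rangle=-\tfrac23\},\qquad F'_i=Q_\tau\cap\{\langle x,v_i\rangle=\tau\}.$$ For $\tfrac49<\tau<1$ the polytope $Q=Q_\tau$ is a *bitruncated 4-simplex*. For $\tau=1$ it is the *rectified 4-simplex*; it is inscribed in the unit sphere, and $Q_1$ minus its vertices, viewed in the open unit ball as the projective (Klein) model of $\mathbb H^4$, is the *ideal hyperbolic rectified 4-simplex* $R$. Label the edges of the complete graph $K_6$ on the vertices $1,\dots,6$ by $1,\dots,5$, adjacent edges having distinct labels, as follows: label 1 on $12,34,56$; label 2 on $16,23,45$; label 3 on $15,24,36$; label 4 on $14,26,35$; label 5 on $13,25,46$. Let $P$ be $Q$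 or $R$. Take a copy of $P$ for each vertex of $K_6$ and, whenever two vertices are joined by an edge of label $i$, glue the facets $F_i$ of the two corresponding copies by the identity; call the result $B$, and let $\partial_i\subset\partial B$ be the union of the facets $F'_i$ of the copies of $P$. Take a copy of $B$ for each vertex of $K_6$ and, whenever two vertices are joined by an edge of label $i$, glue the boundary parts $\partial_i$ of the two corresponding copies by the identity. The resulting space, glued from 36 copies of $P$, is called $X'$ if $P=Q$ and $M'$ if $P=R$. Let $X$ and $M$ be the orientation double covers of $X'$ and $M'$: each is glued from 72 copies of $P$, namely the 36 copies each taken with both of its orientations, where crossing a facet into the neighbouring copy of $P$ reverses the orientation relative to that of $\mathbb R^4$. **Proposition.** For every $\tau$ with $\tfrac49<\tau<1$: 1. The natural maps $X\to X'$ and $M\to M'$ are two-sheeted coverings, and $X$ and $M$ are connected. 2. $M$ carries a hyperbolic structure for which the natural maps $R\to M$ of the 72 copies of $R$ are local isometries; $M$ is regarded as a smooth manifold through it. 3. $X$ is a closed (compact, Hausdorff, second countable, without boundary) orientable smooth 4-manifold, that is, the topological space $X$ carries such a smooth structure, and $X$ contains 10 pairwise disjoint smoothly embedded 2-tori whose complement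 is diffeomorphic to the hyperbolic manifold $M$. -/

import Mathlib

open scoped Manifold ContDiff Topology

noncomputable section

/-- Euclidean 4-space. -/
abbrev E4 : Type := EuclideanSpace ℝ (Fin 4)

/-! ### The regular simplex and the polytopes cut out of it -/

/-- `v 0, …, v 4` are the vertices of a regular 4-simplex with barycentre the origin (by its Gram
matrix, which forces `∑ i, v i = 0`). The scale is the one for which the midpoints of the edges lie
on the unit sphere: the common norm of the vertices is `c = √(8/3)`. -/
def IsRegularSimplex (v : Fin 5 → E4) : Prop :=
  ∀ i j, inner ℝ (v i) (v j) = if i = j then (8 / 3 : ℝ) else -(2 / 3)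

/-- The boundary hyperplane of the half-space `H i`; it carries the facet of the simplex opposite
to the vertex `v i`, since `⟪v j, v i⟫ = -2/3` for `j ≠ i`. -/
def simplexPlane (v : Fin 5 → E4) (i : Fin 5) : Set E4 := {x | inner ℝ x (v i) = -(2 / 3 : ℝ)}

/-- The boundary hyperplane of the cutting half-space `H' i`; it is orthogonal to `v i` and passes
through `(s / c) • v i`, where `c = √(8/3)` and `τ = s * c`. -/
def cuttingPlane (v : Fin 5 → E4) (τ : ℝ) (i : Fin 5) : Set E4 := {x | inner ℝ x (v i) = τ}

/-- The polytope `H 0 ∩ … ∩ H 4 ∩ H' 0 ∩ … ∩ H' 4`. It is the rectified simplex for `τ = 1` (the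
hyperplanes `∂ H' i` and `∂ H' j` then meet the simplex in one point in common, the midpoint of an
edge), the dual rectified simplex for `τ = 4/9` (its vertices are then the barycentres of the
triangles), and the bitruncated simplex for `4/9 < τ < 1`. -/
def cutSimplex (v : Fin 5 → E4) (τ : ℝ) : Set E4 :=
  {x | ∀ i, -(2 / 3 : ℝ) ≤ inner ℝ x (v i) ∧ inner ℝ x (v i) ≤ τ}

/-- The ideal hyperbolic rectified 4-simplex `R`: the rectified simplex is inscribed in the unit
sphere, the open unit ball is the projective (Klein) model of hyperbolic 4-space, and `R` is the
rectified simplex without its (ideal) vertices. -/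
def idealRectifiedSimplex (v : Fin 5 → E4) : Set E4 := cutSimplex v 1 ∩ Metric.ball 0 1

/-! ### The gluing -/

/-- The edge labels of the complete graph `K₆`: the edge joining `u ≠ u'` has label
`edgeLabel u u'`. The diagonal entries are not used. The vertices `0, …, 5` are the corners of a
hexagon in cyclic order, and the labels are `0, …, 4`. -/
def edgeLabel : Fin 6 → Fin 6 → Fin 5 :=
  ![![0, 0, 4, 3, 2, 1],
    ![0, 0, 1, 2, 4, 3],
    ![4, 1, 0, 0, 3, 2],
    ![3, 2, 0, 0, 1, 4],
    ![2, 4, 3, 1, 0, 0],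
    ![1, 3, 2, 4, 0, 0]]

theorem edgeLabel_symm : ∀ u u', edgeLabel u u' = edgeLabel u' u := by decide

/-- Adjacent edges have distinct labels. -/
theorem edgeLabel_proper : ∀ u u₁ u₂, u₁ ≠ u → u₂ ≠ u → u₁ ≠ u₂ →
    edgeLabel u u₁ ≠ edgeLabel u u₂ := by decide

/-- The gluing of 36 copies of a polytope `P ⊆ cutSimplex v τ`. The copy `(w, u)` is the `u`-th copy
of `P` in the `w`-th copy of the building block `B`. The block `B` arises by gluing, through the
identity, the facets in `simplexPlane v i` of the copies `u`, `u'` of `P` whenever `i` is the label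
of the edge joining `u` and `u'`; its boundary component `∂ i` consists of the facets in
`cuttingPlane v τ i`. The whole space arises by gluing, through the identity, the boundary components
`∂ i` of the copies `w`, `w'` of `B` whenever `i` is the label of the edge joining `w` and `w'`. -/
inductive BaseGlue (v : Fin 5 → E4) (τ : ℝ) (P : Set E4) :
    Fin 6 × Fin 6 × P → Fin 6 × Fin 6 × P → Prop
  | inner (w u u' : Fin 6) (x : P) (hne : u ≠ u')
      (hx : (x : E4) ∈ simplexPlane v (edgeLabel u u')) :
      BaseGlue v τ P (w, u, x) (w, u', x)
  | outer (w w' u : Fin 6) (x : P) (hne : w ≠ w')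
      (hx : (x : E4) ∈ cuttingPlane v τ (edgeLabel w w')) :
      BaseGlue v τ P (w, u, x) (w', u, x)

/-- The space obtained from the 36 copies of `P`. -/
def BaseGluing (v : Fin 5 → E4) (τ : ℝ) (P : Set E4) : Type := Quot (BaseGlue v τ P)

instance (v : Fin 5 → E4) (τ : ℝ) (P : Set E4) : TopologicalSpace (BaseGluing v τ P) :=
  inferInstanceAs (TopologicalSpace (Quot (BaseGlue v τ P)))

/-- The gluing of the orientation double cover of `BaseGluing v τ P`. Each of the 36 copies of `P`
is taken with both of its orientations: `(true, w, u)` is the copy `(w, u)` with the orientation of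
`ℝ⁴`, and `(false, w, u)` is that copy with the opposite orientation. As two neighbouring copies of
`P` are glued by the identity of a facet, the orientation of a copy continues across the facet as
the opposite orientation of the neighbouring copy. -/
inductive CoverGlue (v : Fin 5 → E4) (τ : ℝ) (P : Set E4) :
    Bool × Fin 6 × Fin 6 × P → Bool × Fin 6 × Fin 6 × P → Prop
  | mk (ε : Bool) (p q : Fin 6 × Fin 6 × P) (h : BaseGlue v τ P p q) :
      CoverGlue v τ P (ε, p) (!ε, q)

/-- The orientation double cover of `BaseGluing v τ P`, glued from 72 copies of `P`. -/
def CoverGluing (v : Fin 5 → E4) (τ : ℝ) (P : Set E4) : Type := Quot (CoverGlue v τ P)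

instance (v : Fin 5 → E4) (τ : ℝ) (P : Set E4) : TopologicalSpace (CoverGluing v τ P) :=
  inferInstanceAs (TopologicalSpace (Quot (CoverGlue v τ P)))

/-- The map that forgets the orientations. -/
def coverProj (v : Fin 5 → E4) (τ : ℝ) (P : Set E4) :
    CoverGluing v τ P → BaseGluing v τ P :=
  Quot.map Prod.snd (by rintro _ _ ⟨ε, p, q, h⟩; exact h)

/-- The natural map of a copy of `P` to the glued space. -/
def coverCell (v : Fin 5 → E4) (τ : ℝ) (P : Set E4) (ε : Bool) (w u : Fin 6) (x : P) :
    CoverGluing v τ P :=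
  Quot.mk _ (ε, w, u, x)

/-- The space `X'`, glued from 36 copies of the bitruncated simplex. -/
abbrev BaseX (v : Fin 5 → E4) (τ : ℝ) : Type := BaseGluing v τ (cutSimplex v τ)

/-- The space `X`, the orientation double cover of `X'`. -/
abbrev SpaceX (v : Fin 5 → E4) (τ : ℝ) : Type := CoverGluing v τ (cutSimplex v τ)

/-- The space `M'`, glued from 36 copies of the ideal hyperbolic rectified simplex. -/
abbrev BaseM (v : Fin 5 → E4) : Type := BaseGluing v 1 (idealRectifiedSimplex v)

/-- The space `M`, the orientation double cover of `M'`. -/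
abbrev SpaceM (v : Fin 5 → E4) : Type := CoverGluing v 1 (idealRectifiedSimplex v)

/-! ### Double covers, orientability, hyperbolic structures -/

/-- `p` is a covering map with two sheets. -/
def IsDoubleCover {Y Z : Type*} [TopologicalSpace Y] [TopologicalSpace Z] (p : Y → Z) : Prop :=
  IsCoveringMap p ∧ ∀ z, (p ⁻¹' {z}).ncard = 2

/-- A smooth 4-manifold is orientable if its smooth structure contains an atlas all of whose
transition maps have positive Jacobian determinant. -/
def IsOrientable4 (Y : Type*) [TopologicalSpace Y] [ChartedSpace E4 Y] : Prop :=
  ∃ A ⊆ IsManifold.maximalAtlas (𝓡 4) ∞ Y,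
    (∀ y : Y, ∃ e ∈ A, y ∈ e.source) ∧
    ∀ e ∈ A, ∀ e' ∈ A, ∀ x ∈ (e.symm.trans e').source,
      0 < (fderiv ℝ (e.symm.trans e' : E4 → E4) x).det

/-- The hyperbolic distance of the projective (Klein) model, for points of the open unit ball. -/
def kleinDist (x y : E4) : ℝ :=
  Real.arcosh ((1 - inner ℝ x y) / √((1 - ‖x‖ ^ 2) * (1 - ‖y‖ ^ 2)))

/-- The given atlas of `M` is a hyperbolic structure induced by the copies of `R`: its charts have
values in the projective model of hyperbolic 4-space, its transition maps are local isometries for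
the hyperbolic distance, and the natural maps `R → M` of the 72 copies of `R` are, in the charts,
local isometries for the hyperbolic distance. -/
structure IsHyperbolicAtlas (v : Fin 5 → E4) [ChartedSpace E4 (SpaceM v)] : Prop where
  target_subset : ∀ φ ∈ atlas E4 (SpaceM v), φ.target ⊆ Metric.ball 0 1
  transition : ∀ φ ∈ atlas E4 (SpaceM v), ∀ ψ ∈ atlas E4 (SpaceM v),
    ∀ m ∈ φ.source ∩ ψ.source, ∀ᶠ q : SpaceM v × SpaceM v in 𝓝 (m, m),
      kleinDist (φ q.1) (φ q.2) = kleinDist (ψ q.1) (ψ q.2)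
  cell : ∀ φ ∈ atlas E4 (SpaceM v), ∀ (ε : Bool) (w u : Fin 6) (x : idealRectifiedSimplex v),
    coverCell v 1 _ ε w u x ∈ φ.source →
      ∀ᶠ q : idealRectifiedSimplex v × idealRectifiedSimplex v in 𝓝 (x, x),
        kleinDist (φ (coverCell v 1 _ ε w u q.1)) (φ (coverCell v 1 _ ε w u q.2)) =
          kleinDist q.1 q.2

end

open scoped Manifold ContDiff Topology

noncomputable section

/-! In the coordinates `cutCoord`, c_i = (⟨x, v_i⟩ + 2/3) / (τ + 2/3), the polytope Q_τ is the slice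
Σ c_i = S of the unit cube in ℝ⁵, with S = `cutLevel τ`; F_i lies in c_i = 0 and F'_i in c_i = 1.
For τ = 1 one has S = 2, and the ideal vertices are the ten points with two coordinates 1 and three
coordinates 0. For 4/9 < τ < 1 one has 2 < S < 3, and each of these vertices is replaced by a
triangle c_i = c_j = 1.

Combinatorics. The labelling of K₆ is a perfect one-factorisation: the edges of any two labels form
a Hamiltonian hexagon (`hexWalk`). Hence six cells surround each face F_i ∩ F_j, and in X also each
face F'_i ∩ F'_j. A walk around such a face that returns to the same copy has even length, so it
preserves orientations and the orientation covers are unramified. They are connected because K₆ is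
not bipartite.

The hyperbolic manifold. In the Klein model the facets F_i meet each other at angle π/3, F_i is
orthogonal to F'_k for k ≠ i, and no two F'_k meet inside the ball. Around each point the cells are
therefore the chambers of a reflection group contained in A₂ × A₁, and they unfold onto an open
subset of the ball (`exists_unfolding_chart`, `exists_kleinChart`). The reflections are projective
maps preserving a Lorentz form (`IsLor`, `kl`). Two charts developed by the same reflections factor
through a common coordinate, which yields isometric, smooth and orientation preserving transitions
(`exists_common_coord`, `DevelopsVia.transition`).

Filling the cusps. The link of the ideal vertex {i, j} is a prism, triangle times interval. All 72
cells meet at the corresponding cusp: twelve triangles tile a torus and six intervals form a circle.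
In X the circle bounds a disc: the six intervals become six sectors of angle π/3, with angular
coordinate s on the horosphere and radial coordinate ρ = (cusp form)² / (Lorentz form), see
`torus5`. The cusp reflections become linear reflections of two planes in these coordinates
(`torus5_refl5`), so the 36 cells around a vertex of a triangle unfold onto an open subset of ℝ⁴
(`exists_torusChart`).

Compatibility. A piecewise defined homeomorphism (`exists_straightening`) carries Q without the ten
triangles to R and respects all facets, hence it embeds M in X with complement the tori. It is
designed so that near a triangle the coordinates `torusX` of Q correspond exactly to the coordinates
`torus5` of R (`InTorusCell.torus5_stretch`). Thus the torus charts are smooth on the hyperbolic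
part. On a torus itself two such charts differ by reflections and a permutation of barycentric
coordinates. All signs are fixed by the orientation label of a base cell.

The tori. The twelve triangles of a torus form two strips of six, mapped affinely to Circle × Circle
(`stripMap`); that the cells are glued in this pattern is a finite check. In a torus chart the torus
is a coordinate plane, so it is smoothly embedded. -/

/-! ### Labels of cells -/

/-- The perfect matching of `K₆` formed by the edges with label `i`. -/
def edgeMatch : Fin 5 → Fin 6 → Fin 6 :=
  ![![1, 0, 3, 2, 5, 4], ![5, 2, 1, 4, 3, 0], ![4, 3, 5, 1, 0, 2],
    ![3, 5, 4, 0, 2, 1], ![2, 4, 0, 5, 1, 3]]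

theorem edgeMatch_edgeLabel : ∀ u u', u ≠ u' → edgeMatch (edgeLabel u u') u = u' := by decide

theorem edgeMatch_ne : ∀ i u, u ≠ edgeMatch i u := by decide

theorem edgeLabel_edgeMatch : ∀ i u, edgeLabel u (edgeMatch i u) = i := by decide

theorem edgeMatch_edgeMatch : ∀ i u, edgeMatch i (edgeMatch i u) = u := by decide

/-- Labels of the 72 copies of the polytope: orientation, copy of the block, copy in the block. -/
abbrev CellLabel : Type := Bool × Fin 6 × Fin 6

/-- The label of the copy across a facet. -/
def crossFacet : Fin 5 ⊕ Fin 5 → CellLabel → CellLabel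
  | .inl i, l => (!l.1, l.2.1, edgeMatch i l.2.2)
  | .inr k, l => (!l.1, edgeMatch k l.2.1, l.2.2)

theorem crossFacet_crossFacet (a : Fin 5 ⊕ Fin 5) (l : CellLabel) :
    crossFacet a (crossFacet a l) = l := by
  rcases a with i | i <;> simp [crossFacet, edgeMatch_edgeMatch]

/-- The hyperplane that carries a facet. -/
def facetPlane (v : Fin 5 → E4) (τ : ℝ) : Fin 5 ⊕ Fin 5 → Set E4 :=
  Sum.elim (simplexPlane v) (cuttingPlane v τ)

theorem isClosed_facetPlane (v : Fin 5 → E4) (τ : ℝ) (a : Fin 5 ⊕ Fin 5) :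
    IsClosed (facetPlane v τ a) := by
  rcases a with i | i
  · exact isClosed_eq (by fun_prop) continuous_const
  · exact isClosed_eq (by fun_prop) continuous_const

/-- Two labels are linked at `x` if one is reached from the other by crossing facets through `x`. -/
def Linked (v : Fin 5 → E4) (τ : ℝ) (x : E4) : CellLabel → CellLabel → Prop :=
  Relation.ReflTransGen fun l l' => ∃ a, x ∈ facetPlane v τ a ∧ l' = crossFacet a l

namespace Linked

variable {v : Fin 5 → E4} {τ : ℝ} {x : E4} {l l' l'' : CellLabel}

theorem refl : Linked v τ x l l := Relation.ReflTransGen.refl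

theorem cross {a : Fin 5 ⊕ Fin 5} (h : x ∈ facetPlane v τ a) :
    Linked v τ x l (crossFacet a l) := .single ⟨a, h, rfl⟩

theorem trans (h : Linked v τ x l l') (h' : Linked v τ x l' l'') : Linked v τ x l l'' :=
  Relation.ReflTransGen.trans h h'

theorem symm (h : Linked v τ x l l') : Linked v τ x l' l := by
  induction h with
  | refl => exact refl
  | tail _ h ih =>
    obtain ⟨a, ha, rfl⟩ := h
    exact Relation.ReflTransGen.head ⟨a, ha, (crossFacet_crossFacet a _).symm⟩ ih

theorem mono {y : E4} (hxy : ∀ a, x ∈ facetPlane v τ a → y ∈ facetPlane v τ a)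
    (h : Linked v τ x l l') : Linked v τ y l l' :=
  Relation.ReflTransGen.mono (fun _ _ ⟨a, ha, e⟩ => ⟨a, hxy a ha, e⟩) _ _ h

end Linked

/-! ### Points of the glued space -/

section Glue

variable (v : Fin 5 → E4) (τ : ℝ) (P : Set E4)

/-- The point of the glued space given by a point of the cell with a given label. -/
def cellPt (l : CellLabel) (x : P) : CoverGluing v τ P := coverCell v τ P l.1 l.2.1 l.2.2 x

theorem continuous_cellPt (l : CellLabel) : Continuous (cellPt v τ P l) := by
  have : Continuous (fun x : P => (l.1, l.2.1, l.2.2, x)) := by fun_prop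
  exact continuous_quot_mk.comp this

variable {v τ P}

theorem exists_cellPt (m : CoverGluing v τ P) : ∃ l x, m = cellPt v τ P l x := by
  induction m using Quot.ind with
  | mk a => exact ⟨(a.1, a.2.1, a.2.2.1), a.2.2.2, rfl⟩

theorem baseGlue_iff (p q : Fin 6 × Fin 6 × P) (ε : Bool) :
    BaseGlue v τ P p q ↔ p.2.2 = q.2.2 ∧ ∃ a, (p.2.2 : E4) ∈ facetPlane v τ a ∧
      (!ε, q.1, q.2.1) = crossFacet a (ε, p.1, p.2.1) := by
  constructor
  · rintro (⟨w, u, u', x, hne, hx⟩ | ⟨w, w', u, x, hne, hx⟩)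
    · exact ⟨rfl, .inl _, hx, by simp [crossFacet, edgeMatch_edgeLabel u u' hne]⟩
    · exact ⟨rfl, .inr _, hx, by simp [crossFacet, edgeMatch_edgeLabel w w' hne]⟩
  · obtain ⟨w, u, x⟩ := p
    obtain ⟨w', u', x'⟩ := q
    rintro ⟨h, a | a, ha, h2⟩
    · simp only [crossFacet, Prod.mk.injEq, true_and] at h h2
      obtain ⟨rfl, rfl⟩ := h2
      subst h
      exact .inner w' u _ x (edgeMatch_ne a u) (by rw [edgeLabel_edgeMatch]; exact ha)
    · simp only [crossFacet, Prod.mk.injEq, true_and] at h h2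
      obtain ⟨rfl, rfl⟩ := h2
      subst h
      exact .outer w _ u' x (edgeMatch_ne a w) (by rw [edgeLabel_edgeMatch]; exact ha)

theorem cellPt_crossFacet {a : Fin 5 ⊕ Fin 5} {x : P} (h : (x : E4) ∈ facetPlane v τ a)
    (l : CellLabel) : cellPt v τ P (crossFacet a l) x = cellPt v τ P l x := by
  refine (Quot.sound ?_).symm
  have hb : BaseGlue v τ P (l.2.1, l.2.2, x)
      ((crossFacet a l).2.1, (crossFacet a l).2.2, x) := by
    rw [baseGlue_iff _ _ l.1]
    refine ⟨rfl, a, h, ?_⟩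
    rcases a with a | a <;> rfl
  have := CoverGlue.mk l.1 _ _ hb
  rcases a with a | a <;> exact this

/-- Each generating identification keeps the polytope point and crosses one facet through it; the
equivalence closure of this is exactly linkage. -/
theorem cellPt_eq_iff {l l' : CellLabel} {x x' : P} :
    cellPt v τ P l x = cellPt v τ P l' x' ↔ x = x' ∧ Linked v τ x l l' := by
  constructor
  · intro h
    have h' := Quot.eqvGen_exact h
    let S : Bool × Fin 6 × Fin 6 × P → Bool × Fin 6 × Fin 6 × P → Prop := fun p q =>
      p.2.2.2 = q.2.2.2 ∧ Linked v τ p.2.2.2 (p.1, p.2.1, p.2.2.1) (q.1, q.2.1, q.2.2.1)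
    have : ∀ p q, Relation.EqvGen (CoverGlue v τ P) p q → S p q := by
      intro p q hpq
      induction hpq with
      | rel p q hpq =>
        obtain ⟨ε, p, q, hb⟩ := hpq
        obtain ⟨h1, a, ha, h2⟩ := (baseGlue_iff p q ε).1 hb
        exact ⟨h1, by rw [h2]; exact Linked.cross ha⟩
      | refl p => exact ⟨rfl, Linked.refl⟩
      | symm p q _ ih => exact ⟨ih.1.symm, by rw [← ih.1]; exact ih.2.symm⟩
      | trans p q r _ _ ih1 ih2 =>
        exact ⟨ih1.1.trans ih2.1, ih1.2.trans (by rw [ih1.1]; exact ih2.2)⟩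
    exact this _ _ h'
  · rintro ⟨rfl, h⟩
    induction h with
    | refl => rfl
    | tail _ h ih =>
      obtain ⟨a, ha, rfl⟩ := h
      rw [ih, cellPt_crossFacet ha]

theorem isOpen_coverGluing_iff {s : Set (CoverGluing v τ P)} :
    IsOpen s ↔ ∀ l, IsOpen {x : P | cellPt v τ P l x ∈ s} := by
  constructor
  · exact fun h l => h.preimage (continuous_cellPt v τ P l)
  · intro h
    refine isOpen_coinduced.2 ?_
    change IsOpen {p : Bool × Fin 6 × Fin 6 × P | (Quot.mk (CoverGlue v τ P) p : CoverGluing v τ P) ∈ s}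
    have : {p : Bool × Fin 6 × Fin 6 × P | (Quot.mk (CoverGlue v τ P) p : CoverGluing v τ P) ∈ s} = ⋃ l : CellLabel,
        {p | p.1 = l.1 ∧ p.2.1 = l.2.1 ∧ p.2.2.1 = l.2.2 ∧
          p.2.2.2 ∈ {x : P | cellPt v τ P l x ∈ s}} := by
      ext ⟨ε, w, u, x⟩
      simp only [Set.mem_iUnion, Set.mem_ofPred_eq]
      exact ⟨fun hx => ⟨(ε, w, u), rfl, rfl, rfl, hx⟩, by rintro ⟨⟨ε, w, u⟩, rfl, rfl, rfl, hx⟩; exact hx⟩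
    rw [this]
    refine isOpen_iUnion fun l => ?_
    have e1 : IsOpen {p : Bool × Fin 6 × Fin 6 × P | p.1 = l.1} :=
      (isOpen_discrete {l.1}).preimage continuous_fst
    have e2 : IsOpen {p : Bool × Fin 6 × Fin 6 × P | p.2.1 = l.2.1} :=
      (isOpen_discrete {l.2.1}).preimage (f := fun p : Bool × Fin 6 × Fin 6 × P => p.2.1) (by fun_prop)
    have e3 : IsOpen {p : Bool × Fin 6 × Fin 6 × P | p.2.2.1 = l.2.2} :=
      (isOpen_discrete {l.2.2}).preimage (f := fun p : Bool × Fin 6 × Fin 6 × P => p.2.2.1) (by fun_prop)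
    exact e1.inter (e2.inter (e3.inter ((h l).preimage (by fun_prop))))

/-- The map that folds the glued space onto the polytope. -/
def cellCoord (v : Fin 5 → E4) (τ : ℝ) (P : Set E4) : CoverGluing v τ P → P :=
  Quot.lift (fun p => p.2.2.2) (by
    rintro _ _ ⟨ε, p, q, h⟩
    exact ((baseGlue_iff p q ε).1 h).1)

theorem continuous_cellCoord : Continuous (cellCoord v τ P) :=
  continuous_quot_lift (f := fun p : Bool × Fin 6 × Fin 6 × P => p.2.2.2) _ (by fun_prop)

theorem eventually_facets_subset (v : Fin 5 → E4) (τ : ℝ) (x : E4) :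
    ∀ᶠ y in 𝓝 x, ∀ a, y ∈ facetPlane v τ a → x ∈ facetPlane v τ a := by
  rw [Filter.eventually_all]
  intro a
  by_cases h : x ∈ facetPlane v τ a
  · exact Filter.Eventually.of_forall fun _ _ => h
  · filter_upwards [(isClosed_facetPlane v τ a).isOpen_compl.mem_nhds h] with y hy hy'
    exact absurd hy' hy

/-- Neighbourhoods in the glued space are seen in the cells around a point. -/
theorem eventually_nhds_cellPt {p : CoverGluing v τ P → Prop} {l : CellLabel} {x : P}
    (h : ∀ l', Linked v τ x l l' → ∀ᶠ y : P in 𝓝 x, p (cellPt v τ P l' y)) :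
    ∀ᶠ m in 𝓝 (cellPt v τ P l x), p m := by
  have h1 : ∀ᶠ y : P in 𝓝 x, (∀ a, (y : E4) ∈ facetPlane v τ a → (x : E4) ∈ facetPlane v τ a) ∧
      ∀ l', Linked v τ x l l' → p (cellPt v τ P l' y) := by
    refine ((continuous_subtype_val.tendsto x).eventually
      (eventually_facets_subset v τ x)).and ?_
    rw [Filter.eventually_all]
    intro l'
    by_cases hl : Linked v τ x l l'
    · filter_upwards [h l' hl] with y hy _ using hy
    · exact Filter.Eventually.of_forall fun _ h => absurd h hl
  obtain ⟨V, hV, hVo, hxV⟩ := eventually_nhds_iff.1 h1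
  -- Points of `V` lie only on facets through `x`, so linkage at `y ∈ V` implies linkage at `x`.
  -- Hence the preimage of this set in each cell is `V` or empty, and the set is open.
  refine Filter.mem_of_superset (x := {m | ∃ l' y, Linked v τ x l l' ∧ y ∈ V ∧
    m = cellPt v τ P l' y}) (IsOpen.mem_nhds ?_ ⟨l, x, Linked.refl, hxV, rfl⟩) ?_
  · rw [isOpen_coverGluing_iff]
    intro l1
    by_cases hl : Linked v τ x l l1
    · convert hVo using 1
      ext y
      constructor
      · rintro ⟨l', y', -, hy', e⟩
        rwa [(cellPt_eq_iff.1 e).1]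
      · exact fun hy => ⟨l1, y, hl, hy, rfl⟩
    · convert isOpen_empty using 1
      refine Set.eq_empty_of_forall_notMem ?_
      rintro y ⟨l', y', hl', hy', e⟩
      obtain ⟨rfl, e'⟩ := cellPt_eq_iff.1 e
      exact hl (hl'.trans (Linked.mono (hV y hy').1 e').symm)
  · rintro m ⟨l', y, hl', hy, rfl⟩
    exact (hV y hy).2 l' hl'

/-- Points with different polytope coordinates are separated by the folding map. Over one polytope
point the linkage classes stay apart, because linkage can only shrink when passing to nearby points.
-/
instance : T2Space (CoverGluing v τ P) := by
  rw [t2Space_iff_disjoint_nhds]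
  intro m m' hne
  obtain ⟨l, x, rfl⟩ := exists_cellPt m
  obtain ⟨l', x', rfl⟩ := exists_cellPt m'
  by_cases hx : x = x'
  · subst hx
    have hl : ¬ Linked v τ x l l' := fun h => hne (cellPt_eq_iff.2 ⟨rfl, h⟩)
    have key : ∀ l₀, ∀ᶠ m in 𝓝 (cellPt v τ P l₀ x), ∃ (l₁ : _) (y : P), Linked v τ x l₀ l₁ ∧
        (∀ a, (y : E4) ∈ facetPlane v τ a → (x : E4) ∈ facetPlane v τ a) ∧
        m = cellPt v τ P l₁ y := by
      intro l₀
      refine eventually_nhds_cellPt fun l₁ h₁ => ?_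
      filter_upwards [(continuous_subtype_val.tendsto x).eventually
        (eventually_facets_subset v τ x)] with y hy
      exact ⟨l₁, y, h₁, hy, rfl⟩
    refine Filter.disjoint_iff.2 ⟨_, key l, _, key l', ?_⟩
    rw [Set.disjoint_left]
    rintro _ ⟨l₁, y, h₁, hy, rfl⟩ ⟨l₂, y₂, h₂, hy₂, e⟩
    obtain ⟨rfl, e'⟩ := cellPt_eq_iff.1 e
    exact hl (h₁.trans ((Linked.mono hy e').trans h₂.symm))
  · have h := disjoint_nhds_nhds.2 (show cellCoord v τ P (cellPt v τ P l x) ≠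
      cellCoord v τ P (cellPt v τ P l' x') from hx)
    exact (Filter.disjoint_comap h).mono
      (continuous_cellCoord.tendsto _).le_comap (continuous_cellCoord.tendsto _).le_comap

theorem compactSpace_coverGluing (hP : IsCompact P) : CompactSpace (CoverGluing v τ P) := by
  have := isCompact_iff_compactSpace.1 hP
  exact inferInstanceAs (CompactSpace (Quot _))

end Glue

/-! ### Walks around the faces of codimension two -/

/-- The neighbour of a sector of the plane across its wall of the first kind. -/
def nbα : Fin 6 → Fin 6 := ![1, 0, 3, 2, 5, 4]

/-- The neighbour of a sector of the plane across its wall of the second kind. -/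
def nbβ : Fin 6 → Fin 6 := ![5, 2, 1, 4, 3, 0]

/-- The closed walk through all vertices of `K₆` along edges with labels `i` and `j`. -/
def hexWalk (i j : Fin 5) (u : Fin 6) : Fin 6 → Fin 6 :=
  ![u, edgeMatch i u, edgeMatch j (edgeMatch i u), edgeMatch i (edgeMatch j (edgeMatch i u)),
    edgeMatch j (edgeMatch i (edgeMatch j (edgeMatch i u))), edgeMatch j u]

/-- The parity of a sector. -/
def sectorOdd : Fin 6 → Bool := ![false, true, false, true, false, true]

/-- The perfect one-factorisation property: two of the matchings alternate along a single hexagon.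
This is why six cells surround a face of codimension two, for every pair of labels. -/
theorem edgeMatch_hexWalk_left : ∀ i j, i ≠ j → ∀ u n,
    edgeMatch i (hexWalk i j u n) = hexWalk i j u (nbα n) := by decide

theorem edgeMatch_hexWalk_right : ∀ i j, i ≠ j → ∀ u n,
    edgeMatch j (hexWalk i j u n) = hexWalk i j u (nbβ n) := by decide

theorem hexWalk_injective : ∀ i j, i ≠ j → ∀ u n n',
    hexWalk i j u n = hexWalk i j u n' → n = n' := by decide

theorem exists_hexWalk : ∀ i j, i ≠ j → ∀ u u', ∃ n, hexWalk i j u n = u' := by decide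

theorem sectorOdd_nbα : ∀ n, sectorOdd (nbα n) = !sectorOdd n := by decide

theorem sectorOdd_nbβ : ∀ n, sectorOdd (nbβ n) = !sectorOdd n := by decide

/-- The labels of the 36 cells around a corner of the polytope. -/
def cornerLabel (l : CellLabel) (π : Equiv.Perm (Fin 5)) (g : Fin 6 × Fin 6) : CellLabel :=
  (l.1 ^^ (sectorOdd g.1 ^^ sectorOdd g.2), hexWalk (π 2) (π 3) l.2.1 g.2,
    hexWalk (π 0) (π 1) l.2.2 g.1)

/-- The four facets at a corner. -/
def cornerFacet (π : Equiv.Perm (Fin 5)) : Fin 4 → Fin 5 ⊕ Fin 5 :=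
  ![.inl (π 0), .inl (π 1), .inr (π 2), .inr (π 3)]

/-- Crossing the facets at a corner. -/
def cornerNb : Fin 4 → Fin 6 × Fin 6 → Fin 6 × Fin 6 :=
  ![fun g => (nbα g.1, g.2), fun g => (nbβ g.1, g.2), fun g => (g.1, nbα g.2),
    fun g => (g.1, nbβ g.2)]

theorem cornerLabel_zero (l : CellLabel) (π : Equiv.Perm (Fin 5)) : cornerLabel l π (0, 0) = l := by
  simp [cornerLabel, hexWalk, sectorOdd]

theorem crossFacet_cornerLabel (l : CellLabel) (π : Equiv.Perm (Fin 5)) (s : Fin 4)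
    (g : Fin 6 × Fin 6) :
    crossFacet (cornerFacet π s) (cornerLabel l π g) = cornerLabel l π (cornerNb s g) := by
  have h01 : π 0 ≠ π 1 := by simp
  have h23 : π 2 ≠ π 3 := by simp
  fin_cases s <;>
  simp [crossFacet, cornerFacet, cornerLabel, cornerNb, edgeMatch_hexWalk_left _ _ h01,
    edgeMatch_hexWalk_right _ _ h01, edgeMatch_hexWalk_left _ _ h23,
    edgeMatch_hexWalk_right _ _ h23, sectorOdd_nbα, sectorOdd_nbβ]

theorem cornerLabel_injective (l : CellLabel) (π : Equiv.Perm (Fin 5)) {g g' : Fin 6 × Fin 6}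
    (h : (cornerLabel l π g).2 = (cornerLabel l π g').2) : g = g' := by
  have h01 : π 0 ≠ π 1 := by simp
  have h23 : π 2 ≠ π 3 := by simp
  simp only [cornerLabel, Prod.mk.injEq] at h
  exact Prod.ext (hexWalk_injective _ _ h01 _ _ _ h.2) (hexWalk_injective _ _ h23 _ _ _ h.1)

/-- The facets through `x` are among those at the corner given by `π`. -/
def AtCorner (v : Fin 5 → E4) (τ : ℝ) (π : Equiv.Perm (Fin 5)) (x : E4) : Prop :=
  ∀ a, x ∈ facetPlane v τ a → ∃ s, a = cornerFacet π s

theorem Linked.exists_cornerLabel {v : Fin 5 → E4} {τ : ℝ} {π : Equiv.Perm (Fin 5)} {x : E4}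
    (hx : AtCorner v τ π x) {l l' : CellLabel} (h : Linked v τ x l l') :
    ∃ g, l' = cornerLabel l π g := by
  induction h with
  | refl => exact ⟨(0, 0), (cornerLabel_zero l π).symm⟩
  | tail _ h ih =>
    obtain ⟨a, ha, rfl⟩ := h
    obtain ⟨s, rfl⟩ := hx a ha
    obtain ⟨g, rfl⟩ := ih
    exact ⟨_, crossFacet_cornerLabel l π s g⟩

/-- The orientation of a cell around a corner is given by the parities of its positions on two even
cycles, so the copy determines the orientation. This is the absence of orientation-reversing loops
around a face. -/
theorem Linked.eq_of_snd_eq {v : Fin 5 → E4} {τ : ℝ} {π : Equiv.Perm (Fin 5)} {x : E4}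
    (hx : AtCorner v τ π x) {l l' : CellLabel} (h : Linked v τ x l l') (h2 : l.2 = l'.2) :
    l = l' := by
  obtain ⟨g, rfl⟩ := h.exists_cornerLabel hx
  have : (0, 0) = g := by
    apply cornerLabel_injective l π
    rw [cornerLabel_zero, h2]
  rw [← this, cornerLabel_zero]

/-! ### The double cover -/

section Cover

variable {v : Fin 5 → E4} {τ : ℝ} {P : Set E4}

theorem perm_bool_not : ∀ (g : Equiv.Perm Bool) (b : Bool), g (!b) = !g b := by decide

theorem perm_bool_ne_one : ∀ (g : Equiv.Perm Bool), g ≠ 1 → ∀ b, g b = !b := by decide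

instance : MulAction (Equiv.Perm Bool) (CoverGluing v τ P) where
  smul g := Quot.map (fun p => (g p.1, p.2)) (by
    rintro _ _ ⟨ε, p, q, h⟩
    rw [perm_bool_not]
    exact .mk _ _ _ h)
  one_smul m := by
    induction m using Quot.ind with
    | mk a => rfl
  mul_smul g h m := by
    induction m using Quot.ind with
    | mk a => rfl

theorem smul_cellPt (g : Equiv.Perm Bool) (l : CellLabel) (x : P) :
    g • cellPt v τ P l x = cellPt v τ P (g l.1, l.2) x := rfl

instance : ContinuousConstSMul (Equiv.Perm Bool) (CoverGluing v τ P) where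
  continuous_const_smul g := by
    refine continuous_def.2 fun s hs => ?_
    rw [isOpen_coverGluing_iff] at hs ⊢
    exact fun l => hs (g l.1, l.2)

theorem coverProj_cellPt_eq_iff {l l' : CellLabel} {x x' : P} :
    coverProj v τ P (cellPt v τ P l x) = coverProj v τ P (cellPt v τ P l' x') ↔
      cellPt v τ P l x ∈ MulAction.orbit (Equiv.Perm Bool) (cellPt v τ P l' x') := by
  constructor
  · intro h
    have h' := Quot.eqvGen_exact h
    have : ∀ p q, Relation.EqvGen (BaseGlue v τ P) p q → ∀ ε, ∃ ε',
        cellPt v τ P (ε, p.1, p.2.1) p.2.2 = cellPt v τ P (ε', q.1, q.2.1) q.2.2 := by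
      intro p q hpq
      induction hpq with
      | rel p q hpq =>
        intro ε
        exact ⟨!ε, Quot.sound (CoverGlue.mk ε p q hpq)⟩
      | refl p => exact fun ε => ⟨ε, rfl⟩
      | symm p q hpq ih =>
        intro ε
        obtain ⟨ε', h⟩ := ih ε
        -- The symmetric case has to start from a sheet over `q`. If the sheets over `p` and `q`
        -- disagree, exchanging both sheets in the known equality produces the required one.
        by_cases he : ε = ε'
        · subst he
          exact ⟨ε, h.symm⟩
        · obtain ⟨ε₁, h₁⟩ := ih (!ε)
          by_cases he₁ : ε₁ = ε
          · subst he₁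
            exact ⟨_, h₁.symm⟩
          · have h2 := congrArg (fun m => Equiv.swap true false • m) h
            simp only [smul_cellPt] at h2
            have e1 : ∀ ε ε' : Bool, ε ≠ ε' → Equiv.swap true false ε' = ε := by decide
            rw [e1 ε ε' he] at h2
            exact ⟨_, h2.symm⟩
      | trans p q r _ _ ih1 ih2 =>
        intro ε
        obtain ⟨ε', h⟩ := ih1 ε
        obtain ⟨ε'', h'⟩ := ih2 ε'
        exact ⟨ε'', h.trans h'⟩
    obtain ⟨ε', h2⟩ := this _ _ h' l.1
    have e : ∀ ε ε' : Bool, ∃ g : Equiv.Perm Bool, g ε = ε' := by decide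
    obtain ⟨g, hg⟩ := e l'.1 ε'
    refine ⟨g, ?_⟩
    simp only [smul_cellPt, hg]
    exact h2.symm
  · rintro ⟨g, h⟩
    rw [← h]
    rfl

/-- The exchange of orientations acts freely: a fixed point would link two labels that differ only
in orientation. In a Hausdorff space a free action of a group of order two is a covering action, and
the projection is its quotient. -/
theorem isDoubleCover_coverProj (hP : ∀ x ∈ P, ∃ π, AtCorner v τ π x) :
    IsDoubleCover (coverProj v τ P) := by
  have free : ∀ (g : Equiv.Perm Bool), g ≠ 1 → ∀ m : CoverGluing v τ P, g • m ≠ m := by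
    intro g hg m h
    obtain ⟨l, x, rfl⟩ := exists_cellPt m
    rw [smul_cellPt, cellPt_eq_iff] at h
    obtain ⟨π, hπ⟩ := hP x x.2
    have := congrArg Prod.fst (h.2.eq_of_snd_eq hπ rfl)
    rw [perm_bool_ne_one g hg] at this
    simp at this
  have hsurj : Function.Surjective (coverProj v τ P) := by
    intro z
    induction z using Quot.ind with
    | mk a => exact ⟨cellPt v τ P (true, a.1, a.2.1) a.2.2, rfl⟩
  have hq : IsQuotientCoveringMap (coverProj v τ P) (Equiv.Perm Bool) := by
    refine { surjective := hsurj, eq_coinduced := ?_, apply_eq_iff_mem_orbit := ?_,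
             disjoint := ?_ }
    · refine TopologicalSpace.ext_iff.2 fun s => ?_
      rw [isOpen_coinduced, isOpen_coverGluing_iff]
      constructor
      · intro hs l
        have hc : Continuous (fun x : P =>
            (Quot.mk _ (l.2.1, l.2.2, x) : BaseGluing v τ P)) :=
          continuous_quot_mk.comp (f := fun x : P => (l.2.1, l.2.2, x)) (by fun_prop)
        exact hs.preimage hc
      · intro h
        refine isOpen_coinduced.2 ?_
        change IsOpen {p : Fin 6 × Fin 6 × P | (Quot.mk _ p : BaseGluing v τ P) ∈ s}
        have : {p : Fin 6 × Fin 6 × P | (Quot.mk _ p : BaseGluing v τ P) ∈ s} =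
            {p : Fin 6 × Fin 6 × P | (true, p) ∈ {p' : Bool × Fin 6 × Fin 6 × P |
            (Quot.mk _ p' : CoverGluing v τ P) ∈ coverProj v τ P ⁻¹' s}} := rfl
        rw [this]
        have h' : IsOpen (coverProj v τ P ⁻¹' s) := isOpen_coverGluing_iff.2 h
        exact (h'.preimage continuous_quot_mk).preimage (by fun_prop)
    · intro m m'
      obtain ⟨l, x, rfl⟩ := exists_cellPt m
      obtain ⟨l', x', rfl⟩ := exists_cellPt m'
      exact coverProj_cellPt_eq_iff
    · intro m
      have hsw : ∀ g : Equiv.Perm Bool, g ≠ 1 → g = Equiv.swap true false := by decide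
      obtain ⟨U, V, hU, hV, hmU, hmV, hUV⟩ :=
        t2_separation (free (Equiv.swap true false) (by decide) m).symm
      refine ⟨U ∩ (fun m => Equiv.swap true false • m) ⁻¹' V, Filter.inter_mem (hU.mem_nhds hmU)
        ((hV.preimage (continuous_const_smul _)).mem_nhds hmV), fun g hg => ?_⟩
      by_contra hne
      obtain rfl := hsw g hne
      obtain ⟨_, ⟨m', hm', rfl⟩, hm2⟩ := hg
      exact Set.disjoint_left.1 hUV hm2.1 hm'.2
  refine ⟨hq.isCoveringMap, fun z => ?_⟩
  obtain ⟨m, rfl⟩ := hsurj z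
  have : coverProj v τ P ⁻¹' {coverProj v τ P m} = {m, Equiv.swap true false • m} := by
    ext m'
    rw [Set.mem_preimage, Set.mem_singleton_iff, hq.apply_eq_iff_mem_orbit]
    have hsw : ∀ g : Equiv.Perm Bool, g = 1 ∨ g = Equiv.swap true false := by decide
    constructor
    · rintro ⟨g, rfl⟩
      rcases hsw g with rfl | rfl
      · left; exact one_smul _ m
      · right; rfl
    · rintro (rfl | rfl)
      · exact MulAction.mem_orbit_self _
      · exact MulAction.mem_orbit _ _
  rw [this, Set.ncard_pair (free _ (by decide) m).symm]

end Cover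

/-! ### Connectedness -/

theorem connectedSpace_coverGluing {v : Fin 5 → E4} {τ : ℝ} {P : Set E4} (hP : Convex ℝ P)
    (hne : ∀ a, (P ∩ facetPlane v τ a).Nonempty) : ConnectedSpace (CoverGluing v τ P) := by
  obtain ⟨x₀, hx₀⟩ := (hne (.inl 0)).mono Set.inter_subset_left
  have hc : ConnectedSpace P :=
    isConnected_iff_connectedSpace.1 ⟨⟨x₀, hx₀⟩, hP.isPreconnected⟩
  have hcell : ∀ l (x y : P), cellPt v τ P l x ∈ connectedComponent (cellPt v τ P l y) := by
    intro l x y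
    exact (isPreconnected_range (continuous_cellPt v τ P l)).subset_connectedComponent
      ⟨y, rfl⟩ ⟨x, rfl⟩
  set x₁ : P := ⟨x₀, hx₀⟩
  have hstep : ∀ l a, cellPt v τ P (crossFacet a l) x₁ ∈
      connectedComponent (cellPt v τ P l x₁) := by
    intro l a
    obtain ⟨y, hyP, hya⟩ := hne a
    have h1 := hcell (crossFacet a l) x₁ ⟨y, hyP⟩
    rw [cellPt_crossFacet hya] at h1
    rw [connectedComponent_eq (hcell l ⟨y, hyP⟩ x₁)]
    exact h1
  have hreach : ∀ l l' : CellLabel, ∃ L : List (Fin 5 ⊕ Fin 5),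
      l' = L.foldl (fun l a => crossFacet a l) l := by
    have hsame : ∀ (ε : Bool) (w u u' : Fin 6) (b : Bool), ∃ L : List (Fin 5 ⊕ Fin 5),
        (ε ^^ b, w, u') = L.foldl (fun l a => crossFacet a l) (ε, w, u) := by
      intro ε w u u' b
      -- `K₆` contains odd cycles, so at most three steps reach any vertex with a prescribed parity
      -- of the number of steps. This joins the two orientations of a cell.
      have h3 : ∀ (u u' : Fin 6) (b : Bool), (∃ i, b = true ∧ u' = edgeMatch i u) ∨
          (∃ i j, b = false ∧ u' = edgeMatch i (edgeMatch j u)) ∨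
          (∃ i j k, b = true ∧ u' = edgeMatch i (edgeMatch j (edgeMatch k u))) := by decide
      rcases h3 u u' b with ⟨i, rfl, rfl⟩ | ⟨i, j, rfl, rfl⟩ | ⟨i, j, k, rfl, rfl⟩
      · exact ⟨[.inl i], by simp [crossFacet]⟩
      · exact ⟨[.inl j, .inl i], by simp [crossFacet]⟩
      · exact ⟨[.inl k, .inl j, .inl i], by simp [crossFacet]⟩
    rintro ⟨ε, w, u⟩ ⟨ε', w', u'⟩
    have h2 : ∀ w w' : Fin 6, w = w' ∨ ∃ i, w' = edgeMatch i w := by decide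
    rcases h2 w w' with rfl | ⟨i, rfl⟩
    · obtain ⟨L, hL⟩ := hsame ε w u u' (ε ^^ ε')
      exact ⟨L, by simpa using hL⟩
    · obtain ⟨L, hL⟩ := hsame (!ε) (edgeMatch i w) u u' (!ε ^^ ε')
      exact ⟨.inr i :: L, by simpa [crossFacet] using hL⟩
  have hlist : ∀ (L : List (Fin 5 ⊕ Fin 5)) (l : CellLabel),
      cellPt v τ P (L.foldl (fun l a => crossFacet a l) l) x₁ ∈
        connectedComponent (cellPt v τ P l x₁) := by
    intro L
    induction L with
    | nil => exact fun l => mem_connectedComponent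
    | cons a L ih =>
      intro l
      have := ih (crossFacet a l)
      rwa [← connectedComponent_eq (hstep l a)] at this
  rw [connectedSpace_iff_connectedComponent]
  refine ⟨cellPt v τ P (true, 0, 0) x₁, Set.eq_univ_of_forall fun m => ?_⟩
  obtain ⟨l, x, rfl⟩ := exists_cellPt m
  obtain ⟨L, rfl⟩ := hreach (true, 0, 0) l
  rw [connectedComponent_eq (hlist L _)]
  exact hcell _ _ _

/-! ### Charts that unfold the cells around a face -/

section Unfold

variable {v : Fin 5 → E4} {τ : ℝ} {P : Set E4}

/-- The inverse chart sends `d` to the point `fold d` of any cell whose development passes through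
`d`. Hypothesis `hinj` makes this independent of the cell and `hlab` makes it injective; openness is
tested cell by cell. -/
theorem exists_unfolding_chart {G : Type} [Finite G] (x₀ : P) (lab : G → CellLabel)
    (hlabinj : Function.Injective lab) {O B : Set E4} (hO : IsOpen O) (hB : IsOpen B)
    (dev : G → E4 → E4) (fold : E4 → E4)
    (hdev : ∀ g, ContinuousOn (dev g) (P ∩ O)) (hfold : ContinuousOn fold B)
    (hmaps : ∀ g, ∀ x ∈ P ∩ O, dev g x ∈ B) (hfd : ∀ g, ∀ x ∈ P ∩ O, fold (dev g x) = x)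
    (hdf : ∀ d ∈ B, fold d ∈ P ∩ O ∧ ∃ g, dev g (fold d) = d)
    (hlab : ∀ x ∈ P ∩ O, ∀ g l', Linked v τ x (lab g) l' → ∃ g', l' = lab g' ∧ dev g' x = dev g x)
    (hinj : ∀ x ∈ P ∩ O, ∀ g g', dev g x = dev g' x → Linked v τ x (lab g) (lab g')) :
    ∃ e : OpenPartialHomeomorph (CoverGluing v τ P) E4, e.target = B ∧
      (∀ g (x : P), (x : E4) ∈ O → cellPt v τ P (lab g) x ∈ e.source ∧
        e (cellPt v τ P (lab g) x) = dev g x) ∧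
      ∀ m ∈ e.source, ∃ (g : G) (x : P), (x : E4) ∈ O ∧ m = cellPt v τ P (lab g) x := by
  classical
  let proj : E4 → P := fun y => if h : y ∈ P then ⟨y, h⟩ else x₀
  have hproj : ∀ x : P, proj x = x := fun x => dif_pos x.2
  have hproj' : ∀ y ∈ P, (proj y : E4) = y := fun y hy => by simp [proj, hy]
  have hprojc : ContinuousOn proj P := by
    rw [continuousOn_iff_continuous_domRestrict]
    exact continuous_id.congr fun x => (hproj x).symm
  choose ch hch using fun d : B => (hdf d d.2).2
  let Ψ : E4 → CoverGluing v τ P := fun d =>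
    if h : d ∈ B then cellPt v τ P (lab (ch ⟨d, h⟩)) (proj (fold d))
    else cellPt v τ P (true, 0, 0) x₀
  have hΨ : ∀ d ∈ B, ∀ g, dev g (fold d) = d → Ψ d = cellPt v τ P (lab g) (proj (fold d)) := by
    intro d hd g hg
    simp only [Ψ, hd, dif_pos]
    rw [cellPt_eq_iff]
    refine ⟨rfl, ?_⟩
    rw [hproj' _ (hdf d hd).1.1]
    exact hinj _ (hdf d hd).1 _ _ ((hch ⟨d, hd⟩).trans hg.symm)
  have hΨdev : ∀ g (x : P), (x : E4) ∈ O → Ψ (dev g x) = cellPt v τ P (lab g) x := by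
    intro g x hx
    have hf := hfd g x ⟨x.2, hx⟩
    rw [hΨ _ (hmaps g x ⟨x.2, hx⟩) g (by rw [hf]), hf, hproj]
  have hΨinj : Set.InjOn Ψ B := by
    intro d hd d' hd' h
    obtain ⟨hf, g, hg⟩ := hdf d hd
    obtain ⟨hf', g', hg'⟩ := hdf d' hd'
    rw [hΨ d hd g hg, hΨ d' hd' g' hg', cellPt_eq_iff] at h
    have h1 : fold d = fold d' := by
      rw [← hproj' _ hf.1, ← hproj' _ hf'.1, h.1]
    have h2 := h.2
    rw [hproj' _ hf.1] at h2
    obtain ⟨g₂, e, hg₂⟩ := hlab _ hf g _ h2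
    rw [← hlabinj e] at hg₂
    rw [← hg, ← hg', ← hg₂, h1]
  have hΨc : ContinuousOn Ψ B := by
    intro d hd
    rw [ContinuousWithinAt, Filter.tendsto_def]
    intro U hU
    -- There are finitely many developments, and one that misses `d` over `fold d` keeps missing
    -- nearby points. So near `d` only the continuous branches through `d` matter.
    have key : ∀ g, ∀ᶠ d' in 𝓝[B] d, dev g (fold d') = d' →
        cellPt v τ P (lab g) (proj (fold d')) ∈ U := by
      intro g
      have hmt : Set.MapsTo fold B (P ∩ O) := fun d hd => (hdf d hd).1
      have hc : ContinuousOn (fun d' => dev g (fold d')) B := (hdev g).comp hfold hmt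
      by_cases hg : dev g (fold d) = d
      · have hc2 : ContinuousOn (fun d' => cellPt v τ P (lab g) (proj (fold d'))) B :=
          (continuous_cellPt v τ P _).comp_continuousOn
            (hprojc.comp hfold fun d hd => (hdf d hd).1.1)
        have := (hc2 d hd)
        rw [ContinuousWithinAt, ← hΨ d hd g hg] at this
        filter_upwards [this hU] with d' h _ using h
      · have := ((hc d hd).prodMk continuousWithinAt_id).eventually
          (isClosed_diagonal.isOpen_compl.mem_nhds (show (dev g (fold d), d) ∈ _ from hg))
        filter_upwards [this] with d' h h' using absurd h' h
    filter_upwards [Filter.eventually_all.2 key, self_mem_nhdsWithin] with d' h hd'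
    obtain ⟨-, g, hg⟩ := hdf d' hd'
    show Ψ d' ∈ U
    rw [hΨ d' hd' g hg]
    exact h g hg
  have : Nonempty E4 := ⟨0⟩
  let e₀ : PartialEquiv E4 (CoverGluing v τ P) := hΨinj.bijOn_image.toPartialEquiv Ψ B (Ψ '' B)
  have hopen : IsOpenMap (e₀.source.domRestrict e₀) := by
    intro V hV
    obtain ⟨V', hV', rfl⟩ := isOpen_induced_iff.1 hV
    have himg : (e₀.source.domRestrict e₀) '' (Subtype.val ⁻¹' V') = Ψ '' (V' ∩ B) := by
      ext m
      constructor
      · rintro ⟨d, hd, rfl⟩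
        exact ⟨d, ⟨hd, d.2⟩, rfl⟩
      · rintro ⟨d, hd, rfl⟩
        exact ⟨⟨d, hd.2⟩, hd.1, rfl⟩
    rw [himg, isOpen_coverGluing_iff]
    intro l
    by_cases hl : ∃ g, l = lab g
    · obtain ⟨g, rfl⟩ := hl
      have heq : {x : P | cellPt v τ P (lab g) x ∈ Ψ '' (V' ∩ B)} =
          Subtype.val ⁻¹' O ∩ (fun x : P => dev g x) ⁻¹' V' := by
        ext x
        constructor
        · rintro ⟨d, ⟨hdV, hdB⟩, he⟩
          obtain ⟨hf, g', hg'⟩ := hdf d hdB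
          rw [hΨ d hdB g' hg', cellPt_eq_iff] at he
          obtain ⟨hx, hl⟩ := he
          rw [hproj' _ hf.1] at hl
          have hx' : fold d = x := by rw [← hproj' _ hf.1, hx]
          obtain ⟨g₂, e, hg₂⟩ := hlab _ hf g' _ hl
          rw [← hlabinj e] at hg₂
          refine ⟨show (x : E4) ∈ O by rw [← hx']; exact hf.2, ?_⟩
          show dev g x ∈ V'
          rw [← hx', hg₂, hg']
          exact hdV
        · rintro ⟨hxO, hxV⟩
          exact ⟨dev g x, ⟨hxV, hmaps g x ⟨x.2, hxO⟩⟩, hΨdev g x hxO⟩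
      rw [heq]
      have hc : ContinuousOn (fun x : P => dev g x) (Subtype.val ⁻¹' O) :=
        (hdev g).comp continuous_subtype_val.continuousOn fun x hx => ⟨x.2, hx⟩
      exact hc.isOpen_inter_preimage (hO.preimage continuous_subtype_val) hV'
    · convert isOpen_empty using 1
      refine Set.eq_empty_of_forall_notMem ?_
      rintro x ⟨d, ⟨hdV, hdB⟩, he⟩
      obtain ⟨hf, g', hg'⟩ := hdf d hdB
      rw [hΨ d hdB g' hg', cellPt_eq_iff, hproj' _ hf.1] at he
      obtain ⟨g₂, e, -⟩ := hlab _ hf g' _ he.2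
      exact hl ⟨g₂, e⟩
  let e₁ := OpenPartialHomeomorph.ofContinuousOpenRestrict e₀ hΨc hopen hB
  have hmem : ∀ g (x : P), (x : E4) ∈ O → dev g x ∈ e₁.source := fun g x hx =>
    hmaps g x ⟨x.2, hx⟩
  refine ⟨e₁.symm, rfl, fun g x hx => ?_, fun m hm => ?_⟩
  · have h1 : e₁ (dev g x) = cellPt v τ P (lab g) x := hΨdev g x hx
    rw [← h1]
    exact ⟨e₁.map_source (hmem g x hx), e₁.left_inv (hmem g x hx)⟩
  · obtain ⟨d, hd, rfl⟩ : m ∈ Ψ '' B := hm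
    obtain ⟨hf, g, hg⟩ := hdf d hd
    refine ⟨g, ⟨fold d, hf.1⟩, hf.2, ?_⟩
    rw [← hΨdev g ⟨fold d, hf.1⟩ hf.2, hg]

/-- Two maps that develop the cells around a point compatibly with the same reflections have a common
local coordinate. -/
theorem exists_common_coord {l : CellLabel} {x : P} {e e' : CoverGluing v τ P → E4}
    {χ : P → E4} (hχ : ContinuousAt χ x) {R : Fin 5 ⊕ Fin 5 → E4 → E4}
    (hR : ∀ a, (x : E4) ∈ facetPlane v τ a → Filter.Tendsto (R a) (𝓝 (χ x)) (𝓝 (χ x)))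
    {F F' : CellLabel → E4 → E4}
    (hF : ∀ l', Linked v τ x l l' → ∀ᶠ y in 𝓝 x, e (cellPt v τ P l' y) = F l' (χ y))
    (hF' : ∀ l', Linked v τ x l l' → ∀ᶠ y in 𝓝 x, e' (cellPt v τ P l' y) = F' l' (χ y))
    (hFR : ∀ l', Linked v τ x l l' → ∀ a, (x : E4) ∈ facetPlane v τ a →
      F (crossFacet a l') =ᶠ[𝓝 (χ x)] F l' ∘ R a)
    (hFR' : ∀ l', Linked v τ x l l' → ∀ a, (x : E4) ∈ facetPlane v τ a →
      F' (crossFacet a l') =ᶠ[𝓝 (χ x)] F' l' ∘ R a)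
    {V : Set E4} (hV : V ∈ 𝓝 (χ x)) :
    ∀ᶠ m in 𝓝 (cellPt v τ P l x), ∃ z ∈ V, e m = F l z ∧ e' m = F' l z := by
  refine eventually_nhds_cellPt fun l' hl' => ?_
  -- Along a chain of crossings from `l` to `l'` the reflections compose to one map `w`, which
  -- serves both families at once and fixes the base coordinate in the limit.
  have key : ∃ w : E4 → E4, Filter.Tendsto w (𝓝 (χ x)) (𝓝 (χ x)) ∧
      F l' =ᶠ[𝓝 (χ x)] F l ∘ w ∧ F' l' =ᶠ[𝓝 (χ x)] F' l ∘ w := by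
    induction hl' with
    | refl => exact ⟨id, Filter.tendsto_id, by rfl, by rfl⟩
    | @tail l₁ l₂ h₁ h₂ ih =>
      obtain ⟨a, ha, rfl⟩ := h₂
      obtain ⟨w, hw, h3, h4⟩ := ih
      refine ⟨w ∘ R a, hw.comp (hR a ha), ?_, ?_⟩
      · exact (hFR _ h₁ a ha).trans ((hR a ha).eventually h3)
      · exact (hFR' _ h₁ a ha).trans ((hR a ha).eventually h4)
  obtain ⟨w, hw, h3, h4⟩ := key
  filter_upwards [hF l' hl', hF' l' hl', hχ.eventually h3, hχ.eventually h4,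
    (hw.comp hχ).eventually hV] with y h1 h2 h3 h4 h5
  exact ⟨w (χ y), h5, h1.trans h3, h2.trans h4⟩

/-- The sign of an orientation. -/
def boolSign (b : Bool) : ℝ := if b then 1 else -1

theorem boolSign_mul_self (b : Bool) : boolSign b * boolSign b = 1 := by
  cases b <;> simp [boolSign]

theorem boolSign_not (b : Bool) : boolSign (!b) = -boolSign b := by
  cases b <;> simp [boolSign]

theorem boolSign_xor (b c : Bool) : boolSign (b ^^ c) = -(boolSign b * boolSign c) := by
  cases b <;> cases c <;> simp [boolSign]

/-- A chart whose restrictions to the cells extend to smooth local coordinates which are related by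
the reflections `R` of the facets; `η` is the sign of the chart. -/
def DevelopsVia (R : Fin 5 ⊕ Fin 5 → E4 → E4) (e : OpenPartialHomeomorph (CoverGluing v τ P) E4)
    (η : ℝ) (F : CellLabel → E4 → E4) : Prop :=
  ∀ l (x : P), cellPt v τ P l x ∈ e.source →
    ContDiffAt ℝ ∞ (F l) x ∧ 0 < η * boolSign l.1 * (fderiv ℝ (F l) x).det ∧
    (∀ᶠ y in 𝓝 x, e (cellPt v τ P l y) = F l y) ∧
    ∀ a, (x : E4) ∈ facetPlane v τ a → F (crossFacet a l) =ᶠ[𝓝 (x : E4)] F l ∘ R a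

/-- Near `e m` the transition is `F' ∘ F⁻¹`, with the local inverse supplied by the inverse function
theorem; the determinant formula is the chain rule. -/
theorem transition_of_common_coord {Y : Type*} [TopologicalSpace Y]
    {e e' : OpenPartialHomeomorph Y E4} {F F' : E4 → E4} {z : E4} {m : Y} (hm : m ∈ e.source)
    (hF : ContDiffAt ℝ ∞ F z) (hF' : ContDiffAt ℝ ∞ F' z) (hdet : (fderiv ℝ F z).det ≠ 0)
    (hz : ∀ V ∈ 𝓝 z, ∀ᶠ m' in 𝓝 m, ∃ z' ∈ V, e m' = F z' ∧ e' m' = F' z') (hez : e m = F z) :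
    ContDiffAt ℝ ∞ (e.symm.trans e') (e m) ∧
      (fderiv ℝ (e.symm.trans e') (e m)).det = (fderiv ℝ F' z).det * ((fderiv ℝ F z).det)⁻¹ := by
  let A := (fderiv ℝ F z).toContinuousLinearEquivOfDetNeZero hdet
  have hA : (A : E4 →L[ℝ] E4) = fderiv ℝ F z := rfl
  have hd : HasFDerivAt F (A : E4 →L[ℝ] E4) z :=
    (hF.differentiableAt (by simp)).hasFDerivAt
  have hs : HasStrictFDerivAt F (A : E4 →L[ℝ] E4) z :=
    hF.hasStrictFDerivAt' hd (by simp)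
  let G := hs.localInverse F A z
  have hGs : ContDiffAt ℝ ∞ G (F z) := hF.to_localInverse hd (by simp)
  have hGz : G (F z) = z := hs.localInverse_apply_image
  have hGd : HasFDerivAt G (A.symm : E4 →L[ℝ] E4) (F z) := hs.to_localInverse.hasFDerivAt
  have heq : (e.symm.trans e' : E4 → E4) =ᶠ[𝓝 (e m)] F' ∘ G := by
    have h1 := hz _ hs.eventually_left_inverse
    have h2 : Filter.Tendsto e.symm (𝓝 (e m)) (𝓝 m) := by
      have := e.continuousAt_symm (e.map_source hm)
      rwa [ContinuousAt, e.left_inv hm] at this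
    filter_upwards [h2.eventually h1, e.open_target.mem_nhds (e.map_source hm)] with d hd hdt
    obtain ⟨z', hz', h3, h4⟩ := hd
    rw [e.right_inv hdt] at h3
    show e' (e.symm d) = F' (G d)
    rw [h4, h3]
    exact congrArg F' hz'.symm
  rw [hez] at heq ⊢
  constructor
  · refine ContDiffAt.congr_of_eventuallyEq ?_ heq
    exact ContDiffAt.comp _ (by rwa [hGz]) hGs
  · rw [heq.fderiv_eq]
    have hF'd : HasFDerivAt F' (fderiv ℝ F' z) (G (F z)) := by
      rw [hGz]; exact (hF'.differentiableAt (by simp)).hasFDerivAt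
    rw [(hF'd.comp _ hGd).fderiv]
    change LinearMap.det ((fderiv ℝ F' z : E4 →ₗ[ℝ] E4) ∘ₗ ((A.symm : E4 →L[ℝ] E4) : E4 →ₗ[ℝ] E4)) = _
    rw [LinearMap.det_comp]
    congr 1
    have h5 := congrArg LinearMap.det (show ((A.symm : E4 →L[ℝ] E4) : E4 →ₗ[ℝ] E4) ∘ₗ
      ((A : E4 →L[ℝ] E4) : E4 →ₗ[ℝ] E4) = LinearMap.id from by ext; simp)
    rw [LinearMap.det_comp, LinearMap.det_id, hA] at h5
    exact eq_inv_of_mul_eq_one_left h5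

theorem DevelopsVia.common_coord {R : Fin 5 ⊕ Fin 5 → E4 → E4}
    {e e' : OpenPartialHomeomorph (CoverGluing v τ P) E4} {η η' : ℝ} {F F' : CellLabel → E4 → E4}
    (hR : ∀ a, ∀ x ∈ P, x ∈ facetPlane v τ a → Filter.Tendsto (R a) (𝓝 x) (𝓝 x))
    (hF : DevelopsVia R e η F) (hF' : DevelopsVia R e' η' F') {l : CellLabel} {x : P}
    (hm : cellPt v τ P l x ∈ e.source) (hm' : cellPt v τ P l x ∈ e'.source)
    {V : Set E4} (hV : V ∈ 𝓝 (x : E4)) :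
    ∀ᶠ m in 𝓝 (cellPt v τ P l x), ∃ z ∈ V, e m = F l z ∧ e' m = F' l z := by
  have hl : ∀ l', Linked v τ x l l' → cellPt v τ P l' x = cellPt v τ P l x := fun l' h =>
    (cellPt_eq_iff.2 ⟨rfl, h⟩).symm
  exact exists_common_coord (χ := Subtype.val) continuous_subtype_val.continuousAt (R := R)
    (fun a ha => hR a x x.2 ha)
    (fun l' h => (hF l' x (by rw [hl l' h]; exact hm)).2.2.1)
    (fun l' h => (hF' l' x (by rw [hl l' h]; exact hm')).2.2.1)
    (fun l' h => (hF l' x (by rw [hl l' h]; exact hm)).2.2.2)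
    (fun l' h => (hF' l' x (by rw [hl l' h]; exact hm')).2.2.2) hV

/-- Both charts are read in the same cell, so the orientation sign of the cell enters squared and
only the signs of the two charts remain. -/
theorem DevelopsVia.transition {R : Fin 5 ⊕ Fin 5 → E4 → E4}
    {e e' : OpenPartialHomeomorph (CoverGluing v τ P) E4} {η η' : ℝ} {F F' : CellLabel → E4 → E4}
    (hR : ∀ a, ∀ x ∈ P, x ∈ facetPlane v τ a → Filter.Tendsto (R a) (𝓝 x) (𝓝 x))
    (hF : DevelopsVia R e η F) (hF' : DevelopsVia R e' η' F') {m : CoverGluing v τ P}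
    (hm : m ∈ e.source) (hm' : m ∈ e'.source) :
    ContDiffAt ℝ ∞ (e.symm.trans e') (e m) ∧
      0 < η * η' * (fderiv ℝ (e.symm.trans e') (e m)).det := by
  obtain ⟨l, x, rfl⟩ := exists_cellPt m
  obtain ⟨h1, h2, h3, -⟩ := hF l x hm
  obtain ⟨h1', h2', h3', -⟩ := hF' l x hm'
  have hdet : (fderiv ℝ (F l) x).det ≠ 0 := by
    rintro h0
    simp [h0] at h2
  have key := transition_of_common_coord (e' := e') hm h1 h1' hdet
    (fun V hV => hF.common_coord hR hF' hm hm' hV) h3.self_of_nhds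
  refine ⟨key.1, ?_⟩
  rw [key.2]
  have h4 := mul_pos h2 h2'
  have h5 : 0 < ((fderiv ℝ (F l) x).det)⁻¹ ^ 2 := by positivity
  have h6 := mul_pos h4 h5
  have e1 : η * boolSign l.1 * (fderiv ℝ (F l) x).det * (η' * boolSign l.1 *
      (fderiv ℝ (F' l) x).det) * ((fderiv ℝ (F l) x).det)⁻¹ ^ 2 =
      (boolSign l.1 * boolSign l.1) * (η * η' * ((fderiv ℝ (F' l) x).det *
        ((fderiv ℝ (F l) x).det)⁻¹)) := by
    field_simp
  rwa [e1, boolSign_mul_self, one_mul] at h6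

end Unfold

/-! ### Sectors of the plane -/

/-- The six elements of the reflection group of type `A₂`, in the coordinates given by the simple
roots. -/
def sec (n : Fin 6) (p : ℝ × ℝ) : ℝ × ℝ :=
  (![p, (-p.1, p.1 + p.2), (-p.1 - p.2, p.1), (-p.2, -p.1), (p.2, -p.1 - p.2),
    (p.1 + p.2, -p.2)] : Fin 6 → ℝ × ℝ) n

/-- The folding of the plane onto the closed chamber of `A₂`. -/
def fold2 (p : ℝ × ℝ) : ℝ × ℝ :=
  -- With y = (p.1 + p.2, p.2, 0), the coordinates of `p` are the consecutive differences of y, and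
  -- A₂ acts by permuting the entries. Folding sorts y; its middle entry is the sum p.1 + 2 p.2
  -- minus the maximum and the minimum.
  (2 * max (p.1 + p.2) (max p.2 0) + min (p.1 + p.2) (min p.2 0) - (p.1 + 2 * p.2),
    p.1 + 2 * p.2 - max (p.1 + p.2) (max p.2 0) - 2 * min (p.1 + p.2) (min p.2 0))

/-- Starting at sector 0 and crossing walls of the two kinds alternately visits all six sectors. -/
theorem forall_sector {p : Fin 6 → Prop} (h0 : p 0) (hα : ∀ n, p n → p (nbα n))
    (hβ : ∀ n, p n → p (nbβ n)) : ∀ n, p n := by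
  have h1 := hα 0 h0
  have h2 := hβ _ h1
  have h3 := hα _ h2
  have h4 := hβ _ h3
  have h5 := hα _ h4
  intro n
  fin_cases n
  exacts [h0, h1, h2, h3, h4, h5]

theorem sec_zero (p : ℝ × ℝ) : sec 0 p = p := rfl

theorem nbα_nbα : ∀ n, nbα (nbα n) = n := by decide

theorem nbβ_nbβ : ∀ n, nbβ (nbβ n) = n := by decide

theorem sec_nbα (n : Fin 6) (p : ℝ × ℝ) : sec (nbα n) p = sec n (-p.1, p.1 + p.2) := by
  fin_cases n <;> simp [sec, nbα] <;> ring_nf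

theorem sec_nbβ (n : Fin 6) (p : ℝ × ℝ) : sec (nbβ n) p = sec n (p.1 + p.2, -p.2) := by
  fin_cases n <;> simp [sec, nbβ] <;> ring_nf

theorem continuous_fold2 : Continuous fold2 := by
  unfold fold2
  fun_prop

theorem fold2_nonneg (p : ℝ × ℝ) : 0 ≤ (fold2 p).1 ∧ 0 ≤ (fold2 p).2 := by
  simp only [fold2]
  constructor <;>
  · rcases le_total (p.1 + p.2) p.2 with h1 | h1 <;> rcases le_total p.2 0 with h2 | h2 <;>
    rcases le_total (p.1 + p.2) 0 with h3 | h3 <;> simp [h1, h2, h3] <;> linarith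

theorem fold2_sec (n : Fin 6) {p : ℝ × ℝ} (h1 : 0 ≤ p.1) (h2 : 0 ≤ p.2) :
    fold2 (sec n p) = p := by
  have h3 : 0 ≤ p.1 + p.2 := by linarith
  obtain ⟨a, b⟩ := p
  simp only at h1 h2 h3
  have e1 : -a + (a + b) = b := by ring
  have e2 : -a - b + a = -b := by ring
  have e3 : b + (-a - b) = -a := by ring
  have e4 : a + b + -b = a := by ring
  have i1 : b ≤ a + b := by linarith
  have i2 : a ≤ a + b := by linarith
  have i3 : -b ≤ a := by linarith
  have i4 : -a - b ≤ -a := by linarith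
  have i5 : -b + -a ≤ -a := by linarith
  have i6 : -a - b ≤ 0 := by linarith
  have i7 : -a ≤ 0 := by linarith
  have i8 : -b ≤ 0 := by linarith
  have i9 : -b + -a ≤ 0 := by linarith
  fin_cases n <;> refine Prod.ext ?_ ?_ <;>
  simp [fold2, sec, e1, e2, e3, e4, h1, h2, h3, i1, i3, i4, i5, i6, i7, i8, i9] <;> linarith

theorem exists_sec_fold2 (p : ℝ × ℝ) : ∃ n, sec n (fold2 p) = p := by
  obtain ⟨a, b⟩ := p
  simp only [fold2]
  rcases le_total (a + b) b with h1 | h1 <;> rcases le_total b 0 with h2 | h2 <;>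
  rcases le_total (a + b) 0 with h3 | h3 <;> simp only [h1, h2, h3, sup_of_le_left,
    sup_of_le_right, inf_of_le_left, inf_of_le_right]
  · exact ⟨3, by refine Prod.ext ?_ ?_ <;> simp [sec] <;> linarith⟩
  · exact ⟨3, by refine Prod.ext ?_ ?_ <;> simp [sec] <;> linarith⟩
  · exact ⟨2, by refine Prod.ext ?_ ?_ <;> simp [sec] <;> linarith⟩
  · exact ⟨1, by refine Prod.ext ?_ ?_ <;> simp [sec] <;> linarith⟩
  · exact ⟨4, by refine Prod.ext ?_ ?_ <;> simp [sec] <;> linarith⟩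
  · exact ⟨5, by refine Prod.ext ?_ ?_ <;> simp [sec] <;> linarith⟩
  · exact ⟨0, by refine Prod.ext ?_ ?_ <;> simp [sec] <;> linarith⟩
  · exact ⟨0, by refine Prod.ext ?_ ?_ <;> simp [sec] <;> linarith⟩

/-- The stabiliser of a point of the closed chamber is generated by the simple reflections fixing
it. The relation `r` abstracts the linkage of cells. -/
theorem sec_eq_sec {p : ℝ × ℝ} (h1 : 0 ≤ p.1) (h2 : 0 ≤ p.2) {n n' : Fin 6}
    (h : sec n p = sec n' p) {r : Fin 6 → Fin 6 → Prop} (hr : ∀ n, r n n)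
    (ht : ∀ a b c, r a b → r b c → r a c) (hα : p.1 = 0 → ∀ n, r n (nbα n))
    (hβ : p.2 = 0 → ∀ n, r n (nbβ n)) : r n n' := by
  obtain ⟨a, b⟩ := p
  simp only at h1 h2 hα hβ
  rcases h1.eq_or_lt with rfl | h1
  · rcases h2.eq_or_lt with rfl | h2
    · have h0 : ∀ n, r 0 n ∧ r n 0 := by
        refine forall_sector ⟨hr 0, hr 0⟩ (fun n hn => ?_) (fun n hn => ?_)
        · refine ⟨ht _ _ _ hn.1 (hα rfl n), ht _ _ _ ?_ hn.2⟩
          have := hα rfl (nbα n)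
          rwa [nbα_nbα] at this
        · refine ⟨ht _ _ _ hn.1 (hβ rfl n), ht _ _ _ ?_ hn.2⟩
          have := hβ rfl (nbβ n)
          rwa [nbβ_nbβ] at this
      exact ht _ _ _ (h0 n).2 (h0 n').1
    · have : n' = n ∨ n' = nbα n := by
        fin_cases n <;> fin_cases n' <;> simp [nbα] <;> simp [sec] at h <;> linarith
      rcases this with rfl | rfl
      · exact hr _
      · exact hα rfl n
  · rcases h2.eq_or_lt with rfl | h2
    · have : n' = n ∨ n' = nbβ n := by
        fin_cases n <;> fin_cases n' <;> simp [nbβ] <;> simp [sec] at h <;> linarith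
      rcases this with rfl | rfl
      · exact hr _
      · exact hβ rfl n
    · have : n' = n := by
        fin_cases n <;> fin_cases n' <;> first | rfl | (exfalso; simp [sec] at h; linarith)
      subst this
      exact hr _

theorem contDiff_sec (n : Fin 6) : ContDiff ℝ ∞ (sec n) := by
  fin_cases n
  · exact contDiff_id
  · exact (by fun_prop : ContDiff ℝ ∞ fun p : ℝ × ℝ => (-p.1, p.1 + p.2))
  · exact (by fun_prop : ContDiff ℝ ∞ fun p : ℝ × ℝ => (-p.1 - p.2, p.1))
  · exact (by fun_prop : ContDiff ℝ ∞ fun p : ℝ × ℝ => (-p.2, -p.1))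
  · exact (by fun_prop : ContDiff ℝ ∞ fun p : ℝ × ℝ => (p.2, -p.1 - p.2))
  · exact (by fun_prop : ContDiff ℝ ∞ fun p : ℝ × ℝ => (p.1 + p.2, -p.2))

/-! ### Coordinates of the simplex -/

/-- The affine coordinates of the cut simplex: the facets lie where a coordinate is `0` or `1`. -/
def cutCoord (v : Fin 5 → E4) (τ : ℝ) (x : E4) (i : Fin 5) : ℝ :=
  (inner ℝ x (v i) + 2 / 3) / (τ + 2 / 3)

/-- The point with given affine coordinates. -/
def cutPoint (v : Fin 5 → E4) (τ : ℝ) (c : Fin 5 → ℝ) : E4 :=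
  (3 / 10 : ℝ) • ∑ i, ((τ + 2 / 3) * c i - 2 / 3) • v i

/-- The sum of the affine coordinates. -/
def cutLevel (τ : ℝ) : ℝ := 10 / (3 * τ + 2)

section Coord

variable {v : Fin 5 → E4} {τ : ℝ}

theorem continuous_cutCoord : Continuous (cutCoord v τ) := by
  unfold cutCoord
  fun_prop

theorem contDiff_cutCoord : ContDiff ℝ ∞ (cutCoord v τ) := by
  unfold cutCoord
  refine contDiff_pi.2 fun i => ?_
  simp only [div_eq_mul_inv]
  exact ((contDiff_id.inner ℝ contDiff_const).add contDiff_const).mul contDiff_const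

theorem contDiff_cutPoint : ContDiff ℝ ∞ (cutPoint v τ) := by
  unfold cutPoint
  fun_prop

theorem continuous_cutPoint : Continuous (cutPoint v τ) := contDiff_cutPoint.continuous

variable (hv : IsRegularSimplex v)
include hv

/-- The Gram matrix is (10/3) I − (2/3) J, with J the all-ones matrix. -/
theorem inner_sum_smul (y : Fin 5 → ℝ) (i : Fin 5) :
    inner ℝ (∑ j, y j • v j) (v i) = 10 / 3 * y i - 2 / 3 * ∑ j, y j := by
  rw [sum_inner]
  simp only [real_inner_smul_left]
  simp only [hv _ i]
  simp only [Fin.sum_univ_five]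
  fin_cases i <;> simp <;> ring

theorem sum_simplex : ∑ i, v i = 0 := by
  have h : ∀ i, inner ℝ (∑ j, v j) (v i) = 0 := by
    intro i
    have := inner_sum_smul hv (fun _ => 1) i
    simp only [one_smul, Fin.sum_univ_five] at this ⊢
    rw [this]; norm_num
  rw [← inner_self_eq_zero (𝕜 := ℝ)]
  conv_lhs => rw [inner_sum]
  exact Finset.sum_eq_zero fun i _ => h i

/-- The Gram matrix of four of the vertices is nonsingular, so these four vectors span ℝ⁴. -/
theorem eq_zero_of_inner_simplex {y : E4} (h : ∀ i, inner ℝ y (v i) = 0) : y = 0 := by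
  have hli : LinearIndependent ℝ (fun i : Fin 4 => v i.castSucc) := by
    rw [Fintype.linearIndependent_iff]
    intro g hg
    have h1 : ∀ i : Fin 4, 10 / 3 * g i - 2 / 3 * ∑ j, g j = 0 := by
      intro i
      have h2 := inner_sum_smul hv (Fin.snoc (α := fun _ => ℝ) g 0) i.castSucc
      have e1 : ∑ j : Fin 5, (Fin.snoc (α := fun _ => ℝ) g 0 j : ℝ) • v j = 0 := by
        rw [Fin.sum_univ_castSucc]
        simp only [Fin.snoc_castSucc, Fin.snoc_last, zero_smul, add_zero, hg]
      have e2 : ∑ j : Fin 5, (Fin.snoc (α := fun _ => ℝ) g 0 j : ℝ) = ∑ j, g j := by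
        rw [Fin.sum_univ_castSucc]
        simp only [Fin.snoc_castSucc, Fin.snoc_last, add_zero]
      rw [e1, e2, inner_zero_left, Fin.snoc_castSucc] at h2
      exact h2.symm
    intro i
    have h2 := h1 0
    have h3 := h1 1
    have h4 := h1 2
    have h5 := h1 3
    have h6 := h1 i
    simp only [Fin.sum_univ_four] at h2 h3 h4 h5 h6
    linarith
  have htop := hli.span_eq_top_of_card_eq_finrank (by simp)
  have hy : ∀ z ∈ Submodule.span ℝ (Set.range fun i : Fin 4 => v i.castSucc), inner ℝ y z = 0 := by
    intro z hz
    induction hz using Submodule.span_induction with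
    | mem z hz => obtain ⟨i, rfl⟩ := hz; exact h _
    | zero => simp
    | add a b _ _ ha hb => rw [inner_add_right, ha, hb, add_zero]
    | smul t a _ ha => rw [inner_smul_right, ha, mul_zero]
  rw [← inner_self_eq_zero (𝕜 := ℝ)]
  exact hy y (by rw [htop]; trivial)

variable (hτ : 0 < τ + 2 / 3)
include hτ

/-- The inner products with the vertices sum to zero, since the barycentre is the origin. The level
equals 2 at τ = 1 and 3 at τ = 4/9. -/
theorem sum_cutCoord (x : E4) : ∑ i, cutCoord v τ x i = cutLevel τ := by
  have h : ∑ i, inner ℝ x (v i) = 0 := by rw [← inner_sum, sum_simplex hv, inner_zero_right]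
  simp only [cutCoord, cutLevel]
  rw [← Finset.sum_div, Finset.sum_add_distrib, h]
  have : 3 * τ + 2 ≠ 0 := by linarith
  simp
  field_simp
  norm_num

theorem cutCoord_cutPoint {c : Fin 5 → ℝ} (hc : ∑ i, c i = cutLevel τ) :
    cutCoord v τ (cutPoint v τ c) = c := by
  have h3 : 3 * τ + 2 ≠ 0 := by linarith
  have hs : ∑ j, ((τ + 2 / 3) * c j - 2 / 3) = 0 := by
    rw [Finset.sum_sub_distrib, ← Finset.mul_sum, hc, cutLevel]
    have e : (τ + 2 / 3) * (10 / (3 * τ + 2)) = 10 / 3 := by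
      rw [mul_div_assoc', div_eq_iff h3]
      ring
    rw [e]
    simp
    norm_num
  ext i
  rw [cutCoord, cutPoint, real_inner_smul_left, inner_sum_smul hv, hs, div_eq_iff hτ.ne']
  ring

theorem cutPoint_cutCoord (x : E4) : cutPoint v τ (cutCoord v τ x) = x := by
  rw [← sub_eq_zero]
  refine eq_zero_of_inner_simplex hv fun i => ?_
  have h := congrFun (cutCoord_cutPoint hv hτ (sum_cutCoord hv hτ x)) i
  rw [cutCoord, cutCoord, div_left_inj' hτ.ne'] at h
  rw [inner_sub_left]
  linarith

omit hv in
theorem mem_cutSimplex_iff {x : E4} :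
    x ∈ cutSimplex v τ ↔ ∀ i, 0 ≤ cutCoord v τ x i ∧ cutCoord v τ x i ≤ 1 := by
  refine forall_congr' fun i => ?_
  rw [cutCoord, le_div_iff₀ hτ, zero_mul, div_le_one hτ]
  constructor <;> rintro ⟨h1, h2⟩ <;> constructor <;> linarith

omit hv in
theorem mem_facetPlane_inl {x : E4} {i : Fin 5} :
    x ∈ facetPlane v τ (.inl i) ↔ cutCoord v τ x i = 0 := by
  rw [cutCoord, div_eq_zero_iff]
  simp only [hτ.ne', or_false]
  show inner ℝ x (v i) = _ ↔ _
  constructor <;> intro h <;> linarith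

omit hv in
theorem mem_facetPlane_inr {x : E4} {i : Fin 5} :
    x ∈ facetPlane v τ (.inr i) ↔ cutCoord v τ x i = 1 := by
  rw [cutCoord, div_eq_one_iff_eq hτ.ne']
  show inner ℝ x (v i) = _ ↔ _
  constructor <;> intro h <;> linarith

omit hv in
theorem isCompact_cutSimplex (hv : IsRegularSimplex v) : IsCompact (cutSimplex v τ) := by
  have h : cutSimplex v τ = cutPoint v τ '' ({c | ∑ i, c i = cutLevel τ} ∩
      Set.univ.pi fun _ => Set.Icc 0 1) := by
    ext x
    rw [mem_cutSimplex_iff hτ]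
    constructor
    · exact fun h => ⟨cutCoord v τ x, ⟨sum_cutCoord hv hτ x, fun i _ => h i⟩,
        cutPoint_cutCoord hv hτ x⟩
    · rintro ⟨c, ⟨hc, hc2⟩, rfl⟩ i
      rw [cutCoord_cutPoint hv hτ hc]
      exact hc2 i trivial
  rw [h]
  refine IsCompact.image ?_ continuous_cutPoint
  refine (isCompact_univ_pi fun _ => isCompact_Icc).inter_left ?_
  exact isClosed_eq (by fun_prop) continuous_const

omit hτ hv in
theorem convex_cutSimplex : Convex ℝ (cutSimplex v τ) := by
  have : cutSimplex v τ = ⋂ i, {x | -(2 / 3 : ℝ) ≤ innerₗ E4 (v i) x} ∩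
      {x | innerₗ E4 (v i) x ≤ τ} := by
    ext x
    simp [cutSimplex, real_inner_comm]
  rw [this]
  exact convex_iInter fun i => (convex_halfSpace_ge (innerₗ E4 (v i)).isLinear _).inter
    (convex_halfSpace_le (innerₗ E4 (v i)).isLinear _)

end Coord

/-! ### The Klein model in the coordinates of the simplex -/

/-- The Lorentz form in the homogeneous coordinates of the simplex. -/
def bform (C D : Fin 5 → ℝ) : ℝ := (∑ i, C i) * (∑ i, D i) / 2 - ∑ i, C i * D i

/-- The positive light cone. -/
def lorCone : Set (Fin 5 → ℝ) := {C | 0 < bform C C ∧ 0 < ∑ i, C i}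

/-- Homogeneous maps that preserve the Lorentz form and the positive light cone. -/
structure IsLor (A : (Fin 5 → ℝ) → Fin 5 → ℝ) : Prop where
  smul : ∀ (t : ℝ) C, A (t • C) = t • A C
  bform : ∀ C D, bform (A C) (A D) = bform C D
  pos : ∀ C ∈ lorCone, 0 < ∑ i, A C i
  contDiff : ContDiff ℝ ∞ A

namespace IsLor

variable {A B : (Fin 5 → ℝ) → Fin 5 → ℝ}

theorem mem (hA : IsLor A) {C : Fin 5 → ℝ} (hC : C ∈ lorCone) : A C ∈ lorCone :=
  ⟨by rw [hA.bform]; exact hC.1, hA.pos C hC⟩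

theorem comp (hA : IsLor A) (hB : IsLor B) : IsLor (A ∘ B) where
  smul t C := by simp [hA.smul, hB.smul]
  bform C D := by simp [hA.bform, hB.bform]
  pos C hC := hA.pos _ (hB.mem hC)
  contDiff := hA.contDiff.comp hB.contDiff

theorem id : IsLor id where
  smul _ _ := rfl
  bform _ _ := rfl
  pos _ hC := hC.2
  contDiff := contDiff_id

end IsLor

theorem bform_smul_smul (s t : ℝ) (C D : Fin 5 → ℝ) :
    bform (s • C) (t • D) = s * t * bform C D := by
  simp only [bform, Pi.smul_apply, smul_eq_mul, ← Finset.mul_sum, mul_mul_mul_comm s _ t _]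
  ring

/-- Cauchy–Schwarz for the four coordinates other than `i`, inserted in the positivity of the
Lorentz form. -/
theorem lorCone_coord_bound {C : Fin 5 → ℝ} (hC : C ∈ lorCone) (i : Fin 5) :
    C i ^ 2 + (∑ j, C j - C i) ^ 2 / 4 < (∑ j, C j) ^ 2 / 2 := by
  have h1 := hC.1
  rw [bform] at h1
  have h2 := sq_sum_le_card_mul_sum_sq (s := Finset.univ.erase i) (f := C)
  rw [Finset.sum_erase_eq_sub (Finset.mem_univ i), Finset.sum_erase_eq_sub (Finset.mem_univ i),
    Finset.card_erase_of_mem (Finset.mem_univ i)] at h2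
  simp only [Finset.card_univ, Fintype.card_fin] at h2
  have h3 : ∑ j, C j * C j = ∑ j, C j ^ 2 := Finset.sum_congr rfl fun j _ => by ring
  rw [h3] at h1
  norm_num at h2
  linarith

/-- The reflections in the facets of the rectified simplex, in homogeneous coordinates. -/
def refl5 : Fin 5 ⊕ Fin 5 → (Fin 5 → ℝ) → Fin 5 → ℝ
  | .inl i, C => fun j => if j = i then -C i else C j + C i
  | .inr k, C => fun j => if j = k then 2 * ∑ i, C i - 3 * C k else C j

theorem sum_refl5_inl (i : Fin 5) (C : Fin 5 → ℝ) :
    ∑ j, refl5 (.inl i) C j = ∑ j, C j + 2 * C i := by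
  fin_cases i <;> simp [refl5, Fin.sum_univ_five] <;> ring

theorem sum_refl5_inr (k : Fin 5) (C : Fin 5 → ℝ) :
    ∑ j, refl5 (.inr k) C j = 3 * ∑ j, C j - 4 * C k := by
  fin_cases k <;> simp [refl5, Fin.sum_univ_five] <;> ring

theorem isLor_refl5 (a : Fin 5 ⊕ Fin 5) : IsLor (refl5 a) where
  smul t C := by
    rcases a with i | i
    · ext j
      simp only [refl5, Pi.smul_apply, smul_eq_mul]
      split_ifs <;> ring
    · ext j
      simp only [refl5, Pi.smul_apply, smul_eq_mul, ← Finset.mul_sum]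
      split_ifs <;> ring
  bform C D := by
    rcases a with i | i
    · fin_cases i <;> simp [bform, refl5, Fin.sum_univ_five] <;> ring
    · fin_cases i <;> simp [bform, refl5, Fin.sum_univ_five] <;> ring
  -- The bound confines C_i / Σ C to the interval between (1 − √6)/5 and (1 + √6)/5, which lies
  -- inside (−1/2, 3/4). Hence Σ C + 2 C_i and 3 Σ C − 4 C_i are positive.
  pos C hC := by
    rcases a with i | i
    · rw [sum_refl5_inl]
      have := lorCone_coord_bound hC i
      have := hC.2
      by_contra! h
      nlinarith
    · rw [sum_refl5_inr]
      have := lorCone_coord_bound hC i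
      have := hC.2
      by_contra! h
      nlinarith
  contDiff := by
    rcases a with i | i
    · refine contDiff_pi.2 fun j => ?_
      simp only [refl5]
      split_ifs <;> fun_prop
    · refine contDiff_pi.2 fun j => ?_
      simp only [refl5]
      split_ifs <;> fun_prop

/-- Equivariance under relabelling reduces every corner to the standard one with facets 0, 1, 2' and
3'. -/
theorem refl5_comp_perm (π : Equiv.Perm (Fin 5)) (a : Fin 5 ⊕ Fin 5) (C : Fin 5 → ℝ) :
    refl5 (Sum.map π π a) C ∘ π = refl5 a (C ∘ π) := by
  rcases a with i | i
  · ext j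
    simp [refl5]
  · ext j
    simp [refl5, Equiv.sum_comp π C]

theorem bform_comp_perm (π : Equiv.Perm (Fin 5)) (C D : Fin 5 → ℝ) :
    bform (C ∘ π) (D ∘ π) = bform C D := by
  simp [bform, Equiv.sum_comp π C, Equiv.sum_comp π D, Equiv.sum_comp π fun i => C i * D i]

theorem comp_perm_mem_lorCone {π : Equiv.Perm (Fin 5)} {C : Fin 5 → ℝ} (h : C ∈ lorCone) :
    C ∘ π ∈ lorCone :=
  ⟨by rw [bform_comp_perm]; exact h.1, by
    have := Equiv.sum_comp π C
    simpa [this] using h.2⟩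

theorem IsLor.conj {A : (Fin 5 → ℝ) → Fin 5 → ℝ} (hA : IsLor A) (π : Equiv.Perm (Fin 5)) :
    IsLor fun C => A (C ∘ π) ∘ π.symm where
  smul t C := by
    rw [show (t • C) ∘ π = t • (C ∘ π) from rfl, hA.smul]
    rfl
  bform C D := by rw [bform_comp_perm, hA.bform, bform_comp_perm]
  pos C hC := (comp_perm_mem_lorCone (hA.mem (comp_perm_mem_lorCone hC))).2
  contDiff := by
    have h1 : ContDiff ℝ ∞ fun C : Fin 5 → ℝ => C ∘ π :=
      contDiff_pi.2 fun i => contDiff_apply ℝ ℝ (π i)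
    have h2 : ContDiff ℝ ∞ fun C : Fin 5 → ℝ => C ∘ π.symm :=
      contDiff_pi.2 fun i => contDiff_apply ℝ ℝ (π.symm i)
    exact h2.comp (hA.contDiff.comp h1)

/-- The multiple of a vector with coordinate sum `2`. -/
def norm5 (C : Fin 5 → ℝ) : Fin 5 → ℝ := (2 / ∑ i, C i) • C

theorem sum_norm5 {C : Fin 5 → ℝ} (h : ∑ i, C i ≠ 0) : ∑ i, norm5 C i = 2 := by
  simp only [norm5, Pi.smul_apply, smul_eq_mul, ← Finset.mul_sum]
  field_simp

theorem norm5_smul {t : ℝ} (ht : t ≠ 0) (C : Fin 5 → ℝ) : norm5 (t • C) = norm5 C := by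
  simp only [norm5, Pi.smul_apply, smul_eq_mul, ← Finset.mul_sum, smul_smul]
  congr 1
  by_cases h : ∑ i, C i = 0
  · simp [h]
  · field_simp

theorem norm5_of_sum {C : Fin 5 → ℝ} (h : ∑ i, C i = 2) : norm5 C = C := by
  simp [norm5, h]

theorem norm5_mem_lorCone {C : Fin 5 → ℝ} (h : C ∈ lorCone) : norm5 C ∈ lorCone := by
  have h2 := h.2
  refine ⟨?_, ?_⟩
  · rw [norm5, bform_smul_smul]
    have := h.1
    positivity
  · rw [sum_norm5 h2.ne']
    norm_num

section Klein

variable (v : Fin 5 → E4)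

/-- The projective map of the Klein model given by a map of the homogeneous coordinates. -/
def kl (A : (Fin 5 → ℝ) → Fin 5 → ℝ) (x : E4) : E4 := cutPoint v 1 (norm5 (A (cutCoord v 1 x)))

variable {v} (hv : IsRegularSimplex v)
include hv

omit hv in
theorem cutLevel_one : cutLevel 1 = 2 := by norm_num [cutLevel]

theorem sum_cutCoord_one (x : E4) : ∑ i, cutCoord v 1 x i = 2 := by
  rw [sum_cutCoord hv (by norm_num), cutLevel_one]

/-- This identifies `bform` with the Lorentz form of the Klein model up to a constant factor, so
that maps preserving `bform` act as hyperbolic isometries. -/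
theorem bform_cutCoord (x y : E4) :
    1 - inner ℝ x y = 5 / 6 * bform (cutCoord v 1 x) (cutCoord v 1 y) := by
  have hx := cutPoint_cutCoord hv (τ := 1) (by norm_num) x
  have h1 : inner ℝ x y = 3 / 10 * ∑ i, ((1 + 2 / 3) * cutCoord v 1 x i - 2 / 3) *
      ((1 + 2 / 3) * cutCoord v 1 y i - 2 / 3) := by
    conv_lhs => rw [← hx]
    rw [cutPoint, real_inner_smul_left, sum_inner]
    congr 1
    refine Finset.sum_congr rfl fun i _ => ?_
    rw [real_inner_smul_left, real_inner_comm]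
    congr 1
    rw [cutCoord]
    field_simp
    ring
  have sx := sum_cutCoord_one hv x
  have sy := sum_cutCoord_one hv y
  rw [h1, bform, sx, sy]
  simp only [Fin.sum_univ_five] at *
  linear_combination (5 / 6 * (2 / 5)) * sx + (5 / 6 * (2 / 5)) * sy

theorem mem_ball_iff_cutCoord {x : E4} : x ∈ Metric.ball 0 1 ↔ cutCoord v 1 x ∈ lorCone := by
  have h := bform_cutCoord hv x x
  rw [real_inner_self_eq_norm_sq] at h
  rw [mem_ball_zero_iff, lorCone, Set.mem_ofPred_eq, sum_cutCoord_one hv]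
  constructor
  · intro hx
    refine ⟨?_, by norm_num⟩
    nlinarith [norm_nonneg x]
  · rintro ⟨h1, -⟩
    nlinarith [norm_nonneg x]

theorem cutCoord_cutPoint_norm5 {C : Fin 5 → ℝ} (hC : ∑ i, C i ≠ 0) :
    cutCoord v 1 (cutPoint v 1 (norm5 C)) = norm5 C :=
  cutCoord_cutPoint hv (by norm_num) (by rw [sum_norm5 hC, cutLevel_one])

theorem cutCoord_kl {A : (Fin 5 → ℝ) → Fin 5 → ℝ} (hA : IsLor A) {x : E4}
    (hx : x ∈ Metric.ball 0 1) : cutCoord v 1 (kl v A x) = norm5 (A (cutCoord v 1 x)) :=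
  cutCoord_cutPoint_norm5 hv (hA.pos _ ((mem_ball_iff_cutCoord hv).1 hx)).ne'

theorem kl_mem_ball {A : (Fin 5 → ℝ) → Fin 5 → ℝ} (hA : IsLor A) {x : E4}
    (hx : x ∈ Metric.ball 0 1) : kl v A x ∈ Metric.ball 0 1 := by
  rw [mem_ball_iff_cutCoord hv, cutCoord_kl hv hA hx]
  exact norm5_mem_lorCone (hA.mem ((mem_ball_iff_cutCoord hv).1 hx))

theorem kl_kl {A B : (Fin 5 → ℝ) → Fin 5 → ℝ} (hA : IsLor A) (hB : IsLor B) {x : E4}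
    (hx : x ∈ Metric.ball 0 1) : kl v A (kl v B x) = kl v (A ∘ B) x := by
  have h := hB.pos _ ((mem_ball_iff_cutCoord hv).1 hx)
  have e : A (norm5 (B (cutCoord v 1 x))) = (2 / ∑ i, B (cutCoord v 1 x) i) • A (B (cutCoord v 1 x)) :=
    hA.smul _ _
  rw [kl, cutCoord_kl hv hB hx, e, norm5_smul (by positivity)]
  rfl

theorem kl_id (x : E4) : kl v id x = x := by
  rw [kl, id, norm5_of_sum (sum_cutCoord_one hv x), cutPoint_cutCoord hv (by norm_num)]

theorem contDiffAt_kl {A : (Fin 5 → ℝ) → Fin 5 → ℝ} (hA : IsLor A) {x : E4}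
    (hx : x ∈ Metric.ball 0 1) : ContDiffAt ℝ ∞ (kl v A) x := by
  have h := hA.pos _ ((mem_ball_iff_cutCoord hv).1 hx)
  refine contDiff_cutPoint.contDiffAt.comp x ?_
  have h1 : ContDiffAt ℝ ∞ (fun x => A (cutCoord v 1 x)) x :=
    (hA.contDiff.comp contDiff_cutCoord).contDiffAt
  have h2 : ContDiffAt ℝ ∞ (fun x => ∑ i, A (cutCoord v 1 x) i) x :=
    ContDiffAt.sum fun i _ => contDiffAt_pi.1 h1 i
  exact ContDiffAt.smul (f := fun x => 2 / ∑ i, A (cutCoord v 1 x) i)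
    (contDiffAt_const.div h2 h.ne') h1

theorem kleinDist_eq (x y : E4) : kleinDist x y = Real.arcosh
    ((5 / 6 * bform (cutCoord v 1 x) (cutCoord v 1 y)) /
      √((5 / 6 * bform (cutCoord v 1 x) (cutCoord v 1 x)) *
        (5 / 6 * bform (cutCoord v 1 y) (cutCoord v 1 y)))) := by
  rw [kleinDist, ← bform_cutCoord hv, ← bform_cutCoord hv, ← bform_cutCoord hv,
    real_inner_self_eq_norm_sq, real_inner_self_eq_norm_sq]

/-- The factors that normalise the coordinate sums are positive and cancel between the numerator and
the square root in the distance. -/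
theorem kleinDist_kl {A : (Fin 5 → ℝ) → Fin 5 → ℝ} (hA : IsLor A) {x y : E4}
    (hx : x ∈ Metric.ball 0 1) (hy : y ∈ Metric.ball 0 1) :
    kleinDist (kl v A x) (kl v A y) = kleinDist x y := by
  have h1 := hA.pos _ ((mem_ball_iff_cutCoord hv).1 hx)
  have h2 := hA.pos _ ((mem_ball_iff_cutCoord hv).1 hy)
  rw [kleinDist_eq hv, kleinDist_eq hv, cutCoord_kl hv hA hx, cutCoord_kl hv hA hy]
  simp only [norm5, bform_smul_smul, hA.bform]
  set s := 2 / ∑ i, A (cutCoord v 1 x) i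
  set t := 2 / ∑ i, A (cutCoord v 1 y) i
  have hs : 0 < s := by positivity
  have ht : 0 < t := by positivity
  congr 1
  have e : ∀ p q : ℝ, 5 / 6 * (s * s * p) * (5 / 6 * (t * t * q)) =
      (s * t) ^ 2 * (5 / 6 * p * (5 / 6 * q)) := by intro p q; ring
  rw [e, Real.sqrt_mul (by positivity), Real.sqrt_sq (by positivity),
    show ∀ p : ℝ, 5 / 6 * (s * t * p) = s * t * (5 / 6 * p) by intro p; ring,
    mul_div_mul_left _ _ (by positivity)]

/-- The reflection of the Klein model in a facet of the rectified simplex. -/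
def kleinRefl (v : Fin 5 → E4) (a : Fin 5 ⊕ Fin 5) : E4 → E4 := kl v (refl5 a)

theorem cutPoint_one (c : Fin 5 → ℝ) : cutPoint v 1 c = (1 / 2 : ℝ) • ∑ i, c i • v i := by
  have h := sum_simplex hv
  have e : ∑ i, ((1 + 2 / 3) * c i - 2 / 3) • v i =
      (5 / 3 : ℝ) • ∑ i, c i • v i - (2 / 3 : ℝ) • ∑ i, v i := by
    rw [Finset.smul_sum, Finset.smul_sum, ← Finset.sum_sub_distrib]
    refine Finset.sum_congr rfl fun i _ => ?_
    module
  rw [cutPoint, e, h, smul_zero, sub_zero, smul_smul]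
  norm_num

theorem kleinRefl_inl (i : Fin 5) (x : E4) : kleinRefl v (.inl i) x =
    (1 + cutCoord v 1 x i)⁻¹ • (x + cutCoord v 1 x i • (-(3 / 2 : ℝ)) • v i) := by
  have hx := cutPoint_cutCoord hv (τ := 1) (by norm_num) x
  rw [cutPoint_one hv] at hx
  have hs := sum_simplex hv
  rw [kleinRefl, kl, cutPoint_one hv, norm5, sum_refl5_inl, sum_cutCoord_one hv]
  have e : 2 / (2 + 2 * cutCoord v 1 x i) = (1 + cutCoord v 1 x i)⁻¹ := by
    rw [show 2 + 2 * cutCoord v 1 x i = 2 * (1 + cutCoord v 1 x i) by ring, ← div_div, div_self two_ne_zero, one_div]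
  rw [e]
  simp only [Pi.smul_apply, smul_assoc, ← Finset.smul_sum]
  rw [smul_comm]
  congr 1
  conv_rhs => rw [← hx]
  have e2 : ∑ j, refl5 (.inl i) (cutCoord v 1 x) j • v j =
      ∑ j, cutCoord v 1 x j • v j + cutCoord v 1 x i • ∑ j, v j -
        (3 * cutCoord v 1 x i) • v i := by
    rw [Finset.smul_sum, ← Finset.sum_add_distrib, eq_sub_iff_add_eq]
    have : (3 * cutCoord v 1 x i) • v i =
        ∑ j, if j = i then (3 * cutCoord v 1 x i) • v j else 0 := by simp
    rw [this, ← Finset.sum_add_distrib]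
    refine Finset.sum_congr rfl fun j _ => ?_
    simp only [refl5]
    split_ifs with h
    · subst h; module
    · module
  rw [e2, hs]
  rw [hx]
  have hx2 : ∑ j, cutCoord v 1 x j • v j = (2 : ℝ) • x := by
    conv_rhs => rw [← hx]
    rw [smul_smul]; norm_num
  rw [hx2]
  module

theorem kleinRefl_inr (k : Fin 5) (x : E4) : kleinRefl v (.inr k) x =
    (1 + 2 * (1 - cutCoord v 1 x k))⁻¹ • (x + (1 - cutCoord v 1 x k) • (2 : ℝ) • v k) := by
  have hx := cutPoint_cutCoord hv (τ := 1) (by norm_num) x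
  rw [cutPoint_one hv] at hx
  rw [kleinRefl, kl, cutPoint_one hv, norm5, sum_refl5_inr, sum_cutCoord_one hv]
  have e : 2 / (3 * 2 - 4 * cutCoord v 1 x k) = (1 + 2 * (1 - cutCoord v 1 x k))⁻¹ := by
    rw [show 3 * 2 - 4 * cutCoord v 1 x k = 2 * (1 + 2 * (1 - cutCoord v 1 x k)) by ring, ← div_div,
      div_self two_ne_zero, one_div]
  rw [e]
  simp only [Pi.smul_apply, smul_assoc, ← Finset.smul_sum]
  rw [smul_comm]
  congr 1
  have hx2 : ∑ j, cutCoord v 1 x j • v j = (2 : ℝ) • x := by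
    conv_rhs => rw [← hx]
    rw [smul_smul]; norm_num
  have e2 : ∑ j, refl5 (.inr k) (cutCoord v 1 x) j • v j =
      ∑ j, cutCoord v 1 x j • v j + (4 * (1 - cutCoord v 1 x k)) • v k := by
    have : (4 * (1 - cutCoord v 1 x k)) • v k =
        ∑ j, if j = k then (4 * (1 - cutCoord v 1 x k)) • v j else 0 := by simp
    rw [this, ← Finset.sum_add_distrib]
    refine Finset.sum_congr rfl fun j _ => ?_
    simp only [refl5, sum_cutCoord_one hv]
    split_ifs with h
    · subst h; module
    · module
  rw [e2, hx2]
  module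

-- With s the denominator at `x`, the derivative is s⁻¹ times the transvection y ↦ y + ⟨w, y⟩ (a − r
-- f(x)). Dimension four produces the fourth power.
omit hv in
theorem det_fderiv_projective (a w x : E4) (q r : ℝ) (f : E4 → E4)
    (hf : ∀ y, f y = (1 + r * (inner ℝ w y + q))⁻¹ • (y + (inner ℝ w y + q) • a))
    (hs : 1 + r * (inner ℝ w x + q) ≠ 0) :
    (fderiv ℝ f x).det = (1 + r * (inner ℝ w x + q))⁻¹ ^ 4 * (1 + inner ℝ w (a - r • f x)) := by
  set s := 1 + r * (inner ℝ w x + q)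
  have h1 : HasFDerivAt (fun y => inner ℝ w y + q) (innerSL ℝ w) x :=
    ((innerSL ℝ w).hasFDerivAt (x := x)).add_const q
  have h2 : HasFDerivAt (fun y => (1 + r * (inner ℝ w y + q))⁻¹)
      ((-(s ^ 2)⁻¹) • (r • innerSL ℝ w)) x := by
    have := ((h1.const_mul r).const_add 1)
    exact (hasDerivAt_inv hs).comp_hasFDerivAt x this
  have h3 := h2.smul ((hasFDerivAt_id (𝕜 := ℝ) x).add (h1.smul_const a))
  have h5 := h3.congr_of_eventuallyEq (f₁ := f) (Filter.Eventually.of_forall hf)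
  have h6 : ((fderiv ℝ f x : E4 →L[ℝ] E4) : E4 →ₗ[ℝ] E4) =
      s⁻¹ • LinearMap.transvection (innerSL ℝ w : E4 →ₗ[ℝ] ℝ) (a - r • f x) := by
    rw [h5.fderiv]
    ext1 y
    have e1 : f x = s⁻¹ • (x + (inner ℝ w x + q) • a) := hf x
    simp only [LinearMap.smul_apply, LinearMap.transvection.apply, e1, ContinuousLinearMap.coe_coe,
      add_apply, smul_apply,
      ContinuousLinearMap.smulRight_apply, ContinuousLinearMap.id_apply, innerSL_apply_apply,
      smul_eq_mul]
    have e2 : (s ^ 2)⁻¹ = s⁻¹ * s⁻¹ := by rw [sq, mul_inv]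
    rw [e2]
    change s⁻¹ • (y + inner ℝ w y • a) + (-(s⁻¹ * s⁻¹) * (r * inner ℝ w y)) • (x + (inner ℝ w x + q) • a) = _
    module
  rw [ContinuousLinearMap.det, h6, LinearMap.det_smul, LinearMap.transvection.det]
  simp

/-- In the determinant formula for projective maps the last factor reduces to minus the inverse of
the denominator, and the denominator is positive because reflections preserve the positive cone. -/
theorem det_fderiv_kleinRefl_neg (a : Fin 5 ⊕ Fin 5) {x : E4} (hx : x ∈ Metric.ball 0 1) :
    (fderiv ℝ (kleinRefl v a) x).det < 0 := by
  have hc := (mem_ball_iff_cutCoord hv).1 hx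
  have hpos := (isLor_refl5 a).pos _ hc
  rcases a with i | i
  · rw [sum_refl5_inl, sum_cutCoord_one hv] at hpos
    have hcoord : ∀ y, cutCoord v 1 y i = inner ℝ ((3 / 5 : ℝ) • v i) y + 2 / 5 := by
      intro y
      rw [cutCoord, real_inner_smul_left, real_inner_comm]
      field_simp
      ring
    have hs : 1 + cutCoord v 1 x i ≠ 0 := by linarith
    have hf : ∀ y, kleinRefl v (.inl i) y = (1 + 1 * (inner ℝ ((3 / 5 : ℝ) • v i) y + 2 / 5))⁻¹ •
        (y + (inner ℝ ((3 / 5 : ℝ) • v i) y + 2 / 5) • (-(3 / 2 : ℝ)) • v i) := by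
      intro y
      rw [kleinRefl_inl hv, hcoord, one_mul]
    rw [det_fderiv_projective _ _ _ _ _ _ hf (by rw [one_mul, ← hcoord]; exact hs)]
    rw [one_mul, ← hcoord, inner_sub_right, one_smul]
    have e1 := hcoord (kleinRefl v (.inl i) x)
    have e2 := congrFun (cutCoord_kl hv (isLor_refl5 (.inl i)) hx) i
    rw [kleinRefl] at e1
    rw [e2, norm5, sum_refl5_inl, sum_cutCoord_one hv] at e1
    simp only [Pi.smul_apply, refl5, if_true, smul_eq_mul] at e1
    have e3 : inner ℝ ((3 / 5 : ℝ) • v i) (kleinRefl v (.inl i) x) =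
      2 / (2 + 2 * cutCoord v 1 x i) * -cutCoord v 1 x i - 2 / 5 := by
        rw [kleinRefl]; linarith
    rw [e3, real_inner_smul_left, real_inner_smul_right, hv i i, if_pos rfl]
    have hp : 0 < (1 + cutCoord v 1 x i) := by linarith
    refine mul_neg_of_pos_of_neg (by positivity) ?_
    have : (2 + 2 * cutCoord v 1 x i) ≠ 0 := by linarith
    have e4 : 1 + (3 / 5 * (-(3 / 2) * (8 / 3)) - (2 / (2 + 2 * cutCoord v 1 x i) *
        -cutCoord v 1 x i - 2 / 5)) = -(1 + cutCoord v 1 x i)⁻¹ := by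
      field_simp
      ring
    rw [e4]
    simpa using hp
  · rw [sum_refl5_inr, sum_cutCoord_one hv] at hpos
    have hcoord : ∀ y, 1 - cutCoord v 1 y i = inner ℝ ((-(3 / 5 : ℝ)) • v i) y + 3 / 5 := by
      intro y
      rw [cutCoord, real_inner_smul_left, real_inner_comm]
      field_simp
      ring
    have hp : 0 < 1 + 2 * (1 - cutCoord v 1 x i) := by linarith
    have hf : ∀ y, kleinRefl v (.inr i) y = (1 + 2 * (inner ℝ ((-(3 / 5 : ℝ)) • v i) y + 3 / 5))⁻¹ •
        (y + (inner ℝ ((-(3 / 5 : ℝ)) • v i) y + 3 / 5) • (2 : ℝ) • v i) := by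
      intro y
      rw [kleinRefl_inr hv, hcoord]
    rw [det_fderiv_projective _ _ _ _ _ _ hf (by rw [← hcoord]; exact hp.ne')]
    rw [← hcoord, inner_sub_right, real_inner_smul_right _ (kleinRefl v (.inr i) x)]
    have e1 := hcoord (kleinRefl v (.inr i) x)
    have e2 := congrFun (cutCoord_kl hv (isLor_refl5 (.inr i)) hx) i
    rw [kleinRefl] at e1
    rw [e2, norm5, sum_refl5_inr, sum_cutCoord_one hv] at e1
    simp only [Pi.smul_apply, refl5, if_true, smul_eq_mul, sum_cutCoord_one hv] at e1
    have e3 : inner ℝ ((-(3 / 5 : ℝ)) • v i) (kleinRefl v (.inr i) x) =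
      1 - 2 / (3 * 2 - 4 * cutCoord v 1 x i) * (2 * 2 - 3 * cutCoord v 1 x i) - 3 / 5 := by
        rw [kleinRefl]; linarith
    rw [e3, real_inner_smul_left, real_inner_smul_right, hv i i, if_pos rfl]
    refine mul_neg_of_pos_of_neg (by positivity) ?_
    have : (3 * 2 - 4 * cutCoord v 1 x i) ≠ 0 := by linarith
    have h' : (1 + 2 * (1 - cutCoord v 1 x i)) ≠ 0 := hp.ne'
    have e4 : 1 + (-(3 / 5) * (2 * (8 / 3)) - 2 * (1 - 2 / (3 * 2 - 4 * cutCoord v 1 x i) *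
        (2 * 2 - 3 * cutCoord v 1 x i) - 3 / 5)) = -(1 + 2 * (1 - cutCoord v 1 x i))⁻¹ := by
      rw [show 3 * 2 - 4 * cutCoord v 1 x i = 2 * (1 + 2 * (1 - cutCoord v 1 x i)) by ring]
      field_simp
      ring
    rw [e4]
    simpa using hp

theorem kleinRefl_of_mem {a : Fin 5 ⊕ Fin 5} {x : E4} (hx : x ∈ facetPlane v 1 a) :
    kleinRefl v a x = x := by
  have e : refl5 a (cutCoord v 1 x) = cutCoord v 1 x := by
    rcases a with i | i
    · rw [mem_facetPlane_inl (by norm_num)] at hx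
      ext j
      simp only [refl5, hx]
      split_ifs with h
      · rw [h, hx]; simp
      · simp
    · rw [mem_facetPlane_inr (by norm_num)] at hx
      ext j
      simp only [refl5, hx, sum_cutCoord_one hv]
      split_ifs with h
      · rw [h, hx]; norm_num
      · rfl
  rw [kleinRefl, kl, e, norm5_of_sum (sum_cutCoord_one hv x), cutPoint_cutCoord hv (by norm_num)]

end Klein

/-! ### Unfolding the twelve cells around a corner of the rectified simplex -/

/-- The vector with given values of the forms in which the reflections in the facets `0`, `1` and
`2'` decouple. -/
def mk5 (p : ℝ × ℝ) (γ δ₁ δ₂ : ℝ) : Fin 5 → ℝ :=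
  ![p.1, p.2, δ₁ + δ₂ - γ - p.1 - p.2 - γ, δ₁ + δ₂ - γ - p.1 - p.2 - δ₁ + γ,
    δ₁ + δ₂ - γ - p.1 - p.2 - δ₂ + γ]

/-- The form of the facet `2'`. -/
def formγ (D : Fin 5 → ℝ) : ℝ := (∑ i, D i) / 2 - D 2

/-- The sum of the forms of the facets `2'` and `3'`. -/
def formδ₁ (D : Fin 5 → ℝ) : ℝ := ∑ i, D i - D 2 - D 3

/-- The sum of the forms of the facets `2'` and `4'`. -/
def formδ₂ (D : Fin 5 → ℝ) : ℝ := ∑ i, D i - D 2 - D 4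

/-- The forms δ₁ and δ₂ are invariant under the three reflections at the corner, γ is reversed by
the facet 2' only, and the facets 0 and 1 act on (D 0, D 1) as A₂. The formula of `mk5` comes from Σ
D / 2 = δ₁ + δ₂ − γ − D 0 − D 1. -/
theorem mk5_forms (D : Fin 5 → ℝ) : mk5 (D 0, D 1) (formγ D) (formδ₁ D) (formδ₂ D) = D := by
  ext i
  fin_cases i <;> simp [mk5, formγ, formδ₁, formδ₂, Fin.sum_univ_five] <;> ring

section
variable (p : ℝ × ℝ) (γ δ₁ δ₂ : ℝ)

theorem mk5_zero : mk5 p γ δ₁ δ₂ 0 = p.1 := rfl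

theorem mk5_one : mk5 p γ δ₁ δ₂ 1 = p.2 := rfl

theorem formγ_mk5 : formγ (mk5 p γ δ₁ δ₂) = γ := by
  simp [mk5, formγ, Fin.sum_univ_five]; ring

theorem formδ₁_mk5 : formδ₁ (mk5 p γ δ₁ δ₂) = δ₁ := by
  simp [mk5, formδ₁, Fin.sum_univ_five]; ring

theorem formδ₂_mk5 : formδ₂ (mk5 p γ δ₁ δ₂) = δ₂ := by
  simp [mk5, formδ₂, Fin.sum_univ_five]; ring

end

/-- The action of the reflection group of a corner on homogeneous vectors. -/
def actM (g : Fin 6 × Bool) (D : Fin 5 → ℝ) : Fin 5 → ℝ :=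
  mk5 (sec g.1 (D 0, D 1)) (if g.2 then -formγ D else formγ D) (formδ₁ D) (formδ₂ D)

/-- The folding onto the fundamental chamber of the reflection group of a corner. -/
def foldM (D : Fin 5 → ℝ) : Fin 5 → ℝ :=
  mk5 (fold2 (D 0, D 1)) |formγ D| (formδ₁ D) (formδ₂ D)

theorem refl5_zero (D : Fin 5 → ℝ) : refl5 (.inl 0) D =
    mk5 (-D 0, D 0 + D 1) (formγ D) (formδ₁ D) (formδ₂ D) := by
  ext i
  fin_cases i <;> simp [refl5, mk5, formγ, formδ₁, formδ₂, Fin.sum_univ_five] <;> ring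

theorem refl5_one (D : Fin 5 → ℝ) : refl5 (.inl 1) D =
    mk5 (D 0 + D 1, -D 1) (formγ D) (formδ₁ D) (formδ₂ D) := by
  ext i
  fin_cases i <;> simp [refl5, mk5, formγ, formδ₁, formδ₂, Fin.sum_univ_five] <;> ring

theorem refl5_two (D : Fin 5 → ℝ) : refl5 (.inr 2) D =
    mk5 (D 0, D 1) (-formγ D) (formδ₁ D) (formδ₂ D) := by
  ext i
  fin_cases i <;> simp [refl5, mk5, formγ, formδ₁, formδ₂, Fin.sum_univ_five] <;> ring

theorem actM_id (D : Fin 5 → ℝ) : actM (0, false) D = D := by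
  simp [actM, sec_zero, mk5_forms]

theorem actM_nbα (n : Fin 6) (e : Bool) : actM (nbα n, e) = actM (n, e) ∘ refl5 (.inl 0) := by
  ext1 D
  simp only [actM, Function.comp, refl5_zero, formγ_mk5, formδ₁_mk5, formδ₂_mk5, mk5_zero, mk5_one,
    sec_nbα]

theorem actM_nbβ (n : Fin 6) (e : Bool) : actM (nbβ n, e) = actM (n, e) ∘ refl5 (.inl 1) := by
  ext1 D
  simp only [actM, Function.comp, refl5_one, formγ_mk5, formδ₁_mk5, formδ₂_mk5, mk5_zero, mk5_one,
    sec_nbβ]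

theorem actM_not (n : Fin 6) (e : Bool) : actM (n, !e) = actM (n, e) ∘ refl5 (.inr 2) := by
  ext1 D
  simp only [actM, Function.comp, refl5_two, formγ_mk5, formδ₁_mk5, formδ₂_mk5, mk5_zero, mk5_one]
  cases e <;> simp

theorem forall_sector_bool {p : Fin 6 × Bool → Prop} (h0 : p (0, false))
    (hα : ∀ n e, p (n, e) → p (nbα n, e)) (hβ : ∀ n e, p (n, e) → p (nbβ n, e))
    (hγ : ∀ n e, p (n, e) → p (n, !e)) : ∀ g, p g := by
  have h : ∀ n, p (n, false) := forall_sector h0 (fun n => hα n _) (fun n => hβ n _)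
  rintro ⟨n, e⟩
  cases e
  · exact h n
  · exact hγ n false (h n)

theorem isLor_actM (g : Fin 6 × Bool) : IsLor (actM g) := by
  refine forall_sector_bool (p := fun g => IsLor (actM g)) ?_ (fun n e h => ?_) (fun n e h => ?_)
    (fun n e h => ?_) g
  · rw [show actM (0, false) = id from funext actM_id]
    exact IsLor.id
  · rw [actM_nbα]; exact h.comp (isLor_refl5 _)
  · rw [actM_nbβ]; exact h.comp (isLor_refl5 _)
  · rw [actM_not]; exact h.comp (isLor_refl5 _)

theorem foldM_actM (g : Fin 6 × Bool) {D : Fin 5 → ℝ} (h0 : 0 ≤ D 0) (h1 : 0 ≤ D 1)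
    (hγ : 0 ≤ formγ D) : foldM (actM g D) = D := by
  have : |if g.2 then -formγ D else formγ D| = formγ D := by
    split_ifs
    · rw [abs_neg, abs_of_nonneg hγ]
    · rw [abs_of_nonneg hγ]
  conv_rhs => rw [← mk5_forms D]
  simp only [foldM, actM, formγ_mk5, formδ₁_mk5, formδ₂_mk5, mk5_zero, mk5_one, this, Prod.mk.eta]
  rw [fold2_sec g.1 (p := (D 0, D 1)) h0 h1]

theorem exists_actM_foldM (D : Fin 5 → ℝ) : ∃ g, actM g (foldM D) = D := by
  obtain ⟨n, hn⟩ := exists_sec_fold2 (D 0, D 1)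
  refine ⟨(n, decide (formγ D < 0)), ?_⟩
  conv_rhs => rw [← mk5_forms D]
  simp only [foldM, actM, formγ_mk5, formδ₁_mk5, formδ₂_mk5, mk5_zero, mk5_one, Prod.mk.eta, hn]
  congr 1
  by_cases h : formγ D < 0
  · simp [h, abs_of_neg h]
  · simp [h, abs_of_nonneg (not_lt.1 h)]

theorem continuous_foldM : Continuous foldM := by
  have h1 : Continuous formγ := by unfold formγ; fun_prop
  have h2 : Continuous formδ₁ := by unfold formδ₁; fun_prop
  have h3 : Continuous formδ₂ := by unfold formδ₂; fun_prop
  have h4 : Continuous fun D : Fin 5 → ℝ => fold2 (D 0, D 1) :=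
    continuous_fold2.comp (by fun_prop)
  refine continuous_pi fun i => ?_
  fin_cases i <;> simp [foldM, mk5] <;> fun_prop

/-- The stabiliser argument for the product A₂ × A₁, one factor at a time. -/
theorem actM_eq_actM {D : Fin 5 → ℝ} (h0 : 0 ≤ D 0) (h1 : 0 ≤ D 1) {g g' : Fin 6 × Bool}
    (h : actM g D = actM g' D) {r : Fin 6 × Bool → Fin 6 × Bool → Prop} (hr : ∀ g, r g g)
    (ht : ∀ a b c, r a b → r b c → r a c) (hα : D 0 = 0 → ∀ n e, r (n, e) (nbα n, e))
    (hβ : D 1 = 0 → ∀ n e, r (n, e) (nbβ n, e)) (hγ : formγ D = 0 → ∀ n e, r (n, e) (n, !e)) :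
    r g g' := by
  obtain ⟨n, e⟩ := g
  obtain ⟨n', e'⟩ := g'
  have hs : sec n (D 0, D 1) = sec n' (D 0, D 1) := by
    have h2 := congrFun h 0
    have h3 := congrFun h 1
    simp only [actM, mk5_zero, mk5_one] at h2 h3
    exact Prod.ext h2 h3
  have hg := congrArg formγ h
  simp only [actM, formγ_mk5] at hg
  have h4 : r (n, e) (n', e) := sec_eq_sec (r := fun n n' => r (n, e) (n', e)) (p := (D 0, D 1))
    h0 h1 hs (fun n => hr _) (fun a b c => ht _ _ _) (fun h n => hα h n e) (fun h n => hβ h n e)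
  by_cases he : e' = e
  · rw [he]; exact h4
  · obtain rfl : e' = !e := by revert he; cases e <;> cases e' <;> simp
    refine ht _ _ _ h4 (hγ ?_ n' e)
    cases e <;> simp at hg <;> linarith

/-! ### The charts of the hyperbolic manifold -/

section KleinChart

variable (v : Fin 5 → E4)

/-- The development of the cells around a corner in the Klein model. -/
def kleinDev (π : Equiv.Perm (Fin 5)) (g : Fin 6 × Bool) : E4 → E4 :=
  kl v fun C => actM g (C ∘ π) ∘ π.symm

/-- The labels of the twelve cells around a corner. -/
def kleinLabel (l : CellLabel) (π : Equiv.Perm (Fin 5)) (g : Fin 6 × Bool) : CellLabel :=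
  cornerLabel l π (g.1, if g.2 then 1 else 0)

/-- The inverse of the development. -/
def kleinFold (π : Equiv.Perm (Fin 5)) (d : E4) : E4 :=
  cutPoint v 1 (norm5 (foldM (cutCoord v 1 d ∘ π) ∘ π.symm))

/-- The region off all facets except `0`, `1` and `2'`. -/
def kleinRegion (π : Equiv.Perm (Fin 5)) : Set E4 :=
  {x | (0 < cutCoord v 1 x (π 2) ∧ 0 < cutCoord v 1 x (π 3) ∧ 0 < cutCoord v 1 x (π 4)) ∧
    cutCoord v 1 x (π 0) < 1 ∧ cutCoord v 1 x (π 1) < 1 ∧ cutCoord v 1 x (π 3) < 1 ∧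
    cutCoord v 1 x (π 4) < 1}

variable {v}

theorem isOpen_kleinRegion (π : Equiv.Perm (Fin 5)) : IsOpen (kleinRegion v π) := by
  have h : ∀ i, Continuous fun x => cutCoord v 1 x i := fun i =>
    (continuous_apply i).comp continuous_cutCoord
  exact ((isOpen_lt continuous_const (h _)).inter ((isOpen_lt continuous_const (h _)).inter
    (isOpen_lt continuous_const (h _)))).inter ((isOpen_lt (h _) continuous_const).inter
    ((isOpen_lt (h _) continuous_const).inter ((isOpen_lt (h _) continuous_const).inter
    (isOpen_lt (h _) continuous_const))))

theorem kleinLabel_injective (l : CellLabel) (π : Equiv.Perm (Fin 5)) :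
    Function.Injective (kleinLabel l π) := by
  rintro ⟨n, e⟩ ⟨n', e'⟩ h
  have := cornerLabel_injective l π (congrArg Prod.snd h)
  simp only [Prod.mk.injEq] at this
  obtain ⟨rfl, h2⟩ := this
  cases e <;> cases e' <;> simp at h2 <;> rfl

theorem cross_kleinLabel_zero (l : CellLabel) (π : Equiv.Perm (Fin 5)) (n : Fin 6) (e : Bool) :
    crossFacet (.inl (π 0)) (kleinLabel l π (n, e)) = kleinLabel l π (nbα n, e) :=
  crossFacet_cornerLabel l π 0 _

theorem cross_kleinLabel_one (l : CellLabel) (π : Equiv.Perm (Fin 5)) (n : Fin 6) (e : Bool) :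
    crossFacet (.inl (π 1)) (kleinLabel l π (n, e)) = kleinLabel l π (nbβ n, e) :=
  crossFacet_cornerLabel l π 1 _

theorem cross_kleinLabel_two (l : CellLabel) (π : Equiv.Perm (Fin 5)) (n : Fin 6) (e : Bool) :
    crossFacet (.inr (π 2)) (kleinLabel l π (n, e)) = kleinLabel l π (n, !e) := by
  refine (crossFacet_cornerLabel l π 2 _).trans ?_
  cases e <;> rfl

theorem isLor_conj_actM (π : Equiv.Perm (Fin 5)) (g : Fin 6 × Bool) :
    IsLor fun C => actM g (C ∘ π) ∘ π.symm := (isLor_actM g).conj π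

variable (hv : IsRegularSimplex v)
include hv

theorem kleinDev_comp {π : Equiv.Perm (Fin 5)} {g g' : Fin 6 × Bool} {a : Fin 5 ⊕ Fin 5}
    (h : actM g' = actM g ∘ refl5 a) {x : E4} (hx : x ∈ Metric.ball 0 1) :
    kleinDev v π g' x = kleinDev v π g (kleinRefl v (Sum.map π π a) x) := by
  rw [kleinDev, kleinDev, kleinRefl, kl_kl hv (isLor_conj_actM π g) (isLor_refl5 _) hx]
  congr 1
  ext1 C
  simp only [Function.comp_apply, h, refl5_comp_perm]

theorem kleinDev_zero (π : Equiv.Perm (Fin 5)) (x : E4) : kleinDev v π (0, false) x = x := by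
  have : (fun C : Fin 5 → ℝ => actM (0, false) (C ∘ π) ∘ π.symm) = id := by
    ext1 C
    rw [actM_id]
    ext i
    simp
  rw [kleinDev, this, kl_id hv]

theorem det_kleinDev (π : Equiv.Perm (Fin 5)) (g : Fin 6 × Bool) : ∀ x ∈ Metric.ball (0 : E4) 1,
    0 < -boolSign (sectorOdd g.1 ^^ g.2) * (fderiv ℝ (kleinDev v π g) x).det := by
  have step : ∀ (g g' : Fin 6 × Bool) (a : Fin 5 ⊕ Fin 5), actM g' = actM g ∘ refl5 a →
      (sectorOdd g'.1 ^^ g'.2) = !(sectorOdd g.1 ^^ g.2) →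
      (∀ x ∈ Metric.ball (0 : E4) 1,
        0 < -boolSign (sectorOdd g.1 ^^ g.2) * (fderiv ℝ (kleinDev v π g) x).det) →
      ∀ x ∈ Metric.ball (0 : E4) 1,
        0 < -boolSign (sectorOdd g'.1 ^^ g'.2) * (fderiv ℝ (kleinDev v π g') x).det := by
    intro g g' a h hs ih x hx
    have hy := kl_mem_ball hv (isLor_refl5 (Sum.map π π a)) hx
    have h1 : kleinDev v π g' =ᶠ[𝓝 x] kleinDev v π g ∘ kleinRefl v (Sum.map π π a) := by
      filter_upwards [Metric.isOpen_ball.mem_nhds hx] with y hy using kleinDev_comp hv h hy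
    have h2 : DifferentiableAt ℝ (kleinRefl v (Sum.map π π a)) x :=
      (contDiffAt_kl hv (isLor_refl5 _) hx).differentiableAt (by simp)
    have h3 : DifferentiableAt ℝ (kleinDev v π g) (kleinRefl v (Sum.map π π a) x) :=
      (contDiffAt_kl hv (isLor_conj_actM π g) hy).differentiableAt (by simp)
    rw [h1.fderiv_eq, fderiv_comp _ h3 h2]
    change 0 < _ * LinearMap.det (((fderiv ℝ (kleinDev v π g) _ : E4 →L[ℝ] E4) : E4 →ₗ[ℝ] E4) ∘ₗ
      ((fderiv ℝ (kleinRefl v (Sum.map π π a)) x : E4 →L[ℝ] E4) : E4 →ₗ[ℝ] E4))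
    rw [LinearMap.det_comp, hs, boolSign_not]
    have h4 := ih _ hy
    have h5 := det_fderiv_kleinRefl_neg hv (Sum.map π π a) hx
    have h6 := mul_pos h4 (neg_pos.2 h5)
    simp only [ContinuousLinearMap.det] at h6
    refine lt_of_lt_of_eq h6 ?_
    simp only [kleinRefl]
    ring
  refine forall_sector_bool (p := fun g => ∀ x ∈ Metric.ball (0 : E4) 1,
    0 < -boolSign (sectorOdd g.1 ^^ g.2) * (fderiv ℝ (kleinDev v π g) x).det) ?_
    (fun n e h => step _ _ _ (actM_nbα n e) ?_ h) (fun n e h => step _ _ _ (actM_nbβ n e) ?_ h)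
    (fun n e h => step _ _ _ (actM_not n e) ?_ h) g
  · intro x _
    rw [show kleinDev v π (0, false) = id from funext (kleinDev_zero hv π), fderiv_id]
    simp [boolSign, sectorOdd, ContinuousLinearMap.det]
  · rw [sectorOdd_nbα]; simp
  · rw [sectorOdd_nbβ]; simp
  · simp

end KleinChart

/-! ### Corners -/

/-- Enlarge both sets to disjoint two-element sets; the remaining label becomes `π 4`. -/
theorem exists_perm_of_disjoint {I J : Finset (Fin 5)} (hIJ : Disjoint I J) (hI : I.card ≤ 2)
    (hJ : J.card ≤ 2) : ∃ π : Equiv.Perm (Fin 5), (∀ i ∈ I, i = π 0 ∨ i = π 1) ∧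
      ∀ i ∈ J, i = π 2 ∨ i = π 3 := by
  classical
  obtain ⟨I', h1, h2, h3⟩ := Finset.exists_subsuperset_card_eq (s := I) (t := Jᶜ) (n := 2)
    (Finset.subset_compl_iff_disjoint_right.2 hIJ) hI (by rw [Finset.card_compl]; simp; omega)
  obtain ⟨J', h4, h5, h6⟩ := Finset.exists_subsuperset_card_eq (s := J) (t := I'ᶜ) (n := 2)
    (Finset.subset_compl_comm.1 h2) hJ (by rw [Finset.card_compl, h3]; simp)
  obtain ⟨e, he⟩ : ((I' ∪ J')ᶜ).Nonempty := by
    rw [← Finset.card_pos, Finset.card_compl]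
    have := Finset.card_union_le I' J'
    simp
    omega
  obtain ⟨a, b, hab, rfl⟩ := Finset.card_eq_two.1 h3
  obtain ⟨c, d, hcd, rfl⟩ := Finset.card_eq_two.1 h6
  have hc := h5 (Finset.mem_insert_self c _)
  have hd := h5 (Finset.mem_insert_of_mem (Finset.mem_singleton_self d))
  simp only [Finset.mem_compl, Finset.mem_union, Finset.mem_insert, Finset.mem_singleton,
    not_or] at hc hd he
  have hinj : Function.Injective ![a, b, c, d, e] := by
    intro x y h
    fin_cases x <;> fin_cases y <;> simp at h ⊢ <;> grind
  refine ⟨Equiv.ofBijective _ (Finite.injective_iff_bijective.1 hinj), fun i hi => ?_,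
    fun i hi => ?_⟩
  · simpa using h1 hi
  · simpa using h4 hi

section Corner

variable {v : Fin 5 → E4} {τ : ℝ} (hv : IsRegularSimplex v)

theorem card_le_two_of_forall_triple {p : Fin 5 → Prop} [DecidablePred p]
    (h : ∀ i j k, i ≠ j → i ≠ k → j ≠ k → p i → p j → p k → False) :
    (Finset.univ.filter p).card ≤ 2 := by
  by_contra! hc
  obtain ⟨i, hi, j, hj, k, hk, hij, hik, hjk⟩ := Finset.two_lt_card.1 hc
  simp only [Finset.mem_filter, Finset.mem_univ, true_and] at hi hj hk
  exact h i j k hij hik hjk hi hj hk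

theorem exists_remaining {i j k : Fin 5} (hij : i ≠ j) (hik : i ≠ k) (hjk : j ≠ k) :
    ∃ m n, ∀ f : Fin 5 → ℝ, ∑ x, f x = f i + f j + f k + f m + f n := by
  have h : ∀ i j k : Fin 5, i ≠ j → i ≠ k → j ≠ k → ∃ m n : Fin 5,
      [i, j, k, m, n].Nodup := by decide
  obtain ⟨m, n, hn⟩ := h i j k hij hik hjk
  refine ⟨m, n, fun f => ?_⟩
  have e : (Finset.univ : Finset (Fin 5)) = [i, j, k, m, n].toFinset := by
    refine (Finset.eq_univ_of_card _ ?_).symm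
    rw [List.toFinset_card_of_nodup hn]
    rfl
  rw [e, List.sum_toFinset _ hn]
  simp
  ring

include hv

/-- The coordinate sum lies strictly between 2 and 3: three zeros would make it at most 2, and three
ones at least 3. -/
theorem exists_atCorner_cutSimplex (h1 : 4 / 9 < τ) (h2 : τ < 1) :
    ∀ x ∈ cutSimplex v τ, ∃ π, AtCorner v τ π x := by
  classical
  intro x hx
  have hτ : 0 < τ + 2 / 3 := by linarith
  rw [mem_cutSimplex_iff hτ] at hx
  have hs := sum_cutCoord hv hτ x
  have hS : 2 < cutLevel τ ∧ cutLevel τ < 3 := by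
    rw [cutLevel, lt_div_iff₀ (by linarith), div_lt_iff₀ (by linarith)]
    constructor <;> linarith
  obtain ⟨π, hI, hJ⟩ := exists_perm_of_disjoint
    (I := Finset.univ.filter fun i => cutCoord v τ x i = 0)
    (J := Finset.univ.filter fun i => cutCoord v τ x i = 1)
    (Finset.disjoint_filter.2 fun i _ h h' => by rw [h] at h'; norm_num at h')
    (card_le_two_of_forall_triple fun i j k hij hik hjk hi hj hk => by
      obtain ⟨m, n, h⟩ := exists_remaining hij hik hjk
      rw [h] at hs
      linarith [(hx m).2, (hx n).2])
    (card_le_two_of_forall_triple fun i j k hij hik hjk hi hj hk => by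
      obtain ⟨m, n, h⟩ := exists_remaining hij hik hjk
      rw [h] at hs
      linarith [(hx m).1, (hx n).1])
  refine ⟨π, ?_⟩
  rintro (i | i) ha
  · rw [mem_facetPlane_inl hτ] at ha
    rcases hI i (by simpa using ha) with rfl | rfl
    · exact ⟨0, rfl⟩
    · exact ⟨1, rfl⟩
  · rw [mem_facetPlane_inr hτ] at ha
    rcases hJ i (by simpa using ha) with rfl | rfl
    · exact ⟨2, rfl⟩
    · exact ⟨3, rfl⟩

theorem mem_idealRectifiedSimplex_iff {x : E4} : x ∈ idealRectifiedSimplex v ↔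
    (∀ i, 0 ≤ cutCoord v 1 x i ∧ cutCoord v 1 x i ≤ 1) ∧ cutCoord v 1 x ∈ lorCone := by
  rw [idealRectifiedSimplex, Set.mem_inter_iff, mem_cutSimplex_iff (by norm_num),
    mem_ball_iff_cutCoord hv]

/-- When Σ c = 2 the form equals Σ c_i (1 − c_i). On the cube it vanishes only at 0/1 vectors, which
are then the ideal vertices, recognised by two coordinates equal to 1. -/
theorem mem_lorCone_iff {x : E4} (h : ∀ i, 0 ≤ cutCoord v 1 x i ∧ cutCoord v 1 x i ≤ 1) :
    cutCoord v 1 x ∈ lorCone ↔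
      ∀ i j, i ≠ j → cutCoord v 1 x i = 1 → cutCoord v 1 x j = 1 → False := by
  have hs := sum_cutCoord_one hv x
  set c := cutCoord v 1 x
  have hb : bform c c = ∑ i, c i * (1 - c i) := by
    rw [bform, hs]
    simp only [mul_sub, Finset.sum_sub_distrib, mul_one, hs]
    norm_num
  have hnn : ∀ i, 0 ≤ c i * (1 - c i) := fun i => mul_nonneg (h i).1 (by linarith [(h i).2])
  constructor
  · rintro ⟨hq, -⟩ i j hij hi hj
    have hz : ∀ k, c k * (1 - c k) = 0 := by
      intro k
      by_cases hik : i = k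
      · rw [← hik, hi]; norm_num
      by_cases hjk : j = k
      · rw [← hjk, hj]; norm_num
      obtain ⟨m, n, e⟩ := exists_remaining hij hik hjk
      rw [e] at hs
      have : c k = 0 := by linarith [(h m).1, (h n).1, (h k).1]
      rw [this]; norm_num
    rw [hb, Finset.sum_eq_zero fun k _ => hz k] at hq
    exact lt_irrefl _ hq
  · intro hno
    refine ⟨?_, by rw [hs]; norm_num⟩
    rw [hb]
    by_contra! hle
    have hz : ∀ k, c k * (1 - c k) = 0 := fun k =>
      (Finset.sum_eq_zero_iff_of_nonneg fun i _ => hnn i).1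
        (le_antisymm hle (Finset.sum_nonneg fun i _ => hnn i)) k (Finset.mem_univ k)
    have hz' : ∀ k, c k = 0 ∨ c k = 1 := fun k => by
      rcases mul_eq_zero.1 (hz k) with h | h
      · exact .inl h
      · exact .inr (by linarith)
    by_cases hone : ∃ i, c i = 1
    · obtain ⟨i, hi⟩ := hone
      have h0 : ∀ j, j ≠ i → c j = 0 := fun j hj => (hz' j).resolve_right fun h => hno j i hj h hi
      rw [Finset.sum_eq_single i (fun j _ hj => h0 j hj) (by simp), hi] at hs
      norm_num at hs
    · push Not at hone
      rw [Finset.sum_eq_zero fun j _ => (hz' j).resolve_right (hone j)] at hs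
      norm_num at hs

theorem exists_mem_kleinRegion : ∀ x ∈ idealRectifiedSimplex v, ∃ π, x ∈ kleinRegion v π := by
  classical
  intro x hx
  obtain ⟨hx, hc⟩ := (mem_idealRectifiedSimplex_iff hv).1 hx
  have hs := sum_cutCoord_one hv x
  have hno := (mem_lorCone_iff hv hx).1 hc
  -- Three zeros leave two coordinates with sum 2, so both are 1 and the point is an ideal vertex.
  have hI : (Finset.univ.filter fun i => cutCoord v 1 x i = 0).card ≤ 2 :=
    card_le_two_of_forall_triple fun i j k hij hik hjk hi hj hk => by
      obtain ⟨m, n, h⟩ := exists_remaining hij hik hjk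
      have hmn : m ≠ n := by
        rintro rfl
        have h5 := h fun _ => 1
        have h6 := h fun y => if y = m then 1 else 0
        simp only [Finset.sum_ite_eq', Finset.mem_univ, if_true] at h6
        split_ifs at h6 <;> norm_num at h6
      rw [h] at hs
      exact hno m n hmn (by linarith [(hx m).2, (hx n).2]) (by linarith [(hx m).2, (hx n).2])
  have hJ : (Finset.univ.filter fun i => cutCoord v 1 x i = 1).card ≤ 1 := by
    by_contra! hcd
    obtain ⟨i, hi, j, hj, hij⟩ := Finset.one_lt_card.1 hcd
    simp only [Finset.mem_filter, Finset.mem_univ, true_and] at hi hj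
    exact hno i j hij hi hj
  have hIJ : Disjoint (Finset.univ.filter fun i => cutCoord v 1 x i = 0)
      (Finset.univ.filter fun i => cutCoord v 1 x i = 1) :=
    Finset.disjoint_filter.2 fun i _ h h' => by rw [h] at h'; norm_num at h'
  suffices ∃ π : Equiv.Perm (Fin 5), (∀ i, cutCoord v 1 x i = 0 → i = π 0 ∨ i = π 1) ∧
      ∀ i, cutCoord v 1 x i = 1 → i = π 2 by
    obtain ⟨π, h0, h1⟩ := this
    have hpos : ∀ k, k ≠ 0 → k ≠ 1 → 0 < cutCoord v 1 x (π k) := by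
      intro k hk0 hk1
      refine (hx _).1.lt_of_ne' fun h => ?_
      rcases h0 _ h with h | h
      · exact hk0 (π.injective h)
      · exact hk1 (π.injective h)
    have hlt : ∀ k, k ≠ 2 → cutCoord v 1 x (π k) < 1 := fun k hk =>
      (hx _).2.lt_of_ne fun h => hk (π.injective (h1 _ h))
    exact ⟨π, ⟨hpos 2 (by decide) (by decide), hpos 3 (by decide) (by decide),
      hpos 4 (by decide) (by decide)⟩, hlt 0 (by decide), hlt 1 (by decide), hlt 3 (by decide),
      hlt 4 (by decide)⟩
  obtain ⟨π, h0, h1⟩ := exists_perm_of_disjoint hIJ hI (hJ.trans (by norm_num))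
  simp only [Finset.mem_filter, Finset.mem_univ, true_and] at h0 h1
  -- At most one coordinate equals 1. The permutation may have put it in position 3, and a swap
  -- moves it to position 2.
  by_cases h3 : cutCoord v 1 x (π 3) = 1
  · refine ⟨(Equiv.swap 2 3).trans π, h0, fun i hi => ?_⟩
    show i = π (Equiv.swap 2 3 2)
    rw [Equiv.swap_apply_left]
    by_contra hne
    exact hno i _ hne hi h3
  · exact ⟨π, h0, fun i hi => (h1 i hi).resolve_right (by rintro rfl; exact h3 hi)⟩

theorem exists_atCorner_idealRectifiedSimplex :
    ∀ x ∈ idealRectifiedSimplex v, ∃ π, AtCorner v 1 π x := by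
  intro x hx
  obtain ⟨π, ⟨h2, h3, h4⟩, g0, g1, g3, g4⟩ := exists_mem_kleinRegion hv x hx
  refine ⟨π, ?_⟩
  rintro (i | i) ha
  · rw [mem_facetPlane_inl (by norm_num)] at ha
    obtain ⟨k, rfl⟩ := π.surjective i
    fin_cases k
    · exact ⟨0, rfl⟩
    · exact ⟨1, rfl⟩
    · exact absurd ha h2.ne'
    · exact absurd ha h3.ne'
    · exact absurd ha h4.ne'
  · rw [mem_facetPlane_inr (by norm_num)] at ha
    obtain ⟨k, rfl⟩ := π.surjective i
    fin_cases k
    · exact absurd ha g0.ne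
    · exact absurd ha g1.ne
    · exact ⟨2, rfl⟩
    · exact ⟨3, rfl⟩
    · exact absurd ha g4.ne

end Corner

/-! ### The charts of the hyperbolic manifold -/

section KleinChart

variable {v : Fin 5 → E4} (hv : IsRegularSimplex v)

theorem facet_of_mem_kleinRegion {π : Equiv.Perm (Fin 5)} {x : E4} (hx : x ∈ kleinRegion v π)
    {a : Fin 5 ⊕ Fin 5} (ha : x ∈ facetPlane v 1 a) :
    ∃ b, a = Sum.map π π b ∧ ∀ l g, ∃ g', actM g' = actM g ∘ refl5 b ∧
      crossFacet a (kleinLabel l π g) = kleinLabel l π g' := by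
  obtain ⟨⟨h2, h3, h4⟩, g0, g1, g3, g4⟩ := hx
  rcases a with i | i
  · rw [mem_facetPlane_inl (by norm_num)] at ha
    obtain ⟨k, rfl⟩ := π.surjective i
    refine ⟨.inl k, rfl, fun l g => ?_⟩
    obtain ⟨n, e⟩ := g
    fin_cases k
    · exact ⟨(nbα n, e), actM_nbα n e, cross_kleinLabel_zero l π n e⟩
    · exact ⟨(nbβ n, e), actM_nbβ n e, cross_kleinLabel_one l π n e⟩
    · exact absurd ha h2.ne'
    · exact absurd ha h3.ne'
    · exact absurd ha h4.ne'
  · rw [mem_facetPlane_inr (by norm_num)] at ha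
    obtain ⟨k, rfl⟩ := π.surjective i
    refine ⟨.inr k, rfl, fun l g => ?_⟩
    obtain ⟨n, e⟩ := g
    fin_cases k
    · exact absurd ha g0.ne
    · exact absurd ha g1.ne
    · exact ⟨(n, !e), actM_not n e, cross_kleinLabel_two l π n e⟩
    · exact absurd ha g3.ne
    · exact absurd ha g4.ne

include hv

/-- Crossing a facet composes the development with the reflection in this facet, which fixes the
point `x` on it. -/
theorem linked_kleinLabel {π : Equiv.Perm (Fin 5)} {x : E4} (hx : x ∈ kleinRegion v π)
    (hxb : x ∈ Metric.ball 0 1) {l l' : CellLabel} {g : Fin 6 × Bool}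
    (h : Linked v 1 x (kleinLabel l π g) l') :
    ∃ g', l' = kleinLabel l π g' ∧ kleinDev v π g' x = kleinDev v π g x := by
  induction h with
  | refl => exact ⟨g, rfl, rfl⟩
  | tail _ h ih =>
    obtain ⟨a, ha, rfl⟩ := h
    obtain ⟨g', rfl, hg'⟩ := ih
    obtain ⟨b, rfl, hb⟩ := facet_of_mem_kleinRegion hx ha
    obtain ⟨g'', h1, h2⟩ := hb l g'
    refine ⟨g'', h2, ?_⟩
    rw [kleinDev_comp hv h1 hxb, kleinRefl_of_mem hv ha, hg']

theorem cutCoord_kleinDev (π : Equiv.Perm (Fin 5)) (g : Fin 6 × Bool) {x : E4}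
    (hx : x ∈ Metric.ball 0 1) : ∃ t : ℝ, 0 < t ∧
      cutCoord v 1 (kleinDev v π g x) ∘ π = actM g (t • (cutCoord v 1 x ∘ π)) := by
  have hA := isLor_conj_actM π g
  refine ⟨2 / ∑ i, actM g (cutCoord v 1 x ∘ π) (π.symm i),
    div_pos two_pos (hA.pos _ ((mem_ball_iff_cutCoord hv).1 hx)), ?_⟩
  rw [kleinDev, cutCoord_kl hv hA hx, norm5, (isLor_actM g).smul]
  ext i
  simp

/-- The image of the cells around a corner. -/
def kleinRange (v : Fin 5 → E4) (π : Equiv.Perm (Fin 5)) : Set E4 :=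
  {d | d ∈ Metric.ball 0 1 ∧ (∀ k, k ≠ 0 → k ≠ 1 → 0 < foldM (cutCoord v 1 d ∘ π) k) ∧
    ∀ k, k ≠ 2 → foldM (cutCoord v 1 d ∘ π) k < (∑ i, foldM (cutCoord v 1 d ∘ π) i) / 2}

omit hv in
theorem isOpen_kleinRange (π : Equiv.Perm (Fin 5)) : IsOpen (kleinRange v π) := by
  have hc : Continuous fun d => foldM (cutCoord v 1 d ∘ π) := by
    refine continuous_foldM.comp (continuous_pi fun i => ?_)
    exact (continuous_apply (π i)).comp continuous_cutCoord
  have hk : ∀ k, Continuous fun d => foldM (cutCoord v 1 d ∘ π) k := fun k =>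
    (continuous_apply k).comp hc
  have h1 : IsOpen {d | ∀ k : Fin 5, k ≠ 0 → k ≠ 1 → 0 < foldM (cutCoord v 1 d ∘ π) k} := by
    simp only [Set.ofPred_forall]
    exact isOpen_iInter_of_finite fun k => isOpen_iInter_of_finite fun _ =>
      isOpen_iInter_of_finite fun _ => isOpen_lt continuous_const (hk k)
  have h2 : IsOpen {d | ∀ k : Fin 5, k ≠ 2 → foldM (cutCoord v 1 d ∘ π) k <
      (∑ i, foldM (cutCoord v 1 d ∘ π) i) / 2} := by
    simp only [Set.ofPred_forall]
    exact isOpen_iInter_of_finite fun k => isOpen_iInter_of_finite fun _ =>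
      isOpen_lt (hk k) ((continuous_finsetSum _ fun i _ => hk i).div_const 2)
  exact Metric.isOpen_ball.inter (h1.inter h2)

omit hv in
theorem foldM_nonneg (D : Fin 5 → ℝ) :
    0 ≤ foldM D 0 ∧ 0 ≤ foldM D 1 ∧ foldM D 2 ≤ (∑ i, foldM D i) / 2 := by
  have h := fold2_nonneg (D 0, D 1)
  refine ⟨h.1, h.2, ?_⟩
  have h2 : formγ (foldM D) = |formγ D| := formγ_mk5 _ _ _ _
  rw [formγ] at h2
  linarith [abs_nonneg (formγ D)]

theorem chamber_of_mem {π : Equiv.Perm (Fin 5)} {x : E4} (hx : x ∈ idealRectifiedSimplex v) {t : ℝ}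
    (ht : 0 < t) (g : Fin 6 × Bool) : foldM (actM g (t • (cutCoord v 1 x ∘ π))) =
      t • (cutCoord v 1 x ∘ π) := by
  have h := ((mem_idealRectifiedSimplex_iff hv).1 hx).1
  have hs : ∑ i, cutCoord v 1 x (π i) = 2 := by
    rw [Equiv.sum_comp π (cutCoord v 1 x), sum_cutCoord_one hv]
  refine foldM_actM g ?_ ?_ ?_
  · exact mul_nonneg ht.le (h _).1
  · exact mul_nonneg ht.le (h _).1
  · simp only [formγ, Pi.smul_apply, Function.comp_apply, smul_eq_mul, ← Finset.mul_sum, hs]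
    nlinarith [(h (π 2)).2]

/-- The region of `R` near the corner is a piece of the closed chamber of A₂ × A₁ and its twelve
images tile their union, so the chamber folding inverts the development. -/
theorem exists_kleinChart (l : CellLabel) (π : Equiv.Perm (Fin 5)) :
    ∃ e : OpenPartialHomeomorph (SpaceM v) E4, e.target = kleinRange v π ∧
      (∀ g (x : idealRectifiedSimplex v), (x : E4) ∈ kleinRegion v π →
        cellPt v 1 _ (kleinLabel l π g) x ∈ e.source ∧
        e (cellPt v 1 _ (kleinLabel l π g) x) = kleinDev v π g x) ∧
      ∀ m ∈ e.source, ∃ (g : Fin 6 × Bool) (x : idealRectifiedSimplex v),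
        (x : E4) ∈ kleinRegion v π ∧ m = cellPt v 1 _ (kleinLabel l π g) x := by
  obtain ⟨x₀, hx₀⟩ : (idealRectifiedSimplex v).Nonempty := by
    refine ⟨0, ?_, by simp⟩
    intro i
    simp
    norm_num
  refine exists_unfolding_chart ⟨x₀, hx₀⟩ (kleinLabel l π) (kleinLabel_injective l π)
    (isOpen_kleinRegion π) (isOpen_kleinRange π) (kleinDev v π) (kleinFold v π) ?_ ?_ ?_ ?_ ?_ ?_ ?_
  · intro g x hx
    exact (contDiffAt_kl hv (isLor_conj_actM π g) hx.1.2).continuousAt.continuousWithinAt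
  · intro d hd
    have hc : Continuous fun d => foldM (cutCoord v 1 d ∘ π) ∘ π.symm := by
      refine continuous_pi fun i => (continuous_apply (π.symm i)).comp (continuous_foldM.comp
        (continuous_pi fun i => ?_))
      exact (continuous_apply (π i)).comp continuous_cutCoord
    have hpos : ∑ i, foldM (cutCoord v 1 d ∘ π) (π.symm i) ≠ 0 := by
      rw [Equiv.sum_comp π.symm]
      have h0 := foldM_nonneg (cutCoord v 1 d ∘ π)
      have h2 := hd.2.1 2 (by decide) (by decide)
      linarith
    refine (continuous_cutPoint.continuousAt.comp (ContinuousAt.smul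
      (f := fun d => 2 / ∑ i, foldM (cutCoord v 1 d ∘ π) (π.symm i)) ?_
      hc.continuousAt)).continuousWithinAt
    exact continuousAt_const.div (continuous_finsetSum _ fun i _ =>
      (continuous_apply i).comp hc).continuousAt hpos
  · rintro g x ⟨hxR, hxO⟩
    obtain ⟨t, ht, e⟩ := cutCoord_kleinDev hv π g hxR.2
    have hs : ∑ i, cutCoord v 1 x (π i) = 2 := by
      rw [Equiv.sum_comp π (cutCoord v 1 x), sum_cutCoord_one hv]
    refine ⟨kl_mem_ball hv (isLor_conj_actM π g) hxR.2, ?_, ?_⟩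
    · rw [e, chamber_of_mem hv hxR ht]
      intro k hk0 hk1
      refine mul_pos ht ?_
      fin_cases k
      · exact absurd rfl hk0
      · exact absurd rfl hk1
      · exact hxO.1.1
      · exact hxO.1.2.1
      · exact hxO.1.2.2
    · rw [e, chamber_of_mem hv hxR ht]
      intro k hk
      simp only [Pi.smul_apply, Function.comp_apply, smul_eq_mul, ← Finset.mul_sum, hs,
        mul_div_assoc]
      refine mul_lt_mul_of_pos_left ?_ ht
      rw [div_self two_ne_zero]
      fin_cases k
      · exact hxO.2.1
      · exact hxO.2.2.1
      · exact absurd rfl hk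
      · exact hxO.2.2.2.1
      · exact hxO.2.2.2.2
  · rintro g x ⟨hxR, hxO⟩
    obtain ⟨t, ht, e⟩ := cutCoord_kleinDev hv π g hxR.2
    rw [kleinFold, e, chamber_of_mem hv hxR ht,
      show (t • (cutCoord v 1 x ∘ π)) ∘ π.symm = t • cutCoord v 1 x by ext i; simp,
      norm5_smul ht.ne', norm5_of_sum (sum_cutCoord_one hv x), cutPoint_cutCoord hv (by norm_num)]
  -- The folded vector `D` lies in the closed chamber by construction and in the light cone because
  -- it is a reflection image of the coordinates of `d`. The open conditions in `kleinRange` supply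
  -- the remaining inequalities after scaling to sum 2.
  · intro d hd
    set D := foldM (cutCoord v 1 d ∘ π) with hD
    obtain ⟨g, hg⟩ := exists_actM_foldM (cutCoord v 1 d ∘ π)
    have h0 := foldM_nonneg (cutCoord v 1 d ∘ π)
    rw [← hD] at hg h0
    have hd2 := hd.2.1
    have hd3 := hd.2.2
    rw [← hD] at hd2 hd3
    have hsum : 0 < ∑ i, D i := by
      have := hd2 2 (by decide) (by decide)
      linarith
    have hsum' : ∑ i, (D ∘ π.symm) i = ∑ i, D i := Equiv.sum_comp π.symm D
    have hlor : D ∈ lorCone := by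
      refine ⟨?_, hsum⟩
      rw [← (isLor_actM g).bform, hg]
      exact (comp_perm_mem_lorCone ((mem_ball_iff_cutCoord hv).1 hd.1)).1
    have hlor' : D ∘ π.symm ∈ lorCone := comp_perm_mem_lorCone hlor
    have hcf : cutCoord v 1 (kleinFold v π d) = (2 / ∑ i, D i) • (D ∘ π.symm) := by
      rw [kleinFold, cutCoord_cutPoint_norm5 hv hlor'.2.ne', norm5, hsum']
    have hcf' : ∀ k, cutCoord v 1 (kleinFold v π d) (π k) = (2 / ∑ i, D i) * D k := by
      intro k
      rw [hcf]
      simp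
    have ht : 0 < 2 / ∑ i, D i := by positivity
    have hle : ∀ k, (2 / ∑ i, D i) * D k ≤ 1 ↔ D k ≤ (∑ i, D i) / 2 := by
      intro k
      rw [div_mul_eq_mul_div, div_le_one hsum, le_div_iff₀ two_pos, mul_comm]
    have hlt : ∀ k, (2 / ∑ i, D i) * D k < 1 ↔ D k < (∑ i, D i) / 2 := by
      intro k
      rw [div_mul_eq_mul_div, div_lt_one hsum, lt_div_iff₀ two_pos, mul_comm]
    refine ⟨⟨(mem_idealRectifiedSimplex_iff hv).2 ⟨fun i => ?_, ?_⟩, ?_⟩, g, ?_⟩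
    · obtain ⟨k, rfl⟩ := π.surjective i
      rw [hcf', hle]
      constructor
      · refine mul_nonneg ht.le ?_
        by_cases hk0 : k = 0
        · rw [hk0]; exact h0.1
        by_cases hk1 : k = 1
        · rw [hk1]; exact h0.2.1
        exact (hd2 k hk0 hk1).le
      · by_cases hk : k = 2
        · rw [hk]; exact h0.2.2
        · exact (hd3 k hk).le
    · rw [hcf]
      have := norm5_mem_lorCone hlor'
      rwa [norm5, hsum'] at this
    · refine ⟨⟨?_, ?_, ?_⟩, ?_, ?_, ?_, ?_⟩
      · rw [hcf']; exact mul_pos ht (hd2 2 (by decide) (by decide))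
      · rw [hcf']; exact mul_pos ht (hd2 3 (by decide) (by decide))
      · rw [hcf']; exact mul_pos ht (hd2 4 (by decide) (by decide))
      · rw [hcf', hlt]; exact hd3 0 (by decide)
      · rw [hcf', hlt]; exact hd3 1 (by decide)
      · rw [hcf', hlt]; exact hd3 3 (by decide)
      · rw [hcf', hlt]; exact hd3 4 (by decide)
    · rw [kleinDev, kl, hcf, show ((2 / ∑ i, D i) • (D ∘ π.symm)) ∘ π = (2 / ∑ i, D i) • D by
        ext i; simp, (isLor_actM g).smul, hg,
        show ((2 / ∑ i, D i) • (cutCoord v 1 d ∘ π)) ∘ π.symm = (2 / ∑ i, D i) • cutCoord v 1 d by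
          ext i; simp, norm5_smul ht.ne', norm5_of_sum (sum_cutCoord_one hv d),
        cutPoint_cutCoord hv (by norm_num)]
  · rintro x ⟨hxR, hxO⟩ g l' h
    exact linked_kleinLabel hv hxO hxR.2 h
  · rintro x ⟨hxR, hxO⟩ g g' h
    obtain ⟨t, ht, e⟩ := cutCoord_kleinDev hv π g hxR.2
    obtain ⟨t', ht', e'⟩ := cutCoord_kleinDev hv π g' hxR.2
    rw [← h, e] at e'
    have e2 := congrArg foldM e'
    rw [chamber_of_mem hv hxR ht, chamber_of_mem hv hxR ht'] at e2
    rw [← e2] at e'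
    have hx := ((mem_idealRectifiedSimplex_iff hv).1 hxR).1
    have hz : ∀ k, (t • (cutCoord v 1 x ∘ π)) k = 0 → cutCoord v 1 x (π k) = 0 := fun k hk =>
      (mul_eq_zero.1 hk).resolve_left ht.ne'
    have hs : ∑ i, cutCoord v 1 x (π i) = 2 := by
      rw [Equiv.sum_comp π (cutCoord v 1 x), sum_cutCoord_one hv]
    refine actM_eq_actM (r := fun g g' => Linked v 1 x (kleinLabel l π g) (kleinLabel l π g'))
      (mul_nonneg ht.le (hx _).1) (mul_nonneg ht.le (hx _).1) e' (fun _ => .refl)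
      (fun _ _ _ => .trans) (fun h0 n e => ?_) (fun h0 n e => ?_) (fun h0 n e => ?_)
    · rw [← cross_kleinLabel_zero]
      exact .cross ((mem_facetPlane_inl (by norm_num)).2 (hz 0 h0))
    · rw [← cross_kleinLabel_one]
      exact .cross ((mem_facetPlane_inl (by norm_num)).2 (hz 1 h0))
    · rw [← cross_kleinLabel_two]
      refine .cross ((mem_facetPlane_inr (by norm_num)).2 ?_)
      simp only [formγ, Pi.smul_apply, Function.comp_apply, smul_eq_mul, ← Finset.mul_sum, hs] at h0
      have : t * (1 - cutCoord v 1 x (π 2)) = 0 := by linarith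
      linarith [(mul_eq_zero.1 this).resolve_left ht.ne']

-- Crossing one facet reverses the orientation, so the base cell of a chart can be taken with either
-- orientation. This is how the signs of charts are normalised.
omit hv in
theorem exists_cornerLabel_eq (b : Bool) (l : CellLabel) (π : Equiv.Perm (Fin 5)) :
    ∃ (l₀ : CellLabel) (n : Fin 6), l₀.1 = b ∧ cornerLabel l₀ π (n, 0) = l := by
  by_cases h : l.1 = b
  · exact ⟨l, 0, h, cornerLabel_zero l π⟩
  · refine ⟨crossFacet (cornerFacet π 0) l, nbα 0, ?_, ?_⟩
    · show (!l.1) = b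
      revert h
      cases l.1 <;> cases b <;> simp
    · have h1 := crossFacet_cornerLabel (crossFacet (cornerFacet π 0) l) π 0 (0, 0)
      rw [cornerLabel_zero, crossFacet_crossFacet] at h1
      exact h1.symm

/-- Charts with values in the Klein model that develop the cells by isometries. -/
def IsKleinChart (v : Fin 5 → E4) (e : OpenPartialHomeomorph (SpaceM v) E4)
    (A : CellLabel → (Fin 5 → ℝ) → Fin 5 → ℝ) : Prop :=
  e.target ⊆ Metric.ball 0 1 ∧ (∀ l, IsLor (A l)) ∧
    DevelopsVia (kleinRefl v) e 1 fun l => kl v (A l)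

theorem exists_isKleinChart (m : SpaceM v) : ∃ e A, IsKleinChart v e A ∧ m ∈ e.source := by
  classical
  obtain ⟨l', x, rfl⟩ := exists_cellPt m
  obtain ⟨π, hπ⟩ := exists_mem_kleinRegion hv x x.2
  -- A positively oriented base cell makes the chart have sign +1 in the sense of `DevelopsVia`.
  obtain ⟨l, n, hl, hn⟩ := exists_cornerLabel_eq true l' π
  obtain ⟨e, ht, he, hs⟩ := exists_kleinChart hv l π
  let A : CellLabel → (Fin 5 → ℝ) → Fin 5 → ℝ := fun l' =>
    if h : ∃ g, kleinLabel l π g = l' then fun C => actM h.choose (C ∘ π) ∘ π.symm else id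
  have hA : ∀ g, A (kleinLabel l π g) = fun C => actM g (C ∘ π) ∘ π.symm := by
    intro g
    have h : ∃ g', kleinLabel l π g' = kleinLabel l π g := ⟨g, rfl⟩
    simp only [A, h, dif_pos]
    rw [kleinLabel_injective l π h.choose_spec]
  have hkl : ∀ g, kl v (A (kleinLabel l π g)) = kleinDev v π g := fun g => by rw [hA]; rfl
  have hl1 : boolSign l.1 = 1 := by rw [hl]; rfl
  refine ⟨e, A, ⟨?_, ?_, ?_⟩, ?_⟩
  · rw [ht]; exact fun d hd => hd.1
  · intro l'
    simp only [A]
    split_ifs with h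
    · exact isLor_conj_actM π _
    · exact IsLor.id
  · intro l' y hy
    obtain ⟨g, y', hy', h⟩ := hs _ hy
    rw [cellPt_eq_iff] at h
    obtain ⟨rfl, hl⟩ := h
    obtain ⟨g, rfl, -⟩ := linked_kleinLabel hv hy' y.2.2 hl.symm
    simp only [hkl]
    refine ⟨contDiffAt_kl hv (isLor_conj_actM π g) y.2.2, ?_, ?_, fun a ha => ?_⟩
    · have h := det_kleinDev hv π g y y.2.2
      have e1 : (kleinLabel l π g).1 = (l.1 ^^ (sectorOdd g.1 ^^ g.2)) := by
        obtain ⟨n, e⟩ := g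
        cases e <;> rfl
      rw [e1, boolSign_xor, hl1]
      refine lt_of_lt_of_eq h ?_
      ring
    · filter_upwards [(isOpen_kleinRegion π).preimage continuous_subtype_val |>.mem_nhds hy']
        with z hz using (he g z hz).2
    · obtain ⟨b, rfl, hb⟩ := facet_of_mem_kleinRegion hy' ha
      obtain ⟨g'', h1, h2⟩ := hb l g
      rw [h2, hkl]
      filter_upwards [Metric.isOpen_ball.mem_nhds y.2.2] with z hz using kleinDev_comp hv h1 hz
  · have h := (he (n, false) x hπ).1
    rwa [show kleinLabel l π (n, false) = l' from hn] at h

theorem tendsto_kleinRefl (a : Fin 5 ⊕ Fin 5) : ∀ x ∈ idealRectifiedSimplex v,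
    x ∈ facetPlane v 1 a → Filter.Tendsto (kleinRefl v a) (𝓝 x) (𝓝 x) := by
  intro x hx ha
  have := (contDiffAt_kl hv (isLor_refl5 a) hx.2).continuousAt
  rwa [ContinuousAt, show kl v (refl5 a) x = x from kleinRefl_of_mem hv ha] at this

/-- The hyperbolic structure of the glued space. -/
@[reducible] def kleinChartedSpace : ChartedSpace E4 (SpaceM v) where
  atlas := {e | ∃ A, IsKleinChart v e A}
  chartAt m := (exists_isKleinChart hv m).choose
  mem_chart_source m := by
    obtain ⟨A, h⟩ := (exists_isKleinChart hv m).choose_spec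
    exact h.2
  chart_mem_atlas m := by
    obtain ⟨A, h⟩ := (exists_isKleinChart hv m).choose_spec
    exact ⟨A, h.1⟩

omit hv in
theorem isManifold_of_contDiffAt {Y : Type*} [TopologicalSpace Y] [ChartedSpace E4 Y]
    (h : ∀ e ∈ atlas E4 Y, ∀ e' ∈ atlas E4 Y, ∀ m ∈ e.source, m ∈ e'.source →
      ContDiffAt ℝ ∞ (e.symm.trans e') (e m)) : IsManifold (𝓡 4) ∞ Y := by
  refine isManifold_of_contDiffOn (𝓡 4) ∞ Y fun e e' he he' => ?_
  intro d hd
  have hd' : d ∈ (e.symm.trans e').source := by simpa using hd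
  have h1 : d ∈ e.target := hd'.1
  have h2 : e.symm d ∈ e'.source := hd'.2
  have h3 := h e he e' he' (e.symm d) (e.map_target h1) h2
  rw [e.right_inv h1] at h3
  simpa using h3.contDiffWithinAt

theorem isManifold_kleinChartedSpace :
    @IsManifold ℝ _ _ _ _ _ _ (𝓡 4) ∞ (SpaceM v) _ (kleinChartedSpace hv) := by
  let := kleinChartedSpace hv
  refine isManifold_of_contDiffAt fun e he e' he' m hm hm' => ?_
  obtain ⟨A, h⟩ := he
  obtain ⟨A', h'⟩ := he'
  exact (h.2.2.transition (tendsto_kleinRefl hv) h'.2.2 hm hm').1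

/-- Near a point both charts are Klein isometries of the same local coordinate, so both distances
equal the distance of these coordinates. -/
theorem isHyperbolicAtlas_kleinChartedSpace :
    @IsHyperbolicAtlas v (kleinChartedSpace hv) := by
  let := kleinChartedSpace hv
  refine @IsHyperbolicAtlas.mk v _ ?_ ?_ ?_
  · rintro e ⟨A, h⟩
    exact h.1
  · rintro e ⟨A, h⟩ e' ⟨A', h'⟩ m ⟨hm, hm'⟩
    obtain ⟨l, x, rfl⟩ := exists_cellPt m
    have key := h.2.2.common_coord (tendsto_kleinRefl hv) h'.2.2 hm hm'
      (Metric.isOpen_ball.mem_nhds x.2.2)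
    rw [nhds_prod_eq]
    filter_upwards [key.prod_mk key] with q hq
    obtain ⟨⟨z, hz, h1, h2⟩, z', hz', h3, h4⟩ := hq
    rw [h1, h2, h3, h4, kleinDist_kl hv (h.2.1 l) hz hz', kleinDist_kl hv (h'.2.1 l) hz hz']
  · rintro e ⟨A, h⟩ ε w u x hx
    have key := (h.2.2 (ε, w, u) x hx).2.2.1
    rw [nhds_prod_eq]
    filter_upwards [key.prod_mk key] with q hq
    have h1 : e (coverCell v 1 _ ε w u q.1) = _ := hq.1
    have h2 : e (coverCell v 1 _ ε w u q.2) = _ := hq.2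
    rw [h1, h2, kleinDist_kl hv (h.2.1 _) q.1.2.2 q.2.2.2]

end KleinChart

/-! ### The homeomorphism between the two polytopes off the singular faces -/

/-- The piecewise linear homeomorphism of the unit interval with slopes `m` and `1 / m`. -/
def stretch (m c : ℝ) : ℝ := max (m * c) (1 - (1 - c) / m)

/-- The inverse of `stretch`. -/
def shrink (m r : ℝ) : ℝ := min (r / m) (1 - m * (1 - r))

section Stretch

variable {m m' c : ℝ}

theorem shrink_stretch (hm : 0 < m) (c : ℝ) : shrink m (stretch m c) = c := by
  have h1 : ∀ y, y / m = c ↔ y = m * c := fun y => by rw [div_eq_iff hm.ne', mul_comm]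
  rw [shrink, stretch]
  rcases le_total (m * c) (1 - (1 - c) / m) with h | h
  · rw [max_eq_right h, min_eq_right]
    · field_simp; ring
    · rw [le_div_iff₀ hm]
      have : 1 - m * (1 - (1 - (1 - c) / m)) = c := by field_simp; ring
      rw [this]
      linarith
  · rw [max_eq_left h, min_eq_left]
    · field_simp
    · have h2 : m * (1 - (1 - c) / m) ≤ m * (m * c) := mul_le_mul_of_nonneg_left h hm.le
      have h3 : m * (1 - (1 - c) / m) = m - (1 - c) := by field_simp
      rw [mul_div_cancel_left₀ _ hm.ne']
      linarith

theorem stretch_shrink (hm : 0 < m) (r : ℝ) : stretch m (shrink m r) = r := by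
  rw [shrink, stretch]
  rcases le_total (r / m) (1 - m * (1 - r)) with h | h
  · rw [min_eq_left h, max_eq_left]
    · field_simp
    · have h3 : m * (r / m) = r := by field_simp
      rw [h3, sub_le_comm, le_div_iff₀ hm]
      linarith
  · rw [min_eq_right h, max_eq_right]
    · field_simp; ring
    · have h3 : 1 - (1 - (1 - m * (1 - r))) / m = r := by field_simp; ring
      rw [h3]
      rw [le_div_iff₀ hm] at h
      linarith

theorem stretch_mem (hm : 0 < m) (hm1 : m ≤ 1) (h0 : 0 ≤ c) (h1 : c ≤ 1) :
    0 ≤ stretch m c ∧ stretch m c ≤ 1 := by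
  refine ⟨le_max_of_le_left (by positivity), max_le (by nlinarith) ?_⟩
  have : 0 ≤ (1 - c) / m := div_nonneg (by linarith) hm.le
  linarith

theorem shrink_mem (hm : 0 < m) (hm1 : m ≤ 1) (h0 : 0 ≤ c) (h1 : c ≤ 1) :
    0 ≤ shrink m c ∧ shrink m c ≤ 1 :=
  ⟨le_min (by positivity) (by nlinarith), min_le_of_right_le (by nlinarith)⟩

theorem stretch_zero (hm : 0 < m) (hm1 : m ≤ 1) : stretch m 0 = 0 := by
  rw [stretch, mul_zero, max_eq_left]
  have := (one_le_div hm).2 hm1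
  linarith

theorem stretch_one (hm1 : m ≤ 1) : stretch m 1 = 1 := by
  simp [stretch, hm1]

theorem stretch_eq_zero_iff (hm : 0 < m) (hm1 : m ≤ 1) : stretch m c = 0 ↔ c = 0 := by
  refine ⟨fun h => ?_, fun h => by rw [h, stretch_zero hm hm1]⟩
  rw [← shrink_stretch hm c, h]
  exact (congrArg _ (stretch_zero hm hm1)).symm.trans (shrink_stretch hm 0)

theorem stretch_eq_one_iff (hm : 0 < m) (hm1 : m ≤ 1) : stretch m c = 1 ↔ c = 1 := by
  refine ⟨fun h => ?_, fun h => by rw [h, stretch_one hm1]⟩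
  rw [← shrink_stretch hm c, h]
  exact (congrArg _ (stretch_one hm1)).symm.trans (shrink_stretch hm 1)

theorem stretch_le_stretch (hm : 0 < m) (h : m ≤ m') (h0 : 0 ≤ c) (h1 : c ≤ 1) :
    stretch m c ≤ stretch m' c :=
  max_le_max (mul_le_mul_of_nonneg_right h h0)
    (sub_le_sub_left (div_le_div_of_nonneg_left (by linarith) hm h) _)

theorem stretch_lt_stretch (hm : 0 < m) (h : m < m') (h0 : 0 < c) (h1 : c < 1) :
    stretch m c < stretch m' c :=
  max_lt_max (mul_lt_mul_of_pos_right h h0)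
    (sub_lt_sub_left (div_lt_div_of_pos_left (by linarith) hm h) _)

theorem shrink_le_shrink (hm : 0 < m) (h : m ≤ m') (h0 : 0 ≤ c) (h1 : c ≤ 1) :
    shrink m' c ≤ shrink m c :=
  min_le_min (div_le_div_of_nonneg_left h0 hm h)
    (sub_le_sub_left (mul_le_mul_of_nonneg_right h (by linarith)) _)

theorem shrink_lt_shrink (hm : 0 < m) (h : m < m') (h0 : 0 < c) (h1 : c < 1) :
    shrink m' c < shrink m c :=
  min_lt_min (div_lt_div_of_pos_left h0 hm h)
    (sub_lt_sub_left (mul_lt_mul_of_pos_right h (by linarith)) _)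

theorem sum_stretch_lt {c : Fin 5 → ℝ} (hc : ∀ i, 0 ≤ c i ∧ c i ≤ 1)
    (hi : ∃ i, 0 < c i ∧ c i < 1) (hm : 0 < m) (h : m < m') :
    ∑ i, stretch m (c i) < ∑ i, stretch m' (c i) := by
  obtain ⟨i, h0, h1⟩ := hi
  exact Finset.sum_lt_sum (fun j _ => stretch_le_stretch hm h.le (hc j).1 (hc j).2)
    ⟨i, Finset.mem_univ i, stretch_lt_stretch hm h h0 h1⟩

theorem sum_shrink_lt {c : Fin 5 → ℝ} (hc : ∀ i, 0 ≤ c i ∧ c i ≤ 1)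
    (hi : ∃ i, 0 < c i ∧ c i < 1) (hm : 0 < m) (h : m < m') :
    ∑ i, shrink m' (c i) < ∑ i, shrink m (c i) := by
  obtain ⟨i, h0, h1⟩ := hi
  exact Finset.sum_lt_sum (fun j _ => shrink_le_shrink hm h.le (hc j).1 (hc j).2)
    ⟨i, Finset.mem_univ i, shrink_lt_shrink hm h h0 h1⟩

/-- All `stretch m` fix 0 and 1 and strictly increase with `m` in between, so one coordinate inside
(0, 1) makes the sum strictly monotone in `m`. -/
theorem eq_of_sum_stretch_eq {c : Fin 5 → ℝ} (hc : ∀ i, 0 ≤ c i ∧ c i ≤ 1)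
    (hi : ∃ i, 0 < c i ∧ c i < 1) (hm : 0 < m) (hm' : 0 < m')
    (h : ∑ i, stretch m (c i) = ∑ i, stretch m' (c i)) : m = m' := by
  rcases lt_trichotomy m m' with hlt | heq | hlt
  · exact absurd h (sum_stretch_lt hc hi hm hlt).ne
  · exact heq
  · exact absurd h (sum_stretch_lt hc hi hm' hlt).ne'

end Stretch

/-- For 0 < s < m x one has Φ s x < a. This persists for `y` near `x` and by monotonicity forces s <
m y; upper bounds are symmetric. -/
theorem continuous_of_strictMono_implicit {X : Type*} [TopologicalSpace X] {Φ : ℝ → X → ℝ} {m : X → ℝ}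
    {a : ℝ} (hm : ∀ x, 0 < m x ∧ m x < 1) (hc : ∀ t, Continuous (Φ t))
    (hΦ : ∀ x s t, 0 < s → s < t → Φ s x < Φ t x) (ha : ∀ x, Φ (m x) x = a) : Continuous m := by
  have hmono : ∀ x s t, 0 < s → s ≤ t → Φ s x ≤ Φ t x := fun x s t hs h => by
    rcases h.eq_or_lt with rfl | h
    · exact le_rfl
    · exact (hΦ x s t hs h).le
  refine continuous_iff_continuousAt.2 fun x => tendsto_order.2 ⟨fun s hs => ?_, fun t ht => ?_⟩
  · by_cases h0 : s ≤ 0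
    · exact Filter.Eventually.of_forall fun y => h0.trans_lt (hm y).1
    · push Not at h0
      have h1 : Φ s x < a := by rw [← ha x]; exact hΦ x s _ h0 hs
      filter_upwards [(hc s).continuousAt.eventually (gt_mem_nhds h1)] with y hy
      by_contra! h
      have := hmono y _ _ (hm y).1 h
      rw [ha] at this
      linarith
  · have h1 : a < Φ t x := by rw [← ha x]; exact hΦ x _ t (hm x).1 ht
    filter_upwards [(hc t).continuousAt.eventually (lt_mem_nhds h1)] with y hy
    by_contra! h
    have := hmono y _ _ ((hm x).1.trans ht) h
    rw [ha] at this
    linarith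

/-- The part of the polytope off the singular faces. -/
def uncutPart (v : Fin 5 → E4) (τ : ℝ) : Set E4 :=
  {x | x ∈ cutSimplex v τ ∧ ∀ i j, i ≠ j → cutCoord v τ x i = 1 → cutCoord v τ x j = 1 → False}

section Straightening

variable {v : Fin 5 → E4} {τ : ℝ}

theorem cutLevel_mem (h1 : 4 / 9 < τ) (h2 : τ < 1) : 2 < cutLevel τ ∧ cutLevel τ < 3 := by
  rw [cutLevel, lt_div_iff₀ (by linarith), div_lt_iff₀ (by linarith)]
  constructor <;> linarith

theorem exists_mem_Ioo_of_sum {c : Fin 5 → ℝ} (hc : ∀ i, 0 ≤ c i ∧ c i ≤ 1)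
    (hno : ∀ i j, i ≠ j → c i = 1 → c j = 1 → False) (hs : 1 < ∑ i, c i) :
    ∃ i, 0 < c i ∧ c i < 1 := by
  by_contra! h
  have hz : ∀ k, c k = 0 ∨ c k = 1 := fun k => by
    rcases (hc k).1.eq_or_lt with h0 | h0
    · exact .inl h0.symm
    · exact .inr (le_antisymm (hc k).2 (h k h0))
  by_cases hone : ∃ i, c i = 1
  · obtain ⟨i, hi⟩ := hone
    have h0 : ∀ j, j ≠ i → c j = 0 := fun j hj => (hz j).resolve_right fun h => hno j i hj h hi
    rw [Finset.sum_eq_single i (fun j _ hj => h0 j hj) (by simp), hi] at hs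
    exact lt_irrefl _ hs
  · push Not at hone
    rw [Finset.sum_eq_zero fun j _ => (hz j).resolve_right (hone j)] at hs
    norm_num at hs

/-- Intermediate values in `m`. At m = 1 the map is the identity and the sum exceeds 2. For small
`m` every coordinate below 1 is scaled to at most `m`, and at most one coordinate stays 1, so the
sum is below 1 + 5 m. -/
theorem exists_sum_stretch {c : Fin 5 → ℝ} (hc : ∀ i, 0 ≤ c i ∧ c i ≤ 1)
    (hno : ∀ i j, i ≠ j → c i = 1 → c j = 1 → False) (hs : 2 < ∑ i, c i) :
    ∃ m, (0 < m ∧ m < 1) ∧ ∑ i, stretch m (c i) = 2 := by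
  obtain ⟨k, hk⟩ : ∃ k, ∀ i, i ≠ k → c i < 1 := by
    by_cases hone : ∃ i, c i = 1
    · obtain ⟨i, hi⟩ := hone
      exact ⟨i, fun j hj => (hc j).2.lt_of_ne fun h => hno j i hj h hi⟩
    · push Not at hone
      exact ⟨0, fun j _ => (hc j).2.lt_of_ne (hone j)⟩
  have h1 : ∀ᶠ m : ℝ in 𝓝[>] 0, ∀ i, i ≠ k → m < 1 - c i := by
    refine Filter.eventually_all.2 fun i => ?_
    by_cases hi : i = k
    · exact Filter.Eventually.of_forall fun _ h => absurd hi h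
    · filter_upwards [mem_nhdsWithin_of_mem_nhds (gt_mem_nhds (sub_pos.2 (hk i hi)))] with m hm _
        using hm
  obtain ⟨m₀, hm₀, hm4, hpos⟩ := (h1.and ((Filter.Eventually.and (mem_nhdsWithin_of_mem_nhds
    (gt_mem_nhds (show (0 : ℝ) < 1 / 5 by norm_num))) self_mem_nhdsWithin) :
    ∀ᶠ m : ℝ in 𝓝[>] 0, m < 1 / 5 ∧ 0 < m)).exists
  have hlow : ∑ i, stretch m₀ (c i) < 2 := by
    have hb : ∀ i, stretch m₀ (c i) ≤ m₀ + if i = k then 1 else 0 := by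
      intro i
      split_ifs with h
      · have := (stretch_mem hpos (by linarith) (hc i).1 (hc i).2).2
        linarith
      · rw [add_zero]
        refine max_le (mul_le_of_le_one_right hpos.le (hc i).2) ?_
        have : 1 ≤ (1 - c i) / m₀ := (one_le_div hpos).2 (hm₀ i h).le
        linarith
    refine (Finset.sum_le_sum fun i _ => hb i).trans_lt ?_
    rw [Finset.sum_add_distrib]
    simp
    linarith
  have hcont : ContinuousOn (fun m => ∑ i, stretch m (c i)) (Set.Icc m₀ 1) := by
    refine continuousOn_finsetSum _ fun i _ => ?_
    refine ContinuousOn.sup (by fun_prop) (continuousOn_const.sub (continuousOn_const.div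
      continuousOn_id fun m hm => ?_))
    exact (hpos.trans_le hm.1).ne'
  obtain ⟨m, hm, e⟩ := intermediate_value_Icc (by linarith) hcont
    (show (2 : ℝ) ∈ Set.Icc _ _ from ⟨hlow.le, by simpa [stretch] using hs.le⟩)
  refine ⟨m, ⟨hpos.trans_le hm.1, hm.2.lt_of_ne ?_⟩, e⟩
  rintro rfl
  simp [stretch] at e
  linarith

/-- At least three coordinates are positive, since two with sum 2 would both be 1. For small `m`
these are pushed above 1 − m, so the sum passes `S` < 3, while at m = 1 it is 2. -/
theorem exists_sum_shrink {r : Fin 5 → ℝ} {S : ℝ} (hr : ∀ i, 0 ≤ r i ∧ r i ≤ 1)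
    (hno : ∀ i j, i ≠ j → r i = 1 → r j = 1 → False) (hs : ∑ i, r i = 2) (hS : 2 < S) (hS3 : S < 3) :
    ∃ m, (0 < m ∧ m < 1) ∧ ∑ i, shrink m (r i) = S := by
  classical
  obtain ⟨I, hI, hIpos⟩ : ∃ I : Finset (Fin 5), 3 ≤ I.card ∧ ∀ i ∈ I, 0 < r i := by
    refine ⟨Finset.univ.filter fun i => 0 < r i, ?_, by simp⟩
    by_contra! hlt
    have hle : ∑ i ∈ Finset.univ.filter (fun i => 0 < r i), r i = 2 := by
      rw [← hs]
      refine Finset.sum_subset (Finset.subset_univ _) fun i _ hi => ?_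
      simp only [Finset.mem_filter, Finset.mem_univ, true_and, not_lt] at hi
      exact le_antisymm hi (hr i).1
    have hall : ∀ i, 0 < r i → r i = 1 := by
      intro i hi
      by_contra hne
      have h1 := Finset.sum_lt_sum (s := Finset.univ.filter fun i => 0 < r i) (f := r)
        (g := fun _ => 1) (fun j _ => (hr j).2) ⟨i, by simpa using hi, (hr i).2.lt_of_ne hne⟩
      rw [hle] at h1
      simp only [Finset.sum_const, nsmul_eq_mul, mul_one] at h1
      have : (2 : ℝ) < ((2 : ℕ) : ℝ) := h1.trans_le (by exact_mod_cast (by omega))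
      norm_num at this
    have h2 : 2 ≤ (Finset.univ.filter fun i => 0 < r i).card := by
      have h1 := Finset.sum_le_sum (s := Finset.univ.filter fun i => 0 < r i) (f := r)
        (g := fun _ => 1) (fun j _ => (hr j).2)
      rw [hle] at h1
      simp only [Finset.sum_const, nsmul_eq_mul, mul_one] at h1
      exact_mod_cast h1
    obtain ⟨i, hi, j, hj, hij⟩ := Finset.one_lt_card.1 h2
    simp only [Finset.mem_filter, Finset.mem_univ, true_and] at hi hj
    exact hno i j hij (hall i hi) (hall j hj)
  have h1 : ∀ᶠ m : ℝ in 𝓝[>] 0, ∀ i, i ∈ I → m < r i := by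
    refine Filter.eventually_all.2 fun i => ?_
    by_cases hi : i ∈ I
    · filter_upwards [mem_nhdsWithin_of_mem_nhds (gt_mem_nhds (hIpos i hi))] with m hm _
        using hm
    · exact Filter.Eventually.of_forall fun _ h => absurd h hi
  obtain ⟨m₀, hm₀, hm4, hpos⟩ := (h1.and ((Filter.Eventually.and (mem_nhdsWithin_of_mem_nhds
    (gt_mem_nhds (show (0 : ℝ) < (3 - S) / 3 by linarith))) self_mem_nhdsWithin) :
    ∀ᶠ m : ℝ in 𝓝[>] 0, m < (3 - S) / 3 ∧ 0 < m)).exists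
  have hm1 : m₀ < 1 := by linarith
  have hhigh : S < ∑ i, shrink m₀ (r i) := by
    have h2 : ∑ i ∈ I, (1 - m₀) ≤ ∑ i ∈ I, shrink m₀ (r i) := by
      refine Finset.sum_le_sum fun i hi => le_min ?_ ?_
      · have := (one_le_div hpos).2 (hm₀ i hi).le
        linarith
      · nlinarith [(hr i).1]
    have h3 : ∑ i ∈ I, shrink m₀ (r i) ≤ ∑ i, shrink m₀ (r i) :=
      Finset.sum_le_sum_of_subset_of_nonneg (Finset.subset_univ _) fun i _ _ =>
        (shrink_mem hpos hm1.le (hr i).1 (hr i).2).1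
    simp only [Finset.sum_const, nsmul_eq_mul] at h2
    have h4 : (3 : ℝ) ≤ I.card := by exact_mod_cast hI
    nlinarith
  have hcont : ContinuousOn (fun m => ∑ i, shrink m (r i)) (Set.Icc m₀ 1) := by
    refine continuousOn_finsetSum _ fun i _ => ?_
    exact ContinuousOn.inf (continuousOn_const.div continuousOn_id fun m hm =>
      (hpos.trans_le hm.1).ne') (by fun_prop)
  obtain ⟨m, hm, e⟩ := intermediate_value_Icc' hm1.le hcont
    (show S ∈ Set.Icc _ _ from ⟨by simpa [shrink, hs] using hS.le, hhigh.le⟩)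
  refine ⟨m, ⟨hpos.trans_le hm.1, hm.2.lt_of_ne ?_⟩, e⟩
  rintro rfl
  simp [shrink, hs] at e
  linarith

variable (hv : IsRegularSimplex v) (h1 : 4 / 9 < τ) (h2 : τ < 1)
include hv h1 h2

/-- For each point the parameter `m` is determined by the required level of the coordinate sum. It
depends continuously on the point by strict monotonicity, and the inverse uses `shrink` with the
same parameter. -/
theorem exists_straightening : ∃ Φ : uncutPart v τ ≃ₜ idealRectifiedSimplex v,
    ∀ q, ∃ m, (0 < m ∧ m < 1) ∧
      ∀ i, cutCoord v 1 (Φ q) i = stretch m (cutCoord v τ q i) := by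
  have hτ : 0 < τ + 2 / 3 := by linarith
  obtain ⟨hS2, hS3⟩ := cutLevel_mem h1 h2
  have hQ : ∀ q : uncutPart v τ, ∀ i, 0 ≤ cutCoord v τ q i ∧ cutCoord v τ q i ≤ 1 := fun q =>
    (mem_cutSimplex_iff hτ).1 q.2.1
  have hR : ∀ r : idealRectifiedSimplex v, ∀ i, 0 ≤ cutCoord v 1 r i ∧ cutCoord v 1 r i ≤ 1 :=
    fun r => ((mem_idealRectifiedSimplex_iff hv).1 r.2).1
  have hRno : ∀ r : idealRectifiedSimplex v, ∀ i j, i ≠ j → cutCoord v 1 r i = 1 →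
      cutCoord v 1 r j = 1 → False := fun r =>
    (mem_lorCone_iff hv (hR r)).1 ((mem_idealRectifiedSimplex_iff hv).1 r.2).2
  have hQi : ∀ q : uncutPart v τ, ∃ i, 0 < cutCoord v τ q i ∧ cutCoord v τ q i < 1 := fun q =>
    exists_mem_Ioo_of_sum (hQ q) q.2.2 (by rw [sum_cutCoord hv hτ]; linarith)
  have hRi : ∀ r : idealRectifiedSimplex v, ∃ i, 0 < cutCoord v 1 r i ∧ cutCoord v 1 r i < 1 :=
    fun r => exists_mem_Ioo_of_sum (hR r) (hRno r) (by rw [sum_cutCoord_one hv]; norm_num)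
  choose m hm hsm using fun q : uncutPart v τ =>
    exists_sum_stretch (hQ q) q.2.2 (by rw [sum_cutCoord hv hτ]; exact hS2)
  choose n hn hsn using fun r : idealRectifiedSimplex v =>
    exists_sum_shrink (hR r) (hRno r) (sum_cutCoord_one hv _) hS2 hS3
  have hcQ : ∀ i, Continuous fun q : uncutPart v τ => cutCoord v τ q i := fun i =>
    ((continuous_apply i).comp continuous_cutCoord).comp continuous_subtype_val
  have hcR : ∀ i, Continuous fun r : idealRectifiedSimplex v => cutCoord v 1 r i := fun i =>
    ((continuous_apply i).comp continuous_cutCoord).comp continuous_subtype_val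
  have hmc : Continuous m := by
    refine continuous_of_strictMono_implicit
      (Φ := fun t (q : uncutPart v τ) => ∑ i, stretch t (cutCoord v τ q i)) hm (fun t => ?_)
      (fun q s t hs h => sum_stretch_lt (hQ q) (hQi q) hs h) hsm
    refine continuous_finsetSum _ fun i _ => ?_
    have := hcQ i
    unfold stretch
    fun_prop
  have hnc : Continuous n := by
    refine continuous_of_strictMono_implicit
      (Φ := fun t (r : idealRectifiedSimplex v) => -∑ i, shrink t (cutCoord v 1 r i)) hn
      (fun t => ?_) (fun q s t hs h => neg_lt_neg (sum_shrink_lt (hR q) (hRi q) hs h))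
      (fun r => congrArg Neg.neg (hsn r))
    refine (continuous_finsetSum _ fun i _ => ?_).neg
    have := hcR i
    unfold shrink
    fun_prop
  let f : uncutPart v τ → E4 := fun q => cutPoint v 1 fun i => stretch (m q) (cutCoord v τ q i)
  have hf : ∀ q i, cutCoord v 1 (f q) i = stretch (m q) (cutCoord v τ q i) := fun q =>
    congrFun (cutCoord_cutPoint hv (by norm_num) (by rw [cutLevel_one]; exact hsm q))
  let g : idealRectifiedSimplex v → E4 := fun r => cutPoint v τ fun i => shrink (n r) (cutCoord v 1 r i)
  have hg : ∀ r i, cutCoord v τ (g r) i = shrink (n r) (cutCoord v 1 r i) := fun r =>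
    congrFun (cutCoord_cutPoint hv hτ (hsn r))
  have hfm : ∀ q, f q ∈ idealRectifiedSimplex v := by
    intro q
    have hb : ∀ i, 0 ≤ cutCoord v 1 (f q) i ∧ cutCoord v 1 (f q) i ≤ 1 := fun i => by
      rw [hf]
      exact stretch_mem (hm q).1 (hm q).2.le (hQ q i).1 (hQ q i).2
    refine (mem_idealRectifiedSimplex_iff hv).2 ⟨hb, (mem_lorCone_iff hv hb).2 ?_⟩
    intro i j hij hi hj
    rw [hf, stretch_eq_one_iff (hm q).1 (hm q).2.le] at hi hj
    exact q.2.2 i j hij hi hj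
  have hgm : ∀ r, g r ∈ uncutPart v τ := by
    intro r
    refine ⟨(mem_cutSimplex_iff hτ).2 fun i => ?_, fun i j hij hi hj => ?_⟩
    · rw [hg]
      exact shrink_mem (hn r).1 (hn r).2.le (hR r i).1 (hR r i).2
    · rw [hg] at hi hj
      rw [← stretch_eq_one_iff (hn r).1 (hn r).2.le, stretch_shrink (hn r).1] at hi hj
      exact hRno r i j hij hi hj
  refine ⟨{ toFun := fun q => ⟨f q, hfm q⟩, invFun := fun r => ⟨g r, hgm r⟩, left_inv := ?_,
            right_inv := ?_, continuous_toFun := ?_, continuous_invFun := ?_ },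
    fun q => ⟨m q, hm q, hf q⟩⟩
  · intro q
    refine Subtype.ext ?_
    show g ⟨f q, hfm q⟩ = q
    -- Both parameters solve the same equation for the coordinate sum, which is strictly monotone in
    -- the parameter.
    have hnm : n ⟨f q, hfm q⟩ = m q := by
      have e1 := hsn ⟨f q, hfm q⟩
      have e2 : ∑ i, shrink (m q) (cutCoord v 1 (f q) i) = cutLevel τ := by
        rw [← sum_cutCoord hv hτ q]
        exact Finset.sum_congr rfl fun i _ => by rw [hf, shrink_stretch (hm q).1]
      rcases lt_trichotomy (n ⟨f q, hfm q⟩) (m q) with h | h | h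
      · have := sum_shrink_lt (hR ⟨f q, hfm q⟩) (hRi ⟨f q, hfm q⟩) (hn _).1 h
        rw [e1] at this
        exact absurd e2 this.ne
      · exact h
      · have := sum_shrink_lt (hR ⟨f q, hfm q⟩) (hRi ⟨f q, hfm q⟩) (hm q).1 h
        rw [e1] at this
        exact absurd e2 this.ne'
    rw [← cutPoint_cutCoord hv hτ (q : E4)]
    show cutPoint v τ _ = _
    congr 1
    ext i
    show shrink (n ⟨f q, hfm q⟩) (cutCoord v 1 (f q) i) = _
    rw [hnm, hf, shrink_stretch (hm q).1]
  · intro r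
    refine Subtype.ext ?_
    show f ⟨g r, hgm r⟩ = r
    have hnm : m ⟨g r, hgm r⟩ = n r := by
      refine eq_of_sum_stretch_eq (hQ ⟨g r, hgm r⟩) (hQi _) (hm _).1 (hn _).1 ?_
      rw [hsm, ← sum_cutCoord_one hv r]
      exact Finset.sum_congr rfl fun i _ => by rw [hg, stretch_shrink (hn r).1]
    rw [← cutPoint_cutCoord hv (τ := 1) (by norm_num) (r : E4)]
    show cutPoint v 1 _ = _
    congr 1
    ext i
    show stretch (m ⟨g r, hgm r⟩) (cutCoord v τ (g r) i) = _
    rw [hnm, hg, stretch_shrink (hn r).1]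
  · refine Continuous.subtype_mk (continuous_cutPoint.comp (continuous_pi fun i => ?_)) _
    refine Continuous.max (hmc.mul (hcQ i)) (continuous_const.sub
      ((continuous_const.sub (hcQ i)).div hmc fun q => (hm q).1.ne'))
  · refine Continuous.subtype_mk (continuous_cutPoint.comp (continuous_pi fun i => ?_)) _
    refine Continuous.min ((hcR i).div hnc fun q => (hn q).1.ne') (continuous_const.sub
      (hnc.mul (continuous_const.sub (hcR i))))

end Straightening

/-! ### The embedding of the hyperbolic manifold -/

section Kappa

variable {v : Fin 5 → E4} {τ : ℝ}

theorem isOpen_uncut : IsOpen {x : E4 | ∀ i j, i ≠ j → cutCoord v τ x i = 1 →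
    cutCoord v τ x j = 1 → False} := by
  have hc : ∀ i, Continuous fun x => cutCoord v τ x i := fun i =>
    (continuous_apply i).comp continuous_cutCoord
  rw [Set.ofPred_forall]
  refine isOpen_iInter_of_finite fun i => ?_
  rw [Set.ofPred_forall]
  refine isOpen_iInter_of_finite fun j => ?_
  rw [Set.ofPred_forall]
  refine isOpen_iInter_of_finite fun _ => ?_
  have : {x : E4 | cutCoord v τ x i = 1 → cutCoord v τ x j = 1 → False} =
      ({x | cutCoord v τ x i = 1} ∩ {x | cutCoord v τ x j = 1})ᶜ := by
    ext x
    simp [not_and]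
  rw [this]
  exact ((isClosed_eq (hc i) continuous_const).inter
    (isClosed_eq (hc j) continuous_const)).isOpen_compl

theorem linked_iff_of_facets {τ' : ℝ} {x y : E4}
    (h : ∀ a, x ∈ facetPlane v τ a ↔ y ∈ facetPlane v τ' a) {l l' : CellLabel} :
    Linked v τ x l l' ↔ Linked v τ' y l l' :=
  ⟨fun hl => Relation.ReflTransGen.mono (fun _ _ ⟨a, ha, e⟩ => ⟨a, (h a).1 ha, e⟩) _ _ hl,
    fun hl => Relation.ReflTransGen.mono (fun _ _ ⟨a, ha, e⟩ => ⟨a, (h a).2 ha, e⟩) _ _ hl⟩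

/-- `stretch` preserves the values 0 and 1 in both directions, so corresponding points lie on
corresponding facets and have the same linkage classes. The map of cells therefore descends
injectively, and openness holds in each cell. -/
theorem exists_embedding (hτ : 0 < τ + 2 / 3) (Φ : uncutPart v τ ≃ₜ idealRectifiedSimplex v)
    (hΦ : ∀ q, ∃ m, (0 < m ∧ m < 1) ∧
      ∀ i, cutCoord v 1 (Φ q) i = stretch m (cutCoord v τ q i)) :
    ∃ κ : SpaceM v → SpaceX v τ, Topology.IsOpenEmbedding κ ∧
      (∀ l r, κ (cellPt v 1 _ l r) = cellPt v τ _ l ⟨Φ.symm r, (Φ.symm r).2.1⟩) ∧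
      ∀ l q, cellPt v τ _ l q ∈ Set.range κ ↔ (q : E4) ∈ uncutPart v τ := by
  have hfac : ∀ (q : uncutPart v τ) a, (q : E4) ∈ facetPlane v τ a ↔ (Φ q : E4) ∈ facetPlane v 1 a := by
    intro q a
    obtain ⟨m, hm, e⟩ := hΦ q
    rcases a with i | i
    · rw [mem_facetPlane_inl hτ, mem_facetPlane_inl (by norm_num), e,
        stretch_eq_zero_iff hm.1 hm.2.le]
    · rw [mem_facetPlane_inr hτ, mem_facetPlane_inr (by norm_num), e,
        stretch_eq_one_iff hm.1 hm.2.le]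
  have hfac' : ∀ r a, (Φ.symm r : E4) ∈ facetPlane v τ a ↔ (r : E4) ∈ facetPlane v 1 a := by
    intro r a
    rw [hfac, Φ.apply_symm_apply]
  let ι : idealRectifiedSimplex v → cutSimplex v τ := fun r => ⟨Φ.symm r, (Φ.symm r).2.1⟩
  have hι : Continuous ι := (continuous_subtype_val.comp Φ.symm.continuous).subtype_mk _
  let κ : SpaceM v → SpaceX v τ :=
    Quot.map (fun p => (p.1, p.2.1, p.2.2.1, ι p.2.2.2)) (by
      rintro _ _ ⟨ε, p, q, h⟩
      refine CoverGlue.mk ε (p.1, p.2.1, ι p.2.2) (q.1, q.2.1, ι q.2.2) ?_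
      rw [baseGlue_iff _ _ ε] at h ⊢
      obtain ⟨e, a, ha, hl⟩ := h
      exact ⟨by rw [e], a, (hfac' _ a).2 ha, hl⟩)
  have hκ : ∀ l r, κ (cellPt v 1 _ l r) = cellPt v τ _ l (ι r) := fun l r => rfl
  have hlink : ∀ r l l', Linked v τ (ι r) l l' ↔ Linked v 1 (r : E4) l l' := fun r l l' =>
    linked_iff_of_facets (hfac' r)
  have hιinj : Function.Injective ι := fun r r' h =>
    by
    have h' : (Φ.symm r : E4) = Φ.symm r' := congrArg (fun z : cutSimplex v τ => (z : E4)) h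
    exact Φ.symm.injective (Subtype.ext h')
  have hinj : Function.Injective κ := by
    intro m m' h
    obtain ⟨l, r, rfl⟩ := exists_cellPt m
    obtain ⟨l', r', rfl⟩ := exists_cellPt m'
    rw [hκ, hκ, cellPt_eq_iff] at h
    exact cellPt_eq_iff.2 ⟨hιinj h.1, (hlink _ _ _).1 h.2⟩
  have hcont : Continuous κ := by
    refine continuous_quot_lift _ (continuous_quot_mk.comp ?_)
    fun_prop
  have hrange : ∀ q : uncutPart v τ, (⟨q, q.2.1⟩ : cutSimplex v τ) = ι (Φ q) := by
    intro q
    refine Subtype.ext ?_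
    show (q : E4) = Φ.symm (Φ q)
    rw [Φ.symm_apply_apply]
  have hopen : IsOpenMap κ := by
    intro V hV
    rw [isOpen_coverGluing_iff] at hV ⊢
    intro l
    have h1 : {x : cutSimplex v τ | cellPt v τ _ l x ∈ κ '' V} =
        (fun q : uncutPart v τ => (⟨q, q.2.1⟩ : cutSimplex v τ)) ''
          (Φ ⁻¹' {r | cellPt v 1 _ l r ∈ V}) := by
      ext x
      constructor
      · rintro ⟨m, hm, h⟩
        obtain ⟨l', r, rfl⟩ := exists_cellPt m
        rw [hκ, cellPt_eq_iff] at h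
        obtain ⟨rfl, hl⟩ := h
        refine ⟨Φ.symm r, ?_, rfl⟩
        show cellPt v 1 _ l (Φ (Φ.symm r)) ∈ V
        rw [Φ.apply_symm_apply]
        rw [hlink] at hl
        rwa [← cellPt_eq_iff.2 ⟨rfl, hl⟩]
      · rintro ⟨q, hq, rfl⟩
        refine ⟨_, hq, ?_⟩
        rw [hκ, ← hrange]
    rw [h1]
    have hoe : Topology.IsOpenEmbedding
        (fun q : uncutPart v τ => (⟨q, q.2.1⟩ : cutSimplex v τ)) := by
      refine ⟨Topology.IsEmbedding.inclusion (fun x hx => hx.1), ?_⟩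
      convert isOpen_uncut.preimage (continuous_subtype_val (p := (· ∈ cutSimplex v τ))) using 1
      ext x
      constructor
      · rintro ⟨q, rfl⟩
        exact q.2.2
      · intro hx
        exact ⟨⟨x, x.2, hx⟩, rfl⟩
    exact hoe.isOpenMap _ ((hV l).preimage Φ.continuous)
  refine ⟨κ, .of_continuous_injective_isOpenMap hcont hinj hopen, hκ, fun l q => ?_⟩
  constructor
  · rintro ⟨m, h⟩
    obtain ⟨l', r, rfl⟩ := exists_cellPt m
    rw [hκ, cellPt_eq_iff] at h
    rw [← h.1]
    exact (Φ.symm r).2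
  · intro hq
    exact ⟨cellPt v 1 _ l (Φ ⟨q, hq⟩), by rw [hκ, ← hrange ⟨q, hq⟩]⟩

end Kappa

/-! ### Polar coordinates in a sector of the plane -/

/-- The point with polar coordinates `ρ`, `s`, given by its distances to the walls `s = 0` and
`s = 1` of a sector of angle `π / 3`. -/
def polar (ρ s : ℝ) : ℝ × ℝ := (ρ * Real.sin (Real.pi / 3 * s), ρ * Real.sin (Real.pi / 3 * (1 - s)))

/-- The radial coordinate. -/
def polarRadius (z : ℝ × ℝ) : ℝ := √(4 / 3 * (z.1 ^ 2 + z.2 ^ 2 + z.1 * z.2))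

/-- The branch of the angular coordinate near `s₀`. -/
def polarAngle (s₀ : ℝ) (z : ℝ × ℝ) : ℝ :=
  s₀ + 3 / Real.pi * Real.arcsin ((z.1 * Real.cos (Real.pi / 3 * s₀) -
    (2 * z.2 + z.1) / √3 * Real.sin (Real.pi / 3 * s₀)) / polarRadius z)

theorem sin_pi_div_three_mul_one_sub (s : ℝ) : Real.sin (Real.pi / 3 * (1 - s)) =
    √3 / 2 * Real.cos (Real.pi / 3 * s) - 1 / 2 * Real.sin (Real.pi / 3 * s) := by
  rw [mul_sub, mul_one, Real.sin_sub, Real.sin_pi_div_three, Real.cos_pi_div_three]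

theorem polarRadius_nonneg (z : ℝ × ℝ) : 0 ≤ polarRadius z := Real.sqrt_nonneg _

theorem polarRadius_polar {ρ : ℝ} (h : 0 ≤ ρ) (s : ℝ) : polarRadius (polar ρ s) = ρ := by
  have h3 : √3 ^ 2 = (3 : ℝ) := Real.sq_sqrt (by norm_num)
  have h1 := Real.sin_sq_add_cos_sq (Real.pi / 3 * s)
  rw [polarRadius, polar, sin_pi_div_three_mul_one_sub]
  have : 4 / 3 * ((ρ * Real.sin (Real.pi / 3 * s)) ^ 2 + (ρ * (√3 / 2 * Real.cos (Real.pi / 3 * s) -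
      1 / 2 * Real.sin (Real.pi / 3 * s))) ^ 2 + ρ * Real.sin (Real.pi / 3 * s) *
      (ρ * (√3 / 2 * Real.cos (Real.pi / 3 * s) - 1 / 2 * Real.sin (Real.pi / 3 * s)))) = ρ ^ 2 := by
    linear_combination ρ ^ 2 * h1 + 1 / 3 * ρ ^ 2 * Real.cos (Real.pi / 3 * s) ^ 2 * h3
  rw [this, Real.sqrt_sq h]

/-- The argument of the arcsine is sin(π/3 · (s − s₀)); the bound 3/2 keeps the angle within [−π/2,
π/2]. -/
theorem polarAngle_polar {ρ s s₀ : ℝ} (h : 0 < ρ) (hs : |s - s₀| ≤ 3 / 2) :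
    polarAngle s₀ (polar ρ s) = s := by
  have h3 : √3 ^ 2 = (3 : ℝ) := Real.sq_sqrt (by norm_num)
  have h3' : √3 ≠ (0 : ℝ) := by positivity
  have hpi := Real.pi_pos
  rw [abs_le] at hs
  rw [polarAngle, polarRadius_polar h.le, polar, sin_pi_div_three_mul_one_sub]
  have : (ρ * Real.sin (Real.pi / 3 * s) * Real.cos (Real.pi / 3 * s₀) -
      (2 * (ρ * (√3 / 2 * Real.cos (Real.pi / 3 * s) - 1 / 2 * Real.sin (Real.pi / 3 * s))) +
      ρ * Real.sin (Real.pi / 3 * s)) / √3 * Real.sin (Real.pi / 3 * s₀)) / ρ =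
      Real.sin (Real.pi / 3 * (s - s₀)) := by
    rw [mul_sub (Real.pi / 3) s s₀, Real.sin_sub]
    field_simp
    ring
  rw [this, Real.arcsin_sin (by nlinarith) (by nlinarith)]
  field_simp
  ring

theorem exists_polar_eq {z : ℝ × ℝ} (h1 : 0 ≤ z.1) (h2 : 0 ≤ z.2) :
    ∃ s, 0 ≤ s ∧ s ≤ 1 ∧ polar (polarRadius z) s = z := by
  obtain ⟨a, b⟩ := z
  simp only at h1 h2
  have hpi := Real.pi_pos
  have hsq : polarRadius (a, b) ^ 2 = 4 / 3 * (a ^ 2 + b ^ 2 + a * b) :=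
    Real.sq_sqrt (by positivity)
  rcases (polarRadius_nonneg (a, b)).eq_or_lt with h0 | h0
  · rw [← h0] at hsq
    have hab := mul_nonneg h1 h2
    have ha : a = 0 := by nlinarith
    have hb : b = 0 := by nlinarith
    refine ⟨0, le_rfl, zero_le_one, ?_⟩
    rw [← h0, ha, hb]
    simp [polar]
  · set ρ := polarRadius (a, b)
    have h3 : √3 ^ 2 = (3 : ℝ) := Real.sq_sqrt (by norm_num)
    have h3' : (0 : ℝ) < √3 := by positivity
    have hle : a / ρ ≤ √3 / 2 := by
      rw [div_le_div_iff₀ h0 two_pos]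
      refine abs_le_of_sq_le_sq' ?_ (by positivity) |>.2
      rw [mul_pow, mul_pow, h3, hsq]
      nlinarith [mul_nonneg h1 h2]
    have h32 : √3 / 2 ≤ 1 := by
      rw [div_le_one two_pos]
      exact Real.sqrt_le_iff.2 ⟨by norm_num, by norm_num⟩
    have hge : 0 ≤ a / ρ := by positivity
    have e1 : Real.pi / 3 * (3 / Real.pi * Real.arcsin (a / ρ)) = Real.arcsin (a / ρ) := by
      field_simp
    refine ⟨3 / Real.pi * Real.arcsin (a / ρ), ?_, ?_, ?_⟩
    · have := Real.arcsin_nonneg.2 hge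
      positivity
    · have := Real.arcsin_le_arcsin hle
      rw [← Real.sin_pi_div_three, Real.arcsin_sin (by linarith) (by linarith)] at this
      rw [div_mul_eq_mul_div, div_le_one hpi]
      linarith
    · have hcos : √(1 - (a / ρ) ^ 2) = (2 * b + a) / (√3 * ρ) := by
        rw [Real.sqrt_eq_iff_mul_self_eq_of_pos (by
          by_contra! hz
          have : 2 * b + a ≤ 0 := by
            by_contra! hz'
            exact absurd hz (not_le.2 (by positivity))
          have ha : a = 0 := by linarith
          have hb : b = 0 := by linarith
          rw [ha, hb] at hsq
          nlinarith)]
        field_simp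
        rw [h3, hsq]
        ring
      simp only [polar, sin_pi_div_three_mul_one_sub, e1]
      rw [Real.sin_arcsin (by linarith) (by linarith), Real.cos_arcsin, hcos]
      refine Prod.ext ?_ ?_
      · field_simp
      · field_simp
        ring

/-- The reflection s ↦ −s of the angle is the A₂ reflection in the first wall. Together with s ↦ 2 −
s for the second wall it turns the translations along the interval direction of a cusp into
rotations of the plane. -/
theorem polar_neg (ρ s : ℝ) : polar ρ (-s) = (-(polar ρ s).1, (polar ρ s).1 + (polar ρ s).2) := by
  have h : Real.sin (Real.pi / 3 * (1 - -s)) =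
      √3 / 2 * Real.cos (Real.pi / 3 * s) + 1 / 2 * Real.sin (Real.pi / 3 * s) := by
    rw [sin_pi_div_three_mul_one_sub, mul_neg, Real.cos_neg, Real.sin_neg]
    ring
  simp only [polar, h, sin_pi_div_three_mul_one_sub, mul_neg, Real.sin_neg]
  refine Prod.ext rfl ?_
  simp only
  ring

theorem polar_one_sub (ρ s : ℝ) : polar ρ (1 - s) = ((polar ρ s).2, (polar ρ s).1) := by
  simp [polar]

theorem polar_two_sub (ρ s : ℝ) :
    polar ρ (2 - s) = ((polar ρ s).1 + (polar ρ s).2, -(polar ρ s).2) := by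
  have h := polar_neg ρ (1 - s)
  have h2 := polar_one_sub ρ (-(1 - s))
  rw [show 1 - -(1 - s) = 2 - s by ring, h, polar_one_sub] at h2
  rw [h2]
  refine Prod.ext ?_ rfl
  simp only
  ring

theorem polar_zero (s : ℝ) : polar 0 s = (0, 0) := by simp [polar]

/-! ### Charts around the tori -/

/-- Points of `ℝ⁴` as pairs of points of the plane. -/
def pack (p z : ℝ × ℝ) : E4 := !₂[p.1, p.2, z.1, z.2]

@[simp] theorem pack_zero (p z : ℝ × ℝ) : pack p z 0 = p.1 := rfl
@[simp] theorem pack_one (p z : ℝ × ℝ) : pack p z 1 = p.2 := rfl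
@[simp] theorem pack_two (p z : ℝ × ℝ) : pack p z 2 = z.1 := rfl
@[simp] theorem pack_three (p z : ℝ × ℝ) : pack p z 3 = z.2 := rfl

theorem pack_self (d : E4) : pack (d 0, d 1) (d 2, d 3) = d := by
  ext i
  fin_cases i <;> rfl

theorem pack_inj {p z p' z' : ℝ × ℝ} : pack p z = pack p' z' ↔ p = p' ∧ z = z' := by
  constructor
  · intro h
    have h0 := congrArg (fun d : E4 => d 0) h
    have h1 := congrArg (fun d : E4 => d 1) h
    have h2 := congrArg (fun d : E4 => d 2) h
    have h3 := congrArg (fun d : E4 => d 3) h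
    exact ⟨Prod.ext h0 h1, Prod.ext h2 h3⟩
  · rintro ⟨rfl, rfl⟩
    rfl

theorem contDiff_pack {E : Type*} [NormedAddCommGroup E] [NormedSpace ℝ E] {p z : E → ℝ × ℝ}
    {x : E} (hp : ContDiffAt ℝ ∞ p x) (hz : ContDiffAt ℝ ∞ z x) :
    ContDiffAt ℝ ∞ (fun y => pack (p y) (z y)) x := by
  rw [contDiffAt_euclidean]
  intro i
  fin_cases i
  · exact hp.fst
  · exact hp.snd
  · exact hz.fst
  · exact hz.snd

theorem continuous_pack : Continuous fun w : (ℝ × ℝ) × (ℝ × ℝ) => pack w.1 w.2 := by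
  refine (PiLp.continuous_toLp 2 _).comp (continuous_pi fun i => ?_)
  fin_cases i
  · exact continuous_fst.comp continuous_fst
  · exact continuous_snd.comp continuous_fst
  · exact continuous_fst.comp continuous_snd
  · exact continuous_snd.comp continuous_snd

/-- The action of the product of the reflection groups of two sectors. -/
def sec4 (g : Fin 6 × Fin 6) (d : E4) : E4 := pack (sec g.1 (d 0, d 1)) (sec g.2 (d 2, d 3))

/-- The folding onto the product of two sectors. -/
def fold4 (d : E4) : E4 := pack (fold2 (d 0, d 1)) (fold2 (d 2, d 3))

theorem contDiff_sec4 (g : Fin 6 × Fin 6) : ContDiff ℝ ∞ (sec4 g) := by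
  refine contDiff_iff_contDiffAt.2 fun x => contDiff_pack ?_ ?_
  · exact (contDiff_sec g.1).contDiffAt.comp x (f := fun d : E4 => (d 0, d 1)) (by fun_prop)
  · exact (contDiff_sec g.2).contDiffAt.comp x (f := fun d : E4 => (d 2, d 3)) (by fun_prop)

theorem continuous_fold4 : Continuous fold4 := by
  refine continuous_pack.comp (Continuous.prodMk (continuous_fold2.comp ?_)
    (continuous_fold2.comp ?_)) <;> fun_prop

theorem sec4_zero (d : E4) : sec4 (0, 0) d = d := by
  simp only [sec4, sec_zero, pack_self]

theorem sec4_cornerNb (s : Fin 4) (g : Fin 6 × Fin 6) (d : E4) :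
    sec4 (cornerNb s g) d = sec4 g (sec4 (cornerNb s (0, 0)) d) := by
  fin_cases s
  · show pack (sec (nbα g.1) _) (sec g.2 _) = pack (sec g.1 (sec (nbα 0) _)) (sec g.2 (sec 0 _))
    rw [sec_nbα, sec_nbα, sec_zero, sec_zero]
    rfl
  · show pack (sec (nbβ g.1) _) (sec g.2 _) = pack (sec g.1 (sec (nbβ 0) _)) (sec g.2 (sec 0 _))
    rw [sec_nbβ, sec_nbβ, sec_zero, sec_zero]
    rfl
  · show pack (sec g.1 _) (sec (nbα g.2) _) = pack (sec g.1 (sec 0 _)) (sec g.2 (sec (nbα 0) _))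
    rw [sec_nbα, sec_nbα, sec_zero, sec_zero]
    rfl
  · show pack (sec g.1 _) (sec (nbβ g.2) _) = pack (sec g.1 (sec 0 _)) (sec g.2 (sec (nbβ 0) _))
    rw [sec_nbβ, sec_nbβ, sec_zero, sec_zero]
    rfl

theorem sec4_cornerNb_of_eq_zero {s : Fin 4} {d : E4} (h : d s = 0) :
    sec4 (cornerNb s (0, 0)) d = d := by
  ext i
  fin_cases s <;> simp at h <;> fin_cases i <;> simp [sec4, cornerNb, nbα, nbβ, sec, h]

theorem fold4_nonneg (d : E4) (i : Fin 4) : 0 ≤ fold4 d i := by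
  fin_cases i
  · exact (fold2_nonneg _).1
  · exact (fold2_nonneg _).2
  · exact (fold2_nonneg _).1
  · exact (fold2_nonneg _).2

theorem fold4_sec4 (g : Fin 6 × Fin 6) {d : E4} (h : ∀ i, 0 ≤ d i) : fold4 (sec4 g d) = d := by
  conv_rhs => rw [← pack_self d]
  show pack (fold2 (sec g.1 (d 0, d 1))) (fold2 (sec g.2 (d 2, d 3))) = _
  rw [fold2_sec g.1 (p := (d 0, d 1)) (h 0) (h 1), fold2_sec g.2 (p := (d 2, d 3)) (h 2) (h 3)]

theorem exists_sec4_fold4 (d : E4) : ∃ g, sec4 g (fold4 d) = d := by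
  obtain ⟨n, hn⟩ := exists_sec_fold2 (d 0, d 1)
  obtain ⟨n', hn'⟩ := exists_sec_fold2 (d 2, d 3)
  refine ⟨(n, n'), ?_⟩
  conv_rhs => rw [← pack_self d]
  show pack (sec n (fold2 (d 0, d 1))) (sec n' (fold2 (d 2, d 3))) = _
  rw [hn, hn']

/-- A linear reflection is the case `r = 0` of the projective maps, with normal form the coordinate
`s`. -/
theorem det_sec4_cornerNb (s : Fin 4) (x : E4) :
    (fderiv ℝ (sec4 (cornerNb s (0, 0))) x).det = -1 := by
  let nb : Fin 4 → Fin 4 := ![1, 0, 3, 2]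
  let w : E4 := EuclideanSpace.single s (1 : ℝ)
  let a : E4 := EuclideanSpace.single (nb s) (1 : ℝ) - EuclideanSpace.single s (2 : ℝ)
  have hw : ∀ y : E4, inner ℝ w y = y s := fun y => by
    simp [w, EuclideanSpace.inner_single_left]
  have hf : ∀ y, sec4 (cornerNb s (0, 0)) y = (1 + 0 * (inner ℝ w y + 0))⁻¹ •
      (y + (inner ℝ w y + 0) • a) := by
    intro y
    rw [hw]
    ext i
    fin_cases s <;> fin_cases i <;> simp [sec4, cornerNb, nbα, nbβ, sec, a, nb] <;> ring
  rw [det_fderiv_projective a w x 0 0 _ hf (by norm_num)]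
  simp only [hw]
  fin_cases s <;> simp [a, nb] <;> norm_num

theorem det_sec4 (g : Fin 6 × Fin 6) (x : E4) :
    0 < -boolSign (sectorOdd g.1 ^^ sectorOdd g.2) * (fderiv ℝ (sec4 g) x).det := by
  have step : ∀ (g : Fin 6 × Fin 6) s,
      (sectorOdd (cornerNb s g).1 ^^ sectorOdd (cornerNb s g).2) =
        !(sectorOdd g.1 ^^ sectorOdd g.2) →
      (∀ x, 0 < -boolSign (sectorOdd g.1 ^^ sectorOdd g.2) * (fderiv ℝ (sec4 g) x).det) →
      ∀ x, 0 < -boolSign (sectorOdd (cornerNb s g).1 ^^ sectorOdd (cornerNb s g).2) *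
        (fderiv ℝ (sec4 (cornerNb s g)) x).det := by
    intro g s hs ih x
    have h1 : sec4 (cornerNb s g) = sec4 g ∘ sec4 (cornerNb s (0, 0)) :=
      funext fun d => sec4_cornerNb s g d
    rw [h1, fderiv_comp _ ((contDiff_sec4 _).differentiable (by simp)).differentiableAt
      ((contDiff_sec4 _).differentiable (by simp)).differentiableAt]
    change 0 < _ * LinearMap.det (((fderiv ℝ (sec4 g) _ : E4 →L[ℝ] E4) : E4 →ₗ[ℝ] E4) ∘ₗ
      ((fderiv ℝ (sec4 (cornerNb s (0, 0))) x : E4 →L[ℝ] E4) : E4 →ₗ[ℝ] E4))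
    rw [LinearMap.det_comp, hs, boolSign_not]
    have h5 := det_sec4_cornerNb s x
    rw [ContinuousLinearMap.det] at h5
    rw [h5]
    refine lt_of_lt_of_eq (ih (sec4 (cornerNb s (0, 0)) x)) ?_
    simp only [ContinuousLinearMap.det]
    ring
  revert x
  obtain ⟨n, n'⟩ := g
  refine forall_sector (p := fun n' => ∀ n, ∀ x, 0 < -boolSign (sectorOdd n ^^ sectorOdd n') *
    (fderiv ℝ (sec4 (n, n')) x).det) ?_ (fun n' h n => step (n, n') 2 ?_ (h n))
    (fun n' h n => step (n, n') 3 ?_ (h n)) n' n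
  · refine forall_sector ?_ (fun n h => step (n, 0) 0 ?_ h) (fun n h => step (n, 0) 1 ?_ h)
    · intro x
      rw [show sec4 (0, 0) = id from funext sec4_zero, fderiv_id]
      simp [boolSign, sectorOdd, ContinuousLinearMap.det]
    · show (sectorOdd (nbα n) ^^ _) = _
      rw [sectorOdd_nbα]; simp [cornerNb]
    · show (sectorOdd (nbβ n) ^^ _) = _
      rw [sectorOdd_nbβ]; simp [cornerNb]
  · show (_ ^^ sectorOdd (nbα n')) = _
    rw [sectorOdd_nbα]; simp [cornerNb]
  · show (_ ^^ sectorOdd (nbβ n')) = _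
    rw [sectorOdd_nbβ]; simp [cornerNb]

/-- The squared norm of a point of a horosphere. -/
def horoSq (b : ℝ × ℝ) (s : ℝ) : ℝ :=
  b.1 ^ 2 + b.2 ^ 2 + (1 - b.1 - b.2) ^ 2 + s ^ 2 + (1 - s) ^ 2

theorem horoSq_nonneg (b : ℝ × ℝ) (s : ℝ) : 0 ≤ horoSq b s := by
  unfold horoSq
  positivity

theorem horoSq_le {b : ℝ × ℝ} {s : ℝ} (h1 : 0 ≤ b.1) (h2 : 0 ≤ b.2) (h3 : b.1 + b.2 ≤ 1)
    (h4 : 0 ≤ s) (h5 : s ≤ 1) : horoSq b s ≤ 2 := by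
  unfold horoSq
  nlinarith [mul_nonneg h1 h2, mul_nonneg h4 (sub_nonneg.2 h5), mul_nonneg h1 (sub_nonneg.2 h3),
    mul_nonneg h2 (sub_nonneg.2 h3)]

/-- The coordinates around a torus: `b` and `s` are coordinates of a horosphere and `t` measures the
distance from the cusp. -/
def torusCoord (b : ℝ × ℝ) (s t : ℝ) : E4 := pack b (polar (t / (2 - t * horoSq b s)) s)

/-- The inverse of the last coordinate. -/
def horoDepth (b : ℝ × ℝ) (s ρ : ℝ) : ℝ := 2 * ρ / (1 + ρ * horoSq b s)

theorem horoDepth_div {b : ℝ × ℝ} {s t : ℝ} (h : 0 < 2 - t * horoSq b s) :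
    horoDepth b s (t / (2 - t * horoSq b s)) = t := by
  rw [horoDepth]
  have : 1 + t / (2 - t * horoSq b s) * horoSq b s = 2 / (2 - t * horoSq b s) := by
    field_simp
    ring
  rw [this]
  field_simp

theorem div_horoDepth {b : ℝ × ℝ} {s ρ : ℝ} (h : 0 ≤ ρ) :
    horoDepth b s ρ / (2 - horoDepth b s ρ * horoSq b s) = ρ := by
  rw [horoDepth]
  have h1 : 0 < 1 + ρ * horoSq b s := by
    have := mul_nonneg h (horoSq_nonneg b s)
    linarith
  have : 2 - 2 * ρ / (1 + ρ * horoSq b s) * horoSq b s = 2 / (1 + ρ * horoSq b s) := by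
    field_simp
    ring
  rw [this]
  field_simp

/-! ### The coordinates around a torus in the Klein model -/

/-- The form that vanishes at the cusp of the facets `2'` and `3'`. -/
def cuspForm (C : Fin 5 → ℝ) : ℝ := ∑ i, C i - C 2 - C 3

/-- The coordinates around a torus in homogeneous coordinates. -/
def torus5 (C : Fin 5 → ℝ) : E4 :=
  pack (C 0 / cuspForm C, C 1 / cuspForm C)
    (polar (cuspForm C ^ 2 / bform C C) (((∑ i, C i) / 2 - C 2) / cuspForm C))

theorem cuspForm_smul (t : ℝ) (C : Fin 5 → ℝ) : cuspForm (t • C) = t * cuspForm C := by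
  simp only [cuspForm, Pi.smul_apply, smul_eq_mul, ← Finset.mul_sum]
  ring

theorem torus5_smul {t : ℝ} (ht : t ≠ 0) (C : Fin 5 → ℝ) : torus5 (t • C) = torus5 C := by
  have h1 : (t * cuspForm C) ^ 2 / (t * t * bform C C) = cuspForm C ^ 2 / bform C C := by
    rw [mul_pow, ← sq, mul_div_mul_left _ _ (pow_ne_zero 2 ht)]
  have h2 : (t * (∑ i, C i) / 2 - t * C 2) / (t * cuspForm C) =
      ((∑ i, C i) / 2 - C 2) / cuspForm C := by
    rw [mul_div_assoc, ← mul_sub, mul_div_mul_left _ _ ht]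
  simp only [torus5, cuspForm_smul, bform_smul_smul, Pi.smul_apply, smul_eq_mul, ← Finset.mul_sum,
    h1, h2, mul_div_mul_left _ _ ht]

theorem cornerFacet_eq_map (π : Equiv.Perm (Fin 5)) (s : Fin 4) :
    cornerFacet π s = Sum.map π π (cornerFacet 1 s) := by
  fin_cases s <;> rfl

/-- The cusp form is the pairing with the null vector e₂ + e₃ representing the ideal vertex, which
all four facets at the cusp contain. -/
theorem cuspForm_refl5 (s : Fin 4) (C : Fin 5 → ℝ) :
    cuspForm (refl5 (cornerFacet 1 s) C) = cuspForm C := by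
  fin_cases s
  · show cuspForm (refl5 (.inl 0) C) = _
    simp [cuspForm, refl5, Fin.sum_univ_five]; ring
  · show cuspForm (refl5 (.inl 1) C) = _
    simp [cuspForm, refl5, Fin.sum_univ_five]; ring
  · show cuspForm (refl5 (.inr 2) C) = _
    simp [cuspForm, refl5, Fin.sum_univ_five]; ring
  · show cuspForm (refl5 (.inr 3) C) = _
    simp [cuspForm, refl5, Fin.sum_univ_five]; ring

/-- The cusp form and the Lorentz form are invariant, so the radius is unchanged. Facets 0 and 1
reflect the barycentric coordinates, while 2' and 3' send the angle s to −s and to 2 − s. -/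
theorem torus5_refl5 (s : Fin 4) {C : Fin 5 → ℝ} (h : cuspForm C ≠ 0) :
    torus5 (refl5 (cornerFacet 1 s) C) = sec4 (cornerNb s (0, 0)) (torus5 C) := by
  have hb := (isLor_refl5 (cornerFacet 1 s)).bform C C
  rw [torus5, cuspForm_refl5, hb]
  fin_cases s
  · have e : (∑ i, refl5 (.inl 0) C i) / 2 - refl5 (.inl 0) C 2 = (∑ i, C i) / 2 - C 2 := by
      rw [sum_refl5_inl]; simp [refl5]; ring
    show pack (refl5 (.inl 0) C 0 / _, refl5 (.inl 0) C 1 / _) (polar _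
      (((∑ i, refl5 (.inl 0) C i) / 2 - refl5 (.inl 0) C 2) / _)) = _
    rw [e]
    simp [sec4, torus5, cornerNb, nbα, nbβ, sec, refl5, neg_div, add_div, add_comm]
  · have e : (∑ i, refl5 (.inl 1) C i) / 2 - refl5 (.inl 1) C 2 = (∑ i, C i) / 2 - C 2 := by
      rw [sum_refl5_inl]; simp [refl5]; ring
    show pack (refl5 (.inl 1) C 0 / _, refl5 (.inl 1) C 1 / _) (polar _
      (((∑ i, refl5 (.inl 1) C i) / 2 - refl5 (.inl 1) C 2) / _)) = _
    rw [e]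
    simp [sec4, torus5, cornerNb, nbα, nbβ, sec, refl5, neg_div, add_div]
  · have e : (∑ i, refl5 (.inr 2) C i) / 2 - refl5 (.inr 2) C 2 = -((∑ i, C i) / 2 - C 2) := by
      rw [sum_refl5_inr]; simp [refl5]; ring
    show pack (refl5 (.inr 2) C 0 / _, refl5 (.inr 2) C 1 / _) (polar _
      (((∑ i, refl5 (.inr 2) C i) / 2 - refl5 (.inr 2) C 2) / _)) = _
    rw [e, neg_div, polar_neg]
    simp [sec4, torus5, cornerNb, nbα, nbβ, sec, refl5]
  · have e : ((∑ i, refl5 (.inr 3) C i) / 2 - refl5 (.inr 3) C 2) / cuspForm C =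
        2 - ((∑ i, C i) / 2 - C 2) / cuspForm C := by
      rw [sum_refl5_inr, eq_sub_iff_add_eq, ← add_div, div_eq_iff h]
      simp [refl5, cuspForm]; ring
    show pack (refl5 (.inr 3) C 0 / _, refl5 (.inr 3) C 1 / _) (polar _
      (((∑ i, refl5 (.inr 3) C i) / 2 - refl5 (.inr 3) C 2) / _)) = _
    rw [e, polar_two_sub]
    simp [sec4, torus5, cornerNb, nbα, nbβ, sec, refl5]

theorem cuspForm_pos {C : Fin 5 → ℝ} (h : C ∈ lorCone) : 0 < cuspForm C := by
  obtain ⟨h1, h2⟩ := h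
  rw [bform] at h1
  rw [cuspForm]
  simp only [Fin.sum_univ_five] at *
  by_contra! hle
  nlinarith [sq_nonneg (C 2 - C 3), sq_nonneg (C 0), sq_nonneg (C 1), sq_nonneg (C 4)]

/-- This expresses the radius cuspForm² / bform in horospherical coordinates as t / (2 − t ·
`horoSq`), the form used in `torusCoord`, with t the cusp form. -/
theorem bform_eq_of_sum {C : Fin 5 → ℝ} (hs : ∑ i, C i = 2) (h : cuspForm C ≠ 0) :
    bform C C = cuspForm C * (2 - cuspForm C *
      horoSq (C 0 / cuspForm C, C 1 / cuspForm C) ((1 - C 2) / cuspForm C)) := by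
  have e4 : 1 - C 0 / cuspForm C - C 1 / cuspForm C = C 4 / cuspForm C := by
    rw [eq_div_iff h]
    have : cuspForm C = C 0 + C 1 + C 4 := by simp [cuspForm, Fin.sum_univ_five]; ring
    field_simp
    linarith
  have e3 : 1 - (1 - C 2) / cuspForm C = (1 - C 3) / cuspForm C := by
    rw [eq_div_iff h]
    field_simp
    rw [cuspForm, hs]
    ring
  rw [horoSq, e4, e3, bform, hs]
  simp only
  field_simp
  have : cuspForm C = 2 - C 2 - C 3 := by rw [cuspForm, hs]
  simp only [this, Fin.sum_univ_five]
  ring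

theorem torus5_of_sum {C : Fin 5 → ℝ} (hs : ∑ i, C i = 2) (h : cuspForm C ≠ 0) :
    torus5 C = torusCoord (C 0 / cuspForm C, C 1 / cuspForm C) ((1 - C 2) / cuspForm C)
      (cuspForm C) := by
  rw [torus5, torusCoord, bform_eq_of_sum hs h, hs, sq, mul_div_mul_left _ _ h, div_self two_ne_zero]

section TorusKlein

variable (v : Fin 5 → E4)

/-- The coordinates around a torus in the Klein model. -/
def torusKlein (π : Equiv.Perm (Fin 5)) (x : E4) : E4 := torus5 (cutCoord v 1 x ∘ π)

variable {v} (hv : IsRegularSimplex v)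
include hv

theorem comp_perm_cutCoord_mem {π : Equiv.Perm (Fin 5)} {x : E4} (hx : x ∈ Metric.ball 0 1) :
    cutCoord v 1 x ∘ π ∈ lorCone :=
  comp_perm_mem_lorCone ((mem_ball_iff_cutCoord hv).1 hx)

theorem sum_comp_perm_cutCoord_one (π : Equiv.Perm (Fin 5)) (x : E4) :
    ∑ i, (cutCoord v 1 x ∘ π) i = 2 :=
  (Equiv.sum_comp π (cutCoord v 1 x)).trans (sum_cutCoord_one hv x)

theorem torusKlein_kleinRefl (π : Equiv.Perm (Fin 5)) (s : Fin 4) {x : E4}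
    (hx : x ∈ Metric.ball 0 1) : torusKlein v π (kleinRefl v (cornerFacet π s) x) =
      sec4 (cornerNb s (0, 0)) (torusKlein v π x) := by
  have h := (isLor_refl5 (cornerFacet π s)).pos _ ((mem_ball_iff_cutCoord hv).1 hx)
  rw [torusKlein, kleinRefl, cutCoord_kl hv (isLor_refl5 _) hx, norm5,
    show ∀ (t : ℝ) (C : Fin 5 → ℝ), (t • C) ∘ π = t • (C ∘ π) from fun _ _ => rfl,
    torus5_smul (div_pos two_pos h).ne', cornerFacet_eq_map, refl5_comp_perm,
    torus5_refl5 s (cuspForm_pos (comp_perm_cutCoord_mem hv hx)).ne', torusKlein]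

theorem contDiffAt_torusKlein (π : Equiv.Perm (Fin 5)) {x : E4} (hx : x ∈ Metric.ball 0 1) :
    ContDiffAt ℝ ∞ (torusKlein v π) x := by
  have hC := comp_perm_cutCoord_mem hv (π := π) hx
  have hc : ∀ i, ContDiffAt ℝ ∞ (fun x => (cutCoord v 1 x ∘ π) i) x := fun i =>
    (contDiff_pi.1 contDiff_cutCoord (π i)).contDiffAt
  have hs : ContDiffAt ℝ ∞ (fun x => ∑ i, (cutCoord v 1 x ∘ π) i) x := ContDiffAt.sum fun i _ => hc i
  have hl : ContDiffAt ℝ ∞ (fun x => cuspForm (cutCoord v 1 x ∘ π)) x := (hs.sub (hc 2)).sub (hc 3)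
  have hb : ContDiffAt ℝ ∞ (fun x => bform (cutCoord v 1 x ∘ π) (cutCoord v 1 x ∘ π)) x :=
    ((hs.mul hs).div_const 2).sub (ContDiffAt.sum fun i _ => (hc i).mul (hc i))
  have hl0 := (cuspForm_pos hC).ne'
  have hρ := (hl.pow 2).div hb hC.1.ne'
  have hS := ((hs.div_const 2).sub (hc 2)).div hl hl0
  exact contDiff_pack (((hc 0).div hl hl0).prodMk ((hc 1).div hl hl0))
    ((hρ.mul (Real.contDiff_sin.contDiffAt.comp x (contDiffAt_const.mul hS))).prodMk
      (hρ.mul (Real.contDiff_sin.contDiffAt.comp x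
        (contDiffAt_const.mul (contDiffAt_const.sub hS)))))

omit hv in
theorem det_ne_zero_of_leftInverse {f g : E4 → E4} {x : E4} (hf : DifferentiableAt ℝ f x)
    (hg : DifferentiableAt ℝ g (f x)) (h : ∀ᶠ y in 𝓝 x, g (f y) = y) : (fderiv ℝ f x).det ≠ 0 := by
  intro h0
  have h1 : fderiv ℝ (g ∘ f) x = ContinuousLinearMap.id ℝ E4 := by
    rw [Filter.EventuallyEq.fderiv_eq (show g ∘ f =ᶠ[𝓝 x] id from h), fderiv_id]
  rw [fderiv_comp _ hg hf] at h1
  have h2 := congrArg ContinuousLinearMap.det h1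
  change LinearMap.det (((fderiv ℝ g (f x) : E4 →L[ℝ] E4) : E4 →ₗ[ℝ] E4) ∘ₗ
      ((fderiv ℝ f x : E4 →L[ℝ] E4) : E4 →ₗ[ℝ] E4)) = LinearMap.det LinearMap.id at h2
  rw [LinearMap.det_comp, LinearMap.det_id] at h2
  rw [ContinuousLinearMap.det] at h0
  rw [h0, mul_zero] at h2
  exact zero_ne_one h2

/-- The homogeneous coordinates of a point with given coordinates around a torus. -/
def horoVec (b : ℝ × ℝ) (s t : ℝ) : Fin 5 → ℝ :=
  ![t * b.1, t * b.2, 1 - t * s, 1 - t * (1 - s), t * (1 - b.1 - b.2)]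

omit hv in
theorem horoVec_eq {C : Fin 5 → ℝ} (hs : ∑ i, C i = 2) (h : cuspForm C ≠ 0) :
    horoVec (C 0 / cuspForm C, C 1 / cuspForm C) ((1 - C 2) / cuspForm C) (cuspForm C) = C := by
  have h2 : cuspForm C = 2 - C 2 - C 3 := by rw [cuspForm, hs]
  have h3 : cuspForm C = C 0 + C 1 + C 4 := by simp [cuspForm, Fin.sum_univ_five]; ring
  ext i
  fin_cases i <;> simp [horoVec, mul_sub, mul_div_cancel₀ _ h] <;> linarith

omit hv in
theorem differentiableAt_polarAngle {ρ s : ℝ} (hρ : 0 < ρ) {d : E4}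
    (hd : (d 2, d 3) = polar ρ s) :
    DifferentiableAt ℝ (fun d : E4 => polarRadius (d 2, d 3)) d ∧
    DifferentiableAt ℝ (fun d : E4 => polarAngle s (d 2, d 3)) d := by
  have h1 : polarRadius (d 2, d 3) = ρ := by rw [hd, polarRadius_polar hρ.le]
  have hr : DifferentiableAt ℝ (fun d : E4 => polarRadius (d 2, d 3)) d := by
    unfold polarRadius
    refine DifferentiableAt.sqrt (by fun_prop) fun h => ?_
    rw [polarRadius] at h1
    rw [show (4 / 3 * ((d 2) ^ 2 + (d 3) ^ 2 + d 2 * d 3) : ℝ) = 0 from h, Real.sqrt_zero] at h1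
    exact hρ.ne h1
  refine ⟨hr, ?_⟩
  have harg : DifferentiableAt ℝ (fun d : E4 => (d 2 * Real.cos (Real.pi / 3 * s) -
      (2 * d 3 + d 2) / √3 * Real.sin (Real.pi / 3 * s)) / polarRadius (d 2, d 3)) d := by
    have hn : DifferentiableAt ℝ (fun d : E4 => d 2 * Real.cos (Real.pi / 3 * s) -
      (2 * d 3 + d 2) / √3 * Real.sin (Real.pi / 3 * s)) d := by fun_prop
    simp only [div_eq_mul_inv _ (polarRadius _)]
    exact hn.mul (hr.fun_inv (by rw [h1]; exact hρ.ne'))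
  have hval : (d 2 * Real.cos (Real.pi / 3 * s) -
      (2 * d 3 + d 2) / √3 * Real.sin (Real.pi / 3 * s)) / polarRadius (d 2, d 3) = 0 := by
    have h3 : √3 ≠ (0 : ℝ) := by positivity
    have e2 : d 2 = (polar ρ s).1 := congrArg Prod.fst hd
    have e3 : d 3 = (polar ρ s).2 := congrArg Prod.snd hd
    rw [div_eq_zero_iff]
    left
    rw [e2, e3, polar, sin_pi_div_three_mul_one_sub]
    field_simp
    ring
  have has : DifferentiableAt ℝ Real.arcsin ((d 2 * Real.cos (Real.pi / 3 * s) -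
      (2 * d 3 + d 2) / √3 * Real.sin (Real.pi / 3 * s)) / polarRadius (d 2, d 3)) := by
    rw [hval]
    exact Real.differentiableAt_arcsin.2 ⟨by norm_num, by norm_num⟩
  exact ((has.comp d harg).const_mul (3 / Real.pi)).const_add s

/-- There is an explicit local left inverse: radius and angle are recovered from the plane
coordinates, then the depth, then the homogeneous coordinates. The branch of the angle is centred at
the value at `x`, because the angle is unbounded over the ball. -/
theorem det_fderiv_torusKlein_ne_zero (π : Equiv.Perm (Fin 5)) {x : E4} (hx : x ∈ Metric.ball 0 1) :
    (fderiv ℝ (torusKlein v π) x).det ≠ 0 := by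
  let S : E4 → ℝ := fun y => (1 - cutCoord v 1 y (π 2)) / cuspForm (cutCoord v 1 y ∘ π)
  let g : E4 → E4 := fun d => cutPoint v 1 (horoVec (d 0, d 1) (polarAngle (S x) (d 2, d 3))
    (horoDepth (d 0, d 1) (polarAngle (S x) (d 2, d 3)) (polarRadius (d 2, d 3))) ∘ π.symm)
  have hform : ∀ y ∈ Metric.ball (0 : E4) 1, ∃ b ρ, 0 < ρ ∧
      torusKlein v π y = pack b (polar ρ (S y)) ∧
      horoVec b (S y) (horoDepth b (S y) ρ) = cutCoord v 1 y ∘ π := by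
    intro y hy
    have hC := comp_perm_cutCoord_mem hv (π := π) hy
    have hs := sum_comp_perm_cutCoord_one hv π y
    have hl := cuspForm_pos hC
    have hb := hC.1
    rw [bform_eq_of_sum hs hl.ne'] at hb
    have hb' := pos_of_mul_pos_right hb hl.le
    refine ⟨_, _, div_pos hl hb', torus5_of_sum hs hl.ne', ?_⟩
    have e := horoDepth_div hb'
    refine Eq.trans ?_ (horoVec_eq hs hl.ne')
    exact congrArg _ e
  refine det_ne_zero_of_leftInverse (g := g)
    ((contDiffAt_torusKlein hv π hx).differentiableAt (by simp)) ?_ ?_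
  · obtain ⟨b, ρ, hρ, e, -⟩ := hform x hx
    rw [e]
    obtain ⟨h1, h2⟩ := differentiableAt_polarAngle (d := pack b (polar ρ (S x))) hρ rfl
    have hb0 : DifferentiableAt ℝ (fun d : E4 => d 0) (pack b (polar ρ (S x))) := by fun_prop
    have hb1 : DifferentiableAt ℝ (fun d : E4 => d 1) (pack b (polar ρ (S x))) := by fun_prop
    have h3 : DifferentiableAt ℝ (fun d : E4 => horoSq (d 0, d 1) (polarAngle (S x) (d 2, d 3)))
        (pack b (polar ρ (S x))) := by
      unfold horoSq
      fun_prop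
    have h4 : DifferentiableAt ℝ (fun d : E4 => horoDepth (d 0, d 1)
        (polarAngle (S x) (d 2, d 3)) (polarRadius (d 2, d 3))) (pack b (polar ρ (S x))) := by
      have h5 : DifferentiableAt ℝ (fun d : E4 => 1 + polarRadius (d 2, d 3) *
          horoSq (d 0, d 1) (polarAngle (S x) (d 2, d 3))) (pack b (polar ρ (S x))) :=
        (h1.mul h3).const_add 1
      simp only [horoDepth, div_eq_mul_inv]
      refine (h1.const_mul 2).mul (h5.fun_inv ?_)
      have := mul_nonneg (polarRadius_nonneg
        ((pack b (polar ρ (S x))) 2, (pack b (polar ρ (S x))) 3))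
        (horoSq_nonneg ((pack b (polar ρ (S x))) 0, (pack b (polar ρ (S x))) 1)
          (polarAngle (S x) ((pack b (polar ρ (S x))) 2, (pack b (polar ρ (S x))) 3)))
      linarith
    refine (contDiff_cutPoint.differentiable (by simp)).differentiableAt.comp _ ?_
    refine differentiableAt_pi.2 fun i => ?_
    obtain ⟨k, rfl⟩ := π.surjective i
    simp only [Function.comp_apply, Equiv.symm_apply_apply]
    fin_cases k
    · exact h4.mul hb0
    · exact h4.mul hb1
    · exact (h4.mul h2).const_sub 1
    · exact (h4.mul (h2.const_sub 1)).const_sub 1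
    · exact h4.mul ((hb0.const_sub 1).sub hb1)
  · have hcS : ContinuousAt S x := by
      have hc : ∀ i, ContinuousAt (fun x => cutCoord v 1 x i) x := fun i =>
        ((continuous_apply i).comp continuous_cutCoord).continuousAt
      have hl : ContinuousAt (fun x => cuspForm (cutCoord v 1 x ∘ π)) x := by
        unfold cuspForm
        simp only [Function.comp_apply]
        fun_prop
      exact (continuousAt_const.sub (hc _)).div hl
        (cuspForm_pos (comp_perm_cutCoord_mem hv hx)).ne'
    filter_upwards [Metric.isOpen_ball.mem_nhds hx,
      hcS.eventually (Metric.closedBall_mem_nhds (S x) (show (0 : ℝ) < 3 / 2 by norm_num))]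
      with y hy hys
    obtain ⟨b, ρ, hρ, e, e2⟩ := hform y hy
    have hys' : |S y - S x| ≤ 3 / 2 := hys
    rw [e]
    show cutPoint v 1 (horoVec b (polarAngle (S x) (polar ρ (S y))) (horoDepth b
      (polarAngle (S x) (polar ρ (S y))) (polarRadius (polar ρ (S y)))) ∘ π.symm) = y
    rw [polarAngle_polar hρ hys', polarRadius_polar hρ.le, e2]
    rw [show (cutCoord v 1 y ∘ π) ∘ π.symm = cutCoord v 1 y by ext i; simp]
    exact cutPoint_cutCoord hv (by norm_num) y

/-- A continuous nonvanishing determinant on the connected ball has constant sign. Which sign it is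
depends on `π` and need not be known. -/
theorem exists_sign_torusKlein (π : Equiv.Perm (Fin 5)) : ∃ b : Bool,
    ∀ x ∈ Metric.ball (0 : E4) 1, 0 < boolSign b * (fderiv ℝ (torusKlein v π) x).det := by
  have hc : ContinuousOn (fun x => (fderiv ℝ (torusKlein v π) x).det) (Metric.ball 0 1) := by
    have h1 : ContDiffOn ℝ ∞ (torusKlein v π) (Metric.ball 0 1) := fun x hx =>
      (contDiffAt_torusKlein hv π hx).contDiffWithinAt
    exact ContinuousLinearMap.continuous_det.comp_continuousOn
      (h1.continuousOn_fderiv_of_isOpen Metric.isOpen_ball (by simp))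
  have hconn : IsPreconnected (Metric.ball (0 : E4) 1) := (convex_ball 0 1).isPreconnected
  have h0 : (0 : E4) ∈ Metric.ball (0 : E4) 1 := by simp
  have hne : ∀ x ∈ Metric.ball (0 : E4) 1, (fderiv ℝ (torusKlein v π) x).det ≠ 0 := fun x hx =>
    det_fderiv_torusKlein_ne_zero hv π hx
  rcases (hne 0 h0).lt_or_gt with h | h
  · refine ⟨false, fun x hx => ?_⟩
    by_contra! hle
    simp only [boolSign, Bool.false_eq_true, if_false] at hle
    obtain ⟨y, hy, e⟩ := hconn.intermediate_value h0 hx hc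
      (show (0 : ℝ) ∈ Set.Icc _ _ from ⟨h.le, by linarith⟩)
    exact hne y hy e
  · refine ⟨true, fun x hx => ?_⟩
    by_contra! hle
    simp only [boolSign, if_true] at hle
    obtain ⟨y, hy, e⟩ := hconn.intermediate_value hx h0 hc
      (show (0 : ℝ) ∈ Set.Icc _ _ from ⟨by linarith, h.le⟩)
    exact hne y hy e

end TorusKlein

/-! ### The coordinates around a torus in the bitruncated simplex -/

/-- The sum of the coordinates `0`, `1` and `4`. -/
def legSum (c : Fin 5 → ℝ) : ℝ := c 0 + c 1 + c 4

/-- The distance to the face of the facets `2'` and `3'`. -/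
def faceGap (c : Fin 5 → ℝ) : ℝ := 2 - c 2 - c 3

/-- The coordinates around a torus in terms of the affine coordinates. -/
def torusX (c : Fin 5 → ℝ) : E4 :=
  torusCoord (c 0 / legSum c, c 1 / legSum c) ((1 - c 2) / faceGap c) √(faceGap c * legSum c)

/-- The positive solution `x` of `x * (x - k) = t ^ 2`. -/
def legLevel (k t : ℝ) : ℝ := (k + √(k ^ 2 + 4 * t ^ 2)) / 2

/-- The coordinate `t` in terms of the coordinates around a torus. -/
def torusDepth (e : E4) : ℝ :=
  horoDepth (e 0, e 1) (polarAngle 0 (e 2, e 3)) (polarRadius (e 2, e 3))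

/-- The affine coordinates in terms of the coordinates around a torus. -/
def unTorusX (k : ℝ) (e : E4) : Fin 5 → ℝ :=
  ![legLevel k (torusDepth e) * e 0, legLevel k (torusDepth e) * e 1,
    1 - (legLevel k (torusDepth e) - k) * polarAngle 0 (e 2, e 3),
    1 - (legLevel k (torusDepth e) - k) * (1 - polarAngle 0 (e 2, e 3)),
    legLevel k (torusDepth e) * (1 - e 0 - e 1)]

/-- The part of the polytope around a face of the facets `2'` and `3'`. -/
structure InTorusCell (k : ℝ) (c : Fin 5 → ℝ) : Prop where
  mem : ∀ i, 0 ≤ c i ∧ c i ≤ 1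
  sum : ∑ i, c i = k + 2
  pos : 0 < c 4
  lt : legSum c + √(faceGap c * legSum c) < 1

theorem legLevel_mul_sub (k t : ℝ) : legLevel k t * (legLevel k t - k) = t ^ 2 := by
  have h : √(k ^ 2 + 4 * t ^ 2) ^ 2 = k ^ 2 + 4 * t ^ 2 := Real.sq_sqrt (by positivity)
  rw [legLevel]
  linear_combination h / 4

theorem le_legLevel (k t : ℝ) : k ≤ legLevel k t := by
  have : k ≤ √(k ^ 2 + 4 * t ^ 2) := Real.le_sqrt_of_sq_le (by nlinarith [sq_nonneg t])
  rw [legLevel]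
  linarith

theorem legLevel_le {k t : ℝ} (hk : 0 ≤ k) (ht : 0 ≤ t) : legLevel k t ≤ k + t := by
  have : √(k ^ 2 + 4 * t ^ 2) ≤ k + 2 * t := Real.sqrt_le_iff.2 ⟨by linarith, by nlinarith⟩
  rw [legLevel]
  linarith

theorem legLevel_eq {k t L : ℝ} (hk : 0 ≤ k) (hL : k ≤ L) (h : L * (L - k) = t ^ 2) :
    legLevel k t = L := by
  have : √(k ^ 2 + 4 * t ^ 2) = 2 * L - k := by
    rw [← h, show k ^ 2 + 4 * (L * (L - k)) = (2 * L - k) ^ 2 by ring, Real.sqrt_sq (by linarith)]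
  rw [legLevel, this]
  ring

theorem horoDepth_zero (b : ℝ × ℝ) (s : ℝ) : horoDepth b s 0 = 0 := by simp [horoDepth]

theorem horoDepth_nonneg {ρ : ℝ} (h : 0 ≤ ρ) (b : ℝ × ℝ) (s : ℝ) : 0 ≤ horoDepth b s ρ := by
  have := horoSq_nonneg b s
  unfold horoDepth
  positivity

theorem horoDepth_le {ρ : ℝ} (h : 0 ≤ ρ) (b : ℝ × ℝ) (s : ℝ) : horoDepth b s ρ ≤ 2 * ρ := by
  have := mul_nonneg h (horoSq_nonneg b s)
  exact div_le_self (by positivity) (by linarith)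

theorem polarAngle_mem {z : ℝ × ℝ} (h1 : 0 ≤ z.1) (h2 : 0 ≤ z.2) :
    0 ≤ polarAngle 0 z ∧ polarAngle 0 z ≤ 1 ∧ polar (polarRadius z) (polarAngle 0 z) = z := by
  obtain ⟨s, hs0, hs1, e⟩ := exists_polar_eq h1 h2
  rcases (polarRadius_nonneg z).eq_or_lt with h | h
  · rw [← h, polar_zero] at e
    have h0 : polarAngle 0 z = 0 := by simp [polarAngle, ← h]
    rw [h0, ← h, polar_zero]
    exact ⟨le_rfl, zero_le_one, e⟩
  · have h3 : polarAngle 0 z = s := by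
      conv_lhs => rw [← e]
      exact polarAngle_polar h (by rw [abs_le]; constructor <;> linarith)
    rw [h3]
    exact ⟨hs0, hs1, e⟩

namespace InTorusCell

variable {k : ℝ} {c : Fin 5 → ℝ} (hc : InTorusCell k c) (hk : 0 < k)
include hc

theorem faceGap_nonneg : 0 ≤ faceGap c := by
  have h2 := (hc.mem 2).2
  have h3 := (hc.mem 3).2
  unfold faceGap
  linarith

theorem legSum_eq : legSum c = k + faceGap c := by
  have := hc.sum
  simp only [Fin.sum_univ_five] at this
  unfold legSum faceGap
  linarith

theorem angle_mem : 0 ≤ (1 - c 2) / faceGap c ∧ (1 - c 2) / faceGap c ≤ 1 := by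
  have h2 := (hc.mem 2).2
  have h3 := (hc.mem 3).2
  refine ⟨div_nonneg (by linarith) hc.faceGap_nonneg, div_le_one_of_le₀ ?_ hc.faceGap_nonneg⟩
  unfold faceGap
  linarith

include hk

theorem legSum_pos : 0 < legSum c := by
  rw [hc.legSum_eq]
  linarith [hc.faceGap_nonneg]

theorem sq_sqrt : √(faceGap c * legSum c) ^ 2 = faceGap c * legSum c :=
  Real.sq_sqrt (mul_nonneg hc.faceGap_nonneg (hc.legSum_pos hk).le)

theorem horoSq_le_two :
    horoSq (c 0 / legSum c, c 1 / legSum c) ((1 - c 2) / faceGap c) ≤ 2 := by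
  have hL := hc.legSum_pos hk
  refine horoSq_le (div_nonneg (hc.mem 0).1 hL.le) (div_nonneg (hc.mem 1).1 hL.le) ?_
    hc.angle_mem.1 hc.angle_mem.2
  rw [← add_div, div_le_one hL]
  have := (hc.mem 4).1
  unfold legSum
  linarith

/-- Here `legSum` = k + `faceGap` is at least k, so the square root is below 1 − k, and `horoSq` is
at most 2. The bound is uniform up to the torus, which gives continuity there. -/
theorem denom_ge : 2 * k ≤ 2 - √(faceGap c * legSum c) *
    horoSq (c 0 / legSum c, c 1 / legSum c) ((1 - c 2) / faceGap c) := by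
  have h1 := hc.horoSq_le_two hk
  have h2 := Real.sqrt_nonneg (faceGap c * legSum c)
  have h3 := hc.lt
  have h4 := hc.legSum_eq
  have h5 := hc.faceGap_nonneg
  nlinarith [mul_le_mul_of_nonneg_left h1 h2]

theorem denom_pos : 0 < 2 - √(faceGap c * legSum c) *
    horoSq (c 0 / legSum c, c 1 / legSum c) ((1 - c 2) / faceGap c) := by
  linarith [hc.denom_ge hk]

omit hk in
theorem coord_lt_one : ∀ i, i ≠ 2 → i ≠ 3 → c i < 1 := by
  have h1 := hc.lt
  have h2 := Real.sqrt_nonneg (faceGap c * legSum c)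
  have h0 := (hc.mem 0).1
  have h4 := (hc.mem 1).1
  have h5 := hc.pos
  unfold legSum at *
  intro i hi2 hi3
  fin_cases i
  · show c 0 < 1; linarith
  · show c 1 < 1; linarith
  · exact absurd rfl hi2
  · exact absurd rfl hi3
  · show c 4 < 1; linarith

theorem coord_pos : ∀ i, i ≠ 0 → i ≠ 1 → 0 < c i := by
  have h1 := hc.lt
  have h2 := Real.sqrt_nonneg (faceGap c * legSum c)
  have h3 := hc.legSum_eq
  have h4 := (hc.mem 2).2
  have h5 := (hc.mem 3).2
  have h6 : faceGap c = 2 - c 2 - c 3 := rfl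
  intro i hi0 hi1
  fin_cases i
  · exact absurd rfl hi0
  · exact absurd rfl hi1
  · show 0 < c 2; linarith
  · show 0 < c 3; linarith
  · exact hc.pos

theorem torusX_nonneg : ∀ i, 0 ≤ torusX c i := by
  have hL := hc.legSum_pos hk
  have hρ : 0 ≤ √(faceGap c * legSum c) / (2 - √(faceGap c * legSum c) *
      horoSq (c 0 / legSum c, c 1 / legSum c) ((1 - c 2) / faceGap c)) :=
    div_nonneg (Real.sqrt_nonneg _) (hc.denom_pos hk).le
  obtain ⟨h1, h2⟩ := hc.angle_mem
  have hpi := Real.pi_pos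
  intro i
  fin_cases i
  · exact div_nonneg (hc.mem 0).1 hL.le
  · exact div_nonneg (hc.mem 1).1 hL.le
  · exact mul_nonneg hρ (Real.sin_nonneg_of_nonneg_of_le_pi (by positivity) (by nlinarith))
  · exact mul_nonneg hρ (Real.sin_nonneg_of_nonneg_of_le_pi
      (mul_nonneg (by positivity) (by linarith)) (by nlinarith))

theorem unTorusX_torusX : unTorusX k (torusX c) = c := by
  have hL := hc.legSum_pos hk
  have hLe := hc.legSum_eq
  have hg : faceGap c = 2 - c 2 - c 3 := rfl
  have hl : legSum c = c 0 + c 1 + c 4 := rfl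
  set b : ℝ × ℝ := (c 0 / legSum c, c 1 / legSum c) with hb
  set s := (1 - c 2) / faceGap c with hs
  set t := √(faceGap c * legSum c) with ht
  have ht2 : t ^ 2 = faceGap c * legSum c := hc.sq_sqrt hk
  have hd : 0 < 2 - t * horoSq b s := hc.denom_pos hk
  have hE : torusX c = pack b (polar (t / (2 - t * horoSq b s)) s) := rfl
  have hρ : 0 ≤ t / (2 - t * horoSq b s) := div_nonneg (Real.sqrt_nonneg _) hd.le
  -- On the torus itself `faceGap` is zero and the angle is meaningless, so only its product with
  -- `faceGap` is compared.
  have key : torusDepth (torusX c) = t ∧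
      faceGap c * polarAngle 0 (polar (t / (2 - t * horoSq b s)) s) = faceGap c * s := by
    rw [torusDepth, hE]
    show horoDepth b (polarAngle 0 (polar _ s)) (polarRadius (polar _ s)) = t ∧ _
    rw [polarRadius_polar hρ]
    rcases hc.faceGap_nonneg.eq_or_lt with h0 | h0
    · have : t = 0 := by rw [ht, ← h0]; simp
      rw [this, zero_div, horoDepth_zero, ← h0]
      simp
    · have htp : 0 < t := Real.sqrt_pos.2 (mul_pos h0 hL)
      have := polarAngle_polar (ρ := t / (2 - t * horoSq b s)) (s := s) (s₀ := 0)
        (div_pos htp hd) (by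
          rw [abs_le]
          constructor <;> linarith [hc.angle_mem.1, hc.angle_mem.2])
      rw [this, horoDepth_div hd]
      exact ⟨rfl, rfl⟩
  have hlev : legLevel k t = legSum c := by
    refine legLevel_eq hk.le (by linarith [hc.faceGap_nonneg]) ?_
    rw [ht2, hLe]
    ring
  have hgs : faceGap c * s = 1 - c 2 := by
    rcases hc.faceGap_nonneg.eq_or_lt with h0 | h0
    · have h2 := (hc.mem 2).2
      have h3 := (hc.mem 3).2
      rw [← h0]
      linarith
    · rw [hs]
      field_simp
  have hk' : legSum c - k = faceGap c := by linarith
  ext i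
  simp only [unTorusX, key.1, hlev, hk']
  rw [hE]
  fin_cases i
  · show legSum c * (c 0 / legSum c) = c 0
    field_simp
  · show legSum c * (c 1 / legSum c) = c 1
    field_simp
  · show 1 - faceGap c * polarAngle 0 (polar _ s) = c 2
    rw [key.2, hgs]
    ring
  · show 1 - faceGap c * (1 - polarAngle 0 (polar _ s)) = c 3
    rw [mul_sub, key.2, hgs]
    linarith
  · show legSum c * (1 - c 0 / legSum c - c 1 / legSum c) = c 4
    field_simp
    linarith

theorem torusX_eq_zero_iff : (torusX c 0 = 0 ↔ c 0 = 0) ∧ (torusX c 1 = 0 ↔ c 1 = 0) ∧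
    (torusX c 2 = 0 ↔ c 2 = 1) ∧ (torusX c 3 = 0 ↔ c 3 = 1) := by
  have hL := hc.legSum_pos hk
  have hpi := Real.pi_pos
  obtain ⟨hs0, hs1⟩ := hc.angle_mem
  have hg : faceGap c = 2 - c 2 - c 3 := rfl
  have hsin : ∀ s : ℝ, 0 ≤ s → s ≤ 1 → (Real.sin (Real.pi / 3 * s) = 0 ↔ s = 0) := by
    intro s h0 h1
    refine ⟨fun h => ?_, fun h => by rw [h]; simp⟩
    rcases h0.eq_or_lt with h2 | h2
    · exact h2.symm
    · exact absurd h (Real.sin_pos_of_pos_of_lt_pi (by positivity) (by nlinarith)).ne'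
  have h2 := (hc.mem 2).2
  have h3 := (hc.mem 3).2
  refine ⟨?_, ?_, ?_, ?_⟩
  · show c 0 / legSum c = 0 ↔ _
    rw [div_eq_zero_iff, or_iff_left hL.ne']
  · show c 1 / legSum c = 0 ↔ _
    rw [div_eq_zero_iff, or_iff_left hL.ne']
  · show _ * Real.sin _ = 0 ↔ _
    rw [mul_eq_zero, hsin _ hs0 hs1, div_eq_zero_iff, div_eq_zero_iff,
      or_iff_left (hc.denom_pos hk).ne', Real.sqrt_eq_zero (mul_nonneg hc.faceGap_nonneg hL.le),
      mul_eq_zero, or_iff_left hL.ne']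
    constructor
    · rintro (h | h | h) <;> linarith
    · exact fun h => .inr (.inl (by linarith))
  · show _ * Real.sin _ = 0 ↔ _
    have e : 1 - (1 - c 2) / faceGap c = 0 ↔ 1 - c 2 = faceGap c ∧ faceGap c ≠ 0 := by
      by_cases h0 : faceGap c = 0
      · simp [h0]
      · rw [sub_eq_zero, eq_comm, div_eq_one_iff_eq h0, and_iff_left h0]
    rw [mul_eq_zero, hsin _ (by linarith) (by linarith), e, div_eq_zero_iff,
      or_iff_left (hc.denom_pos hk).ne', Real.sqrt_eq_zero (mul_nonneg hc.faceGap_nonneg hL.le),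
      mul_eq_zero, or_iff_left hL.ne']
    constructor
    · rintro (h | h)
      · linarith
      · linarith [h.1]
    · intro h
      by_cases h0 : faceGap c = 0
      · exact .inl h0
      · exact .inr ⟨by linarith, h0⟩

/-- The link between the two polytopes. With t² = faceGap · legSum and n = t / legSum = faceGap / t,
stretching by `n` multiplies the coordinates 0, 1, 4 by n and divides the gaps 1 − c₂, 1 − c₃ by n.
Their totals both become t, so the sum is 2 and n is the straightening parameter. All ratios
entering the torus coordinates are unchanged. -/
theorem torus5_stretch (h0 : 0 < faceGap c) {m : ℝ} (hm : 0 < m) {r : Fin 5 → ℝ}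
    (hr : ∀ i, r i = stretch m (c i)) (hs : ∑ i, r i = 2) : torus5 r = torusX c := by
  have hL := hc.legSum_pos hk
  have hLe := hc.legSum_eq
  have hg : faceGap c = 2 - c 2 - c 3 := rfl
  have hl : legSum c = c 0 + c 1 + c 4 := rfl
  have hlt := hc.lt
  set t := √(faceGap c * legSum c) with ht
  have ht2 : t ^ 2 = faceGap c * legSum c := hc.sq_sqrt hk
  have htp : 0 < t := Real.sqrt_pos.2 (mul_pos h0 hL)
  have htL : t < legSum c := by nlinarith
  set n := t / legSum c with hn
  have hn0 : 0 < n := div_pos htp hL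
  have hn1 : n < 1 := (div_lt_one hL).2 htL
  have hnL : n * legSum c = t := by rw [hn]; field_simp
  have hnt : n * t = faceGap c := by
    rw [hn]
    field_simp
    linarith
  have hleg : ∀ i, i ≠ 2 → i ≠ 3 → c i ≤ legSum c := by
    have h0 := (hc.mem 0).1
    have h1 := (hc.mem 1).1
    have h4 := (hc.mem 4).1
    intro i hi2 hi3
    fin_cases i
    · show c 0 ≤ _; linarith
    · show c 1 ≤ _; linarith
    · exact absurd rfl hi2
    · exact absurd rfl hi3
    · show c 4 ≤ _; linarith
  -- The linear branch of the maximum applies because c_i (1 + n) ≤ legSum + t < 1.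
  have hst1 : ∀ i, i ≠ 2 → i ≠ 3 → stretch n (c i) = n * c i := by
    intro i hi2 hi3
    refine max_eq_left ?_
    rw [sub_le_comm, le_div_iff₀ hn0]
    have h1 := hleg i hi2 hi3
    have h2 : c i * (1 + n) ≤ 1 := by nlinarith
    nlinarith
  have hgap : ∀ i, i = 2 ∨ i = 3 → 1 - c i ≤ faceGap c := by
    have h2 := (hc.mem 2).2
    have h3 := (hc.mem 3).2
    rintro i (rfl | rfl) <;> linarith
  -- The other branch applies because faceGap (1 + n) = n (t + faceGap) ≤ n, as faceGap ≤ legSum.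
  have hst2 : ∀ i, i = 2 ∨ i = 3 → stretch n (c i) = 1 - (1 - c i) / n := by
    intro i hi
    refine max_eq_right ?_
    rw [le_sub_comm, div_le_iff₀ hn0]
    have h1 := hgap i hi
    have h2 : faceGap c * (1 + n) ≤ n := by
      rw [← hnt]
      nlinarith
    have h3 : (1 - c i) * (1 + n) ≤ n :=
      (mul_le_mul_of_nonneg_right h1 (by linarith)).trans h2
    have h4 := mul_le_mul_of_nonneg_right h3 (sub_nonneg.2 hn1.le)
    linarith
  have hsn : ∑ i, stretch n (c i) = 2 := by
    rw [Fin.sum_univ_five, hst1 0 (by decide) (by decide), hst1 1 (by decide) (by decide),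
      hst2 2 (.inl rfl), hst2 3 (.inr rfl), hst1 4 (by decide) (by decide)]
    have e : (1 - c 2) / n + (1 - c 3) / n = t := by
      rw [← add_div, div_eq_iff hn0.ne', mul_comm t, hnt, hg]
      ring
    nlinarith
  have hmn : m = n := eq_of_sum_stretch_eq hc.mem
    ⟨4, hc.pos, hc.coord_lt_one 4 (by decide) (by decide)⟩ hm hn0 (by
      rw [hsn, ← hs]
      exact Finset.sum_congr rfl fun i _ => (hr i).symm)
  subst hmn
  have hr0 : r 0 = n * c 0 := (hr 0).trans (hst1 0 (by decide) (by decide))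
  have hr1 : r 1 = n * c 1 := (hr 1).trans (hst1 1 (by decide) (by decide))
  have hr2 : r 2 = 1 - (1 - c 2) / n := (hr 2).trans (hst2 2 (.inl rfl))
  have hr3 : r 3 = 1 - (1 - c 3) / n := (hr 3).trans (hst2 3 (.inr rfl))
  have hcusp : cuspForm r = t := by
    rw [cuspForm, hs, hr2, hr3]
    have e : (1 - c 2) / n + (1 - c 3) / n = t := by
      rw [← add_div, div_eq_iff hn0.ne', mul_comm t, hnt, hg]
      ring
    linarith
  have e1 : (1 - r 2) / t = (1 - c 2) / faceGap c := by
    rw [hr2, sub_sub_cancel, div_div, hnt]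
  have e2 : ∀ x, n * x / t = x / legSum c := fun x => by
    rw [← hnL]
    field_simp
  rw [torus5_of_sum hs (by rw [hcusp]; exact htp.ne'), hcusp, torusX, hr0, hr1, e1, e2, e2]

end InTorusCell

/-- The depth and the angle are read off by inverting the polar coordinates; the leg sum L is then
the root of L (L − k) = t² with L ≥ k. At t = 0 both sides have radius zero, so the arbitrary angle
does no harm. -/
theorem inTorusCell_unTorusX {k : ℝ} (hk : 0 < k) {e : E4} (he : ∀ i, 0 ≤ e i)
    (h1 : 0 < 1 - e 0 - e 1) (h2 : legLevel k (torusDepth e) + torusDepth e < 1) :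
    InTorusCell k (unTorusX k e) ∧ torusX (unTorusX k e) = e := by
  obtain ⟨hs0, hs1, hpol⟩ := polarAngle_mem (z := (e 2, e 3)) (he 2) (he 3)
  set s := polarAngle 0 (e 2, e 3) with hs
  set t := torusDepth e with ht
  have hρ := polarRadius_nonneg (e 2, e 3)
  have hte : t = horoDepth (e 0, e 1) s (polarRadius (e 2, e 3)) := rfl
  have ht0 : 0 ≤ t := horoDepth_nonneg hρ _ _
  set L := legLevel k t with hL
  have hkL : k ≤ L := le_legLevel k t
  have hLt : L ≤ k + t := legLevel_le hk.le ht0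
  have hLk : L * (L - k) = t ^ 2 := legLevel_mul_sub k t
  have hc0 : unTorusX k e 0 = L * e 0 := rfl
  have hc1 : unTorusX k e 1 = L * e 1 := rfl
  have hc2 : unTorusX k e 2 = 1 - (L - k) * s := rfl
  have hc3 : unTorusX k e 3 = 1 - (L - k) * (1 - s) := rfl
  have hc4 : unTorusX k e 4 = L * (1 - e 0 - e 1) := rfl
  have hleg : legSum (unTorusX k e) = L := by
    rw [legSum, hc0, hc1, hc4]
    ring
  have hgap : faceGap (unTorusX k e) = L - k := by
    rw [faceGap, hc2, hc3]
    ring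
  have hsqrt : √(faceGap (unTorusX k e) * legSum (unTorusX k e)) = t := by
    rw [hleg, hgap, mul_comm, hLk, Real.sqrt_sq ht0]
  have he0 := he 0
  have he1 := he 1
  have hL0 : 0 < L := by linarith
  refine ⟨⟨fun i => ?_, ?_, ?_, ?_⟩, ?_⟩
  · have m1 := mul_nonneg (sub_nonneg.2 hkL) hs0
    have m2 := mul_nonneg (sub_nonneg.2 hkL) (sub_nonneg.2 hs1)
    have m3 := mul_nonneg hL0.le he0
    have m4 := mul_nonneg hL0.le he1
    have m5 := mul_pos hL0 h1
    fin_cases i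
    · show 0 ≤ unTorusX k e 0 ∧ unTorusX k e 0 ≤ 1
      rw [hc0]
      exact ⟨m3, by nlinarith⟩
    · show 0 ≤ unTorusX k e 1 ∧ unTorusX k e 1 ≤ 1
      rw [hc1]
      exact ⟨m4, by nlinarith⟩
    · show 0 ≤ unTorusX k e 2 ∧ unTorusX k e 2 ≤ 1
      rw [hc2]
      exact ⟨by nlinarith, by linarith⟩
    · show 0 ≤ unTorusX k e 3 ∧ unTorusX k e 3 ≤ 1
      rw [hc3]
      exact ⟨by nlinarith, by linarith⟩
    · show 0 ≤ unTorusX k e 4 ∧ unTorusX k e 4 ≤ 1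
      rw [hc4]
      exact ⟨m5.le, by nlinarith⟩
  · rw [Fin.sum_univ_five, hc0, hc1, hc2, hc3, hc4]
    ring
  · rw [hc4]
    exact mul_pos hL0 h1
  · rw [hsqrt, hleg]
    exact h2
  · rw [torusX, hsqrt, hleg, hgap, hc0, hc1, hc2, mul_div_cancel_left₀ _ hL0.ne',
      mul_div_cancel_left₀ _ hL0.ne', sub_sub_cancel, torusCoord]
    conv_rhs => rw [← pack_self e, ← hpol]
    rcases hkL.eq_or_lt with h0 | h0
    · have ht1 : t = 0 := by
        rw [← h0] at hLk
        simpa using hLk.symm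
      have hρ0 : polarRadius (e 2, e 3) = 0 := by
        have := div_horoDepth (b := (e 0, e 1)) (s := s) hρ
        rw [← hte, ht1] at this
        simpa using this.symm
      rw [ht1, hρ0, zero_div, polar_zero, polar_zero]
    · rw [mul_div_cancel_left₀ _ (sub_pos.2 h0).ne', hte, div_horoDepth hρ]

/-! ### The charts around the tori -/

theorem continuousWithinAt_of_abs_le {X : Type*} [TopologicalSpace X] {f ρ : X → ℝ} {S : Set X}
    {x : X} (C : ℝ) (hρ : ContinuousWithinAt ρ S x) (h0 : ρ x = 0) (hx : x ∈ S)
    (hle : ∀ y ∈ S, |f y| ≤ C * ρ y) : ContinuousWithinAt f S x := by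
  have hf : f x = 0 := by
    have := hle x hx
    rw [h0, mul_zero] at this
    exact abs_nonpos_iff.1 this
  rw [ContinuousWithinAt, hf]
  refine squeeze_zero_norm' (a := fun y => C * ρ y)
    (Filter.eventually_of_mem self_mem_nhdsWithin hle) ?_
  have := hρ.const_mul C
  rwa [ContinuousWithinAt, h0, mul_zero] at this

theorem abs_polarAngle_le (z : ℝ × ℝ) : |polarAngle 0 z| ≤ 3 / 2 := by
  have hpi := Real.pi_pos
  rw [polarAngle, zero_add, abs_mul, abs_of_pos (by positivity)]
  have h : |Real.arcsin ((z.1 * Real.cos (Real.pi / 3 * 0) -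
      (2 * z.2 + z.1) / √3 * Real.sin (Real.pi / 3 * 0)) / polarRadius z)| ≤ Real.pi / 2 :=
    abs_le.2 ⟨Real.neg_pi_div_two_le_arcsin _, Real.arcsin_le_pi_div_two _⟩
  refine (mul_le_mul_of_nonneg_left h (by positivity)).trans (le_of_eq ?_)
  field_simp

theorem continuous_polarRadius_comp : Continuous fun e : E4 => polarRadius (e 2, e 3) := by
  unfold polarRadius
  fun_prop

theorem continuousAt_polarAngle {e : E4} (h : polarRadius (e 2, e 3) ≠ 0) :
    ContinuousAt (fun e : E4 => polarAngle 0 (e 2, e 3)) e := by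
  unfold polarAngle
  refine continuousAt_const.add (continuousAt_const.mul
    (Real.continuous_arcsin.continuousAt.comp (ContinuousAt.div ?_
      continuous_polarRadius_comp.continuousAt h)))
  fun_prop

theorem torusDepth_nonneg (e : E4) : 0 ≤ torusDepth e :=
  horoDepth_nonneg (polarRadius_nonneg _) _ _

theorem continuous_torusDepth : Continuous torusDepth := by
  refine continuous_iff_continuousAt.2 fun e => ?_
  have hr := continuous_polarRadius_comp.continuousAt (x := e)
  by_cases h : polarRadius (e 2, e 3) = 0
  · rw [← continuousWithinAt_univ] at hr ⊢
    refine continuousWithinAt_of_abs_le 2 hr h trivial fun e' _ => ?_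
    rw [abs_of_nonneg (torusDepth_nonneg e')]
    exact horoDepth_le (polarRadius_nonneg _) _ _
  · have hs := continuousAt_polarAngle h
    have hq : ContinuousAt (fun e : E4 => horoSq (e 0, e 1) (polarAngle 0 (e 2, e 3))) e := by
      unfold horoSq
      fun_prop
    refine ContinuousAt.div (hr.const_mul 2) (continuousAt_const.add (hr.mul hq)) ?_
    have := mul_nonneg (polarRadius_nonneg (e 2, e 3)) (horoSq_nonneg (e 0, e 1)
      (polarAngle 0 (e 2, e 3)))
    linarith

theorem continuous_legLevel_torusDepth (k : ℝ) :
    Continuous fun e => legLevel k (torusDepth e) := by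
  have := continuous_torusDepth
  unfold legLevel
  fun_prop

theorem continuous_unTorusX {k : ℝ} (hk : 0 ≤ k) : Continuous (unTorusX k) := by
  have hL := continuous_legLevel_torusDepth k
  have hs : Continuous fun e : E4 =>
      (legLevel k (torusDepth e) - k) * polarAngle 0 (e 2, e 3) := by
    refine continuous_iff_continuousAt.2 fun e => ?_
    by_cases h : polarRadius (e 2, e 3) = 0
    · rw [← continuousWithinAt_univ]
      refine continuousWithinAt_of_abs_le 3
        continuous_polarRadius_comp.continuousAt.continuousWithinAt h trivial fun e' _ => ?_
      have h1 := le_legLevel k (torusDepth e')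
      have h2 := legLevel_le hk (torusDepth_nonneg e')
      have h3 : torusDepth e' ≤ 2 * polarRadius (e' 2, e' 3) :=
        horoDepth_le (polarRadius_nonneg _) _ _
      rw [abs_mul, abs_of_nonneg (by linarith)]
      have h4 := abs_polarAngle_le (e' 2, e' 3)
      have h5 := polarRadius_nonneg (e' 2, e' 3)
      have h6 := mul_le_mul (show legLevel k (torusDepth e') - k ≤ 2 * polarRadius (e' 2, e' 3) by
        linarith) h4 (abs_nonneg _) (by linarith)
      linarith
    · exact (hL.continuousAt.sub continuousAt_const).mul (continuousAt_polarAngle h)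
  refine continuous_pi fun i => ?_
  fin_cases i
  · exact hL.mul (by fun_prop)
  · exact hL.mul (by fun_prop)
  · exact continuous_const.sub hs
  · show Continuous fun e : E4 =>
      1 - (legLevel k (torusDepth e) - k) * (1 - polarAngle 0 (e 2, e 3))
    simp only [mul_sub, mul_one]
    exact continuous_const.sub ((hL.sub continuous_const).sub hs)
  · exact hL.mul (by fun_prop)

/-- On the torus the angle is discontinuous, but the radius is at most a constant times √(faceGap ·
legSum) by the lower bound of the denominator, so the plane coordinates tend to zero. -/
theorem continuousOn_torusX {k : ℝ} (hk : 0 < k) : ContinuousOn torusX {c | InTorusCell k c} := by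
  intro c (hc : InTorusCell k c)
  have hl : Continuous legSum := by unfold legSum; fun_prop
  have hg : Continuous faceGap := by unfold faceGap; fun_prop
  have ht : Continuous fun c => √(faceGap c * legSum c) := (hg.mul hl).sqrt
  have hb : ∀ i, ContinuousAt (fun c : Fin 5 → ℝ => c i / legSum c) c := fun i =>
    (continuous_apply i).continuousAt.div hl.continuousAt (hc.legSum_pos hk).ne'
  set ρ : (Fin 5 → ℝ) → ℝ := fun c => √(faceGap c * legSum c) / (2 - √(faceGap c * legSum c) *
    horoSq (c 0 / legSum c, c 1 / legSum c) ((1 - c 2) / faceGap c)) with hρ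
  suffices h : ContinuousWithinAt (fun c => polar (ρ c) ((1 - c 2) / faceGap c))
      {c | InTorusCell k c} c from
    (continuous_pack.continuousAt.comp_continuousWithinAt
      (((hb 0).prodMk (hb 1)).continuousWithinAt.prodMk h) :)
  rcases hc.faceGap_nonneg.eq_or_lt with h0 | h0
  · have hle : ∀ c' ∈ {c | InTorusCell k c}, ∀ x, |ρ c' * Real.sin x| ≤
        1 / (2 * k) * √(faceGap c' * legSum c') := by
      intro c' (hc' : InTorusCell k c') x
      have h1 := hc'.denom_ge hk
      have h2 := Real.sqrt_nonneg (faceGap c' * legSum c')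
      have h3 : |ρ c'| ≤ 1 / (2 * k) * √(faceGap c' * legSum c') := by
        rw [abs_of_nonneg (div_nonneg h2 (hc'.denom_pos hk).le), one_div_mul_eq_div]
        exact div_le_div_of_nonneg_left h2 (by positivity) h1
      rw [abs_mul]
      exact (mul_le_of_le_one_right (abs_nonneg _) (Real.abs_sin_le_one x)).trans h3
    have h00 : √(faceGap c * legSum c) = 0 := by rw [← h0]; simp
    exact (continuousWithinAt_of_abs_le (1 / (2 * k)) ht.continuousWithinAt h00 hc
      fun c' hc' => hle c' hc' _).prodMk (continuousWithinAt_of_abs_le (1 / (2 * k))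
      ht.continuousWithinAt h00 hc fun c' hc' => hle c' hc' _)
  · have hs : ContinuousAt (fun c : Fin 5 → ℝ => (1 - c 2) / faceGap c) c :=
      (continuousAt_const.sub (continuous_apply 2).continuousAt).div hg.continuousAt h0.ne'
    have hb0 := hb 0
    have hb1 := hb 1
    have hq : ContinuousAt (fun c : Fin 5 → ℝ =>
        horoSq (c 0 / legSum c, c 1 / legSum c) ((1 - c 2) / faceGap c)) c := by
      unfold horoSq
      simp only
      fun_prop
    have hρc : ContinuousAt ρ c := ht.continuousAt.div
      (continuousAt_const.sub (ht.continuousAt.mul hq)) (hc.denom_pos hk).ne'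
    refine ContinuousAt.continuousWithinAt ?_
    unfold polar
    fun_prop

section TorusChart

variable (v : Fin 5 → E4) (τ : ℝ)

/-- A neighbourhood of the interior of a face of the facets `2'` and `3'`. -/
def torusRegion (π : Equiv.Perm (Fin 5)) : Set E4 :=
  {x | 0 < cutCoord v τ x (π 4) ∧ legSum (cutCoord v τ x ∘ π) +
    √(faceGap (cutCoord v τ x ∘ π) * legSum (cutCoord v τ x ∘ π)) < 1}

/-- The development of the cells around a torus. -/
def torusDev (π : Equiv.Perm (Fin 5)) (g : Fin 6 × Fin 6) (x : E4) : E4 :=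
  sec4 g (torusX (cutCoord v τ x ∘ π))

/-- The image of the cells around a torus. -/
def torusRange : Set E4 :=
  {d | 0 < 1 - fold4 d 0 - fold4 d 1 ∧
    legLevel (cutLevel τ - 2) (torusDepth (fold4 d)) + torusDepth (fold4 d) < 1}

variable {v τ}

theorem isOpen_torusRegion (π : Equiv.Perm (Fin 5)) : IsOpen (torusRegion v τ π) := by
  have h : ∀ i, Continuous fun x => cutCoord v τ x i := fun i =>
    (continuous_apply i).comp continuous_cutCoord
  have hL : Continuous fun x => legSum (cutCoord v τ x ∘ π) +
      √(faceGap (cutCoord v τ x ∘ π) * legSum (cutCoord v τ x ∘ π)) := by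
    unfold legSum faceGap
    simp only [Function.comp_apply]
    fun_prop
  exact (isOpen_lt continuous_const (h _)).inter (isOpen_lt hL continuous_const)

theorem isOpen_torusRange : IsOpen (torusRange τ) := by
  have hf := continuous_fold4
  have ht := continuous_torusDepth.comp continuous_fold4
  have hL := (continuous_legLevel_torusDepth (cutLevel τ - 2)).comp continuous_fold4
  have h0 : Continuous fun d => 1 - fold4 d 0 - fold4 d 1 := by fun_prop
  exact (isOpen_lt continuous_const h0).inter (isOpen_lt (hL.add ht) continuous_const)

variable (hv : IsRegularSimplex v) (h1 : 4 / 9 < τ) (h2 : τ < 1)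
include hv h1

theorem inTorusCell_of_mem {π : Equiv.Perm (Fin 5)} {x : E4} (hx : x ∈ cutSimplex v τ)
    (hxO : x ∈ torusRegion v τ π) : InTorusCell (cutLevel τ - 2) (cutCoord v τ x ∘ π) where
  mem i := (mem_cutSimplex_iff (by linarith)).1 hx (π i)
  sum := by
    refine (Equiv.sum_comp π (cutCoord v τ x)).trans ?_
    rw [sum_cutCoord hv (by linarith)]
    ring
  pos := hxO.1
  lt := hxO.2

include h2

theorem cornerFacet_iff {π : Equiv.Perm (Fin 5)} {x : E4} (hx : x ∈ cutSimplex v τ)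
    (hxO : x ∈ torusRegion v τ π) (s : Fin 4) : x ∈ facetPlane v τ (cornerFacet π s) ↔
      torusX (cutCoord v τ x ∘ π) s = 0 := by
  have hτ : 0 < τ + 2 / 3 := by linarith
  have hk : 0 < cutLevel τ - 2 := by linarith [(cutLevel_mem h1 h2).1]
  obtain ⟨e0, e1, e2, e3⟩ := (inTorusCell_of_mem hv h1 hx hxO).torusX_eq_zero_iff hk
  fin_cases s
  · exact (mem_facetPlane_inl hτ).trans e0.symm
  · exact (mem_facetPlane_inl hτ).trans e1.symm
  · exact (mem_facetPlane_inr hτ).trans e2.symm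
  · exact (mem_facetPlane_inr hτ).trans e3.symm

theorem atCorner_of_mem_torusRegion {π : Equiv.Perm (Fin 5)} {x : E4} (hx : x ∈ cutSimplex v τ)
    (hxO : x ∈ torusRegion v τ π) : AtCorner v τ π x := by
  have hτ : 0 < τ + 2 / 3 := by linarith
  have hk : 0 < cutLevel τ - 2 := by linarith [(cutLevel_mem h1 h2).1]
  have hc := inTorusCell_of_mem hv h1 hx hxO
  rintro (i | i) ha
  · rw [mem_facetPlane_inl hτ] at ha
    obtain ⟨j, rfl⟩ := π.surjective i
    by_cases hj0 : j = 0
    · exact ⟨0, by rw [hj0]; rfl⟩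
    by_cases hj1 : j = 1
    · exact ⟨1, by rw [hj1]; rfl⟩
    exact absurd ha (hc.coord_pos hk j hj0 hj1).ne'
  · rw [mem_facetPlane_inr hτ] at ha
    obtain ⟨j, rfl⟩ := π.surjective i
    by_cases hj0 : j = 2
    · exact ⟨2, by rw [hj0]; rfl⟩
    by_cases hj1 : j = 3
    · exact ⟨3, by rw [hj1]; rfl⟩
    exact absurd ha (hc.coord_lt_one j hj0 hj1).ne

theorem linked_cornerLabel {π : Equiv.Perm (Fin 5)} {x : E4} (hx : x ∈ cutSimplex v τ)
    (hxO : x ∈ torusRegion v τ π) {l l' : CellLabel} {g : Fin 6 × Fin 6}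
    (h : Linked v τ x (cornerLabel l π g) l') :
    ∃ g', l' = cornerLabel l π g' ∧ torusDev v τ π g' x = torusDev v τ π g x := by
  induction h with
  | refl => exact ⟨g, rfl, rfl⟩
  | tail _ h ih =>
    obtain ⟨a, ha, rfl⟩ := h
    obtain ⟨g', rfl, hg'⟩ := ih
    obtain ⟨s, rfl⟩ := atCorner_of_mem_torusRegion hv h1 h2 hx hxO a ha
    -- A point on the facet `s` has vanishing torus coordinate `s`, so the reflection across this
    -- facet fixes its coordinates.
    refine ⟨cornerNb s g', crossFacet_cornerLabel l π s g', ?_⟩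
    rw [← hg', torusDev, sec4_cornerNb,
      sec4_cornerNb_of_eq_zero ((cornerFacet_iff hv h1 h2 hx hxO s).1 ha), torusDev]

/-- In torus coordinates the cell is a piece of a product of two closed A₂ chambers, so the 36 cells
around the corner unfold by the product of the two reflection groups. -/
theorem exists_torusChart (l : CellLabel) (π : Equiv.Perm (Fin 5)) :
    ∃ e : OpenPartialHomeomorph (SpaceX v τ) E4, e.target = torusRange τ ∧
      (∀ g (x : cutSimplex v τ), (x : E4) ∈ torusRegion v τ π →
        cellPt v τ _ (cornerLabel l π g) x ∈ e.source ∧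
        e (cellPt v τ _ (cornerLabel l π g) x) = torusDev v τ π g x) ∧
      ∀ m ∈ e.source, ∃ (g : Fin 6 × Fin 6) (x : cutSimplex v τ),
        (x : E4) ∈ torusRegion v τ π ∧ m = cellPt v τ _ (cornerLabel l π g) x := by
  have hτ : 0 < τ + 2 / 3 := by linarith
  set k := cutLevel τ - 2 with hkdef
  have hk : 0 < k := by linarith [(cutLevel_mem h1 h2).1]
  have hcell : ∀ x ∈ cutSimplex v τ ∩ torusRegion v τ π, InTorusCell k (cutCoord v τ x ∘ π) :=
    fun x hx => inTorusCell_of_mem hv h1 hx.1 hx.2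
  have hcc : Continuous fun x => cutCoord v τ x ∘ π :=
    continuous_pi fun i => (continuous_apply (π i)).comp continuous_cutCoord
  have hx₀ : (0 : E4) ∈ cutSimplex v τ := by
    intro i
    simp
    constructor <;> linarith
  have hfold : ∀ d ∈ torusRange τ, InTorusCell k (unTorusX k (fold4 d)) ∧
      torusX (unTorusX k (fold4 d)) = fold4 d := fun d hd =>
    inTorusCell_unTorusX hk (fold4_nonneg d) hd.1 hd.2
  refine exists_unfolding_chart ⟨0, hx₀⟩ (cornerLabel l π)
    (fun g g' h => cornerLabel_injective l π (congrArg Prod.snd h))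
    (isOpen_torusRegion π) isOpen_torusRange (torusDev v τ π)
    (fun d => cutPoint v τ (unTorusX k (fold4 d) ∘ π.symm)) ?_ ?_ ?_ ?_ ?_ ?_ ?_
  · intro g
    exact (contDiff_sec4 g).continuous.comp_continuousOn
      ((continuousOn_torusX hk).comp hcc.continuousOn hcell)
  · refine (continuous_cutPoint.comp (continuous_pi fun i => ?_)).continuousOn
    exact (continuous_apply (π.symm i)).comp ((continuous_unTorusX hk.le).comp continuous_fold4)
  · intro g x hx
    have hc := hcell x hx
    have hf : fold4 (torusDev v τ π g x) = torusX (cutCoord v τ x ∘ π) :=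
      fold4_sec4 g (hc.torusX_nonneg hk)
    have hu := hc.unTorusX_torusX hk
    have e0 : legLevel k (torusDepth (torusX (cutCoord v τ x ∘ π))) =
        legSum (cutCoord v τ x ∘ π) := by
      conv_rhs => rw [← hu]
      simp only [legSum, unTorusX, Matrix.cons_val]
      ring
    have hL := hc.legSum_pos hk
    have e1 : torusDepth (torusX (cutCoord v τ x ∘ π)) = √(faceGap (cutCoord v τ x ∘ π) *
        legSum (cutCoord v τ x ∘ π)) := by
      have h3 := legLevel_mul_sub k (torusDepth (torusX (cutCoord v τ x ∘ π)))
      rw [e0] at h3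
      rw [mul_comm, show faceGap (cutCoord v τ x ∘ π) = legSum (cutCoord v τ x ∘ π) - k by
        rw [hc.legSum_eq]; ring, h3, Real.sqrt_sq (torusDepth_nonneg _)]
    refine ⟨?_, ?_⟩
    · rw [hf]
      have h4 := congrFun hu 4
      rw [show unTorusX k (torusX (cutCoord v τ x ∘ π)) 4 = legLevel k (torusDepth
        (torusX (cutCoord v τ x ∘ π))) * (1 - torusX (cutCoord v τ x ∘ π) 0 -
          torusX (cutCoord v τ x ∘ π) 1) from rfl, e0] at h4
      have := hc.pos
      rw [← h4] at this
      exact pos_of_mul_pos_right this hL.le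
    · rw [hf, e0, e1]
      exact hc.lt
  · intro g x hx
    have hc := hcell x hx
    have hf : fold4 (torusDev v τ π g x) = torusX (cutCoord v τ x ∘ π) :=
      fold4_sec4 g (hc.torusX_nonneg hk)
    simp only [hf, hc.unTorusX_torusX hk]
    rw [show (cutCoord v τ x ∘ π) ∘ π.symm = cutCoord v τ x by ext i; simp]
    exact cutPoint_cutCoord hv hτ x
  · intro d hd
    obtain ⟨hc, hX⟩ := hfold d hd
    have hco : cutCoord v τ (cutPoint v τ (unTorusX k (fold4 d) ∘ π.symm)) ∘ π =
        unTorusX k (fold4 d) := by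
      rw [cutCoord_cutPoint hv hτ]
      · ext i; simp
      · refine (Equiv.sum_comp π.symm (unTorusX k (fold4 d))).trans ?_
        rw [hc.sum, hkdef]
        ring
    refine ⟨⟨(mem_cutSimplex_iff hτ).2 fun i => ?_, ?_, ?_⟩, ?_⟩
    · obtain ⟨j, rfl⟩ := π.surjective i
      rw [← Function.comp_apply (f := cutCoord v τ _), hco]
      exact hc.mem j
    · show 0 < (cutCoord v τ _ ∘ π) 4
      rw [hco]
      exact hc.pos
    · rw [hco]
      exact hc.lt
    · obtain ⟨g, hg⟩ := exists_sec4_fold4 d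
      refine ⟨g, ?_⟩
      rw [torusDev, hco, hX, hg]
  · rintro x ⟨hx, hxO⟩ g l' h
    exact linked_cornerLabel hv h1 h2 hx hxO h
  · rintro x ⟨hx, hxO⟩ ⟨n, n'⟩ ⟨m, m'⟩ h
    have hnn := (hcell x ⟨hx, hxO⟩).torusX_nonneg hk
    obtain ⟨hp, hz⟩ := pack_inj.1 h
    have hcr : ∀ s g, torusX (cutCoord v τ x ∘ π) s = 0 →
        Linked v τ x (cornerLabel l π g) (cornerLabel l π (cornerNb s g)) := by
      intro s g hs
      rw [← crossFacet_cornerLabel]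
      exact .cross ((cornerFacet_iff hv h1 h2 hx hxO s).2 hs)
    have r1 : Linked v τ x (cornerLabel l π (n, n')) (cornerLabel l π (m, n')) :=
      sec_eq_sec (r := fun a b => Linked v τ x (cornerLabel l π (a, n')) (cornerLabel l π (b, n')))
        (hnn 0) (hnn 1) hp (fun _ => .refl) (fun _ _ _ => .trans)
        (fun h a => hcr 0 (a, n') h) (fun h a => hcr 1 (a, n') h)
    have r2 : Linked v τ x (cornerLabel l π (m, n')) (cornerLabel l π (m, m')) :=
      sec_eq_sec (r := fun a b => Linked v τ x (cornerLabel l π (m, a)) (cornerLabel l π (m, b)))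
        (hnn 2) (hnn 3) hz (fun _ => .refl) (fun _ _ _ => .trans)
        (fun h a => hcr 2 (m, a) h) (fun h a => hcr 3 (m, a) h)
    exact r1.trans r2

end TorusChart

/-! ### The hyperbolic manifold as an open subset of the closed manifold -/

/-- The embedding of the hyperbolic manifold that opens the cusps. -/
structure CuspOpening (v : Fin 5 → E4) (τ : ℝ) where
  Φ : uncutPart v τ ≃ₜ idealRectifiedSimplex v
  stretch : ∀ q, ∃ m, (0 < m ∧ m < 1) ∧ ∀ i, cutCoord v 1 (Φ q) i = stretch m (cutCoord v τ q i)
  κ : OpenPartialHomeomorph (SpaceM v) (SpaceX v τ)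
  source_eq : κ.source = Set.univ
  κ_cellPt : ∀ l r, κ (cellPt v 1 _ l r) = cellPt v τ _ l ⟨Φ.symm r, (Φ.symm r).2.1⟩
  mem_target : ∀ l q, cellPt v τ _ l q ∈ κ.target ↔ (q : E4) ∈ uncutPart v τ

theorem nonempty_cuspOpening {v : Fin 5 → E4} {τ : ℝ} (hv : IsRegularSimplex v) (h1 : 4 / 9 < τ)
    (h2 : τ < 1) : Nonempty (CuspOpening v τ) := by
  obtain ⟨Φ, hΦ⟩ := exists_straightening hv h1 h2
  obtain ⟨κ, hκ, hc, hr⟩ := exists_embedding (by linarith) Φ hΦ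
  have : Nonempty (SpaceM v) := by
    refine ⟨cellPt v 1 _ (true, 0, 0) ⟨0, ?_, by simp⟩⟩
    intro i
    simp
    norm_num
  exact ⟨⟨Φ, hΦ, hκ.toOpenPartialHomeomorph κ, rfl, hc, fun l q => by
    rw [hκ.toOpenPartialHomeomorph_target]
    exact hr l q⟩⟩

namespace CuspOpening

variable {v : Fin 5 → E4} {τ : ℝ} (K : CuspOpening v τ)

theorem facet_iff (hτ : 0 < τ + 2 / 3) (r : idealRectifiedSimplex v) (a : Fin 5 ⊕ Fin 5) :
    (K.Φ.symm r : E4) ∈ facetPlane v τ a ↔ (r : E4) ∈ facetPlane v 1 a := by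
  obtain ⟨m, hm, e⟩ := K.stretch (K.Φ.symm r)
  rw [K.Φ.apply_symm_apply] at e
  rcases a with i | i
  · rw [mem_facetPlane_inl hτ, mem_facetPlane_inl (by norm_num), e,
      stretch_eq_zero_iff hm.1 hm.2.le]
  · rw [mem_facetPlane_inr hτ, mem_facetPlane_inr (by norm_num), e,
      stretch_eq_one_iff hm.1 hm.2.le]

theorem mem_source (m : SpaceM v) : m ∈ K.κ.source := by
  rw [K.source_eq]
  trivial

end CuspOpening

/-- The charts around a torus. -/
structure IsTorusChart (v : Fin 5 → E4) (τ : ℝ) (l : CellLabel) (π : Equiv.Perm (Fin 5))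
    (e : OpenPartialHomeomorph (SpaceX v τ) E4) : Prop where
  apply : ∀ g (x : cutSimplex v τ), (x : E4) ∈ torusRegion v τ π →
    cellPt v τ _ (cornerLabel l π g) x ∈ e.source ∧
      e (cellPt v τ _ (cornerLabel l π g) x) = torusDev v τ π g x
  exists_cell : ∀ m ∈ e.source, ∃ (g : Fin 6 × Fin 6) (x : cutSimplex v τ),
    (x : E4) ∈ torusRegion v τ π ∧ m = cellPt v τ _ (cornerLabel l π g) x
  sign : ∀ x ∈ Metric.ball (0 : E4) 1, 0 < boolSign l.1 * (fderiv ℝ (torusKlein v π) x).det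

section

variable {v : Fin 5 → E4} {τ : ℝ} (hv : IsRegularSimplex v) (h1 : 4 / 9 < τ) (h2 : τ < 1)
include hv h1 h2

/-- The orientation of the base cell is chosen equal to the sign of the Jacobian of `torusKlein`, so
that the chart is positively oriented. -/
theorem exists_isTorusChart (l : CellLabel) {π : Equiv.Perm (Fin 5)} {x : cutSimplex v τ}
    (hx : (x : E4) ∈ torusRegion v τ π) :
    ∃ l₀ e, IsTorusChart v τ l₀ π e ∧ cellPt v τ _ l x ∈ e.source := by
  obtain ⟨b, hb⟩ := exists_sign_torusKlein hv π
  obtain ⟨l₀, n, hl₀, hn⟩ := exists_cornerLabel_eq b l π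
  obtain ⟨e, -, ha, hs⟩ := exists_torusChart hv h1 h2 l₀ π
  refine ⟨l₀, e, ⟨ha, hs, by rw [hl₀]; exact hb⟩, ?_⟩
  rw [← hn]
  exact (ha _ x hx).1

theorem IsTorusChart.exists_label {l : CellLabel} {π : Equiv.Perm (Fin 5)}
    {e : OpenPartialHomeomorph (SpaceX v τ) E4} (he : IsTorusChart v τ l π e) {l' : CellLabel}
    {x : cutSimplex v τ} (h : cellPt v τ _ l' x ∈ e.source) :
    (x : E4) ∈ torusRegion v τ π ∧ ∃ g, l' = cornerLabel l π g := by
  obtain ⟨g, y, hy, e'⟩ := he.exists_cell _ h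
  rw [cellPt_eq_iff] at e'
  obtain ⟨rfl, hl⟩ := e'
  obtain ⟨g', rfl, -⟩ := linked_cornerLabel hv h1 h2 x.2 hy hl.symm
  exact ⟨hy, g', rfl⟩

omit hv h1 h2 in
theorem boolSign_cornerLabel (l : CellLabel) (π : Equiv.Perm (Fin 5)) (g : Fin 6 × Fin 6) :
    boolSign (cornerLabel l π g).1 = boolSign l.1 * -boolSign (sectorOdd g.1 ^^ sectorOdd g.2) := by
  show boolSign (l.1 ^^ (sectorOdd g.1 ^^ sectorOdd g.2)) = _
  rw [boolSign_xor]
  ring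

omit hv h1 h2 in
theorem det_fderiv_comp {f g : E4 → E4} {x : E4} (hg : DifferentiableAt ℝ g (f x))
    (hf : DifferentiableAt ℝ f x) :
    (fderiv ℝ (g ∘ f) x).det = (fderiv ℝ g (f x)).det * (fderiv ℝ f x).det := by
  rw [fderiv_comp _ hg hf]
  exact LinearMap.det_comp _ _

/-- By `InTorusCell.torus5_stretch` the torus chart, pulled back to `M`, is `torusKlein` followed by
a group element. The former is smooth on the whole ball and intertwines the Klein reflections with
the linear ones. -/
theorem IsTorusChart.developsVia (K : CuspOpening v τ) {l : CellLabel} {π : Equiv.Perm (Fin 5)}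
    {e : OpenPartialHomeomorph (SpaceX v τ) E4} (he : IsTorusChart v τ l π e) :
    ∃ F, DevelopsVia (kleinRefl v) (K.κ.trans e) 1 F := by
  classical
  have hτ : 0 < τ + 2 / 3 := by linarith
  have hk : 0 < cutLevel τ - 2 := by linarith [(cutLevel_mem h1 h2).1]
  let F : CellLabel → E4 → E4 := fun l' =>
    if h : ∃ g, cornerLabel l π g = l' then sec4 h.choose ∘ torusKlein v π else id
  have hF : ∀ g, F (cornerLabel l π g) = sec4 g ∘ torusKlein v π := by
    intro g
    have h : ∃ g', cornerLabel l π g' = cornerLabel l π g := ⟨g, rfl⟩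
    simp only [F, h, dif_pos]
    rw [cornerLabel_injective l π (congrArg Prod.snd h.choose_spec)]
  refine ⟨F, fun l' x hx => ?_⟩
  have hx' : cellPt v τ _ l' ⟨K.Φ.symm x, (K.Φ.symm x).2.1⟩ ∈ e.source := by
    rw [← K.κ_cellPt]
    exact hx.2
  obtain ⟨hO, g, rfl⟩ := he.exists_label hv h1 h2 hx'
  have hO : (K.Φ.symm x : E4) ∈ torusRegion v τ π := hO
  have hsm := contDiffAt_torusKlein hv π x.2.2
  have hsec := contDiff_sec4 g
  refine ⟨?_, ?_, ?_, fun a ha => ?_⟩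
  · rw [hF]
    exact hsec.contDiffAt.comp _ hsm
  · rw [hF, det_fderiv_comp (hsec.differentiable (by simp)).differentiableAt
      (hsm.differentiableAt (by simp)), boolSign_cornerLabel]
    have := mul_pos (det_sec4 g (torusKlein v π x)) (he.sign x x.2.2)
    refine lt_of_lt_of_eq this ?_
    ring
  · have hc : Continuous fun y : idealRectifiedSimplex v => (K.Φ.symm y : E4) :=
      continuous_subtype_val.comp K.Φ.symm.continuous
    filter_upwards [hc.continuousAt.eventually ((isOpen_torusRegion π).mem_nhds hO)] with y hy
    rw [hF]
    show e (K.κ _) = _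
    rw [K.κ_cellPt, (he.apply g ⟨K.Φ.symm y, (K.Φ.symm y).2.1⟩ hy).2]
    show sec4 g _ = sec4 g _
    congr 1
    obtain ⟨m, hm, e'⟩ := K.stretch (K.Φ.symm y)
    rw [K.Φ.apply_symm_apply] at e'
    have hcell := inTorusCell_of_mem hv h1 (K.Φ.symm y).2.1 hy
    refine (hcell.torus5_stretch hk ?_ hm.1 (fun i => e' (π i))
      (sum_comp_perm_cutCoord_one hv π y)).symm
    refine hcell.faceGap_nonneg.lt_of_ne fun h0 => ?_
    have b2 := (hcell.mem 2).2
    have b3 := (hcell.mem 3).2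
    rw [faceGap] at h0
    exact (K.Φ.symm y).2.2 (π 2) (π 3) (by simp)
      (show (cutCoord v τ _ ∘ π) 2 = 1 by linarith) (show (cutCoord v τ _ ∘ π) 3 = 1 by linarith)
  · obtain ⟨s, rfl⟩ := atCorner_of_mem_torusRegion hv h1 h2 (K.Φ.symm x).2.1 hO a
      ((K.facet_iff hτ x a).2 ha)
    rw [crossFacet_cornerLabel, hF, hF]
    filter_upwards [Metric.isOpen_ball.mem_nhds x.2.2] with y hy
    show sec4 _ _ = sec4 _ (torusKlein v π _)
    rw [torusKlein_kleinRefl hv π s hy, sec4_cornerNb]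

omit hv h1 h2 in
theorem IsKleinChart.developsVia (K : CuspOpening v τ) {e : OpenPartialHomeomorph (SpaceM v) E4}
    {A : CellLabel → (Fin 5 → ℝ) → Fin 5 → ℝ} (he : IsKleinChart v e A) :
    ∃ F, DevelopsVia (kleinRefl v) (K.κ.trans (K.κ.symm.trans e)) 1 F := by
  have hinv : ∀ m, K.κ.symm (K.κ m) = m := fun m => K.κ.left_inv (K.mem_source m)
  refine ⟨fun l => kl v (A l), fun l x hx => ?_⟩
  have hx' : cellPt v 1 _ l x ∈ e.source := by
    have h : K.κ.symm (K.κ (cellPt v 1 _ l x)) ∈ e.source := hx.2.2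
    rwa [hinv] at h
  obtain ⟨d1, d2, d3, d4⟩ := he.2.2 l x hx'
  refine ⟨d1, d2, ?_, d4⟩
  filter_upwards [d3] with y hy
  show e (K.κ.symm (K.κ _)) = _
  rw [hinv, hy]

end

/-! ### Change of the distinguished corner of a triangle of a torus -/

/-- The barycentric coordinates on a torus, with the two normal coordinates. -/
def torusExt (d : E4) : Fin 5 → ℝ := ![d 0, d 1, d 2, d 3, 1 - d 0 - d 1]

/-- The linear part of `torusExt`. -/
def torusLin (d : E4) : Fin 5 → ℝ := ![d 0, d 1, d 2, d 3, - d 0 - d 1]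

/-- Permutation of barycentric coordinates. -/
def reindex (σ : Equiv.Perm (Fin 5)) (d : E4) : E4 :=
  WithLp.toLp 2 fun i : Fin 4 => torusExt d (σ i.castSucc)

/-- The linear part of `reindex`. -/
def reindexL (σ : Equiv.Perm (Fin 5)) : E4 →L[ℝ] E4 :=
  LinearMap.toContinuousLinearMap
    { toFun := fun d => WithLp.toLp 2 fun i : Fin 4 => torusLin d (σ i.castSucc)
      map_add' := fun d d' => by
        ext i
        show torusLin (d + d') (σ i.castSucc) = torusLin d (σ i.castSucc) + torusLin d' (σ i.castSucc)
        generalize σ i.castSucc = j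
        fin_cases j <;> simp [torusLin] <;> ring
      map_smul' := fun t d => by
        ext i
        show torusLin (t • d) (σ i.castSucc) = t * torusLin d (σ i.castSucc)
        generalize σ i.castSucc = j
        fin_cases j <;> simp [torusLin] <;> ring }

theorem reindex_eq (σ : Equiv.Perm (Fin 5)) (d : E4) : reindex σ d = reindexL σ d + reindex σ 0 := by
  ext i
  show torusExt d (σ i.castSucc) = torusLin d (σ i.castSucc) + torusExt 0 (σ i.castSucc)
  generalize σ i.castSucc = j
  fin_cases j <;> simp [torusLin, torusExt] <;> ring

theorem contDiff_reindex (σ : Equiv.Perm (Fin 5)) : ContDiff ℝ ∞ (reindex σ) := by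
  rw [show reindex σ = fun d => reindexL σ d + reindex σ 0 from funext (reindex_eq σ)]
  exact (reindexL σ).contDiff.add contDiff_const

theorem fderiv_reindex (σ : Equiv.Perm (Fin 5)) (d : E4) : fderiv ℝ (reindex σ) d = reindexL σ := by
  rw [show reindex σ = fun d => reindexL σ d + reindex σ 0 from funext (reindex_eq σ)]
  exact ((reindexL σ).hasFDerivAt.add_const _).fderiv

/-- The reflections of `cornerNb` in terms of `torusExt`. -/
def reflExt (s : Fin 5) (Y : Fin 5 → ℝ) (j : Fin 5) : ℝ :=
  if j = s then -Y s else if ((j = 2 ∨ j = 3) ↔ (s = 2 ∨ s = 3)) then Y j + Y s else Y j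

theorem torusExt_sec4 (s : Fin 4) (d : E4) :
    torusExt (sec4 (cornerNb s (0, 0)) d) = reflExt s.castSucc (torusExt d) := by
  ext j
  fin_cases s <;> fin_cases j <;> simp [torusExt, sec4, cornerNb, nbα, nbβ, sec, reflExt] <;> ring

theorem sec4_toLp (s : Fin 4) (Y : Fin 5 → ℝ) :
    sec4 (cornerNb s (0, 0)) (WithLp.toLp 2 fun i : Fin 4 => Y i.castSucc) =
      WithLp.toLp 2 fun i : Fin 4 => reflExt s.castSucc Y i.castSucc := by
  ext i
  fin_cases s <;> fin_cases i <;> simp [sec4, cornerNb, nbα, nbβ, sec, reflExt] <;> ring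

/-- The reflection formula only distinguishes whether two indices lie on the same side of the
partition {2, 3}, {0, 1, 4}; a permutation preserving it is therefore equivariant. -/
theorem reflExt_comp {σ : Equiv.Perm (Fin 5)} (hσ : ∀ j, (σ j = 2 ∨ σ j = 3) ↔ (j = 2 ∨ j = 3))
    (s : Fin 5) (Y : Fin 5 → ℝ) : reflExt (σ s) Y ∘ σ = reflExt s (Y ∘ σ) := by
  ext j
  simp [reflExt, hσ]

theorem reindex_sec4 {σ : Equiv.Perm (Fin 5)}
    (hσ : ∀ j, (σ j = 2 ∨ σ j = 3) ↔ (j = 2 ∨ j = 3)) {s s' : Fin 4}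
    (hs : σ s'.castSucc = s.castSucc) (d : E4) :
    reindex σ (sec4 (cornerNb s (0, 0)) d) = sec4 (cornerNb s' (0, 0)) (reindex σ d) := by
  have e := sec4_toLp s' (torusExt d ∘ σ)
  rw [← reflExt_comp hσ, hs, ← torusExt_sec4] at e
  exact e.symm

theorem sum_of_not_mem (f : Fin 5 → ℝ) : ∀ a b d : Fin 5, a ≠ b → a ≠ d → b ≠ d →
    ¬(a = 2 ∨ a = 3) → ¬(b = 2 ∨ b = 3) → ¬(d = 2 ∨ d = 3) → f a + f b + f d = f 0 + f 1 + f 4 := by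
  have h : ∀ a : Fin 5, ¬(a = 2 ∨ a = 3) → a = 0 ∨ a = 1 ∨ a = 4 := by decide
  intro a b d h1 h2 h3 ha hb hd
  rcases h a ha with rfl | rfl | rfl <;> rcases h b hb with rfl | rfl | rfl <;>
    rcases h d hd with rfl | rfl | rfl <;> first | exact absurd rfl h1 | exact absurd rfl h2 | exact absurd rfl h3 | ring

theorem perm_two_three {σ : Equiv.Perm (Fin 5)}
    (hσ : ∀ j, (σ j = 2 ∨ σ j = 3) ↔ (j = 2 ∨ j = 3)) :
    (σ 2 = 2 ∧ σ 3 = 3) ∨ (σ 2 = 3 ∧ σ 3 = 2) := by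
  have a2 := (hσ 2).2 (.inl rfl)
  have a3 := (hσ 3).2 (.inr rfl)
  have a4 : σ 2 ≠ σ 3 := fun h => absurd (σ.injective h) (by decide)
  rcases a2 with h | h <;> rcases a3 with h' | h'
  · exact absurd (h.trans h'.symm) a4
  · exact .inl ⟨h, h'⟩
  · exact .inr ⟨h, h'⟩
  · exact absurd (h.trans h'.symm) a4

theorem pack_eq_reindex {σ : Equiv.Perm (Fin 5)}
    (hσ : ∀ j, (σ j = 2 ∨ σ j = 3) ↔ (j = 2 ∨ j = 3)) {b : Fin 5 → ℝ} (h4 : 1 - b 0 - b 1 = b 4)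
    {z z' : ℝ × ℝ} (h2 : σ 2 = 2 → z' = z) (h3 : σ 2 = 3 → z' = (z.2, z.1)) :
    pack (b (σ 0), b (σ 1)) z' = reindex σ (pack (b 0, b 1) z) := by
  have hleg : ∀ j, ¬(j = 2 ∨ j = 3) → torusExt (pack (b 0, b 1) z) j = b j := by
    have h : ∀ a : Fin 5, ¬(a = 2 ∨ a = 3) → a = 0 ∨ a = 1 ∨ a = 4 := by decide
    intro j hj
    rcases h j hj with rfl | rfl | rfl
    · rfl
    · rfl
    · exact h4
  have n0 : ¬(σ 0 = 2 ∨ σ 0 = 3) := by rw [hσ]; decide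
  have n1 : ¬(σ 1 = 2 ∨ σ 1 = 3) := by rw [hσ]; decide
  have e2 : z'.1 = torusExt (pack (b 0, b 1) z) (σ 2) ∧
      z'.2 = torusExt (pack (b 0, b 1) z) (σ 3) := by
    rcases perm_two_three hσ with ⟨h, h'⟩ | ⟨h, h'⟩
    · rw [h2 h, h, h']; exact ⟨rfl, rfl⟩
    · rw [h3 h, h, h']; exact ⟨rfl, rfl⟩
  ext i
  fin_cases i
  · exact (hleg _ n0).symm
  · exact (hleg _ n1).symm
  · exact e2.1
  · exact e2.2

theorem horoSq_one_sub (b : ℝ × ℝ) (s : ℝ) : horoSq b (1 - s) = horoSq b s := by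
  simp only [horoSq]
  ring

/-- `horoSq` is symmetric in the three barycentric coordinates and under s ↦ 1 − s. Exchanging 2 and
3 replaces s by 1 − s, which swaps the two plane coordinates; with zero gap the angle is irrelevant
because t = 0. -/
theorem torusCoord_perm {σ : Equiv.Perm (Fin 5)}
    (hσ : ∀ j, (σ j = 2 ∨ σ j = 3) ↔ (j = 2 ∨ j = 3)) {c : Fin 5 → ℝ} (hL : legSum c ≠ 0) {t : ℝ}
    (ht : faceGap c = 0 → t = 0) : legSum (c ∘ σ) = legSum c ∧ faceGap (c ∘ σ) = faceGap c ∧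
      torusCoord (c (σ 0) / legSum c, c (σ 1) / legSum c) ((1 - c (σ 2)) / faceGap c) t =
      reindex σ (torusCoord (c 0 / legSum c, c 1 / legSum c) ((1 - c 2) / faceGap c) t) := by
  have hl : legSum c = c 0 + c 1 + c 4 := rfl
  have hg : faceGap c = 2 - c 2 - c 3 := rfl
  have n0 : ¬(σ 0 = 2 ∨ σ 0 = 3) := by rw [hσ]; decide
  have n1 : ¬(σ 1 = 2 ∨ σ 1 = 3) := by rw [hσ]; decide
  have n4 : ¬(σ 4 = 2 ∨ σ 4 = 3) := by rw [hσ]; decide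
  have hne : ∀ a b : Fin 5, a ≠ b → σ a ≠ σ b := fun a b h h' => h (σ.injective h')
  have key : ∀ f : Fin 5 → ℝ, f (σ 0) + f (σ 1) + f (σ 4) = f 0 + f 1 + f 4 := fun f =>
    sum_of_not_mem f _ _ _ (hne _ _ (by decide)) (hne _ _ (by decide)) (hne _ _ (by decide)) n0 n1 n4
  have k1 := key c
  have e4 : 1 - c 0 / legSum c - c 1 / legSum c = c 4 / legSum c := by
    rw [eq_div_iff hL, sub_mul, sub_mul, div_mul_cancel₀ _ hL, div_mul_cancel₀ _ hL]
    linarith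
  have e4' : 1 - c (σ 0) / legSum c - c (σ 1) / legSum c = c (σ 4) / legSum c := by
    rw [eq_div_iff hL, sub_mul, sub_mul, div_mul_cancel₀ _ hL, div_mul_cancel₀ _ hL]
    linarith
  have h23 := perm_two_three hσ
  refine ⟨k1, ?_, ?_⟩
  · show 2 - c (σ 2) - c (σ 3) = 2 - c 2 - c 3
    rcases h23 with ⟨h, h'⟩ | ⟨h, h'⟩ <;> rw [h, h'] <;> ring
  have hsq : ∀ s, horoSq (c (σ 0) / legSum c, c (σ 1) / legSum c) s =
      horoSq (c 0 / legSum c, c 1 / legSum c) s := fun s => by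
    have := key fun i => (c i / legSum c) ^ 2
    simp only [horoSq, e4, e4']
    linarith
  rw [torusCoord, torusCoord, hsq]
  refine pack_eq_reindex hσ (b := fun i => c i / legSum c) e4 (fun h => ?_) (fun h => ?_)
  · rw [h]
  · rw [h]
    by_cases h0 : faceGap c = 0
    · rw [ht h0, zero_mul, zero_div, zero_div, polar_zero, polar_zero]
    · have e3 : (1 - c 3) / faceGap c = 1 - (1 - c 2) / faceGap c := by
        rw [div_eq_iff h0, sub_mul, div_mul_cancel₀ _ h0]
        linarith
      rw [e3, horoSq_one_sub, polar_one_sub]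

theorem torusX_perm {σ : Equiv.Perm (Fin 5)}
    (hσ : ∀ j, (σ j = 2 ∨ σ j = 3) ↔ (j = 2 ∨ j = 3)) {c : Fin 5 → ℝ} (hL : legSum c ≠ 0) :
    torusX (c ∘ σ) = reindex σ (torusX c) := by
  obtain ⟨a1, a2, a3⟩ := torusCoord_perm hσ hL (t := √(faceGap c * legSum c))
    (fun h => by rw [h]; simp)
  rw [torusX, torusX, a1, a2, ← a3]
  rfl

theorem torus5_perm {σ : Equiv.Perm (Fin 5)}
    (hσ : ∀ j, (σ j = 2 ∨ σ j = 3) ↔ (j = 2 ∨ j = 3)) {C : Fin 5 → ℝ} (hs : ∑ i, C i = 2)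
    (h : cuspForm C ≠ 0) : torus5 (C ∘ σ) = reindex σ (torus5 C) := by
  have hs' : ∑ i, (C ∘ σ) i = 2 := (Equiv.sum_comp σ C).trans hs
  have hl : ∀ D : Fin 5 → ℝ, cuspForm D = legSum D := fun D => by
    simp only [cuspForm, legSum, Fin.sum_univ_five]; ring
  have hg : ∀ D : Fin 5 → ℝ, ∑ i, D i = 2 → cuspForm D = faceGap D := fun D hD => by
    rw [cuspForm, hD, faceGap]
  obtain ⟨a1, a2, a3⟩ := torusCoord_perm hσ (by rwa [← hl]) (t := cuspForm C)
    (fun h0 => absurd ((hg C hs).trans h0) h)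
  have e : cuspForm (C ∘ σ) = cuspForm C := by rw [hl, a1, hl]
  rw [torus5_of_sum hs h, torus5_of_sum hs' (by rwa [e]), e]
  rw [← hl, ← hg C hs] at a3
  exact a3

/-! ### The smooth structure of the closed manifold -/

section ClosedManifold

variable {v : Fin 5 → E4} {τ : ℝ} (hv : IsRegularSimplex v) (h1 : 4 / 9 < τ) (h2 : τ < 1)
include hv h1 h2

-- Off the hyperbolic part exactly two coordinates equal 1, and both permutations place their
-- indices in positions 2 and 3.
omit h2 in
theorem perm_of_not_mem_uncutPart {x : E4} (hx : x ∈ cutSimplex v τ) (hu : x ∉ uncutPart v τ)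
    {π π' : Equiv.Perm (Fin 5)} (hπ : x ∈ torusRegion v τ π) (hπ' : x ∈ torusRegion v τ π')
    (j : Fin 5) : ((π'.trans π.symm) j = 2 ∨ (π'.trans π.symm) j = 3) ↔ (j = 2 ∨ j = 3) := by
  have key : ∃ a b, a ≠ b ∧ cutCoord v τ x a = 1 ∧ cutCoord v τ x b = 1 := by
    by_contra! h
    exact hu ⟨hx, fun i j hij hi hj => h i j hij hi hj⟩
  obtain ⟨a, b, hab, ha, hb⟩ := key
  have h : ∀ π : Equiv.Perm (Fin 5), x ∈ torusRegion v τ π →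
      ∀ k, (k = 2 ∨ k = 3) ↔ (π k = a ∨ π k = b) := by
    intro π hπ
    have hlt : ∀ c, cutCoord v τ x c = 1 → π.symm c = 2 ∨ π.symm c = 3 := by
      intro c hc
      by_contra! hne
      refine ((inTorusCell_of_mem hv h1 hx hπ).coord_lt_one _ hne.1 hne.2).ne ?_
      simpa using hc
    have hne : π.symm a ≠ π.symm b := fun h => hab (π.symm.injective h)
    intro k
    rw [← Equiv.eq_symm_apply, ← Equiv.eq_symm_apply]
    rcases hlt a ha with e | e <;> rcases hlt b hb with e' | e'
    · exact absurd (e.trans e'.symm) hne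
    · rw [e, e']
    · rw [e, e', or_comm]
    · exact absurd (e.trans e'.symm) hne
  rw [h π' hπ' j, h π hπ]
  simp

/-- At a point of a torus the two charts share the coordinate `torusX` for `π`; the second chart
uses its image under the affine map `reindex σ`. Hence the transition is a composition of group
elements with `reindex σ`. -/
theorem IsTorusChart.transition {l l' : CellLabel} {π π' : Equiv.Perm (Fin 5)}
    {e e' : OpenPartialHomeomorph (SpaceX v τ) E4} (he : IsTorusChart v τ l π e)
    (he' : IsTorusChart v τ l' π' e') {l₁ : CellLabel} {x : cutSimplex v τ}
    (hu : (x : E4) ∉ uncutPart v τ) (hm : cellPt v τ _ l₁ x ∈ e.source)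
    (hm' : cellPt v τ _ l₁ x ∈ e'.source) :
    ContDiffAt ℝ ∞ (e.symm.trans e') (e (cellPt v τ _ l₁ x)) ∧
      0 < (fderiv ℝ (e.symm.trans e') (e (cellPt v τ _ l₁ x))).det := by
  classical
  have hk : 0 < cutLevel τ - 2 := by linarith [(cutLevel_mem h1 h2).1]
  obtain ⟨hO, g, hg⟩ := he.exists_label hv h1 h2 hm
  obtain ⟨hO', g', hg'⟩ := he'.exists_label hv h1 h2 hm'
  set σ := π'.trans π.symm with hσdef
  have hσ := perm_of_not_mem_uncutPart hv h1 x.2 hu hO hO'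
  have hπσ : ∀ k, π (σ k) = π' k := fun k => by simp [σ]
  have hcσ : ∀ y : E4, cutCoord v τ y ∘ π' = (cutCoord v τ y ∘ π) ∘ σ := fun y => by
    ext k
    simp [σ]
  let F : CellLabel → E4 → E4 := fun l₂ =>
    if h : ∃ g, cornerLabel l π g = l₂ then sec4 h.choose else id
  have hF : ∀ g, F (cornerLabel l π g) = sec4 g := by
    intro g
    have h : ∃ g', cornerLabel l π g' = cornerLabel l π g := ⟨g, rfl⟩
    simp only [F, h, dif_pos]
    rw [cornerLabel_injective l π (congrArg Prod.snd h.choose_spec)]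
  let F' : CellLabel → E4 → E4 := fun l₂ =>
    if h : ∃ g, cornerLabel l' π' g = l₂ then sec4 h.choose ∘ reindex σ else id
  have hF' : ∀ g, F' (cornerLabel l' π' g) = sec4 g ∘ reindex σ := by
    intro g
    have h : ∃ g', cornerLabel l' π' g' = cornerLabel l' π' g := ⟨g, rfl⟩
    simp only [F', h, dif_pos]
    rw [cornerLabel_injective l' π' (congrArg Prod.snd h.choose_spec)]
  let R : Fin 5 ⊕ Fin 5 → E4 → E4 := fun a =>
    if h : ∃ s, cornerFacet π s = a then sec4 (cornerNb h.choose (0, 0)) else id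
  have hR : ∀ s, R (cornerFacet π s) = sec4 (cornerNb s (0, 0)) := by
    intro s
    have h : ∃ s', cornerFacet π s' = cornerFacet π s := ⟨s, rfl⟩
    have hs := h.choose_spec
    simp only [R, h, dif_pos]
    congr 2
    generalize h.choose = s' at hs
    fin_cases s <;> fin_cases s' <;> simp [cornerFacet] at hs ⊢
  have hlab : ∀ l₂, Linked v τ x l₁ l₂ → ∃ g, l₂ = cornerLabel l π g := fun l₂ h => by
    rw [hg] at h
    obtain ⟨g₂, e, -⟩ := linked_cornerLabel hv h1 h2 x.2 hO h
    exact ⟨g₂, e⟩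
  have hlab' : ∀ l₂, Linked v τ x l₁ l₂ → ∃ g, l₂ = cornerLabel l' π' g := fun l₂ h => by
    rw [hg'] at h
    obtain ⟨g₂, e, -⟩ := linked_cornerLabel hv h1 h2 x.2 hO' h
    exact ⟨g₂, e⟩
  have hcc : Continuous fun y : cutSimplex v τ => cutCoord v τ y ∘ π :=
    continuous_pi fun i => (continuous_apply (π i)).comp (continuous_cutCoord.comp continuous_subtype_val)
  have hnear : ∀ π : Equiv.Perm (Fin 5), (x : E4) ∈ torusRegion v τ π →
      ∀ᶠ y : cutSimplex v τ in 𝓝 x, (y : E4) ∈ torusRegion v τ π := fun π h =>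
    continuous_subtype_val.continuousAt.eventually ((isOpen_torusRegion π).mem_nhds h)
  -- The common coordinate is `torusX` rather than the polytope point: the charts are not known to
  -- extend smoothly in the affine coordinates across the torus.
  let χ : cutSimplex v τ → E4 := fun y => torusX (cutCoord v τ y ∘ π)
  have hχ : ContinuousAt χ x := by
    have h3 := (continuousOn_torusX hk) _ (inTorusCell_of_mem hv h1 x.2 hO)
    exact h3.tendsto.comp (tendsto_nhdsWithin_iff.2 ⟨hcc.continuousAt, by
      filter_upwards [hnear π hO] with y hy using inTorusCell_of_mem hv h1 y.2 hy⟩)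
  have hcom : ∀ V ∈ 𝓝 (χ x), ∀ᶠ m in 𝓝 (cellPt v τ _ l₁ x), ∃ z ∈ V, e m = F l₁ z ∧ e' m = F' l₁ z := by
    intro V hV
    refine exists_common_coord hχ (R := R) ?_ ?_ ?_ ?_ ?_ hV
    · intro a ha
      obtain ⟨s, rfl⟩ := atCorner_of_mem_torusRegion hv h1 h2 x.2 hO a ha
      rw [hR]
      have := (contDiff_sec4 (cornerNb s (0, 0))).continuous.tendsto (χ x)
      rwa [sec4_cornerNb_of_eq_zero ((cornerFacet_iff hv h1 h2 x.2 hO s).1 ha)] at this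
    · intro l₂ h
      obtain ⟨g₂, rfl⟩ := hlab l₂ h
      filter_upwards [hnear π hO] with y hy
      rw [hF, (he.apply g₂ y hy).2, torusDev]
    · intro l₂ h
      obtain ⟨g₂, rfl⟩ := hlab' l₂ h
      filter_upwards [hnear π' hO', hnear π hO] with y hy hyπ
      rw [hF', (he'.apply g₂ y hy).2, torusDev, hcσ,
        torusX_perm hσ ((inTorusCell_of_mem hv h1 y.2 hyπ).legSum_pos hk).ne']
      rfl
    · intro l₂ h a ha
      obtain ⟨g₂, rfl⟩ := hlab l₂ h
      obtain ⟨s, rfl⟩ := atCorner_of_mem_torusRegion hv h1 h2 x.2 hO a ha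
      rw [crossFacet_cornerLabel, hF, hF, hR]
      exact .of_eq (funext fun d => sec4_cornerNb s g₂ d)
    · intro l₂ h a ha
      obtain ⟨g₂, rfl⟩ := hlab' l₂ h
      obtain ⟨s, rfl⟩ := atCorner_of_mem_torusRegion hv h1 h2 x.2 hO a ha
      obtain ⟨s', hs'⟩ := atCorner_of_mem_torusRegion hv h1 h2 x.2 hO' _ ha
      have hss : σ s'.castSucc = s.castSucc := by
        refine π.injective ?_
        rw [hπσ]
        fin_cases s <;> fin_cases s' <;> simp [cornerFacet] at hs' ⊢ <;> simp [hs']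
      rw [hs', crossFacet_cornerLabel, ← hs', hF', hF', hR]
      refine .of_eq (funext fun d => ?_)
      show sec4 _ _ = sec4 _ (reindex σ (sec4 _ d))
      rw [reindex_sec4 hσ hss, ← sec4_cornerNb]
  have hsec := contDiff_sec4 g
  have hsec' := contDiff_sec4 g'
  have hre := contDiff_reindex σ
  have hF1 : F l₁ = sec4 g := by rw [hg, hF]
  have hF2 : F' l₁ = sec4 g' ∘ reindex σ := by rw [hg', hF']
  have d1 : 0 < boolSign l₁.1 * boolSign l.1 * (fderiv ℝ (sec4 g) (χ x)).det := by
    rw [hg, boolSign_cornerLabel]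
    refine lt_of_lt_of_eq (det_sec4 g (χ x)) ?_
    linear_combination (boolSign (sectorOdd g.1 ^^ sectorOdd g.2) *
      (fderiv ℝ (sec4 g) (χ x)).det) * boolSign_mul_self l.1
  have d2 : 0 < boolSign l₁.1 * boolSign l'.1 * (fderiv ℝ (sec4 g') (reindex σ (χ x))).det := by
    rw [hg', boolSign_cornerLabel]
    refine lt_of_lt_of_eq (det_sec4 g' (reindex σ (χ x))) ?_
    linear_combination (boolSign (sectorOdd g'.1 ^^ sectorOdd g'.2) *
      (fderiv ℝ (sec4 g') (reindex σ (χ x))).det) * boolSign_mul_self l'.1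
  -- The sign of the affine change is obtained at the centre of the Klein ball, where the two
  -- `torusKlein` maps differ by the same `reindex σ` and their signs were built into the base
  -- labels.
  have d3 : 0 < boolSign l.1 * boolSign l'.1 * (reindexL σ).det := by
    have h0 : (0 : E4) ∈ Metric.ball (0 : E4) 1 := by simp
    have heq : torusKlein v π' =ᶠ[𝓝 (0 : E4)] reindex σ ∘ torusKlein v π := by
      filter_upwards [Metric.isOpen_ball.mem_nhds h0] with y hy
      have hcσ' : cutCoord v 1 y ∘ π' = (cutCoord v 1 y ∘ π) ∘ σ := by
        ext k
        simp [σ]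
      show torus5 _ = reindex σ (torus5 _)
      rw [hcσ', torus5_perm hσ (sum_comp_perm_cutCoord_one hv π y)
        (cuspForm_pos (comp_perm_cutCoord_mem hv hy)).ne']
    have a1 := he.sign 0 h0
    have a2 := he'.sign 0 h0
    rw [heq.fderiv_eq, det_fderiv_comp (hre.differentiable (by simp)).differentiableAt
      ((contDiffAt_torusKlein hv π h0).differentiableAt (by simp)), fderiv_reindex] at a2
    have a3 := mul_pos a1 a2
    have a4 : 0 < (fderiv ℝ (torusKlein v π) 0).det ^ 2 :=
      sq_pos_of_ne_zero (right_ne_zero_of_mul a1.ne')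
    refine pos_of_mul_pos_left (lt_of_lt_of_eq a3 ?_) a4.le
    ring
  have key := transition_of_common_coord (e' := e') (z := χ x) (m := cellPt v τ _ l₁ x) hm
    (F := F l₁) (F' := F' l₁) (by rw [hF1]; exact hsec.contDiffAt)
    (by rw [hF2]; exact (hsec'.comp hre).contDiffAt)
    (by rw [hF1]; exact right_ne_zero_of_mul d1.ne') hcom
    (by
      obtain ⟨z, -, h3, -⟩ := (hcom _ Filter.univ_mem).self_of_nhds
      rw [hF1, hg, (he.apply g x hO).2]
      rfl)
  refine ⟨key.1, ?_⟩
  rw [key.2, hF1, hF2, det_fderiv_comp (hsec'.differentiable (by simp)).differentiableAt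
      (hre.differentiable (by simp)).differentiableAt, fderiv_reindex]
  have d4 := mul_pos (mul_pos d1 d2) d3
  have d5 : 0 < ((fderiv ℝ (sec4 g) (χ x)).det)⁻¹ ^ 2 := 
    sq_pos_of_ne_zero (inv_ne_zero (right_ne_zero_of_mul d1.ne'))
  have hne := right_ne_zero_of_mul d1.ne'
  refine lt_of_lt_of_eq (mul_pos d4 d5) ?_
  have b1 := boolSign_mul_self l.1
  have b2 := boolSign_mul_self l'.1
  have b3 := boolSign_mul_self l₁.1
  generalize (fderiv ℝ (sec4 g) (χ x)).det = D at *
  generalize (fderiv ℝ (sec4 g') (reindex σ (χ x))).det = D' at *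
  generalize (reindexL σ).det = S
  have : boolSign l₁.1 * boolSign l.1 * D * (boolSign l₁.1 * boolSign l'.1 * D') *
      (boolSign l.1 * boolSign l'.1 * S) * D⁻¹ ^ 2 = (boolSign l₁.1 * boolSign l₁.1) *
      (boolSign l.1 * boolSign l.1) * (boolSign l'.1 * boolSign l'.1) * (D * D⁻¹) * (D' * S * D⁻¹) := by
    ring
  rw [this, b1, b2, b3, mul_inv_cancel₀ hne]
  ring

theorem exists_mem_torusRegion {x : E4} (hx : x ∈ cutSimplex v τ) (hu : x ∉ uncutPart v τ) :
    ∃ π, x ∈ torusRegion v τ π := by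
  have hτ : 0 < τ + 2 / 3 := by linarith
  have hk := cutLevel_mem h1 h2
  have hc := (mem_cutSimplex_iff hτ).1 hx
  obtain ⟨i, j, hij, hi, hj⟩ : ∃ a b, a ≠ b ∧ cutCoord v τ x a = 1 ∧ cutCoord v τ x b = 1 := by
    by_contra! h
    exact hu ⟨hx, fun i j hij hi hj => h i j hij hi hj⟩
  -- The coordinate sum exceeds 2, so some coordinate besides the two ones is positive; its index
  -- becomes the distinguished corner `π 4`.
  obtain ⟨m, hmi, hmj, hm⟩ : ∃ m, m ≠ i ∧ m ≠ j ∧ 0 < cutCoord v τ x m := by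
    by_contra! h
    have h3 : ∑ k, cutCoord v τ x k ≤ ∑ k, ((if k = i then 1 else 0) + if k = j then 1 else 0) := by
      refine Finset.sum_le_sum fun k _ => ?_
      by_cases hki : k = i
      · rw [hki, hi, if_pos rfl, if_neg hij]; norm_num
      by_cases hkj : k = j
      · rw [hkj, hj, if_pos rfl, if_neg hij.symm]; norm_num
      · rw [if_neg hki, if_neg hkj]; simpa using h k hki hkj
    rw [sum_cutCoord hv hτ, Finset.sum_add_distrib, Finset.sum_ite_eq', Finset.sum_ite_eq'] at h3
    norm_num at h3
    linarith
  obtain ⟨π, hI, hJ⟩ := exists_perm_of_disjoint (I := Finset.univ \ {i, j, m}) (J := {i, j})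
    (by
      refine Finset.disjoint_left.2 fun k hk hk' => ?_
      simp at hk hk'
      tauto)
    (by
      rw [Finset.card_sdiff_of_subset (Finset.subset_univ _),
        Finset.card_eq_three.2 ⟨i, j, m, hij, hmi.symm, hmj.symm, rfl⟩]
      simp)
    (Finset.card_le_two)
  have h4 : π 4 = m := by
    by_contra h
    have h5 : π 4 ≠ π 0 ∧ π 4 ≠ π 1 ∧ π 4 ≠ π 2 ∧ π 4 ≠ π 3 := by simp
    by_cases h6 : π 4 = i ∨ π 4 = j
    · have := hJ (π 4) (by simpa using h6)
      tauto
    · have := hI (π 4) (by simp; tauto)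
      tauto
  have h23 : cutCoord v τ x (π 2) = 1 ∧ cutCoord v τ x (π 3) = 1 := by
    have a := hJ i (by simp)
    have b := hJ j (by simp)
    rcases a with a | a <;> rcases b with b | b
    · exact absurd (a.trans b.symm) hij
    · exact ⟨a ▸ hi, b ▸ hj⟩
    · exact ⟨b ▸ hj, a ▸ hi⟩
    · exact absurd (a.trans b.symm) hij
  have hs : ∑ k, cutCoord v τ x (π k) = cutLevel τ :=
    (Equiv.sum_comp π (cutCoord v τ x)).trans (sum_cutCoord hv hτ x)
  rw [Fin.sum_univ_five, h23.1, h23.2] at hs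
  refine ⟨π, by rw [h4]; exact hm, ?_⟩
  have hg : faceGap (cutCoord v τ x ∘ π) = 0 := by
    show 2 - cutCoord v τ x (π 2) - cutCoord v τ x (π 3) = 0
    rw [h23.1, h23.2]; norm_num
  have hl : legSum (cutCoord v τ x ∘ π) = cutLevel τ - 2 := by
    show cutCoord v τ x (π 0) + cutCoord v τ x (π 1) + cutCoord v τ x (π 4) = _
    linarith
  rw [hg, hl, zero_mul, Real.sqrt_zero]
  linarith

omit h1 h2

/-- The charts of the closed manifold: the charts of its hyperbolic part and those around the
tori. -/
def CuspOpening.charts (K : CuspOpening v τ) : Set (OpenPartialHomeomorph (SpaceX v τ) E4) :=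
  {e | (∃ e₀ A, IsKleinChart v e₀ A ∧ e = K.κ.symm.trans e₀) ∨ ∃ l π, IsTorusChart v τ l π e}

include h1 h2

/-- On the hyperbolic part all charts, pulled back to `M`, develop via the Klein reflections. Off it
only torus charts are present. -/
theorem CuspOpening.transition (K : CuspOpening v τ) {e e' : OpenPartialHomeomorph (SpaceX v τ) E4}
    (he : e ∈ K.charts) (he' : e' ∈ K.charts) {m : SpaceX v τ} (hm : m ∈ e.source)
    (hm' : m ∈ e'.source) : ContDiffAt ℝ ∞ (e.symm.trans e') (e m) ∧
      0 < (fderiv ℝ (e.symm.trans e') (e m)).det := by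
  have hdev : ∀ e ∈ K.charts, ∃ F, DevelopsVia (kleinRefl v) (K.κ.trans e) 1 F := by
    rintro e (⟨e₀, A, h, rfl⟩ | ⟨l, π, h⟩)
    · exact h.developsVia K
    · exact h.developsVia hv h1 h2 K
  by_cases hk : m ∈ K.κ.target
  · obtain ⟨F, hF⟩ := hdev e he
    obtain ⟨F', hF'⟩ := hdev e' he'
    have hp : K.κ (K.κ.symm m) = m := K.κ.right_inv hk
    have key := hF.transition (tendsto_kleinRefl hv) hF' (m := K.κ.symm m)
      ⟨K.mem_source _, (congrArg (· ∈ e.source) hp).mpr hm⟩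
      ⟨K.mem_source _, (congrArg (· ∈ e'.source) hp).mpr hm'⟩
    rw [one_mul, one_mul, show (K.κ.trans e) (K.κ.symm m) = e m from congrArg e hp] at key
    have heq : ((K.κ.trans e).symm.trans (K.κ.trans e') : E4 → E4) =ᶠ[𝓝 (e m)] e.symm.trans e' := by
      have hc := e.continuousAt_symm (e.map_source hm)
      rw [ContinuousAt, e.left_inv hm] at hc
      filter_upwards [hc.eventually (K.κ.open_target.mem_nhds hk)] with d hd
      exact congrArg e' (K.κ.right_inv hd)
    rw [heq.fderiv_eq] at key
    exact ⟨key.1.congr_of_eventuallyEq heq.symm, key.2⟩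
  · obtain ⟨l, x, rfl⟩ := exists_cellPt m
    have hu : (x : E4) ∉ uncutPart v τ := fun h => hk ((K.mem_target l x).2 h)
    rcases he with ⟨e₀, A, h, rfl⟩ | ⟨l₁, π, h⟩
    · exact absurd hm.1 hk
    rcases he' with ⟨e₀, A, h', rfl⟩ | ⟨l₁', π', h'⟩
    · exact absurd hm'.1 hk
    exact h.transition hv h1 h2 h' hu hm hm'

theorem CuspOpening.exists_chart (K : CuspOpening v τ) (m : SpaceX v τ) :
    ∃ e ∈ K.charts, m ∈ e.source := by
  by_cases hk : m ∈ K.κ.target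
  · obtain ⟨e, A, he, hm⟩ := exists_isKleinChart hv (K.κ.symm m)
    exact ⟨_, .inl ⟨e, A, he, rfl⟩, hk, hm⟩
  · obtain ⟨l, x, rfl⟩ := exists_cellPt m
    obtain ⟨π, hπ⟩ := exists_mem_torusRegion hv h1 h2 x.2 fun h => hk ((K.mem_target l x).2 h)
    obtain ⟨l₀, e, he, hm⟩ := exists_isTorusChart hv h1 h2 l hπ
    exact ⟨e, .inr ⟨l₀, π, he⟩, hm⟩

/-- The smooth structure of the closed manifold. -/
@[reducible] def CuspOpening.chartedSpace (K : CuspOpening v τ) : ChartedSpace E4 (SpaceX v τ) where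
  atlas := K.charts
  chartAt m := (K.exists_chart hv h1 h2 m).choose
  mem_chart_source m := (K.exists_chart hv h1 h2 m).choose_spec.2
  chart_mem_atlas m := (K.exists_chart hv h1 h2 m).choose_spec.1

theorem CuspOpening.isManifold (K : CuspOpening v τ) :
    @IsManifold ℝ _ _ _ _ _ _ (𝓡 4) ∞ (SpaceX v τ) _ (K.chartedSpace hv h1 h2) := by
  let := K.chartedSpace hv h1 h2
  exact isManifold_of_contDiffAt fun e he e' he' m hm hm' => (K.transition hv h1 h2 he he' hm hm').1

theorem CuspOpening.isOrientable4 (K : CuspOpening v τ) :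
    @IsOrientable4 (SpaceX v τ) _ (K.chartedSpace hv h1 h2) := by
  let := K.chartedSpace hv h1 h2
  have := K.isManifold hv h1 h2
  refine ⟨K.charts, fun e he => IsManifold.subset_maximalAtlas he, K.exists_chart hv h1 h2,
    fun e he e' he' x hx => ?_⟩
  have h := (K.transition hv h1 h2 he he' (e.map_target hx.1) hx.2).2
  rwa [e.right_inv hx.1] at h

theorem secondCountableTopology_spaceX : SecondCountableTopology (SpaceX v τ) := by
  obtain ⟨K⟩ := nonempty_cuspOpening hv h1 h2
  let := K.chartedSpace hv h1 h2
  have : CompactSpace (SpaceX v τ) := compactSpace_coverGluing (isCompact_cutSimplex (by linarith) hv)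
  exact ChartedSpace.secondCountable_of_sigmaCompact E4 (SpaceX v τ)

end ClosedManifold

/-! ### The hyperbolic manifold as a smooth open subset -/

section CuspDiffeo

variable {v : Fin 5 → E4} {τ : ℝ} (hv : IsRegularSimplex v) (h1 : 4 / 9 < τ) (h2 : τ < 1)
include hv h1 h2

/-- Charts of `M` transported by `κ` belong to the atlas of `X`, so in such charts the map is the
identity. -/
theorem CuspOpening.contMDiffAt_symm (K : CuspOpening v τ) {m : SpaceX v τ} (hm : m ∈ K.κ.target) :
    letI := K.chartedSpace hv h1 h2
    letI := kleinChartedSpace hv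
    ContMDiffAt (𝓡 4) (𝓡 4) ∞ K.κ.symm m := by
  let := K.chartedSpace hv h1 h2
  let := kleinChartedSpace hv
  have := K.isManifold hv h1 h2
  have := isManifold_kleinChartedSpace hv
  obtain ⟨e, A, he, hs⟩ := exists_isKleinChart hv (K.κ.symm m)
  have he1 : e ∈ IsManifold.maximalAtlas (𝓡 4) ∞ (SpaceM v) := IsManifold.subset_maximalAtlas ⟨A, he⟩
  have he2 : K.κ.symm.trans e ∈ IsManifold.maximalAtlas (𝓡 4) ∞ (SpaceX v τ) :=
    IsManifold.subset_maximalAtlas (.inl ⟨e, A, he, rfl⟩)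
  have hms : m ∈ (K.κ.symm.trans e).source := ⟨hm, hs⟩
  refine (contMDiffAt_iff_of_mem_maximalAtlas he2 he1 hms hs).2 ⟨K.κ.continuousAt_symm hm, ?_⟩
  refine contDiffWithinAt_id.congr_of_eventuallyEq (f := id) ?_ ?_
  · filter_upwards [mem_nhdsWithin_of_mem_nhds ((K.κ.symm.trans e).open_target.mem_nhds
      ((K.κ.symm.trans e).map_source hms))] with d hd
    exact (K.κ.symm.trans e).right_inv hd
  · exact (K.κ.symm.trans e).right_inv ((K.κ.symm.trans e).map_source hms)

theorem CuspOpening.contMDiffAt (K : CuspOpening v τ) (m : SpaceM v) :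
    letI := K.chartedSpace hv h1 h2
    letI := kleinChartedSpace hv
    ContMDiffAt (𝓡 4) (𝓡 4) ∞ K.κ m := by
  let := K.chartedSpace hv h1 h2
  let := kleinChartedSpace hv
  have := K.isManifold hv h1 h2
  have := isManifold_kleinChartedSpace hv
  obtain ⟨e, A, he, hs⟩ := exists_isKleinChart hv m
  have he1 : e ∈ IsManifold.maximalAtlas (𝓡 4) ∞ (SpaceM v) := IsManifold.subset_maximalAtlas ⟨A, he⟩
  have he2 : K.κ.symm.trans e ∈ IsManifold.maximalAtlas (𝓡 4) ∞ (SpaceX v τ) :=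
    IsManifold.subset_maximalAtlas (.inl ⟨e, A, he, rfl⟩)
  have hinv : ∀ m, K.κ.symm (K.κ m) = m := fun m => K.κ.left_inv (K.mem_source m)
  have hms : K.κ m ∈ (K.κ.symm.trans e).source :=
    ⟨K.κ.map_source (K.mem_source m), (congrArg (· ∈ e.source) (hinv m)).mpr hs⟩
  refine (contMDiffAt_iff_of_mem_maximalAtlas he1 he2 hs hms).2
    ⟨K.κ.continuousAt (K.mem_source m), ?_⟩
  have key : ∀ d ∈ e.target, (K.κ.symm.trans e) (K.κ (e.symm d)) = d := fun d hd =>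
    (congrArg e (hinv _)).trans (e.right_inv hd)
  refine contDiffWithinAt_id.congr_of_eventuallyEq (f := id) ?_ ?_
  · filter_upwards [mem_nhdsWithin_of_mem_nhds (e.open_target.mem_nhds (e.map_source hs))] with d hd
    exact key d hd
  · exact key _ (e.map_source hs)

theorem CuspOpening.nonempty_diffeomorph (K : CuspOpening v τ)
    (U : TopologicalSpace.Opens (SpaceX v τ)) (hU : (U : Set (SpaceX v τ)) = K.κ.target) :
    letI := K.chartedSpace hv h1 h2
    letI := kleinChartedSpace hv
    Nonempty (U ≃ₘ^∞⟮𝓡 4, 𝓡 4⟯ SpaceM v) := by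
  let := K.chartedSpace hv h1 h2
  let := kleinChartedSpace hv
  have hmem : ∀ m, K.κ m ∈ U := fun m => by
    rw [← SetLike.mem_coe, hU]
    exact K.κ.map_source (K.mem_source m)
  have hmem' : ∀ m : U, (m : SpaceX v τ) ∈ K.κ.target := fun m => by
    rw [← hU]
    exact m.2
  refine ⟨⟨⟨fun m => K.κ.symm m, fun m => ⟨K.κ m, hmem m⟩, fun m => Subtype.ext ?_, fun m => ?_⟩,
    fun m => ?_, fun m => ?_⟩⟩
  · exact K.κ.right_inv (hmem' m)
  · exact K.κ.left_inv (K.mem_source m)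
  · exact contMDiffAt_subtype_iff.2 (K.contMDiffAt_symm hv h1 h2 (hmem' m))
  · exact (ContMDiffAt.subtypeVal_comp_iff U _ m).1 (K.contMDiffAt hv h1 h2 m)

end CuspDiffeo

/-! ### The triangulation of a rectangular torus -/

/-- Barycentric coordinates of a point of a triangle. -/
def IsBary (b : ZMod 3 → ℝ) : Prop := (∀ d, 0 ≤ b d) ∧ ∑ d, b d = 1

/-- The distance of a point of the `t`-th triangle of a strip from the lower side of the strip. -/
def stripHeight (t : ℤ) (b : ZMod 3 → ℝ) : ℝ := if Even t then b t else 1 - b t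

/-- The position of a point of the `t`-th triangle along its strip. -/
def stripPos (t : ℤ) (b : ZMod 3 → ℝ) : ℝ := t + b (t + 1) - b (t + 2)

/-- The map of the `t`-th triangle of one of the two strips to the torus. -/
def stripMap (r : Bool) (t : ℤ) (b : ZMod 3 → ℝ) : Circle × Circle :=
  (Circle.exp (Real.pi * (boolSign r * stripHeight t b)), Circle.exp (Real.pi / 3 * stripPos t b))

/-- The affine reflection of barycentric coordinates that fixes the side opposite to a vertex. -/
def reflBary (d : ZMod 3) (b : ZMod 3 → ℝ) : ZMod 3 → ℝ := fun e => if e = d then -b d else b e + b d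

/-- The triangles reached from a triangle of the strips by crossing the sides through a point. -/
def StripLinked (b : ZMod 3 → ℝ) : Bool × ℤ → Bool × ℤ → Prop :=
  Relation.ReflTransGen fun x y => (b x.2 = 0 ∧ y = (!x.1, x.2)) ∨
    (b (x.2 + 2) = 0 ∧ y = (x.1, x.2 + 1)) ∨ (b (x.2 + 1) = 0 ∧ y = (x.1, x.2 - 1))

theorem zmod_three_cases : ∀ d e : ZMod 3, e = d ∨ e = d + 1 ∨ e = d + 2 := by decide

theorem zmod_three_add : ∀ d : ZMod 3, d + 1 + 1 = d + 2 ∧ d + 1 + 2 = d ∧ d + 2 + 1 = d ∧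
    d + 2 + 2 = d + 1 := by decide

theorem zmod_three_ne : ∀ d : ZMod 3, d + 1 ≠ d ∧ d + 2 ≠ d ∧ d + 1 ≠ d + 2 := by decide

theorem sum_zmod_three (b : ZMod 3 → ℝ) (d : ZMod 3) : ∑ e, b e = b d + b (d + 1) + b (d + 2) := by
  have h : ∀ d : ZMod 3, (Finset.univ : Finset (ZMod 3)) = {d, d + 1, d + 2} := by decide
  obtain ⟨h1, h2, h3⟩ := zmod_three_ne d
  rw [h d, Finset.sum_insert (by simp [h1.symm, h2.symm]), Finset.sum_insert (by simp [h3]),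
    Finset.sum_singleton, add_assoc]

theorem ext_zmod_three {b b' : ZMod 3 → ℝ} (d : ZMod 3) (h0 : b d = b' d)
    (h1 : b (d + 1) = b' (d + 1)) (h2 : b (d + 2) = b' (d + 2)) : b = b' := by
  ext e
  rcases zmod_three_cases d e with rfl | rfl | rfl <;> assumption

theorem circle_exp_add_two_pi_mul (x : ℝ) (n : ℤ) :
    Circle.exp (x + n * (2 * Real.pi)) = Circle.exp x := Circle.exp_eq_exp.2 ⟨n, rfl⟩

/-- A step of 6 preserves the residue mod 3, hence the vertex labels, and the parity; the position
moves by one full turn. -/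
theorem stripMap_congr {r : Bool} {t t' : ℤ} (h : (t : ZMod 6) = t') (b : ZMod 3 → ℝ) :
    stripMap r t b = stripMap r t' b := by
  obtain ⟨n, hn⟩ : (6 : ℤ) ∣ t' - t := (ZMod.intCast_eq_intCast_iff_dvd_sub t t' 6).1 h
  obtain rfl : t' = t + 6 * n := by omega
  have h3 : ((t + 6 * n : ℤ) : ZMod 3) = t := by
    push_cast
    rw [show (6 : ZMod 3) = 0 from rfl, zero_mul, add_zero]
  have h2 : Even (t + 6 * n) ↔ Even t := by
    rw [Int.even_add]
    exact iff_of_eq (by simp [show Even (6 * n) from ⟨3 * n, by ring⟩])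
  rw [stripMap, stripMap, stripHeight, stripHeight, stripPos, stripPos, h3]
  refine Prod.ext ?_ ?_
  · simp only [h2]
  · refine (circle_exp_add_two_pi_mul _ n).symm.trans (congrArg _ ?_)
    push_cast
    ring

section Reflections

variable {b : ZMod 3 → ℝ} (hb : ∑ d, b d = 1) (r : Bool) (t : ℤ)
include hb

-- Crossing to the other strip reflects the height. For odd `t` the common side is at height 1, so
-- the two angles agree only up to a full turn.
omit hb in
theorem stripMap_not : stripMap (!r) t b = stripMap r t (reflBary t b) := by
  obtain ⟨h1, h2, h3⟩ := zmod_three_ne (t : ZMod 3)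
  refine Prod.ext ?_ ?_
  · simp only [stripMap, stripHeight, reflBary, boolSign_not, if_true]
    by_cases he : Even t
    · simp only [he, if_true]
      congr 1; ring
    · simp only [he, if_false]
      obtain ⟨n, hn⟩ : ∃ n : ℤ, boolSign r = n := by
        cases r
        · exact ⟨-1, by simp [boolSign]⟩
        · exact ⟨1, by simp [boolSign]⟩
      rw [← circle_exp_add_two_pi_mul _ n]
      congr 1
      rw [hn]
      ring
  · simp only [stripMap, stripPos, reflBary, h1, h2, if_false]
    congr 1; ring

theorem stripMap_add_one : stripMap r (t + 1) b = stripMap r t (reflBary (t + 2) b) := by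
  obtain ⟨h1, h2, h3⟩ := zmod_three_ne (t : ZMod 3)
  obtain ⟨a1, a2, a3, a4⟩ := zmod_three_add (t : ZMod 3)
  rw [sum_zmod_three b t] at hb
  refine Prod.ext ?_ ?_
  · simp only [stripMap, stripHeight, reflBary, Int.even_add_one, Int.cast_add, Int.cast_one, h2.symm,
      if_false]
    by_cases he : Even t
    · simp only [he, if_true, not_true, if_false]
      congr 3; linarith
    · simp only [he, if_false, not_false_iff, if_true]
      congr 3; linarith
  · simp only [stripMap, stripPos, reflBary, Int.cast_add, Int.cast_one, a1, a2, h3, if_false, if_true]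
    congr 2; linarith

theorem stripMap_sub_one : stripMap r (t - 1) b = stripMap r t (reflBary (t + 1) b) := by
  obtain ⟨h1, h2, h3⟩ := zmod_three_ne (t : ZMod 3)
  have e0 : ((t - 1 : ℤ) : ZMod 3) = t + 2 := by
    push_cast
    rw [sub_eq_add_neg]
    rfl
  obtain ⟨a1, a2, a3, a4⟩ := zmod_three_add (t : ZMod 3)
  rw [sum_zmod_three b t] at hb
  refine Prod.ext ?_ ?_
  · simp only [stripMap, stripHeight, reflBary, Int.even_sub_one, e0, h1.symm,
      if_false]
    by_cases he : Even t
    · simp only [he, if_true, not_true, if_false]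
      congr 3; linarith
    · simp only [he, if_false, not_false_iff, if_true]
      congr 3; linarith
  · simp only [stripMap, stripPos, reflBary, e0, a3, a4, h3.symm, if_false, if_true]
    push_cast
    congr 2; linarith

end Reflections

theorem StripLinked.symm {b : ZMod 3 → ℝ} {x y : Bool × ℤ} (h : StripLinked b x y) :
    StripLinked b y x := by
  induction h with
  | refl => exact .refl
  | @tail y z _ h ih =>
    refine .trans (.single ?_) ih
    obtain ⟨a1, a2, a3, a4⟩ := zmod_three_add (y.2 : ZMod 3)
    rcases h with ⟨h, rfl⟩ | ⟨h, rfl⟩ | ⟨h, rfl⟩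
    · exact .inl ⟨h, by simp⟩
    · refine .inr (.inr ⟨?_, by simp⟩)
      push_cast
      rwa [a1]
    · refine .inr (.inl ⟨?_, by simp⟩)
      push_cast
      rwa [show (y.2 : ZMod 3) - 1 + 2 = y.2 + 1 by ring]

theorem stripHeight_mem {b : ZMod 3 → ℝ} (hb : IsBary b) (t : ℤ) :
    0 ≤ stripHeight t b ∧ stripHeight t b ≤ 1 := by
  have h := hb.2
  rw [sum_zmod_three b t] at h
  have := hb.1 t
  have := hb.1 (t + 1)
  have := hb.1 (t + 2)
  rw [stripHeight]
  split_ifs <;> constructor <;> linarith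

/-- A point on the boundary of the strip lies on the outer side of its triangle or is the opposite
vertex. In the latter case the neighbouring triangle has its outer side there, and the strip is
changed through it. -/
theorem stripLinked_not {b : ZMod 3 → ℝ} (hb : IsBary b) (r : Bool) {t : ℤ}
    (h : stripHeight t b = 0 ∨ stripHeight t b = 1) : StripLinked b (r, t) (!r, t) := by
  have hs := hb.2
  rw [sum_zmod_three b t] at hs
  have h1 := hb.1 (t + 1)
  have h2 := hb.1 (t + 2)
  have h' : b t = 0 ∨ b t = 1 := by
    rw [stripHeight] at h
    split_ifs at h
    · exact h
    · rcases h with h | h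
      · exact .inr (by linarith)
      · exact .inl (by linarith)
  rcases h' with h0 | h0
  · exact .single (.inl ⟨h0, rfl⟩)
  · have e2 : b (t + 2) = 0 := by linarith
    have e1 : b (t + 1) = 0 := by linarith
    have s1 : StripLinked b (r, t) (r, t + 1) := .single (.inr (.inl ⟨e2, rfl⟩))
    have s2 : StripLinked b (r, t + 1) (!r, t + 1) :=
      .single (.inl ⟨by push_cast; exact e1, rfl⟩)
    have s3 : StripLinked b (!r, t) (!r, t + 1) := .single (.inr (.inl ⟨e2, rfl⟩))
    exact (s1.trans s2).trans s3.symm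

/-- The position differs from the index of the triangle by at most 1, so indices differ by at most
2. A difference of 1 means the common side, a difference of 2 the common vertex. -/
theorem stripLinked_of_le {b b' : ZMod 3 → ℝ} (hb : IsBary b) (hb' : IsBary b') (r : Bool) {t t' : ℤ}
    (hle : t ≤ t') (hh : stripHeight t b = stripHeight t' b') (hp : stripPos t b = stripPos t' b') :
    b = b' ∧ StripLinked b (r, t) (r, t') := by
  obtain ⟨a1, a2, a3, a4⟩ := zmod_three_add (t : ZMod 3)
  have hs := hb.2
  have hs' := hb'.2
  rw [sum_zmod_three b t] at hs
  rw [sum_zmod_three b' t] at hs'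
  have p0 := hb.1 t
  have p1 := hb.1 (t + 1)
  have p2 := hb.1 (t + 2)
  have q0 := hb'.1 t
  have q1 := hb'.1 (t + 1)
  have q2 := hb'.1 (t + 2)
  obtain ⟨n, rfl⟩ : ∃ n : ℕ, t' = t + n := ⟨(t' - t).toNat, by omega⟩
  rcases n with _ | _ | _ | n
  · simp only [Nat.cast_zero, add_zero] at hh hp ⊢
    simp only [stripHeight, stripPos] at hh hp
    have h0 : b t = b' t := by
      split_ifs at hh <;> linarith
    exact ⟨ext_zmod_three t h0 (by linarith) (by linarith), .refl⟩
  · simp only [zero_add, Nat.cast_one] at hh hp ⊢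
    simp only [stripHeight, stripPos, Int.even_add_one, Int.cast_add, Int.cast_one, a1, a2] at hh hp
    have h0 : 1 - b t = b' (t + 1) := by
      split_ifs at hh <;> linarith
    have e2 : b (t + 2) = 0 := by linarith
    exact ⟨ext_zmod_three t (by linarith) (by linarith) (by linarith),
      .single (.inr (.inl ⟨e2, rfl⟩))⟩
  · have e : (t + ((0 + 1 + 1 : ℕ) : ℤ)) = t + 2 := by norm_num
    rw [e] at hh hp ⊢
    have he : Even (t + 2) ↔ Even t := by simp
    simp only [stripHeight, stripPos, he, Int.cast_add, Int.cast_ofNat, a3, a4] at hh hp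
    have h0 : b t = b' (t + 2) := by
      split_ifs at hh <;> linarith
    have e1 : b (t + 1) = 1 := by linarith
    have e0 : b t = 0 := by linarith
    have e2 : b (t + 2) = 0 := by linarith
    refine ⟨ext_zmod_three t (by linarith) (by linarith) (by linarith), ?_⟩
    have s1 : StripLinked b (r, t) (r, t + 1) := .single (.inr (.inl ⟨e2, rfl⟩))
    have s2 : StripLinked b (r, t + 1) (r, t + 2) := by
      refine .single (.inr (.inl ⟨?_, ?_⟩))
      · push_cast
        rwa [a2]
      · simp [add_assoc]
    exact s1.trans s2
  · exfalso
    have b1 : ∀ (c : ZMod 3 → ℝ), IsBary c → ∀ s : ℤ, |c (s + 1) - c (s + 2)| ≤ 1 := by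
      intro c hc s
      have h := hc.2
      rw [sum_zmod_three c s] at h
      have := hc.1 s
      have := hc.1 (s + 1)
      have := hc.1 (s + 2)
      rw [abs_le]
      constructor <;> linarith
    have h1 := abs_le.1 (b1 b hb t)
    have h2 := abs_le.1 (b1 b' hb' (t + ((n + 1 + 1 + 1 : ℕ) : ℤ)))
    simp only [stripPos] at hp
    have h3 : ((t + ((n + 1 + 1 + 1 : ℕ) : ℤ) : ℤ) : ℝ) = t + n + 3 := by push_cast; ring
    rw [h3] at hp
    have : (0 : ℝ) ≤ n := n.cast_nonneg
    linarith [h1.1, h1.2, h2.1, h2.2]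

/-- Injectivity up to gluing. Equal angles mean equal positions modulo 6 and equal signed heights
modulo 2; as heights lie in [0, 1], the strips can differ only on their common boundary lines. -/
theorem stripLinked_of_stripMap_eq {b b' : ZMod 3 → ℝ} (hb : IsBary b) (hb' : IsBary b')
    {r r' : Bool} {t t' : ℤ} (h : stripMap r t b = stripMap r' t' b') :
    b = b' ∧ ∃ t'' : ℤ, (t'' : ZMod 6) = t' ∧ StripLinked b (r, t) (r', t'') := by
  obtain ⟨hA, hB⟩ := Prod.ext_iff.1 h
  obtain ⟨m, hm⟩ := Circle.exp_eq_exp.1 hA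
  obtain ⟨n, hn⟩ := Circle.exp_eq_exp.1 hB
  have hpi := Real.pi_pos
  have hm' : boolSign r * stripHeight t b = boolSign r' * stripHeight t' b' + 2 * m := by
    have := mul_left_cancel₀ hpi.ne' (hm.trans (by ring : _ = Real.pi *
      (boolSign r' * stripHeight t' b' + 2 * m)))
    exact this
  have hn' : stripPos t b = stripPos t' b' + 6 * n := by
    have := mul_left_cancel₀ (show Real.pi / 3 ≠ 0 by positivity) (hn.trans (by ring : _ = Real.pi / 3 *
      (stripPos t' b' + 6 * n)))
    exact this
  have h6 : ((6 * n : ℤ) : ZMod 6) = 0 := by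
    push_cast
    rw [show (6 : ZMod 6) = 0 from rfl, zero_mul]
  have h63 : ((6 * n : ℤ) : ZMod 3) = 0 := by
    push_cast
    rw [show (6 : ZMod 3) = 0 from rfl, zero_mul]
  set t₁ := t' + 6 * n with ht₁
  have ht6 : (t₁ : ZMod 6) = t' := by
    rw [ht₁, Int.cast_add, h6, add_zero]
  have ht3 : (t₁ : ZMod 3) = t' := by
    rw [ht₁, Int.cast_add, h63, add_zero]
  have hev : Even t₁ ↔ Even t' := by
    rw [ht₁, Int.even_add]
    exact iff_of_eq (by simp [show Even (6 * n) from ⟨3 * n, by ring⟩])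
  have hp : stripPos t b = stripPos t₁ b' := by
    rw [hn', stripPos, stripPos, ht3, ht₁]
    push_cast
    ring
  have hH : stripHeight t₁ b' = stripHeight t' b' := by
    simp only [stripHeight, ht3, hev]
  obtain ⟨u0, u1⟩ := stripHeight_mem hb t
  obtain ⟨w0, w1⟩ := stripHeight_mem hb' t'
  have key : stripHeight t b = stripHeight t' b' ∧
      (r = r' ∨ (r' = !r ∧ (stripHeight t b = 0 ∨ stripHeight t b = 1))) := by
    have hmlt : ∀ x : ℝ, x = 2 * m → |x| < 2 → m = 0 := by
      intro x hx hlt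
      rw [hx, abs_lt] at hlt
      have a1 : (-1 : ℝ) < m := by linarith [hlt.1]
      have a2 : (m : ℝ) < 1 := by linarith [hlt.2]
      have a1' : -1 < m := by exact_mod_cast a1
      have a2' : m < 1 := by exact_mod_cast a2
      omega
    by_cases hr : r = r'
    · subst hr
      refine ⟨?_, .inl rfl⟩
      have hm0 : m = 0 := by
        refine hmlt (boolSign r * (stripHeight t b - stripHeight t' b')) (by linarith) ?_
        rw [abs_lt]
        cases r <;> simp only [boolSign, if_true, Bool.false_eq_true, if_false] <;>
          constructor <;> linarith
      rw [hm0] at hm'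
      have := congrArg (boolSign r * ·) hm'
      simp only [Int.cast_zero, mul_zero, add_zero, ← mul_assoc, boolSign_mul_self, one_mul] at this
      exact this
    · have hr' : r' = !r := by revert hr; cases r <;> cases r' <;> simp
      subst hr'
      rw [boolSign_not] at hm'
      have hsum : boolSign r * (stripHeight t b + stripHeight t' b') = 2 * m := by linarith
      by_cases h2 : stripHeight t b + stripHeight t' b' = 2
      · exact ⟨by linarith, .inr ⟨rfl, .inr (by linarith)⟩⟩
      · have hlt : stripHeight t b + stripHeight t' b' < 2 := lt_of_le_of_ne (by linarith) h2
        have hm0 : m = 0 := by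
          refine hmlt _ hsum ?_
          rw [abs_lt]
          cases r <;> simp only [boolSign, if_true, Bool.false_eq_true, if_false] <;>
            constructor <;> linarith
        rw [hm0] at hsum
        have := congrArg (boolSign r * ·) hsum
        simp only [Int.cast_zero, mul_zero, ← mul_assoc, boolSign_mul_self, one_mul] at this
        exact ⟨by linarith, .inr ⟨rfl, .inl (by linarith)⟩⟩
  have hh : stripHeight t b = stripHeight t₁ b' := by rw [hH]; exact key.1
  have hrow : b = b' ∧ StripLinked b (r, t) (r, t₁) := by
    rcases le_total t t₁ with hle | hle
    · exact stripLinked_of_le hb hb' r hle hh hp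
    · obtain ⟨e, hl⟩ := stripLinked_of_le hb' hb r hle hh.symm hp.symm
      subst e
      exact ⟨rfl, hl.symm⟩
  refine ⟨hrow.1, t₁, ht6, ?_⟩
  rcases key.2 with rfl | ⟨rfl, h01⟩
  · exact hrow.2
  · exact (stripLinked_not hb r h01).trans (by
      rcases le_total t t₁ with hle | hle
      · exact (stripLinked_of_le hb hb' (!r) hle hh hp).2
      · obtain ⟨e, hl⟩ := stripLinked_of_le hb' hb (!r) hle hh.symm hp.symm
        subst e
        exact hl.symm)

/-- The barycentric coordinates with given values at `d + 1` and `d + 2`. -/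
def baryOf (d : ZMod 3) (p : ℝ × ℝ) : ZMod 3 → ℝ := fun e =>
  if e = d then 1 - p.1 - p.2 else if e = d + 1 then p.1 else p.2

theorem baryOf_apply (d : ZMod 3) (p : ℝ × ℝ) : baryOf d p d = 1 - p.1 - p.2 ∧
    baryOf d p (d + 1) = p.1 ∧ baryOf d p (d + 2) = p.2 := by
  obtain ⟨h1, h2, h3⟩ := zmod_three_ne d
  simp [baryOf, h1, h2, h3.symm]

theorem sum_baryOf (d : ZMod 3) (p : ℝ × ℝ) : ∑ e, baryOf d p e = 1 := by
  obtain ⟨h1, h2, h3⟩ := baryOf_apply d p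
  rw [sum_zmod_three _ d, h1, h2, h3]
  ring

theorem isBary_baryOf {d : ZMod 3} {p : ℝ × ℝ} (h1 : 0 ≤ p.1) (h2 : 0 ≤ p.2) (h3 : p.1 + p.2 ≤ 1) :
    IsBary (baryOf d p) := by
  obtain ⟨a1, a2, a3⟩ := baryOf_apply d p
  refine ⟨fun e => ?_, sum_baryOf d p⟩
  rcases zmod_three_cases d e with rfl | rfl | rfl
  · rw [a1]; linarith
  · rw [a2]; exact h1
  · rw [a3]; exact h2

/-- At height `p` an even triangle covers positions within 1 − p of its index and an odd one within
p. The two triangles with indices around `g` together cover the unit interval. -/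
theorem exists_stripPos (p g : ℝ) (h0 : 0 ≤ p) (h1 : p ≤ 1) :
    ∃ t b, IsBary b ∧ stripHeight t b = p ∧ stripPos t b = g := by
  have key : ∀ (t : ℤ) (y : ℝ), (y = if Even t then 1 - p else p) → |g - t| ≤ y →
      ∃ t b, IsBary b ∧ stripHeight t b = p ∧ stripPos t b = g := by
    intro t y hy ht
    have hy1 : y ≤ 1 := by rw [hy]; split_ifs <;> linarith
    rw [abs_le] at ht
    obtain ⟨a1, a2, a3⟩ := baryOf_apply (t : ZMod 3) ((y + (g - t)) / 2, (y - (g - t)) / 2)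
    refine ⟨t, baryOf t ((y + (g - t)) / 2, (y - (g - t)) / 2),
      isBary_baryOf (by simp; linarith) (by simp; linarith) (by simp; linarith), ?_, ?_⟩
    · rw [stripHeight, a1, hy]
      split_ifs <;> ring
    · rw [stripPos, a2, a3]
      ring
  have hf0 := Int.floor_le g
  have hf1 := (Int.lt_floor_add_one g).le
  by_cases he : Even ⌊g⌋
  · rcases le_total (g - ⌊g⌋) (1 - p) with h | h
    · exact key ⌊g⌋ _ rfl (by rw [if_pos he, abs_le]; constructor <;> linarith)
    · refine key (⌊g⌋ + 1) _ rfl ?_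
      rw [if_neg (by simpa [Int.even_add_one] using he), abs_le]
      push_cast
      constructor <;> linarith
  · rcases le_total (g - ⌊g⌋) p with h | h
    · exact key ⌊g⌋ _ rfl (by rw [if_neg he, abs_le]; constructor <;> linarith)
    · refine key (⌊g⌋ + 1) _ rfl ?_
      rw [if_pos (by simpa [Int.even_add_one] using he), abs_le]
      push_cast
      constructor <;> linarith

theorem exists_stripMap_eq (z : Circle × Circle) : ∃ r t b, IsBary b ∧ stripMap r t b = z := by
  have hpi := Real.pi_pos
  obtain ⟨z1, z2⟩ := z
  have h1 := Complex.neg_pi_lt_arg (z1 : ℂ)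
  have h2 := Complex.arg_le_pi (z1 : ℂ)
  obtain ⟨t, b, hb, hh, hp⟩ := exists_stripPos (|Complex.arg z1| / Real.pi)
    (3 / Real.pi * Complex.arg z2) (by positivity)
    (by rw [div_le_one hpi, abs_le]; constructor <;> linarith)
  have hz2 : Circle.exp (Real.pi / 3 * stripPos t b) = z2 := by
    rw [hp, show Real.pi / 3 * (3 / Real.pi * Complex.arg z2) = Complex.arg z2 by field_simp]
    exact Circle.exp_arg z2
  rcases le_total 0 (Complex.arg (z1 : ℂ)) with h | h
  · refine ⟨true, t, b, hb, Prod.ext ?_ hz2⟩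
    show Circle.exp (Real.pi * (1 * stripHeight t b)) = z1
    rw [hh, abs_of_nonneg h, one_mul, mul_div_cancel₀ _ hpi.ne']
    exact Circle.exp_arg z1
  · refine ⟨false, t, b, hb, Prod.ext ?_ hz2⟩
    show Circle.exp (Real.pi * (-1 * stripHeight t b)) = z1
    rw [hh, abs_of_nonpos h, neg_div, neg_one_mul, neg_neg, mul_div_cancel₀ _ hpi.ne']
    exact Circle.exp_arg z1

/-! ### The cells around the tori -/

/-- The labels of the two cutting facets that meet along a torus. -/
def torusPair : Fin 10 → Fin 2 → Fin 5 :=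
  ![![0, 1], ![0, 2], ![0, 3], ![0, 4], ![1, 2], ![1, 3], ![1, 4], ![2, 3], ![2, 4], ![3, 4]]

/-- The remaining labels. -/
def torusRest : Fin 10 → ZMod 3 → Fin 5 :=
  ![![2, 3, 4], ![1, 3, 4], ![1, 2, 4], ![1, 2, 3], ![0, 3, 4], ![0, 2, 4], ![0, 2, 3], ![0, 1, 4],
    ![0, 1, 3], ![0, 1, 2]]

/-- The residue of the index of a triangle of a strip. -/
def stripType : ZMod 6 → ZMod 3 := (![0, 1, 2, 0, 1, 2] : Fin 6 → Fin 3)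

/-- The copies of the polytope in a block that form the first strip of a torus. -/
def torusBlockBase : Fin 10 → ZMod 3 → Fin 6 :=
  ![![2, 0, 4], ![3, 5, 0], ![1, 4, 3], ![0, 3, 4], ![0, 2, 3], ![4, 1, 0], ![2, 4, 5], ![2, 0, 1],
    ![4, 2, 3], ![0, 4, 5]]

/-- The copies of the polytope in a block that form the two strips of a torus. -/
def torusBlock (k : Fin 10) (r : Bool) (t : ZMod 6) : Fin 6 :=
  if r then torusBlockBase k (stripType t)
  else edgeMatch (torusRest k (stripType t)) (torusBlockBase k (stripType t))

/-- The parity of a block around a torus. -/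
def blockOdd (k : Fin 10) (w : Fin 6) : Bool :=
  decide (∃ n, sectorOdd n = true ∧ hexWalk (torusPair k 0) (torusPair k 1) 0 n = w)

/-- The parity of a triangle of a strip. -/
def stripOdd : ZMod 6 → Bool := sectorOdd

/-- A cell of the gluing contains the `t`-th triangle of the strip `r` of a torus. -/
def IsTorusCell (k : Fin 10) (l : CellLabel) (r : Bool) (t : ZMod 6) : Prop :=
  (l.1 ^^ blockOdd k l.2.1) = (r ^^ stripOdd t) ∧ l.2.2 = torusBlock k r t

/-- Blocks around a torus alternate in parity, because the two labels of the pair run along one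
hexagon. -/
theorem blockOdd_edgeMatch : ∀ k s w, blockOdd k (edgeMatch (torusPair k s) w) = !blockOdd k w := by
  decide

theorem blockOdd_hexWalk : ∀ k n,
    blockOdd k (hexWalk (torusPair k 0) (torusPair k 1) 0 n) = sectorOdd n := by decide

/-- These finite checks show that the tables realise the strip pattern: crossing the facet of a
remaining label crosses the side of the triangle opposite to the vertex with this label. -/
theorem torusBlock_not : ∀ k r t,
    torusBlock k (!r) t = edgeMatch (torusRest k (stripType t)) (torusBlock k r t) := by decide

theorem torusBlock_add_one : ∀ k r t,
    torusBlock k r (t + 1) = edgeMatch (torusRest k (stripType t + 2)) (torusBlock k r t) := by decide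

theorem torusBlock_sub_one : ∀ k r t,
    torusBlock k r (t - 1) = edgeMatch (torusRest k (stripType t + 1)) (torusBlock k r t) := by decide

theorem stripOdd_add_one : ∀ t, stripOdd (t + 1) = !stripOdd t := by decide

theorem stripOdd_sub_one : ∀ t, stripOdd (t - 1) = !stripOdd t := by decide

/-- The twelve triangles correspond to the pairs of a parity and a copy in the block, so each of the
72 cells contains exactly one triangle of each torus. -/
theorem exists_torusBlock : ∀ k (c : Bool) u, ∃ r t, c = (r ^^ stripOdd t) ∧ u = torusBlock k r t := by
  decide

theorem torusBlock_injective : ∀ k r t r' t', (r ^^ stripOdd t) = (r' ^^ stripOdd t') →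
    torusBlock k r t = torusBlock k r' t' → r = r' ∧ t = t' := by decide

theorem stripType_intCast (t : ℤ) : stripType t = t := by
  have h : ∀ x : ZMod 6, ZMod.castHom (show 3 ∣ 6 by norm_num) (ZMod 3) x = stripType x := by decide
  rw [← h, map_intCast]

theorem torusPerm_injective : ∀ k d, Function.Injective (![torusRest k (d + 1), torusRest k (d + 2),
    torusPair k 0, torusPair k 1, torusRest k d] : Fin 5 → Fin 5) := by decide

theorem exists_torusPair : ∀ i j : Fin 5, i ≠ j → ∃ k, (∃ s, i = torusPair k s) ∧
    ∃ s, j = torusPair k s := by decide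

theorem exists_torusPair_eq_torusRest : ∀ k k', k ≠ k' → ∃ s d, torusPair k' s = torusRest k d := by
  decide

/-- The permutation that puts the labels of a torus and of a vertex of its triangles into standard
position. -/
def torusPerm (k : Fin 10) (d : ZMod 3) : Equiv.Perm (Fin 5) :=
  Equiv.ofBijective _ (Finite.injective_iff_bijective.1 (torusPerm_injective k d))

theorem torusPerm_eq (k : Fin 10) (d : ZMod 3) : ⇑(torusPerm k d) = ![torusRest k (d + 1),
    torusRest k (d + 2), torusPair k 0, torusPair k 1, torusRest k d] := rfl

theorem torusRest_or_torusPair (k : Fin 10) (i : Fin 5) :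
    (∃ d, i = torusRest k d) ∨ ∃ s, i = torusPair k s := by
  obtain ⟨j, rfl⟩ := (torusPerm k 0).surjective i
  rw [torusPerm_eq]
  fin_cases j
  · exact .inl ⟨_, rfl⟩
  · exact .inl ⟨_, rfl⟩
  · exact .inr ⟨_, rfl⟩
  · exact .inr ⟨_, rfl⟩
  · exact .inl ⟨_, rfl⟩

theorem exists_isTorusCell (k : Fin 10) (l : CellLabel) : ∃ r, ∃ t : ℤ, IsTorusCell k l r t := by
  obtain ⟨r, t, h1, h2⟩ := exists_torusBlock k (l.1 ^^ blockOdd k l.2.1) l.2.2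
  obtain ⟨t, rfl⟩ := ZMod.intCast_surjective t
  exact ⟨r, t, h1, h2⟩

namespace IsTorusCell

variable {k : Fin 10} {l : CellLabel} {r : Bool} {t : ZMod 6}

theorem unique {r' : Bool} {t' : ZMod 6} (h : IsTorusCell k l r t) (h' : IsTorusCell k l r' t') :
    r = r' ∧ t = t' :=
  torusBlock_injective k r t r' t' (h.1.symm.trans h'.1) (h.2.symm.trans h'.2)

theorem cross_not (h : IsTorusCell k l r t) :
    IsTorusCell k (crossFacet (.inl (torusRest k (stripType t))) l) (!r) t := by
  refine ⟨?_, ?_⟩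
  · show ((!l.1) ^^ blockOdd k l.2.1) = _
    rw [Bool.not_xor, h.1, Bool.not_xor]
  · show edgeMatch (torusRest k (stripType t)) l.2.2 = _
    rw [h.2, torusBlock_not]

theorem cross_add_one (h : IsTorusCell k l r t) :
    IsTorusCell k (crossFacet (.inl (torusRest k (stripType t + 2))) l) r (t + 1) := by
  refine ⟨?_, ?_⟩
  · show ((!l.1) ^^ blockOdd k l.2.1) = _
    rw [Bool.not_xor, h.1, stripOdd_add_one, Bool.xor_not]
  · show edgeMatch (torusRest k (stripType t + 2)) l.2.2 = _
    rw [h.2, torusBlock_add_one]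

theorem cross_sub_one (h : IsTorusCell k l r t) :
    IsTorusCell k (crossFacet (.inl (torusRest k (stripType t + 1))) l) r (t - 1) := by
  refine ⟨?_, ?_⟩
  · show ((!l.1) ^^ blockOdd k l.2.1) = _
    rw [Bool.not_xor, h.1, stripOdd_sub_one, Bool.xor_not]
  · show edgeMatch (torusRest k (stripType t + 1)) l.2.2 = _
    rw [h.2, torusBlock_sub_one]

theorem cross_pair (h : IsTorusCell k l r t) (s : Fin 2) :
    IsTorusCell k (crossFacet (.inr (torusPair k s)) l) r t := by
  refine ⟨?_, h.2⟩
  show ((!l.1) ^^ blockOdd k (edgeMatch (torusPair k s) l.2.1)) = _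
  rw [blockOdd_edgeMatch, Bool.not_xor_not, h.1]

end IsTorusCell

/-- The map of the triangle in a cell to the rectangular torus. -/
def torusLift (k : Fin 10) (l : CellLabel) (b : ZMod 3 → ℝ) : Circle × Circle :=
  stripMap (exists_isTorusCell k l).choose (exists_isTorusCell k l).choose_spec.choose b

theorem torusLift_eq {k : Fin 10} {l : CellLabel} {r : Bool} {t : ℤ} (h : IsTorusCell k l r t)
    (b : ZMod 3 → ℝ) : torusLift k l b = stripMap r t b := by
  have key : ∀ r' (t' : ℤ), IsTorusCell k l r' t' → stripMap r' t' b = stripMap r t b := by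
    intro r' t' h'
    obtain ⟨rfl, h2⟩ := h'.unique h
    exact stripMap_congr h2 b
  exact key _ _ (exists_isTorusCell k l).choose_spec.choose_spec

/-- The map of triangles is affine across sides. It is stated for all coordinates with sum 1, not
only on the triangle, so that it can be iterated along unfoldings. -/
theorem torusLift_cross_rest (k : Fin 10) (l : CellLabel) (d : ZMod 3) {b : ZMod 3 → ℝ}
    (hb : ∑ e, b e = 1) : torusLift k (crossFacet (.inl (torusRest k d)) l) b =
      torusLift k l (reflBary d b) := by
  obtain ⟨r, t, h⟩ := exists_isTorusCell k l
  have e := stripType_intCast t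
  rw [torusLift_eq h]
  rcases zmod_three_cases (t : ZMod 3) d with rfl | rfl | rfl
  · have h' := h.cross_not
    rw [e] at h'
    rw [torusLift_eq h', stripMap_not]
  · have h' := h.cross_sub_one
    rw [e] at h'
    rw [torusLift_eq (t := t - 1) (by push_cast; exact h'), stripMap_sub_one hb]
  · have h' := h.cross_add_one
    rw [e] at h'
    rw [torusLift_eq (t := t + 1) (by push_cast; exact h'), stripMap_add_one hb]

theorem torusLift_cross_pair (k : Fin 10) (l : CellLabel) (s : Fin 2) (b : ZMod 3 → ℝ) :
    torusLift k (crossFacet (.inr (torusPair k s)) l) b = torusLift k l b := by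
  obtain ⟨r, t, h⟩ := exists_isTorusCell k l
  rw [torusLift_eq h, torusLift_eq (h.cross_pair s)]

theorem reflBary_of_eq_zero {d : ZMod 3} {b : ZMod 3 → ℝ} (h : b d = 0) : reflBary d b = b := by
  ext e
  by_cases he : e = d
  · simp [reflBary, he, h]
  · simp [reflBary, he, h]

/-- The coordinates of the points of the polytope on a torus. -/
def torusCut (τ : ℝ) (k : Fin 10) (b : ZMod 3 → ℝ) (i : Fin 5) : ℝ :=
  (![(cutLevel τ - 2) * b 1, (cutLevel τ - 2) * b 2, 1, 1, (cutLevel τ - 2) * b 0] : Fin 5 → ℝ)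
    ((torusPerm k 0).symm i)

theorem torusCut_rest (τ : ℝ) (k : Fin 10) (b : ZMod 3 → ℝ) (d : ZMod 3) :
    torusCut τ k b (torusRest k d) = (cutLevel τ - 2) * b d := by
  have h : ∀ j, torusCut τ k b (torusPerm k 0 j) = (![(cutLevel τ - 2) * b 1,
      (cutLevel τ - 2) * b 2, 1, 1, (cutLevel τ - 2) * b 0] : Fin 5 → ℝ) j := fun j => by
    rw [torusCut, Equiv.symm_apply_apply]
  rcases zmod_three_cases 0 d with rfl | rfl | rfl
  · exact h 4
  · exact h 0
  · exact h 1

theorem torusCut_pair (τ : ℝ) (k : Fin 10) (b : ZMod 3 → ℝ) (s : Fin 2) :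
    torusCut τ k b (torusPair k s) = 1 := by
  have h : ∀ j, torusCut τ k b (torusPerm k 0 j) = (![(cutLevel τ - 2) * b 1,
      (cutLevel τ - 2) * b 2, 1, 1, (cutLevel τ - 2) * b 0] : Fin 5 → ℝ) j := fun j => by
    rw [torusCut, Equiv.symm_apply_apply]
  fin_cases s
  · exact h 2
  · exact h 3

theorem torusCut_comp_perm (τ : ℝ) (k : Fin 10) (b : ZMod 3 → ℝ) (d : ZMod 3) :
    torusCut τ k b ∘ torusPerm k d = ![(cutLevel τ - 2) * b (d + 1), (cutLevel τ - 2) * b (d + 2),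
      1, 1, (cutLevel τ - 2) * b d] := by
  rw [torusPerm_eq]
  ext j
  fin_cases j
  · exact torusCut_rest τ k b _
  · exact torusCut_rest τ k b _
  · exact torusCut_pair τ k b 0
  · exact torusCut_pair τ k b 1
  · exact torusCut_rest τ k b _

theorem sum_torusCut (τ : ℝ) (k : Fin 10) {b : ZMod 3 → ℝ} (hb : ∑ d, b d = 1) :
    ∑ i, torusCut τ k b i = cutLevel τ := by
  have h := Equiv.sum_comp (torusPerm k 0) (torusCut τ k b)
  rw [← h, show (fun i => torusCut τ k b (torusPerm k 0 i)) = torusCut τ k b ∘ torusPerm k 0 from rfl,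
    torusCut_comp_perm, Fin.sum_univ_five]
  rw [sum_zmod_three b 0] at hb
  simp only [Matrix.cons_val]
  linear_combination (cutLevel τ - 2) * hb

/-! ### The map of a rectangular torus to the closed manifold -/

section TorusMap

variable (v : Fin 5 → E4) (τ : ℝ) (k : Fin 10)

/-- The points of the polytope on a torus. -/
def torusPoint (b : ZMod 3 → ℝ) : E4 := cutPoint v τ (torusCut τ k b)

/-- The map of a rectangular torus to the closed manifold that is compatible with the maps of the
triangles. -/
def IsTorusMap (T : Circle × Circle → SpaceX v τ) : Prop :=
  ∀ l b (x : cutSimplex v τ), IsBary b → (x : E4) = torusPoint v τ k b →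
    T (torusLift k l b) = cellPt v τ _ l x

variable {v τ k} (hv : IsRegularSimplex v) (h1 : 4 / 9 < τ) (h2 : τ < 1)
include hv h1

theorem cutCoord_torusPoint {b : ZMod 3 → ℝ} (hb : ∑ d, b d = 1) :
    cutCoord v τ (torusPoint v τ k b) = torusCut τ k b :=
  cutCoord_cutPoint hv (by linarith) (sum_torusCut τ k hb)

include h2

omit hv in
theorem torusCut_rest_mem {b : ZMod 3 → ℝ} (hb : IsBary b) (d : ZMod 3) :
    0 ≤ torusCut τ k b (torusRest k d) ∧ torusCut τ k b (torusRest k d) < 1 := by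
  obtain ⟨a1, a2⟩ := cutLevel_mem h1 h2
  have hs := hb.2
  rw [sum_zmod_three b d] at hs
  have p0 := hb.1 d
  have p1 := hb.1 (d + 1)
  have p2 := hb.1 (d + 2)
  rw [torusCut_rest]
  constructor
  · exact mul_nonneg (by linarith) p0
  · nlinarith

theorem torusPoint_mem {b : ZMod 3 → ℝ} (hb : IsBary b) : torusPoint v τ k b ∈ cutSimplex v τ := by
  rw [mem_cutSimplex_iff (by linarith), cutCoord_torusPoint hv h1 hb.2]
  intro i
  rcases torusRest_or_torusPair k i with ⟨d, rfl⟩ | ⟨s, rfl⟩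
  · exact ⟨(torusCut_rest_mem h1 h2 hb d).1, (torusCut_rest_mem h1 h2 hb d).2.le⟩
  · rw [torusCut_pair]
    norm_num

theorem torusPoint_mem_facetPlane_iff {b : ZMod 3 → ℝ} (hb : IsBary b) (a : Fin 5 ⊕ Fin 5) :
    torusPoint v τ k b ∈ facetPlane v τ a ↔
      (∃ d, a = .inl (torusRest k d) ∧ b d = 0) ∨ ∃ s, a = .inr (torusPair k s) := by
  have hτ : 0 < τ + 2 / 3 := by linarith
  have hk : cutLevel τ - 2 ≠ 0 := by linarith [(cutLevel_mem h1 h2).1]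
  rcases a with i | i
  · rw [mem_facetPlane_inl hτ, cutCoord_torusPoint hv h1 hb.2]
    constructor
    · intro h
      rcases torusRest_or_torusPair k i with ⟨d, rfl⟩ | ⟨s, rfl⟩
      · rw [torusCut_rest] at h
        exact .inl ⟨d, rfl, (mul_eq_zero.1 h).resolve_left hk⟩
      · rw [torusCut_pair] at h
        exact absurd h one_ne_zero
    · rintro (⟨d, h, h0⟩ | ⟨s, h⟩)
      · obtain rfl := Sum.inl_injective h
        rw [torusCut_rest, h0, mul_zero]
      · exact absurd h (by simp)
  · rw [mem_facetPlane_inr hτ, cutCoord_torusPoint hv h1 hb.2]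
    constructor
    · intro h
      rcases torusRest_or_torusPair k i with ⟨d, rfl⟩ | ⟨s, rfl⟩
      · exact absurd h (torusCut_rest_mem h1 h2 hb d).2.ne
      · exact .inr ⟨s, rfl⟩
    · rintro (⟨d, h, h0⟩ | ⟨s, h⟩)
      · exact absurd h (by simp)
      · obtain rfl := Sum.inr_injective h
        exact torusCut_pair τ k b s

/-- Cells containing the same triangle differ only by their block, and orientation follows the
parity of the block. Every point of the torus lies on both facets of the pair, so the hexagon of
blocks can be walked around it. -/
theorem linked_of_isTorusCell {b : ZMod 3 → ℝ} (hb : IsBary b) {l l' : CellLabel} {r : Bool}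
    {t : ZMod 6} (h : IsTorusCell k l r t) (h' : IsTorusCell k l' r t) :
    Linked v τ (torusPoint v τ k b) l l' := by
  have hp : ∀ s, torusPoint v τ k b ∈ facetPlane v τ (.inr (torusPair k s)) := fun s =>
    (torusPoint_mem_facetPlane_iff hv h1 h2 hb _).2 (.inr ⟨s, rfl⟩)
  have key : ∀ l, Linked v τ (torusPoint v τ k b) (l.1 ^^ blockOdd k l.2.1, 0, l.2.2) l := by
    intro l
    set l₀ : CellLabel := (l.1 ^^ blockOdd k l.2.1, 0, l.2.2) with hl₀
    have hw : ∀ n, Linked v τ (torusPoint v τ k b) l₀ (cornerLabel l₀ (torusPerm k 0) (0, n)) := by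
      refine forall_sector ?_ (fun n hn => ?_) (fun n hn => ?_)
      · rw [cornerLabel_zero]
        exact .refl
      · have h3 := crossFacet_cornerLabel l₀ (torusPerm k 0) 2 (0, n)
        exact hn.trans (h3 ▸ .cross (hp 0))
      · have h3 := crossFacet_cornerLabel l₀ (torusPerm k 0) 3 (0, n)
        exact hn.trans (h3 ▸ .cross (hp 1))
    have h01 : torusPair k 0 ≠ torusPair k 1 := (torusPerm k 0).injective.ne (show (2 : Fin 5) ≠ 3 by decide)
    obtain ⟨n, hn⟩ := exists_hexWalk _ _ h01 0 l.2.1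
    have e : cornerLabel l₀ (torusPerm k 0) (0, n) = l := by
      have hodd := blockOdd_hexWalk k n
      rw [hn] at hodd
      show ((l.1 ^^ blockOdd k l.2.1) ^^ (false ^^ sectorOdd n),
        hexWalk (torusPair k 0) (torusPair k 1) 0 n, l.2.2) = l
      rw [hn, hodd, Bool.false_xor, Bool.xor_assoc, Bool.xor_self, Bool.xor_false]
    exact e ▸ hw n
  have e : ((l.1 ^^ blockOdd k l.2.1, 0, l.2.2) : CellLabel) =
      (l'.1 ^^ blockOdd k l'.2.1, 0, l'.2.2) := by
    rw [h.1, h'.1, h.2, h'.2]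
  exact (key l).symm.trans (e ▸ key l')

theorem linked_of_stripLinked {b : ZMod 3 → ℝ} (hb : IsBary b) {x y : Bool × ℤ}
    (hxy : StripLinked b x y) {l l' : CellLabel} (h : IsTorusCell k l x.1 x.2)
    (h' : IsTorusCell k l' y.1 y.2) : Linked v τ (torusPoint v τ k b) l l' := by
  have hf : ∀ d, b d = 0 → torusPoint v τ k b ∈ facetPlane v τ (.inl (torusRest k d)) := fun d hd =>
    (torusPoint_mem_facetPlane_iff hv h1 h2 hb _).2 (.inl ⟨d, rfl, hd⟩)
  have key : ∃ l'', Linked v τ (torusPoint v τ k b) l l'' ∧ IsTorusCell k l'' y.1 y.2 := by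
    clear h'
    induction hxy with
    | refl => exact ⟨l, .refl, h⟩
    | @tail y z _ hz ih =>
      obtain ⟨l'', h3, h4⟩ := ih
      rcases hz with ⟨h0, rfl⟩ | ⟨h0, rfl⟩ | ⟨h0, rfl⟩ <;> rw [← stripType_intCast] at h0
      · exact ⟨_, h3.trans (.cross (hf _ h0)), h4.cross_not⟩
      · refine ⟨_, h3.trans (.cross (hf _ h0)), ?_⟩
        push_cast
        exact h4.cross_add_one
      · refine ⟨_, h3.trans (.cross (hf _ h0)), ?_⟩
        push_cast
        exact h4.cross_sub_one
  obtain ⟨l'', h3, h4⟩ := key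
  exact h3.trans (linked_of_isTorusCell hv h1 h2 hb h4 h')

/-- Facets through the point are either those of the pair, which do not change the triangle, or
sides containing it, whose reflections fix it. -/
theorem torusLift_eq_of_linked {b : ZMod 3 → ℝ} (hb : IsBary b) {l l' : CellLabel}
    (h : Linked v τ (torusPoint v τ k b) l l') : torusLift k l b = torusLift k l' b := by
  induction h with
  | refl => rfl
  | tail _ h ih =>
    obtain ⟨a, ha, rfl⟩ := h
    rw [ih]
    rcases (torusPoint_mem_facetPlane_iff hv h1 h2 hb a).1 ha with ⟨d, rfl, h0⟩ | ⟨s, rfl⟩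
    · rw [torusLift_cross_rest k _ d hb.2, reflBary_of_eq_zero h0]
    · rw [torusLift_cross_pair]

omit hv h1 h2 in
theorem exists_torusLift_eq (k : Fin 10) (z : Circle × Circle) :
    ∃ l b, IsBary b ∧ torusLift k l b = z := by
  obtain ⟨r, t, b, hb, rfl⟩ := exists_stripMap_eq z
  refine ⟨(r ^^ stripOdd t, 0, torusBlock k r t), b, hb, torusLift_eq ⟨?_, rfl⟩ b⟩
  have h0 : blockOdd k 0 = false := blockOdd_hexWalk k 0
  show ((r ^^ stripOdd t) ^^ blockOdd k 0) = _
  rw [h0, Bool.xor_false]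

theorem cellPt_torusPoint_eq {l l' : CellLabel} {b b' : ZMod 3 → ℝ} {x x' : cutSimplex v τ}
    (hb : IsBary b) (hb' : IsBary b') (hx : (x : E4) = torusPoint v τ k b)
    (hx' : (x' : E4) = torusPoint v τ k b') (h : torusLift k l b = torusLift k l' b') :
    cellPt v τ _ l x = cellPt v τ _ l' x' := by
  obtain ⟨r, t, hl⟩ := exists_isTorusCell k l
  obtain ⟨r', t', hl'⟩ := exists_isTorusCell k l'
  rw [torusLift_eq hl, torusLift_eq hl'] at h
  obtain ⟨rfl, t'', ht, hlink⟩ := stripLinked_of_stripMap_eq hb hb' h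
  rw [← ht] at hl'
  rw [cellPt_eq_iff]
  refine ⟨Subtype.ext (hx.trans hx'.symm), ?_⟩
  rw [hx]
  exact linked_of_stripLinked hv h1 h2 hb hlink hl hl'

/-- Each point of the rectangular torus lies in some triangle; different choices give the same point
of `X` because coincidences in the torus come from linked cells. -/
theorem exists_isTorusMap (k : Fin 10) : ∃ T, IsTorusMap v τ k T := by
  choose l b hb hl using exists_torusLift_eq k
  have hmem : ∀ z, torusPoint v τ k (b z) ∈ cutSimplex v τ := fun z => torusPoint_mem hv h1 h2 (hb z)
  exact ⟨fun z => cellPt v τ _ (l z) ⟨_, hmem z⟩, fun l' b' x hb' hx =>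
    cellPt_torusPoint_eq hv h1 h2 (hb _) hb' rfl hx (hl _)⟩

theorem torusPoint_inj {b b' : ZMod 3 → ℝ} (hb : IsBary b) (hb' : IsBary b')
    (h : torusPoint v τ k b = torusPoint v τ k b') : b = b' := by
  have hk : cutLevel τ - 2 ≠ 0 := by linarith [(cutLevel_mem h1 h2).1]
  have e := congrArg (cutCoord v τ) h
  rw [cutCoord_torusPoint hv h1 hb.2, cutCoord_torusPoint hv h1 hb'.2] at e
  ext d
  have e1 := congrFun e (torusRest k d)
  rw [torusCut_rest, torusCut_rest] at e1
  exact mul_left_cancel₀ hk e1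

theorem IsTorusMap.injective {T : Circle × Circle → SpaceX v τ} (hT : IsTorusMap v τ k T) :
    Function.Injective T := by
  intro z z' h
  obtain ⟨l, b, hb, rfl⟩ := exists_torusLift_eq k z
  obtain ⟨l', b', hb', rfl⟩ := exists_torusLift_eq k z'
  rw [hT l b ⟨_, torusPoint_mem hv h1 h2 hb⟩ hb rfl, hT l' b' ⟨_, torusPoint_mem hv h1 h2 hb'⟩ hb' rfl,
    cellPt_eq_iff] at h
  obtain rfl := torusPoint_inj hv h1 h2 hb hb' (congrArg Subtype.val h.1)
  exact torusLift_eq_of_linked hv h1 h2 hb h.2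

/-- A label in the pair of one torus but not of the other has coordinate 1 on the former and less
than 1 on the latter. -/
theorem IsTorusMap.disjoint_range {k' : Fin 10} (hk : k ≠ k') {T T' : Circle × Circle → SpaceX v τ}
    (hT : IsTorusMap v τ k T) (hT' : IsTorusMap v τ k' T') :
    Disjoint (Set.range T) (Set.range T') := by
  rw [Set.disjoint_left]
  rintro _ ⟨z, rfl⟩ ⟨z', h⟩
  obtain ⟨l, b, hb, rfl⟩ := exists_torusLift_eq k z
  obtain ⟨l', b', hb', rfl⟩ := exists_torusLift_eq k' z'
  rw [hT l b ⟨_, torusPoint_mem hv h1 h2 hb⟩ hb rfl, hT' l' b' ⟨_, torusPoint_mem hv h1 h2 hb'⟩ hb' rfl,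
    cellPt_eq_iff] at h
  have e := congrArg (cutCoord v τ) (congrArg Subtype.val h.1)
  rw [cutCoord_torusPoint hv h1 hb.2, cutCoord_torusPoint hv h1 hb'.2] at e
  obtain ⟨s, d, hsd⟩ := exists_torusPair_eq_torusRest k k' hk
  have e1 := congrFun e (torusPair k' s)
  rw [torusCut_pair, hsd] at e1
  exact (torusCut_rest_mem h1 h2 hb d).2.ne e1.symm

theorem exists_torusPoint {x : E4} (hx : x ∈ cutSimplex v τ) (hu : x ∉ uncutPart v τ) :
    ∃ k b, IsBary b ∧ x = torusPoint v τ k b := by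
  have hτ : 0 < τ + 2 / 3 := by linarith
  have hk : 0 < cutLevel τ - 2 := by linarith [(cutLevel_mem h1 h2).1]
  obtain ⟨i, j, hij, hi, hj⟩ : ∃ a b, a ≠ b ∧ cutCoord v τ x a = 1 ∧ cutCoord v τ x b = 1 := by
    by_contra! h
    exact hu ⟨hx, fun i j hij hi hj => h i j hij hi hj⟩
  obtain ⟨k, ⟨s, rfl⟩, ⟨s', rfl⟩⟩ := exists_torusPair i j hij
  have hss : s ≠ s' := fun h => hij (by rw [h])
  have hpair : ∀ s, cutCoord v τ x (torusPair k s) = 1 := by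
    intro u
    have hu : u = s ∨ u = s' := by omega
    rcases hu with rfl | rfl <;> assumption
  have hsum := sum_cutCoord (τ := τ) hv hτ x
  rw [← Equiv.sum_comp (torusPerm k 0), Fin.sum_univ_five, torusPerm_eq] at hsum
  simp only [Matrix.cons_val, hpair] at hsum
  have hb : IsBary fun d => cutCoord v τ x (torusRest k d) / (cutLevel τ - 2) := by
    refine ⟨fun d => div_nonneg ((mem_cutSimplex_iff hτ).1 hx _).1 hk.le, ?_⟩
    rw [sum_zmod_three _ 0, ← add_div, ← add_div, div_eq_one_iff_eq hk.ne']
    linarith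
  refine ⟨k, _, hb, ?_⟩
  rw [torusPoint, ← cutPoint_cutCoord hv hτ x]
  congr 1
  rw [cutPoint_cutCoord hv hτ x]
  ext i
  rcases torusRest_or_torusPair k i with ⟨d, rfl⟩ | ⟨s, rfl⟩
  · rw [torusCut_rest]
    field_simp
  · rw [torusCut_pair, hpair]

theorem iUnion_range_torusMap (K : CuspOpening v τ) {T : Fin 10 → Circle × Circle → SpaceX v τ}
    (hT : ∀ k, IsTorusMap v τ k (T k)) : K.κ.target = (⋃ k, Set.range (T k))ᶜ := by
  ext m
  obtain ⟨l, x, rfl⟩ := exists_cellPt m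
  rw [K.mem_target, Set.mem_compl_iff, Set.mem_iUnion, not_exists]
  constructor
  · rintro hx k ⟨z, hz⟩
    obtain ⟨l', b, hb, rfl⟩ := exists_torusLift_eq k z
    rw [hT k l' b ⟨_, torusPoint_mem hv h1 h2 hb⟩ hb rfl, cellPt_eq_iff] at hz
    have e : (x : E4) = torusPoint v τ k b := (congrArg Subtype.val hz.1).symm
    have h : ∀ s, cutCoord v τ x (torusPair k s) = 1 := fun s => by
      rw [e, cutCoord_torusPoint hv h1 hb.2, torusCut_pair]
    exact hx.2 _ _ ((torusPerm k 0).injective.ne (show (2 : Fin 5) ≠ 3 by decide)) (h 0) (h 1)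
  · intro h
    by_contra hx
    obtain ⟨k, b, hb, e⟩ := exists_torusPoint hv h1 h2 x.2 hx
    exact h k ⟨_, hT k l b x hb e⟩

end TorusMap

/-! ### Charts of the circle -/

section CircleChart

attribute [local instance] finrank_real_complex_fact'

theorem contDiffAt_arg {z : ℂ} (hz : z ∈ Complex.slitPlane) : ContDiffAt ℝ ∞ Complex.arg z := by
  have h : Complex.arg = fun z => Complex.imCLM (Complex.log z) := by
    ext z
    exact (Complex.log_im z).symm
  rw [h]
  exact Complex.imCLM.contDiff.contDiffAt.comp z ((Complex.contDiffAt_log hz).restrict_scalars ℝ)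

theorem contMDiff_coe_circle : ContMDiff (𝓡 1) 𝓘(ℝ, ℂ) ∞ fun z : Circle => (z : ℂ) :=
  contMDiff_coe_sphere (E := ℂ) (n := 1)

/-- The chart of the circle by the angle, scaled by a factor, around a point. -/
def angleChart {κ : ℝ} (hκ : 0 < κ) (c : ℝ) (θ : EuclideanSpace ℝ (Fin 1)) :
    OpenPartialHomeomorph Circle (EuclideanSpace ℝ (Fin 1)) where
  toFun z := WithLp.toLp 2 fun _ =>
    Complex.arg ((z : ℂ) * ((Circle.exp (κ * (c + θ 0)))⁻¹ : Circle)) / κ + θ 0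
  invFun x := Circle.exp (κ * (c + x 0))
  source := {z | (z : ℂ) * ((Circle.exp (κ * (c + θ 0)))⁻¹ : Circle) ∈ Complex.slitPlane}
  target := {x | |κ * (x 0 - θ 0)| < Real.pi}
  map_source' z hz := by
    have h1 := Complex.mem_slitPlane_iff_arg.1 hz
    have h2 := Complex.arg_mem_Ioc ((z : ℂ) * ((Circle.exp (κ * (c + θ 0)))⁻¹ : Circle))
    show |κ * (_ / κ + θ 0 - θ 0)| < Real.pi
    rw [add_sub_cancel_right, mul_div_cancel₀ _ hκ.ne', abs_lt]
    exact ⟨h2.1, lt_of_le_of_ne h2.2 h1.1⟩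
  map_target' x hx := by
    rw [Set.mem_ofPred_eq, abs_lt] at hx
    rw [Set.mem_ofPred_eq, ← Circle.coe_mul, ← Circle.exp_neg, ← Circle.exp_add,
      Complex.mem_slitPlane_iff_arg]
    rw [show κ * (c + x 0) + -(κ * (c + θ 0)) = κ * (x 0 - θ 0) by ring]
    refine ⟨?_, Circle.coe_ne_zero _⟩
    rw [Circle.arg_exp hx.1 hx.2.le]
    exact hx.2.ne
  left_inv' z hz := by
    have h : Circle.exp (Complex.arg (z * (Circle.exp (κ * (c + θ 0)))⁻¹ : Circle)) =
        z * (Circle.exp (κ * (c + θ 0)))⁻¹ := Circle.exp_arg _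
    rw [Circle.coe_mul] at h
    show Circle.exp (κ * (c + (_ / κ + θ 0))) = z
    rw [show ∀ a : ℝ, κ * (c + (a / κ + θ 0)) = a + κ * (c + θ 0) from fun a => by
      field_simp; ring, Circle.exp_add, h, inv_mul_cancel_right]
  right_inv' x hx := by
    rw [Set.mem_ofPred_eq, abs_lt] at hx
    ext i
    obtain rfl : i = 0 := Subsingleton.elim _ _
    show Complex.arg _ / κ + θ 0 = x 0
    rw [← Circle.coe_mul, ← Circle.exp_neg, ← Circle.exp_add,
      show κ * (c + x 0) + -(κ * (c + θ 0)) = κ * (x 0 - θ 0) by ring,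
      Circle.arg_exp hx.1 hx.2.le]
    field_simp
    ring
  open_source := Complex.isOpen_slitPlane.preimage (by fun_prop)
  open_target := isOpen_lt (by fun_prop) continuous_const
  continuousOn_toFun := by
    refine (PiLp.continuous_toLp 2 _).comp_continuousOn (continuousOn_pi.2 fun _ => ?_)
    refine (ContinuousOn.div_const (fun z hz => ?_) _).add continuousOn_const
    have h := Complex.continuousAt_arg hz
    exact (h.comp (f := fun z : Circle => (z : ℂ) * ((Circle.exp (κ * (c + θ 0)))⁻¹ : Circle))
      (by fun_prop)).continuousWithinAt
  continuousOn_invFun := by fun_prop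

theorem exists_circleChart {κ : ℝ} (hκ : 0 < κ) (c : ℝ) (θ : EuclideanSpace ℝ (Fin 1)) :
    ∃ φ ∈ IsManifold.maximalAtlas (𝓡 1) ∞ Circle, Circle.exp (κ * (c + θ 0)) ∈ φ.source ∧
      φ (Circle.exp (κ * (c + θ 0))) = θ ∧ ∀ x, φ.symm x = Circle.exp (κ * (c + x 0)) := by
  have hm : θ ∈ (angleChart hκ c θ).target := by
    show |κ * (θ 0 - θ 0)| < Real.pi
    simp [Real.pi_pos]
  refine ⟨angleChart hκ c θ, ?_, (angleChart hκ c θ).map_target hm,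
    (angleChart hκ c θ).right_inv hm, fun x => rfl⟩
  have hθ : ContDiff ℝ ∞ fun x : EuclideanSpace ℝ (Fin 1) => κ * (c + x 0) := by fun_prop
  have hsymm : ContMDiff (𝓡 1) (𝓡 1) ∞ (angleChart hκ c θ).symm :=
    contMDiff_circleExp.comp hθ.contMDiff
  have hto : ContMDiffOn (𝓡 1) (𝓡 1) ∞ (angleChart hκ c θ) (angleChart hκ c θ).source := by
    have h : ContDiffOn ℝ ∞ (fun z : ℂ => (WithLp.toLp 2 fun _ =>
        Complex.arg (z * ((Circle.exp (κ * (c + θ 0)))⁻¹ : Circle)) / κ + θ 0 :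
          EuclideanSpace ℝ (Fin 1)))
        {z | z * ((Circle.exp (κ * (c + θ 0)))⁻¹ : Circle) ∈ Complex.slitPlane} := by
      refine contDiffOn_euclidean.2 fun _ => ?_
      refine ContDiffOn.add (ContDiffOn.div_const (fun z hz => ?_) _) contDiffOn_const
      exact ((contDiffAt_arg hz).comp (f := fun z : ℂ => z * ((Circle.exp (κ * (c + θ 0)))⁻¹ : Circle)) z
        (by fun_prop)).contDiffWithinAt
    exact h.contMDiffOn.comp contMDiff_coe_circle.contMDiffOn fun z hz => hz
  exact OpenPartialHomeomorph.mem_maximalAtlas_of_contMDiffOn _ hto hsymm.contMDiffOn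

end CircleChart

/-! ### The tori are smoothly embedded -/

/-- Height and position are affine in the barycentric coordinates with nondegenerate linear part;
the three cases say which vertex of the triangle is `d`. -/
theorem exists_stripMap_baryOf_eq (r : Bool) (t : ℤ) (d : ZMod 3) :
    ∃ (A : ℝ × ℝ →ₗ[ℝ] ℝ × ℝ) (c : ℝ × ℝ), Function.Injective A ∧
      ∀ p, stripMap r t (baryOf d p) = (Circle.exp (Real.pi * (c.1 + (A p).1)),
        Circle.exp (Real.pi / 3 * (c.2 + (A p).2))) := by
  obtain ⟨σ, h, hσ, hh⟩ : ∃ σ h : ℝ, σ ≠ 0 ∧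
      ∀ b, boolSign r * stripHeight t b = h + σ * b t := by
    have hr : boolSign r ≠ 0 := by cases r <;> simp [boolSign]
    by_cases he : Even t
    · refine ⟨boolSign r, 0, hr, fun b => ?_⟩
      rw [stripHeight, if_pos he]
      ring
    · refine ⟨-boolSign r, boolSign r, neg_ne_zero.2 hr, fun b => ?_⟩
      rw [stripHeight, if_neg he]
      ring
  have key : ∀ (a₀ a₁ a₂ c₀ c₁ c₂ : ℝ), σ * (a₁ * c₂ - a₂ * c₁) ≠ 0 →
      (∀ p, baryOf d p t = a₀ + a₁ * p.1 + a₂ * p.2) →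
      (∀ p, baryOf d p (t + 1) - baryOf d p (t + 2) = c₀ + c₁ * p.1 + c₂ * p.2) →
      ∃ (A : ℝ × ℝ →ₗ[ℝ] ℝ × ℝ) (c : ℝ × ℝ), Function.Injective A ∧
        ∀ p, stripMap r t (baryOf d p) = (Circle.exp (Real.pi * (c.1 + (A p).1)),
          Circle.exp (Real.pi / 3 * (c.2 + (A p).2))) := by
    intro a₀ a₁ a₂ c₀ c₁ c₂ hdet ha hc
    refine ⟨((σ * a₁) • LinearMap.fst ℝ ℝ ℝ + (σ * a₂) • LinearMap.snd ℝ ℝ ℝ).prod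
      (c₁ • LinearMap.fst ℝ ℝ ℝ + c₂ • LinearMap.snd ℝ ℝ ℝ), (h + σ * a₀, t + c₀), ?_, fun p => ?_⟩
    · rw [← LinearMap.ker_eq_bot, LinearMap.ker_eq_bot']
      rintro ⟨x, y⟩ hxy
      have e1 : σ * a₁ * x + σ * a₂ * y = 0 := congrArg Prod.fst hxy
      have e2 : c₁ * x + c₂ * y = 0 := congrArg Prod.snd hxy
      have hx : σ * (a₁ * c₂ - a₂ * c₁) * x = 0 := by linear_combination c₂ * e1 - σ * a₂ * e2
      have hy : σ * (a₁ * c₂ - a₂ * c₁) * y = 0 := by linear_combination σ * a₁ * e2 - c₁ * e1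
      exact Prod.ext ((mul_eq_zero.1 hx).resolve_left hdet) ((mul_eq_zero.1 hy).resolve_left hdet)
    · rw [stripMap, hh, ha, stripPos, add_sub_assoc, hc]
      refine Prod.ext ?_ ?_
      · show Circle.exp _ = Circle.exp (Real.pi * (h + σ * a₀ + (σ * a₁ * p.1 + σ * a₂ * p.2)))
        congr 1
        ring
      · show Circle.exp _ = Circle.exp (Real.pi / 3 * (t + c₀ + (c₁ * p.1 + c₂ * p.2)))
        congr 1
        ring
  obtain ⟨e1, e2, e3, e4⟩ := zmod_three_add d
  have hb := baryOf_apply d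
  rcases zmod_three_cases d t with ht | ht | ht <;> rw [ht] at key
  · refine key 1 (-1) (-1) 0 1 (-1) (by simpa using by norm_num [hσ]) (fun p => ?_) fun p => ?_
    · rw [(hb p).1]; ring
    · rw [(hb p).2.1, (hb p).2.2]; ring
  · rw [e1, e2] at key
    refine key 0 1 0 (-1) 1 2 (by norm_num [hσ]) (fun p => ?_) fun p => ?_
    · rw [(hb p).2.1]; ring
    · rw [(hb p).1, (hb p).2.2]; ring
  · rw [e3, e4] at key
    refine key 0 0 1 1 (-2) (-1) (by norm_num [hσ]) (fun p => ?_) fun p => ?_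
    · rw [(hb p).2.2]; ring
    · rw [(hb p).1, (hb p).2.1]; ring

theorem reflBary_baryOf_add_one (d : ZMod 3) (p : ℝ × ℝ) :
    reflBary (d + 1) (baryOf d p) = baryOf d (-p.1, p.1 + p.2) := by
  obtain ⟨h1, h2, h3⟩ := zmod_three_ne d
  obtain ⟨a1, a2, a3⟩ := baryOf_apply d p
  obtain ⟨b1, b2, b3⟩ := baryOf_apply d (-p.1, p.1 + p.2)
  refine ext_zmod_three d ?_ ?_ ?_
  · rw [reflBary, if_neg h1.symm, a1, a2, b1]; ring
  · rw [reflBary, if_pos rfl, a2, b2]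
  · rw [reflBary, if_neg h3.symm, a3, a2, b3]; ring

theorem reflBary_baryOf_add_two (d : ZMod 3) (p : ℝ × ℝ) :
    reflBary (d + 2) (baryOf d p) = baryOf d (p.1 + p.2, -p.2) := by
  obtain ⟨h1, h2, h3⟩ := zmod_three_ne d
  obtain ⟨a1, a2, a3⟩ := baryOf_apply d p
  obtain ⟨b1, b2, b3⟩ := baryOf_apply d (p.1 + p.2, -p.2)
  refine ext_zmod_three d ?_ ?_ ?_
  · rw [reflBary, if_neg h2.symm, a1, a3, b1]; ring
  · rw [reflBary, if_neg h3, a2, a3, b2]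
  · rw [reflBary, if_pos rfl, a3, b3]

theorem sec_origin (n : Fin 6) : sec n (0, 0) = (0, 0) := by
  fin_cases n <;> simp [sec]

/-- Moving to another cell around the corner reflects the barycentric coordinates about the vertex
`d`, which is the action of `sec`. The second index only changes the block. -/
theorem torusLift_cornerLabel (k : Fin 10) (l : CellLabel) (d : ZMod 3) (n n' : Fin 6)
    (p : ℝ × ℝ) : torusLift k (cornerLabel l (torusPerm k d) (n, n')) (baryOf d p) =
      torusLift k l (baryOf d (sec n p)) := by
  have hn' : ∀ n n', torusLift k (cornerLabel l (torusPerm k d) (n, n')) (baryOf d p) =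
      torusLift k (cornerLabel l (torusPerm k d) (n, 0)) (baryOf d p) := by
    intro n
    refine forall_sector rfl (fun n' h => ?_) fun n' h => ?_
    · have h3 : crossFacet (.inr (torusPair k 0)) (cornerLabel l (torusPerm k d) (n, n')) = _ :=
        crossFacet_cornerLabel l (torusPerm k d) 2 (n, n')
      rw [← h, ← torusLift_cross_pair k (cornerLabel l (torusPerm k d) (n, n')) 0, h3]
      rfl
    · have h3 : crossFacet (.inr (torusPair k 1)) (cornerLabel l (torusPerm k d) (n, n')) = _ :=
        crossFacet_cornerLabel l (torusPerm k d) 3 (n, n')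
      rw [← h, ← torusLift_cross_pair k (cornerLabel l (torusPerm k d) (n, n')) 1, h3]
      rfl
  rw [hn']
  clear hn'
  revert p
  have := forall_sector (p := fun n => ∀ p, torusLift k (cornerLabel l (torusPerm k d) (n, 0))
    (baryOf d p) = torusLift k l (baryOf d (sec n p))) ?_ (fun n h p => ?_) (fun n h p => ?_)
  · exact this n
  · intro p
    rw [cornerLabel_zero, sec_zero]
  · have h3 : crossFacet (.inl (torusRest k (d + 1))) (cornerLabel l (torusPerm k d) (n, 0)) =
        cornerLabel l (torusPerm k d) (nbα n, 0) :=
      crossFacet_cornerLabel l (torusPerm k d) 0 (n, 0)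
    rw [← h3, torusLift_cross_rest _ _ _ (sum_baryOf d p), reflBary_baryOf_add_one, h, sec_nbα]
  · have h3 : crossFacet (.inl (torusRest k (d + 2))) (cornerLabel l (torusPerm k d) (n, 0)) =
        cornerLabel l (torusPerm k d) (nbβ n, 0) :=
      crossFacet_cornerLabel l (torusPerm k d) 1 (n, 0)
    rw [← h3, torusLift_cross_rest _ _ _ (sum_baryOf d p), reflBary_baryOf_add_two, h, sec_nbβ]

section

variable {v : Fin 5 → E4} {τ : ℝ} (hv : IsRegularSimplex v) (h1 : 4 / 9 < τ) (h2 : τ < 1)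
include hv h1 h2

theorem torusPoint_mem_torusRegion (k : Fin 10) {b : ZMod 3 → ℝ} (hb : IsBary b) {d : ZMod 3}
    (hd : 0 < b d) : torusPoint v τ k b ∈ torusRegion v τ (torusPerm k d) := by
  obtain ⟨a1, a2⟩ := cutLevel_mem h1 h2
  have e := torusCut_comp_perm τ k b d
  rw [← cutCoord_torusPoint hv h1 hb.2] at e
  have hs := hb.2
  rw [sum_zmod_three b d] at hs
  have hg : faceGap (cutCoord v τ (torusPoint v τ k b) ∘ torusPerm k d) = 0 := by
    rw [faceGap, e]; simp only [Matrix.cons_val]; norm_num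
  have hl : legSum (cutCoord v τ (torusPoint v τ k b) ∘ torusPerm k d) = cutLevel τ - 2 := by
    rw [legSum, e]; simp only [Matrix.cons_val]; linear_combination (cutLevel τ - 2) * hs
  refine ⟨?_, ?_⟩
  · have := congrFun e 4
    simp only [Function.comp_apply, Matrix.cons_val] at this
    rw [this]
    exact mul_pos (by linarith) hd
  · show legSum (cutCoord v τ (torusPoint v τ k b) ∘ torusPerm k d) +
      √(faceGap (cutCoord v τ (torusPoint v τ k b) ∘ torusPerm k d) *
        legSum (cutCoord v τ (torusPoint v τ k b) ∘ torusPerm k d)) < 1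
    rw [hg, hl, zero_mul, Real.sqrt_zero]
    linarith

theorem torusDev_torusPoint (k : Fin 10) {b : ZMod 3 → ℝ} (hb : IsBary b) (d : ZMod 3)
    (g : Fin 6 × Fin 6) : torusDev v τ (torusPerm k d) g (torusPoint v τ k b) =
      pack (sec g.1 (b (d + 1), b (d + 2))) (0, 0) := by
  obtain ⟨a1, a2⟩ := cutLevel_mem h1 h2
  have hk : cutLevel τ - 2 ≠ 0 := by linarith
  have e := torusCut_comp_perm τ k b d
  rw [← cutCoord_torusPoint hv h1 hb.2] at e
  have hs := hb.2
  rw [sum_zmod_three b d] at hs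
  have hl : legSum (cutCoord v τ (torusPoint v τ k b) ∘ torusPerm k d) = cutLevel τ - 2 := by
    rw [legSum, e]; simp only [Matrix.cons_val]; linear_combination (cutLevel τ - 2) * hs
  have hg : faceGap (cutCoord v τ (torusPoint v τ k b) ∘ torusPerm k d) = 0 := by
    rw [faceGap, e]; simp only [Matrix.cons_val]; norm_num
  have hX : torusX (cutCoord v τ (torusPoint v τ k b) ∘ torusPerm k d) =
      pack (b (d + 1), b (d + 2)) (0, 0) := by
    rw [torusX, hl, hg, e, torusCoord]
    simp only [Matrix.cons_val, zero_mul, Real.sqrt_zero, zero_div, polar_zero,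
      mul_div_cancel_left₀ _ hk]
  rw [torusDev, hX, sec4]
  exact congrArg (pack _) (sec_origin g.2)

/-- In the charts around a torus, the map of the torus is linear. -/
theorem IsTorusMap.exists_chart {k : Fin 10} {T : Circle × Circle → SpaceX v τ}
    (hT : IsTorusMap v τ k T) (z : Circle × Circle) :
    ∃ (l₀ : CellLabel) (π : Equiv.Perm (Fin 5)) (e : OpenPartialHomeomorph (SpaceX v τ) E4)
      (r : Bool) (t : ℤ) (d : ZMod 3) (p₀ : ℝ × ℝ) (D : Set (ℝ × ℝ)), IsTorusChart v τ l₀ π e ∧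
      IsOpen D ∧ p₀ ∈ D ∧ z = stripMap r t (baryOf d p₀) ∧ ∀ p ∈ D,
        T (stripMap r t (baryOf d p)) ∈ e.source ∧
          e (T (stripMap r t (baryOf d p))) = pack p (0, 0) := by
  obtain ⟨l, b, hb, rfl⟩ := exists_torusLift_eq k z
  obtain ⟨d, hd⟩ : ∃ d, 0 < b d := by
    by_contra! h
    have := hb.2
    rw [Finset.sum_eq_zero fun d _ => le_antisymm (h d) (hb.1 d)] at this
    exact zero_ne_one this
  have hx := torusPoint_mem_torusRegion hv h1 h2 k hb hd
  obtain ⟨l₀, e, he, hs⟩ := exists_isTorusChart hv h1 h2 l (x := ⟨_, torusPoint_mem hv h1 h2 hb⟩) hx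
  obtain ⟨-, g, hg⟩ := he.exists_label hv h1 h2 hs
  obtain ⟨r, t, hrt⟩ := exists_isTorusCell k l₀
  have hbd : baryOf d (b (d + 1), b (d + 2)) = b := by
    obtain ⟨e1, e2, e3⟩ := baryOf_apply d (b (d + 1), b (d + 2))
    have hs := hb.2
    rw [sum_zmod_three b d] at hs
    refine ext_zmod_three d ?_ e2 e3
    rw [e1]
    linarith
  -- The domain is the open star of the vertex `d`: points whose folded coordinates leave a positive
  -- barycentric coordinate at `d`. On it the affine extension from one triangle describes all six.
  refine ⟨l₀, torusPerm k d, e, r, t, d, sec g.1 (b (d + 1), b (d + 2)),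
    {p | 0 < 1 - (fold2 p).1 - (fold2 p).2}, he, ?_, ?_, ?_, fun p hp => ?_⟩
  · exact isOpen_lt continuous_const
      ((continuous_const.sub continuous_fold2.fst).sub continuous_fold2.snd)
  · have := hb.2
    rw [sum_zmod_three b d] at this
    show 0 < 1 - (fold2 _).1 - (fold2 _).2
    rw [fold2_sec _ (hb.1 _) (hb.1 _)]
    show 0 < 1 - b (d + 1) - b (d + 2)
    linarith
  · rw [← torusLift_eq hrt, ← torusLift_cornerLabel k l₀ d g.1 g.2, hbd, ← hg]
  · obtain ⟨n, hn⟩ := exists_sec_fold2 p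
    have hp : 0 < 1 - (fold2 p).1 - (fold2 p).2 := hp
    have hf := fold2_nonneg p
    have hb' : IsBary (baryOf d (fold2 p)) := isBary_baryOf hf.1 hf.2 (by linarith)
    obtain ⟨e1, e2, e3⟩ := baryOf_apply d (fold2 p)
    have hm := he.apply (n, 0) ⟨_, torusPoint_mem hv h1 h2 hb'⟩
      (torusPoint_mem_torusRegion hv h1 h2 k hb' (by rw [e1]; exact hp))
    have h4 := hT (cornerLabel l₀ (torusPerm k d) (n, 0)) _ ⟨_, torusPoint_mem hv h1 h2 hb'⟩ hb' rfl
    rw [torusLift_cornerLabel, hn, torusLift_eq hrt] at h4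
    rw [h4]
    refine ⟨hm.1, hm.2.trans ?_⟩
    show torusDev v τ (torusPerm k d) (n, 0) (torusPoint v τ k (baryOf d (fold2 p))) = _
    rw [torusDev_torusPoint hv h1 h2 k hb', e2, e3]
    exact congrArg (pack · _) hn

/-- In a torus chart and angular coordinates the map is the inclusion of a linear plane, hence an
immersion; it is an embedding because it is injective on a compact space with Hausdorff target. -/
theorem IsTorusMap.isSmoothEmbedding (K : CuspOpening v τ) {k : Fin 10}
    {T : Circle × Circle → SpaceX v τ} (hT : IsTorusMap v τ k T) :
    letI := K.chartedSpace hv h1 h2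
    Manifold.IsSmoothEmbedding ((𝓡 1).prod (𝓡 1)) (𝓡 4) ∞ T := by
  let := K.chartedSpace hv h1 h2
  have := K.isManifold hv h1 h2
  have himm : Manifold.IsImmersion ((𝓡 1).prod (𝓡 1)) (𝓡 4) ∞ T := by
    refine ⟨ℝ × ℝ, inferInstance, inferInstance, fun z => ?_⟩
    obtain ⟨l₀, π, e, r, t, d, p₀, D, he, hD, hp₀, rfl, hTD⟩ := hT.exists_chart hv h1 h2 z
    obtain ⟨A, c, hA, hAc⟩ := exists_stripMap_baryOf_eq r t d
    -- The chart coordinates along the torus are changed to the angular ones by `A`, and the two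
    -- normal coordinates form the complement required for an immersion.
    let B : E4 →ₗ[ℝ] (EuclideanSpace ℝ (Fin 1) × EuclideanSpace ℝ (Fin 1)) × (ℝ × ℝ) :=
      { toFun := fun x => ((WithLp.toLp 2 fun _ => (A (x 0, x 1)).1,
          WithLp.toLp 2 fun _ => (A (x 0, x 1)).2), (x 2, x 3))
        map_add' := fun x y => by
          have : A ((x + y) 0, (x + y) 1) = A (x 0, x 1) + A (y 0, y 1) := by
            rw [← map_add]; rfl
          rw [this]
          rfl
        map_smul' := fun a x => by
          have : A ((a • x) 0, (a • x) 1) = a • A (x 0, x 1) := by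
            rw [← map_smul]; rfl
          rw [this]
          rfl }
    have hB : Function.Injective B := by
      intro x y h
      have e1 : (A (x 0, x 1)).1 = (A (y 0, y 1)).1 :=
        congrArg (fun q => q.1.1 0) h
      have e2 : (A (x 0, x 1)).2 = (A (y 0, y 1)).2 :=
        congrArg (fun q => q.1.2 0) h
      have e3 : (x 0, x 1) = (y 0, y 1) := hA (Prod.ext e1 e2)
      have e4 : (x 2, x 3) = (y 2, y 3) := congrArg Prod.snd h
      rw [← pack_self x, ← pack_self y, e3, e4]
    let L : E4 ≃L[ℝ] (EuclideanSpace ℝ (Fin 1) × EuclideanSpace ℝ (Fin 1)) × (ℝ × ℝ) :=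
      (LinearMap.linearEquivOfInjective B hB (by simp)).toContinuousLinearEquiv
    have hL : ∀ x, L x = B x := fun x => rfl
    have hpack : ∀ θ, L.symm (θ, 0) =
        pack ((L.symm (θ, 0)) 0, (L.symm (θ, 0)) 1) (0, 0) := by
      intro θ
      have h := L.apply_symm_apply (θ, 0)
      have e4 : ((L.symm (θ, 0)) 2, (L.symm (θ, 0)) 3) = (0, 0) := congrArg Prod.snd h
      rw [← e4, pack_self]
    have hθ : ∀ θ : EuclideanSpace ℝ (Fin 1) × EuclideanSpace ℝ (Fin 1),
        stripMap r t (baryOf d ((L.symm (θ, 0)) 0, (L.symm (θ, 0)) 1)) =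
          (Circle.exp (Real.pi * (c.1 + θ.1 0)), Circle.exp (Real.pi / 3 * (c.2 + θ.2 0))) := by
      intro θ
      have h := L.apply_symm_apply (θ, 0)
      have e1 : (A ((L.symm (θ, 0)) 0, (L.symm (θ, 0)) 1)).1 = θ.1 0 :=
        congrArg (fun q => q.1.1 0) h
      have e2 : (A ((L.symm (θ, 0)) 0, (L.symm (θ, 0)) 1)).2 = θ.2 0 :=
        congrArg (fun q => q.1.2 0) h
      rw [hAc, e1, e2]
    let θ₀ := (B (pack p₀ (0, 0))).1
    have hs₀ : L.symm (θ₀, 0) = pack p₀ (0, 0) := by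
      rw [ContinuousLinearEquiv.symm_apply_eq]
      rfl
    obtain ⟨φ, hφ, hφs, hφa, hφi⟩ := exists_circleChart Real.pi_pos c.1 θ₀.1
    obtain ⟨ψ, hψ, hψs, hψa, hψi⟩ := exists_circleChart (κ := Real.pi / 3) (by positivity) c.2 θ₀.2
    have hz := hθ θ₀
    have hp : ((L.symm (θ₀, 0)) 0, (L.symm (θ₀, 0)) 1) = p₀ := by rw [hs₀]; rfl
    rw [hp] at hz
    let O : Set (EuclideanSpace ℝ (Fin 1) × EuclideanSpace ℝ (Fin 1)) :=
      {θ | ((L.symm (θ, 0)) 0, (L.symm (θ, 0)) 1) ∈ D}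
    have hO : IsOpen O := hD.preimage (by fun_prop)
    let base := φ.prod ψ
    have hbase : base ∈ IsManifold.maximalAtlas ((𝓡 1).prod (𝓡 1)) ∞ (Circle × Circle) :=
      IsManifold.mem_maximalAtlas_prod hφ hψ
    let S := base.source ∩ base ⁻¹' O
    have hS : IsOpen S := base.isOpen_inter_preimage hO
    have hbs : ∀ θ : EuclideanSpace ℝ (Fin 1) × EuclideanSpace ℝ (Fin 1), base.symm θ =
        stripMap r t (baryOf d ((L.symm (θ, 0)) 0, (L.symm (θ, 0)) 1)) := fun θ => by
      rw [hθ]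
      exact Prod.ext (hφi _) (hψi _)
    have hzs : stripMap r t (baryOf d p₀) ∈ base.source := by
      rw [hz]
      exact ⟨hφs, hψs⟩
    have hdom : ∀ w ∈ S, ∃ p ∈ D, w = stripMap r t (baryOf d p) := fun w hw =>
      ⟨_, hw.2, by rw [← hbs, base.left_inv hw.1]⟩
    have hzS : stripMap r t (baryOf d p₀) ∈ S := by
      refine ⟨hzs, ?_⟩
      have : base (stripMap r t (baryOf d p₀)) = θ₀ := by
        rw [hz]
        exact Prod.ext hφa hψa
      show base _ ∈ O
      rw [this]
      show (_, _) ∈ D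
      rwa [hp]
    refine Manifold.IsImmersionAtOfComplement.mk_of_charts L.symm (base.restr S) e
      ⟨hzs, by rwa [hS.interior_eq]⟩ (hTD _ hp₀).1 ?_ ?_ ?_ ?_
    · exact restr_mem_maximalAtlas _ hbase hS
    · exact IsManifold.subset_maximalAtlas (Or.inr ⟨l₀, π, he⟩)
    · intro w hw
      have hw : w ∈ S := interior_subset hw.2
      obtain ⟨p, hp, rfl⟩ := hdom w hw
      exact (hTD p hp).1
    · intro θ hθm
      have hθO : ((L.symm (θ, 0)) 0, (L.symm (θ, 0)) 1) ∈ D := by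
        have h3 : θ ∈ (base.restr S).target := by
          rw [OpenPartialHomeomorph.extend_target] at hθm
          exact hθm.1
        have h4 : base.symm θ ∈ S := interior_subset h3.2
        have h5 : base (base.symm θ) = θ := base.right_inv h3.1
        have h6 := h4.2
        rw [Set.mem_preimage, h5] at h6
        exact h6
      have h4 := (hTD _ hθO).2
      rw [← hbs, ← hpack] at h4
      exact h4
  refine ⟨himm, ?_⟩
  have := compactSpace_coverGluing (v := v) (τ := τ) (isCompact_cutSimplex (v := v) (τ := τ) (by linarith) hv)
  exact (himm.contMDiff.continuous.isClosedEmbedding (hT.injective hv h1 h2)).isEmbedding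

end

/-! ### The facets are nonempty -/

section

variable {v : Fin 5 → E4} {τ : ℝ} (hv : IsRegularSimplex v)
include hv

/-- One coordinate is put equal to 0 or 1 and the other four are equal; their common value is below
1 because the level is below 3. -/
theorem exists_mem_facetPlane (h1 : 4 / 9 < τ) (h2 : τ ≤ 1) (a : Fin 5 ⊕ Fin 5) :
    ∃ x ∈ facetPlane v τ a, (∀ i, 0 ≤ cutCoord v τ x i ∧ cutCoord v τ x i ≤ 1) ∧
      ∀ i j, i ≠ j → cutCoord v τ x i = 1 → cutCoord v τ x j = 1 → False := by
  have hτ : 0 < τ + 2 / 3 := by linarith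
  obtain ⟨a1, a2⟩ : 2 ≤ cutLevel τ ∧ cutLevel τ < 3 := by
    rw [cutLevel, le_div_iff₀ (by linarith), div_lt_iff₀ (by linarith)]
    constructor <;> linarith
  have key : ∀ (k : Fin 5) (ε : ℝ), 0 ≤ ε → ε ≤ 1 → ∃ x, cutCoord v τ x k = ε ∧
      (∀ i, 0 ≤ cutCoord v τ x i ∧ cutCoord v τ x i ≤ 1) ∧
      ∀ i j, i ≠ j → cutCoord v τ x i = 1 → cutCoord v τ x j = 1 → False := by
    intro k ε h0 h1
    have hs : ∑ i, (if i = k then ε else (cutLevel τ - ε) / 4) = cutLevel τ := by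
      rw [Finset.sum_ite, Finset.filter_eq' Finset.univ k, Finset.filter_ne' Finset.univ k]
      simp
      ring
    refine ⟨cutPoint v τ fun i => if i = k then ε else (cutLevel τ - ε) / 4, ?_, ?_, ?_⟩ <;>
      rw [cutCoord_cutPoint hv hτ hs]
    · exact if_pos rfl
    · intro i
      dsimp only
      split_ifs
      · exact ⟨h0, h1⟩
      · constructor <;> linarith
    · intro i j hij hi hj
      dsimp only at hi hj
      split_ifs at hi hj with h3 h4
      · exact hij (h3.trans h4.symm)
      all_goals linarith
  rcases a with k | k
  · obtain ⟨x, hx, h⟩ := key k 0 le_rfl zero_le_one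
    exact ⟨x, (mem_facetPlane_inl hτ).2 hx, h⟩
  · obtain ⟨x, hx, h⟩ := key k 1 zero_le_one le_rfl
    exact ⟨x, (mem_facetPlane_inr hτ).2 hx, h⟩

theorem connectedSpace_spaceX (h1 : 4 / 9 < τ) (h2 : τ < 1) : ConnectedSpace (SpaceX v τ) := by
  refine connectedSpace_coverGluing convex_cutSimplex fun a => ?_
  obtain ⟨x, hx, h, -⟩ := exists_mem_facetPlane hv h1 h2.le a
  exact ⟨x, (mem_cutSimplex_iff (by linarith)).2 h, hx⟩

theorem connectedSpace_spaceM : ConnectedSpace (SpaceM v) := by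
  refine connectedSpace_coverGluing (convex_cutSimplex.inter (convex_ball 0 1)) fun a => ?_
  obtain ⟨x, hx, h, h'⟩ := exists_mem_facetPlane hv (τ := 1) (by norm_num) le_rfl a
  exact ⟨x, (mem_idealRectifiedSimplex_iff hv).2 ⟨h, (mem_lorCone_iff hv h).2 h'⟩, hx⟩

end

end

theorem mainTheorem6 (v : Fin 5 → E4) (hv : IsRegularSimplex v)
    (τ : ℝ) (hτ : 4 / 9 < τ) (hτ' : τ < 1) :
    -- `X` and `M` are the connected orientation double covers of `X'` and `M'`
    ConnectedSpace (SpaceX v τ) ∧ IsDoubleCover (coverProj v τ (cutSimplex v τ)) ∧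
    ConnectedSpace (SpaceM v) ∧ IsDoubleCover (coverProj v 1 (idealRectifiedSimplex v)) ∧
    -- `X` is a closed 4-manifold
    CompactSpace (SpaceX v τ) ∧ T2Space (SpaceX v τ) ∧ SecondCountableTopology (SpaceX v τ) ∧
    ∃ (_ : ChartedSpace E4 (SpaceX v τ)) (_ : IsManifold (𝓡 4) ∞ (SpaceX v τ))
      -- the hyperbolic structure of `M`, and the smooth structure that it induces
      (_ : ChartedSpace E4 (SpaceM v)) (_ : IsManifold (𝓡 4) ∞ (SpaceM v))
      (T : Fin 10 → Circle × Circle → SpaceX v τ)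
      (U : TopologicalSpace.Opens (SpaceX v τ)),
      IsOrientable4 (SpaceX v τ) ∧
      IsHyperbolicAtlas v ∧
      (∀ k, Manifold.IsSmoothEmbedding ((𝓡 1).prod (𝓡 1)) (𝓡 4) ∞ (T k)) ∧
      (Pairwise fun k l => Disjoint (Set.range (T k)) (Set.range (T l))) ∧
      (U : Set (SpaceX v τ)) = (⋃ k, Set.range (T k))ᶜ ∧
      Nonempty (U ≃ₘ^∞⟮𝓡 4, 𝓡 4⟯ SpaceM v) := by
  obtain ⟨K⟩ := nonempty_cuspOpening hv hτ hτ'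
  choose T hT using exists_isTorusMap hv hτ hτ'
  exact ⟨connectedSpace_spaceX hv hτ hτ', isDoubleCover_coverProj (exists_atCorner_cutSimplex hv hτ hτ'),
    connectedSpace_spaceM hv, isDoubleCover_coverProj (exists_atCorner_idealRectifiedSimplex hv),
    compactSpace_coverGluing (isCompact_cutSimplex (by linarith) hv), inferInstance,
    secondCountableTopology_spaceX hv hτ hτ', K.chartedSpace hv hτ hτ', K.isManifold hv hτ hτ',
    kleinChartedSpace hv, isManifold_kleinChartedSpace hv, T, ⟨K.κ.target, K.κ.open_target⟩,
    K.isOrientable4 hv hτ hτ', isHyperbolicAtlas_kleinChartedSpace hv,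
    fun k => (hT k).isSmoothEmbedding hv hτ hτ' K,
    fun k k' hk => (hT k).disjoint_range hv hτ hτ' hk (hT k'), iUnion_range_torusMap hv hτ hτ' K hT,
    K.nonempty_diffeomorph hv hτ hτ' _ rfl⟩
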